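/- For an integer $N\ge 1$ let $\varphi\in\mathbb C^N$, $\bar\varphi\cdot\varphi=\sum_{p=1}^N|\varphi_p|^2$, $d\nu(\varphi)=\pi^{-N}\prod_p d(\mathrm{Re}\,\varphi_p)\,d(\mathrm{Im}\,\varphi_p)$, and for $\mathrm{Re}\,z\le 0$ put $$Z(z,N)=\int d\nu\; e^{-\bar\varphi\cdot\varphi+\frac{z}{2N}(\bar\varphi\cdot\varphi)^2},\qquad G_2(z,N)=\frac1{Z(z,N)}\int d\nu\;\tfrac1N(\bar\varphi\cdot\varphi)\,e^{-\bar\varphi\cdot\varphi+\frac{z}{2N}(\bar\varphi\cdot\varphi)^2}.$$ The perturbation series $\sum_q a_q(N)z^q$ of $G_2$ is the formal power series obtained as the quotient of the two series that arise by expanding $e^{\frac{z}{2N}(\bar\varphi\cdot\varphi)^2}$ in powers of $z$ and integrating term by term. Write $z=|z|e^{i\pi+i\phi}$ with $\phi\in\mathbb R$, $z\ne0$, as a point of the Riemann surface of the logarithm (with coordinate $\log|z|+i\phi$), and $\sqrt z=i\sqrt{|z|}e^{i\phi/2}$. The cardioid is $\{|\phi|<\pi,\ 4|z|<\cos^2(\phi/2)\}$.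 The extended cardioid is $C=C_+\cup C_-$, where $C_+$ is the union of $\{0\le\phi<\pi/2,\ 4|z|<1\}$ and $\{\pi/2\le\phi<3\pi/2,\ 4|z|<\cos^2(\phi/2-\pi/4)\}$, and $C_-$ is the complex conjugate of $C_+$ ($\phi\mapsto-\phi$). A rooted plane tree $\mathcal T$ with $n\ge0$ ordinary vertices is a tree on the labelled vertices $0,1,\dots,n$, with root $0$ and a linear order on the children of each vertex. Let $d_i=1+\#\{\text{children of }i\}$ be the number of corners of the vertex $i$ (the root carries a cilium, so that $\sum_i d_i=2n+1$); $C(\mathcal T)$ is the set of the $2n+1$ corners, and $i(c)$ the vertex of the corner $c$. For $w\in[0,1]^{\text{edges}}$ let $X^{\mathcal T}_{ii}(w)=1$ and, for $i\neq j$, let $X^{\mathcal T}_{ij}(w)$ be the minimum of $w_\ell$ over the edges $\ell$ of the path from $i$ to $j$. Let $\int dw_{\mathcal T}$ be integration over the cube $[0,1]^{\text{edges}}$ and let $d\mu_{\mathcal T}$ be the centred Gaussian measure on $\mathbb R^{n+1}$ with covariance $X^{\mathcal T}(w)/N$ (this matrix is positive semidefinite). Then the following holds. 1. For all $N\ge1$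 the integrals defining $Z$ and $G_2$ converge absolutely for $\mathrm{Re}\,z\le0$, and $Z(z,N)\ne0$ if moreover $4|z|<1$. For every $N\ge1$ the function $G_2(\cdot,N)$, defined on $\{|\phi|\le\pi/2,\ 4|z|<1\}$ by these integrals, has an analytic continuation, still denoted by $G_2(\cdot,N)$, to the extended cardioid $C$, which does not depend on $N$. 2. In the cardioid, $$G_2(z,N)=\sum_{\mathcal T}\frac{z^n}{n!}\int dw_{\mathcal T}\int d\mu_{\mathcal T}\prod_{c\in C(\mathcal T)}\frac1{1-\sqrt z\,\tau_{i(c)}}.$$ 3. If $|\psi|<\pi/2$, $|\phi+2\psi|\le\pi/2$ and $4|z|<\cos^2\psi$ (every point of $C$ admits such a $\psi$, and only such points do; $\psi=0$ is allowed if $|\phi|\le\pi/2$), then $$G_2(z,N)=\sum_{\mathcal T}\frac{z^n}{n!}\Big[\prod_{i=0}^n\int_0^{e^{i\psi}\infty}d\beta_i\,\frac{\beta_i^{d_i-1}}{(d_i-1)!}e^{-\beta_i}\Big]\int dw_{\mathcal T}\;e^{\frac z{2N}\sum_{ij}\beta_iX^{\mathcal T}_{ij}(w)\beta_j},$$ and,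 uniformly in $N$, $|G_2(z,N)|\le\sum_{n\ge0}C_n|z|^n(\cos\psi)^{-2n-1}$, where $C_n$ is the $n$-th Catalan number. All the integrals in 2 and 3 and the sums over all labelled trees converge absolutely. 4. For every $z\in C$, $\displaystyle\lim_{N\to\infty}G_2(z,N)=\frac{1-\sqrt{1-4z}}{2z}$ (principal branch of $\sqrt{1-4z}$), the generating function of the Catalan numbers. 5. There is a constant $K>0$ such that for all $N\ge1$, all $p\ge1$ and all $z$ in the half-disk $\mathrm{Re}\,z\le0$, $16|z|<1$, $$\Big|G_2(z,N)-\sum_{q=0}^{p-1}a_q(N)z^q\Big|\le K^p\,p!\,|z|^p .$$ 6. For every $N\ge 1$, $G_2$ is the unique Borel sum of its perturbation series, with constants that do not depend on $N$. Precisely, with $x=-z$, $f_N(x)=G_2(-x,N)$, $b_k(N)=(-1)^ka_k(N)$ and $D_R=\{\mathrm{Re}(1/x)>1/R\}$, there are constants $A$, $\sigma>0$, $C'$ such that for all $N\ge1$: (a) $f_N$ is analytic in $D_{1/16}$ and $|f_N(x)-\sum_{k<p}b_k(N)x^k|\le A\sigma^pp!|x|^p$ there for all $p\ge0$; (b) $B_N(t)=\sum_kb_k(N)t^k/k!$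 converges for $|t|<1/\sigma$ and continues analytically to $\{t:\mathrm{dist}(t,[0,\infty))<1/\sigma\}$ with $|B_N(t)|\le C'e^{16|t|}$, and $f_N(x)=\frac1x\int_0^\infty B_N(t)e^{-t/x}dt$, absolutely convergent, for $x\in D_{1/16}$; (c) if $R>0$ and $f$ is analytic in $D_R$ with $|f(x)-\sum_{k<p}b_k(N)x^k|\le A'\sigma'^pp!|x|^p$ there for all $p\ge 0$ and some constants $A',\sigma'$, then $f=f_N$ on $D_R\cap D_{1/16}$. -/

import Mathlib

open MeasureTheory Filter Topology

namespace NVector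

/-! ### The quartic `N`-vector model -/

/-- `φ̄ · φ = ∑ₚ φ̄ₚ φₚ`. -/
noncomputable def sqNorm {N : ℕ} (φ : Fin N → ℂ) : ℝ := ∑ p, Complex.normSq (φ p)

/-- The Boltzmann weight `exp(-(φ̄·φ) + z/(2N) (φ̄·φ)²)`, including the normalisation `π⁻ᴺ` of
`dφ̄ dφ / (2iπ)ᴺ = π⁻ᴺ ∏ₚ d(Re φₚ) d(Im φₚ)`. -/
noncomputable def weight (N : ℕ) (z : ℂ) (φ : Fin N → ℂ) : ℂ :=
  Complex.exp (-(sqNorm φ : ℂ) + z / (2 * (N : ℂ)) * (sqNorm φ : ℂ) ^ 2) / (Real.pi : ℂ) ^ N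

/-- The partition function `Z(z, N)`. -/
noncomputable def partitionFunction (N : ℕ) (z : ℂ) : ℂ :=
  ∫ φ : Fin N → ℂ, weight N z φ

/-- The two-point function `G₂(z, N)` as a quotient of functional integrals
(meaningful for `Re z ≤ 0`, `Z(z, N) ≠ 0`). -/
noncomputable def twoPoint (N : ℕ) (z : ℂ) : ℂ :=
  (∫ φ : Fin N → ℂ, (sqNorm φ : ℂ) / (N : ℂ) * weight N z φ) / partitionFunction N z

/-- Moments of the free Gaussian measure: `⟨(φ̄·φ)ᵏ⟩₀`. -/
noncomputable def freeMoment (N k : ℕ) : ℝ :=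
  ∫ φ : Fin N → ℂ, sqNorm φ ^ k * Real.exp (-sqNorm φ) / Real.pi ^ N

/-- The formal power series in `z` obtained by expanding the quartic interaction in `Z(z, N)` and
integrating term by term. -/
noncomputable def partitionSeries (N : ℕ) : PowerSeries ℂ :=
  PowerSeries.mk fun q => (freeMoment N (2 * q) : ℂ) / ((q.factorial : ℂ) * (2 * (N : ℂ)) ^ q)

/-- The same for the unnormalised two-point function. -/
noncomputable def twoPointNumeratorSeries (N : ℕ) : PowerSeries ℂ :=
  PowerSeries.mk fun q =>
    (freeMoment N (2 * q + 1) : ℂ) / (N : ℂ) / ((q.factorial : ℂ) * (2 * (N : ℂ)) ^ q)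

/-- The coefficients of the perturbation series of `G₂(z, N)` in powers of `z`. -/
noncomputable def perturbativeCoeff (N q : ℕ) : ℂ :=
  PowerSeries.coeff q (twoPointNumeratorSeries N * (partitionSeries N)⁻¹)

/-! ### Labelled rooted plane trees -/

/-- A rooted plane tree on the labelled vertices `0, 1, …, n`, with root `0`: a tree together with
a linear ordering of the children of each vertex. (At the root the cilium, and at any other vertex
the edge to the parent, turns the cyclic order of the half-edges into a linear order.) -/
structure PlaneTree (n : ℕ) where
  graph : SimpleGraph (Fin (n + 1))
  isTree : graph.IsTree
  children : Fin (n + 1) → List (Fin (n + 1))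
  nodup : ∀ i, (children i).Nodup
  mem_children : ∀ i j, j ∈ children i ↔ graph.Adj i j ∧ graph.dist 0 j = graph.dist 0 i + 1

namespace PlaneTree

variable {n : ℕ}

/-- The edges of the tree. -/
abbrev Edge (T : PlaneTree n) : Type := T.graph.edgeSet

noncomputable instance (T : PlaneTree n) : Fintype T.Edge := Fintype.ofFinite _

/-- The degree (number of corners) of a vertex: the edges to its children, plus the edge to its
parent for an ordinary vertex, respectively the cilium for the root. -/
def degree (T : PlaneTree n) (i : Fin (n + 1)) : ℕ := (T.children i).length + 1

/-- The corners of the tree, `c ↦ c.1` being the vertex `i(c)` to which a corner belongs. -/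
abbrev Corner (T : PlaneTree n) : Type := Σ i : Fin (n + 1), Fin (T.degree i)

/-- The cube `[0,1]^{edges}` of the weakening parameters `w`. -/
def cube (T : PlaneTree n) : Set (T.Edge → ℝ) := Set.Icc 0 1

/-- The matrix `Xᵀ(w)`: `1` on the diagonal, and for `i ≠ j` the infimum of `w` over the edges of
the unique path from `i` to `j`. -/
noncomputable def X (T : PlaneTree n) (w : T.Edge → ℝ) : Matrix (Fin (n + 1)) (Fin (n + 1)) ℝ :=
  fun i j => if i = j then 1 else
    ⨅ e : {e : T.Edge // ∃ p : T.graph.Walk i j, p.IsPath ∧ (e : Sym2 (Fin (n + 1))) ∈ p.edges},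
      w e

/-- The centred Gaussian measure with covariance `Xᵀ(w) / N`. -/
noncomputable def gaussian (T : PlaneTree n) (N : ℕ) (w : T.Edge → ℝ) :
    Measure (EuclideanSpace ℝ (Fin (n + 1))) :=
  ProbabilityTheory.multivariateGaussian 0 ((N : ℝ)⁻¹ • T.X w)

/-- The product over all corners of the resolvents `1 / (1 - s τ_{i(c)})`, with `s = √z`. -/
noncomputable def resolvents (T : PlaneTree n) (s : ℂ) (τ : EuclideanSpace ℝ (Fin (n + 1))) : ℂ :=
  ∏ c : T.Corner, 1 / (1 - s * (τ c.1 : ℂ))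

/-- `∫ dw ∫ dμ(τ) ∏_c 1 / (1 - s τ_{i(c)})`, with `s = √z`. -/
noncomputable def lveAmplitude (T : PlaneTree n) (N : ℕ) (s : ℂ) : ℂ :=
  ∫ w in T.cube, ∫ τ, T.resolvents s τ ∂(T.gaussian N w)

/-- `exp( z/(2N) ∑_{ij} b_i Xᵀ_{ij}(w) b_j )`. -/
noncomputable def quadExp (T : PlaneTree n) (N : ℕ) (z : ℂ) (b : Fin (n + 1) → ℂ)
    (w : T.Edge → ℝ) : ℂ :=
  Complex.exp (z / (2 * (N : ℂ)) * ∑ i, ∑ j, b i * (T.X w i j : ℂ) * b j)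

/-- The integrand of the `β`-representation with all the `β_i` on the ray of direction `e^{iψ}`,
parametrised by `β_i = e^{iψ} t_i`, `dβ_i = e^{iψ} dt_i`, `t_i > 0`. -/
noncomputable def betaIntegrand (T : PlaneTree n) (N : ℕ) (z : ℂ) (ψ : ℝ)
    (t : Fin (n + 1) → ℝ) : ℂ :=
  let b : Fin (n + 1) → ℂ := fun i => Complex.exp (ψ * Complex.I) * (t i : ℂ)
  (∏ i, Complex.exp (ψ * Complex.I) *
      (b i ^ (T.degree i - 1) / ((T.degree i - 1).factorial : ℂ) * Complex.exp (-b i))) *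
    ∫ w in T.cube, T.quadExp N z b w

/-- The open orthant `t_i > 0`. -/
def orthant (n : ℕ) : Set (Fin (n + 1) → ℝ) := Set.univ.pi fun _ => Set.Ioi 0

/-- `[∏_i ∫_0^{e^{iψ}∞} dβ_i β_i^{d_i-1}/(d_i-1)! e^{-β_i}] ∫ dw exp(z/(2N) ∑ β_i X_{ij}(w) β_j)`. -/
noncomputable def betaAmplitude (T : PlaneTree n) (N : ℕ) (z : ℂ) (ψ : ℝ) : ℂ :=
  ∫ t in orthant n, T.betaIntegrand N z ψ t

end PlaneTree

/-- All labelled rooted plane trees, with any number `T.1 = n` of ordinary vertices. -/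
abbrev AnyPlaneTree : Type := Σ n : ℕ, PlaneTree n

/-! ### The cardioid domains

A point `z = |z| e^{iπ + iφ}` is described by the logarithmic coordinate `u = log |z| + iφ`, so that
`z = -e^u` and `√z = i √|z| e^{iφ/2} = i e^{u/2}`. The extended cardioid contains `φ` beyond `±π`, so
that it is a domain of the Riemann surface of the logarithm, on which `u` is a global holomorphic
coordinate. -/

/-- `z = -e^u`. -/
noncomputable def zOf (u : ℂ) : ℂ := -Complex.exp u

/-- `√z = i e^{u/2}`. -/
noncomputable def sqrtZOf (u : ℂ) : ℂ := Complex.I * Complex.exp (u / 2)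

/-- The cardioid `|φ| < π`, `4|z| < cos²(φ/2)`. -/
def cardioid : Set ℂ :=
  {u | |u.im| < Real.pi ∧ 4 * ‖zOf u‖ < Real.cos (u.im / 2) ^ 2}

/-- The part `C₊` of the extended cardioid: the quarter-disk `0 ≤ φ < π/2`, `4|z| < 1`, together with
`π/2 ≤ φ < 3π/2`, `4|z| < cos²(φ/2 - π/4)`. -/
def extendedCardioidPlus : Set ℂ :=
  {u | 0 ≤ u.im ∧ u.im < Real.pi / 2 ∧ 4 * ‖zOf u‖ < 1} ∪
  {u | Real.pi / 2 ≤ u.im ∧ u.im < 3 * Real.pi / 2 ∧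
    4 * ‖zOf u‖ < Real.cos (u.im / 2 - Real.pi / 4) ^ 2}

/-- The extended cardioid `C₊ ∪ C₋`, where `C₋` is the complex conjugate of `C₊`. -/
def extendedCardioid : Set ℂ :=
  extendedCardioidPlus ∪ {u | (starRingEnd ℂ) u ∈ extendedCardioidPlus}

/-! ### Borel summability -/

/-- The Borel disk `Re (1/x) > 1/R`. -/
def borelDisk (R : ℝ) : Set ℂ := {x | R⁻¹ < (x⁻¹).re}

/-- `f` is analytic in the Borel disk and has there the Taylor expansion with coefficients `a` and
remainders bounded by `A σ^p p! |x|^p`. -/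
def BorelSummable (R A σ : ℝ) (f : ℂ → ℂ) (a : ℕ → ℂ) : Prop :=
  AnalyticOnNhd ℂ f (borelDisk R) ∧
  ∀ p : ℕ, ∀ x ∈ borelDisk R,
    ‖f x - ∑ k ∈ Finset.range p, a k * x ^ k‖ ≤ A * σ ^ p * (p.factorial : ℝ) * ‖x‖ ^ p

/-- The open neighbourhood of radius `δ` of the half-line `[0, ∞)` in the complex plane. -/
def halfStrip (δ : ℝ) : Set ℂ := {t | ∃ s : ℝ, 0 ≤ s ∧ ‖t - (s : ℂ)‖ < δ}

/-- In the Borel disk `Re (1/x) > 1/R`, `f` is the Borel sum of `∑ a_k x^k`: the Borel transform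
`B(t) = ∑ a_k t^k / k!` converges for `|t| < 1/σ`, continues analytically to the neighbourhood of
radius `1/σ` of `[0, ∞)`, is bounded there by `C e^{|t|/R}`, and
`f(x) = (1/x) ∫_0^∞ B(t) e^{-t/x} dt` with an absolutely convergent integral. -/
def IsBorelSum (R σ C : ℝ) (f : ℂ → ℂ) (a : ℕ → ℂ) : Prop :=
  ∃ B : ℂ → ℂ,
    AnalyticOnNhd ℂ B (halfStrip σ⁻¹) ∧
    (∀ t : ℂ, ‖t‖ < σ⁻¹ → HasSum (fun k : ℕ => a k / (k.factorial : ℂ) * t ^ k) (B t)) ∧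
    (∀ t ∈ halfStrip σ⁻¹, ‖B t‖ ≤ C * Real.exp (‖t‖ / R)) ∧
    ∀ x ∈ borelDisk R,
      IntegrableOn (fun t : ℝ => B t * Complex.exp (-(t : ℂ) / x)) (Set.Ioi 0) ∧
      f x = 1 / x * ∫ t in Set.Ioi (0 : ℝ), B t * Complex.exp (-(t : ℂ) / x)

end NVector

open NVector

/-! Put `t = 1/N`. Everything rests on one entire function, `E_t(y) = ∑ a_q(t) y^q/(2q)!`
(`seriesKernel`), and on the identity `G₂(z) = ∫₀^∞ e^{-B} E_t(zB²) dB`, proved in the half-disk `Re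
z ≤ 0`, `4|z| < 1`.

The identity. The Schwinger–Dyson equations give the Riccati equation `P = 1 + z(P/N + (2/N) z P' +
P²)` for the perturbation series `P` (`perturbativeCoeff_eq`). Hence `a_q = ∑_{n+l=q} c(n,l) t^l`
with natural numbers `c(n,l)` (`mapCoeff`), and `c(n,0)` is a Catalan number. In polar coordinates
`Z = L(1)`, where `L` is the Laplace transform of the radial density `ρ(B) = e^{zB²/(2N)}
B^{N-1}/(N-1)!`. The relation numerator `= P · Z` between power series becomes a convolution
identity, `N (E ∗ ρ)(B) = B ρ(B)`, so `-L' = N K L` with `K` the Laplace transform of `E_t(zB²)`.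
This linear equation forces `L(1) ≠ 0`, and then `G₂ = -L'(1)/(N L(1)) = K(1)` (`twoPoint_eq`).

The bound. Grouping by `n`, `E_t(zu) = ∑ zⁿ branch n (zt) u`. Here `branch 0 x u = e^{xu/2}`, and
the other `branch n` are produced from it by sums, products and integrals with positive weights
(`branch_succ_eq`). The property that on `Re x ≤ 0` every Taylor remainder is at most the next term
(`TaylorMaj`) survives these operations, so `|branch n x u| ≤ Cₙ uⁿ/(2n)!` and `|E_t(zs²)| ≤
cosh(2√|z| s)` when `Re z ≤ 0`, uniformly in `N`. The Laplace integral along the ray of direction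
`e^{iψ}` therefore converges if `Re(z e^{2iψ}) ≤ 0` and `2√|z| < cos ψ`. Its independence of `ψ`
(`rayIntegral_eq_of_forall`) gives the continuation to the extended cardioid; dominated convergence
gives the limit `N → ∞`, and the remainder bounds give the Taylor estimates.

The trees. `branch n x (B²)` is also `1/n!` times the density in `B = ∑ βᵢ` of the sum over labelled
trees with `n` ordinary vertices (`treeIntegral_eq`). Indeed, split the cube of the `w`'s according
to the edge carrying the smallest parameter `m`. Cutting the tree there leaves two trees, and the
matrix `X - s` becomes `m - s` times the all-ones matrix plus the blocks `X₁ - m`, `X₂ - m`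
(`energy_glue`); this is the recursion of `branch`. The argument uses nonnegative integrals with `x
≥ 0`; the identity then extends to `Re x ≤ 0` by analytic continuation under a cutoff. Absolute
convergence comes from positivity of `X`. The loop vertex expansion is the `β`-representation at `ψ
= -φ/2`, where `e^{iψ}√z` is purely imaginary and the Gaussian integral is a characteristic
function.

Borel summability. With `v` standard Gaussian, `B_N(t) = 𝔼 E_{1/N}(-2tv²)`, since the Gaussian
moments change `1/(2k)!` into `1/k!`. If `τ` is exponential and independent of `v`, then `√(2τ) v`
has the symmetrised exponential law, which turns the first identity into the Borel–Laplace formula.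
Uniqueness is Nevanlinna's theorem: optimal truncation makes the difference of two candidates
exponentially small, and a Phragmén–Lindelöf argument makes it vanish. -/

namespace NVector

/-! ### Cutting a tree at an edge and gluing two trees by an edge -/

section Glue

open SimpleGraph

variable {V : Type} {A : Finset V}

/-- Two graphs on complementary vertex sets, joined by one edge. -/
def glue (A : Finset V) (G₁ : SimpleGraph {x // x ∈ A}) (G₂ : SimpleGraph {x // x ∉ A})
    (a : {x // x ∈ A}) (b : {x // x ∉ A}) : SimpleGraph V where
  Adj i j := (∃ hi hj, G₁.Adj ⟨i, hi⟩ ⟨j, hj⟩) ∨ (∃ hi hj, G₂.Adj ⟨i, hi⟩ ⟨j, hj⟩) ∨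
    (i = a ∧ j = b) ∨ (i = b ∧ j = a)
  symm := ⟨by
    rintro i j (⟨hi, hj, h⟩ | ⟨hi, hj, h⟩ | ⟨h, h'⟩ | ⟨h, h'⟩)
    · exact Or.inl ⟨hj, hi, h.symm⟩
    · exact Or.inr (Or.inl ⟨hj, hi, h.symm⟩)
    · exact Or.inr (Or.inr (Or.inr ⟨h', h⟩))
    · exact Or.inr (Or.inr (Or.inl ⟨h', h⟩))⟩
  loopless := ⟨by
    rintro i (⟨hi, hj, h⟩ | ⟨hi, hj, h⟩ | ⟨h, h'⟩ | ⟨h, h'⟩)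
    · exact G₁.loopless.irrefl _ h
    · exact G₂.loopless.irrefl _ h
    · exact b.2 (h'.symm.trans h ▸ a.2)
    · exact b.2 (h.symm.trans h' ▸ a.2)⟩

variable {G₁ : SimpleGraph {x // x ∈ A}} {G₂ : SimpleGraph {x // x ∉ A}}
  {a : {x // x ∈ A}} {b : {x // x ∉ A}}

lemma glue_adj_left (i j : {x // x ∈ A}) : (glue A G₁ G₂ a b).Adj i j ↔ G₁.Adj i j := by
  refine ⟨?_, fun h => Or.inl ⟨i.2, j.2, h⟩⟩
  rintro (⟨hi, hj, h⟩ | ⟨hi, hj, h⟩ | ⟨h, h'⟩ | ⟨h, h'⟩)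
  · exact h
  · exact absurd i.2 hi
  · exact absurd (h' ▸ j.2) b.2
  · exact absurd (h ▸ i.2) b.2

lemma glue_adj_right (i j : {x // x ∉ A}) : (glue A G₁ G₂ a b).Adj i j ↔ G₂.Adj i j := by
  refine ⟨?_, fun h => Or.inr (Or.inl ⟨i.2, j.2, h⟩)⟩
  rintro (⟨hi, hj, h⟩ | ⟨hi, hj, h⟩ | ⟨h, h'⟩ | ⟨h, h'⟩)
  · exact absurd hi i.2
  · exact h
  · exact absurd a.2 (h ▸ i.2)
  · exact absurd a.2 (h' ▸ j.2)

lemma glue_adj_cross {i j : V} (hi : i ∈ A) (hj : j ∉ A) :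
    (glue A G₁ G₂ a b).Adj i j ↔ i = a ∧ j = b := by
  refine ⟨?_, fun h => Or.inr (Or.inr (Or.inl h))⟩
  rintro (⟨_, hj', h⟩ | ⟨hi', hj, h⟩ | h | ⟨h, h'⟩)
  · exact absurd hj' hj
  · exact absurd hi hi'
  · exact h
  · exact absurd (h ▸ hi) b.2

lemma glue_adj_bridge : (glue A G₁ G₂ a b).Adj a b := (glue_adj_cross a.2 b.2).2 ⟨rfl, rfl⟩

variable (G₁ G₂ a b) in
/-- The inclusion of the first graph into the glued graph. -/
def glueLeft : G₁ →g glue A G₁ G₂ a b := ⟨Subtype.val, fun h => (glue_adj_left _ _).2 h⟩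

variable (G₁ G₂ a b) in
/-- The inclusion of the second graph into the glued graph. -/
def glueRight : G₂ →g glue A G₁ G₂ a b := ⟨Subtype.val, fun h => (glue_adj_right _ _).2 h⟩

variable (G₁ G₂ a b) in
/-- The edge joining the two parts. -/
def bridge : (glue A G₁ G₂ a b).edgeSet := ⟨s((a : V), (b : V)), glue_adj_bridge⟩

variable (G₁ G₂ a b) in
/-- The edges of the glued graph other than the bridge are those of the two parts. -/
noncomputable def glueEdges :
    G₁.edgeSet ⊕ G₂.edgeSet ≃ {e : (glue A G₁ G₂ a b).edgeSet // e ≠ bridge G₁ G₂ a b} := by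
  refine Equiv.ofBijective (Sum.elim
    (fun e => ⟨(glueLeft G₁ G₂ a b).mapEdgeSet e, ?_⟩)
    (fun e => ⟨(glueRight G₁ G₂ a b).mapEdgeSet e, ?_⟩)) ⟨?_, ?_⟩
  · obtain ⟨e, he⟩ := e
    induction e with | _ x y
    intro h
    have h2 : s((x : V), (y : V)) = s((a : V), (b : V)) := congrArg Subtype.val h
    have := b.2
    have := x.2
    have := y.2
    rcases Sym2.eq_iff.1 h2 with ⟨_, h⟩ | ⟨h, _⟩ <;> simp_all
  · obtain ⟨e, he⟩ := e
    induction e with | _ x y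
    intro h
    have h2 : s((x : V), (y : V)) = s((a : V), (b : V)) := congrArg Subtype.val h
    have := a.2
    have := x.2
    have := y.2
    rcases Sym2.eq_iff.1 h2 with ⟨h, _⟩ | ⟨_, h⟩ <;> simp_all
  · have hc : ∀ (e : G₁.edgeSet) (f : G₂.edgeSet),
        Sym2.map Subtype.val e.1 ≠ Sym2.map Subtype.val f.1 := by
      rintro ⟨e, he⟩ ⟨f, hf⟩ h
      induction e with | _ x y
      induction f with | _ x' y'
      have := x.2
      have := x'.2
      have := y'.2
      rcases Sym2.eq_iff.1 h with ⟨h, _⟩ | ⟨h, _⟩ <;> simp_all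
    rintro (e | e) (f | f) h
    · exact congrArg Sum.inl (Subtype.ext (Sym2.map.injective Subtype.val_injective
        (congrArg Subtype.val (congrArg Subtype.val h))))
    · exact absurd (congrArg Subtype.val (congrArg Subtype.val h)) (hc e f)
    · exact absurd (congrArg Subtype.val (congrArg Subtype.val h)).symm (hc f e)
    · exact congrArg Sum.inr (Subtype.ext (Sym2.map.injective Subtype.val_injective
        (congrArg Subtype.val (congrArg Subtype.val h))))
  · rintro ⟨⟨e, he⟩, hne⟩
    induction e with | _ x y
    rcases he with ⟨hi, hj, h⟩ | ⟨hi, hj, h⟩ | ⟨h, h'⟩ | ⟨h, h'⟩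
    · exact ⟨Sum.inl ⟨s(⟨x, hi⟩, ⟨y, hj⟩), h⟩, rfl⟩
    · exact ⟨Sum.inr ⟨s(⟨x, hi⟩, ⟨y, hj⟩), h⟩, rfl⟩
    · exact absurd (Subtype.ext (Sym2.eq_iff.2 (Or.inl ⟨h, h'⟩))) hne
    · exact absurd (Subtype.ext (Sym2.eq_iff.2 (Or.inr ⟨h, h'⟩))) hne

/-- Connectedness goes through the bridge. Acyclicity follows from counting: one edge more than in
the two trees together, on the union of their vertices, keeps the relation between the numbers of
edges and vertices. -/
lemma glue_isTree [Fintype V] (h₁ : G₁.IsTree) (h₂ : G₂.IsTree) :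
    (glue A G₁ G₂ a b).IsTree := by
  classical
  rw [isTree_iff_connected_and_card] at h₁ h₂ ⊢
  constructor
  · have ha : ∀ x, (glue A G₁ G₂ a b).Reachable a x := by
      intro x
      by_cases hx : x ∈ A
      · exact (h₁.1 a ⟨x, hx⟩).map (glueLeft G₁ G₂ a b)
      · exact glue_adj_bridge.reachable.trans ((h₂.1 b ⟨x, hx⟩).map (glueRight G₁ G₂ a b))
    exact (connected_iff_exists_forall_reachable _).2 ⟨a, ha⟩
  · have e := Nat.card_congr (glueEdges G₁ G₂ a b)
    have e2 := Nat.card_congr (Equiv.sumCompl (fun e => e = bridge G₁ G₂ a b))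
    rw [Nat.card_sum] at e e2
    have e3 : Nat.card V = Nat.card {x // x ∈ A} + Nat.card {x // x ∉ A} := by
      rw [← Nat.card_sum]; exact (Nat.card_congr (Equiv.sumCompl (fun x => x ∈ A))).symm
    have e4 : Nat.card {e // e = bridge G₁ G₂ a b} = 1 := by simp
    rw [← e2, e3, e4, ← h₁.2, ← h₂.2]
    change 1 + Nat.card {e // e ≠ bridge G₁ G₂ a b} + 1 = _
    rw [← e]; ring

/-- Cutting a tree at an edge. -/
lemma exists_eq_glue [Fintype V] {G : SimpleGraph V} (hG : G.IsTree) (r : V) {e : Sym2 V}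
    (he : e ∈ G.edgeSet) :
    ∃ (A : Finset V) (_ : r ∈ A) (G₁ : SimpleGraph {x // x ∈ A}) (G₂ : SimpleGraph {x // x ∉ A})
      (a : {x // x ∈ A}) (b : {x // x ∉ A}), G₁.IsTree ∧ G₂.IsTree ∧
      e = s((a : V), (b : V)) ∧ G = glue A G₁ G₂ a b := by
  classical
  set H := G.deleteEdges {e} with hH
  set A : Finset V := Finset.univ.filter (fun x => H.Reachable r x) with hA
  have memA : ∀ x, x ∈ A ↔ H.Reachable r x := fun x => by simp [hA]
  have adjH : ∀ x y, H.Adj x y ↔ G.Adj x y ∧ s(x, y) ≠ e := fun x y => by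
    simp [hH, deleteEdges_adj]
  have hr : r ∈ A := (memA r).2 (Reachable.refl r)
  have hclosed : ∀ x y, H.Adj x y → (x ∈ A ↔ y ∈ A) := fun x y h => by
    rw [memA, memA]; exact ⟨fun h' => h'.trans h.reachable, fun h' => h'.trans h.symm.reachable⟩
  -- orient the edge
  obtain ⟨x, y, hxy, hx, hy⟩ : ∃ x y, e = s(x, y) ∧ x ∈ A ∧ y ∉ A := by
    induction e with | _ x y
    -- Every edge of a tree is a bridge, so exactly one end of `e` stays connected to `r` once `e`
    -- is deleted; that end is called `x`.
    have hbr := isBridge_iff.1 ((isAcyclic_iff_forall_adj_isBridge.1 hG.2) he)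
    have hor : ∀ z, H.Reachable x z ∨ H.Reachable y z := by
      intro z
      obtain ⟨p⟩ := hG.1 x z
      by_contra hcon
      push Not at hcon
      obtain ⟨d, hd, hd1, hd2⟩ := p.exists_boundary_dart {z | H.Reachable x z ∨ H.Reachable y z}
        (Or.inl (Reachable.refl x)) (by simpa using hcon)
      apply hd2
      by_cases hde : s(d.fst, d.snd) = s(x, y)
      · rcases Sym2.eq_iff.1 hde with ⟨_, h⟩ | ⟨_, h⟩
        · exact Or.inr (h ▸ Reachable.refl _)
        · exact Or.inl (h ▸ Reachable.refl _)
      · have := (adjH _ _).2 ⟨d.adj, hde⟩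
        exact hd1.imp (fun h => h.trans this.reachable) (fun h => h.trans this.reachable)
    rcases hor r with h | h
    · exact ⟨x, y, rfl, (memA _).2 h.symm, fun h' => hbr (h.trans ((memA _).1 h'))⟩
    · exact ⟨y, x, Sym2.eq_swap, (memA _).2 h.symm,
        fun h' => hbr (h.trans ((memA _).1 h')).symm⟩
  have hGadj : G.Adj x y := by rw [hxy] at he; exact he
  have hcross : ∀ i j, i ∈ A → j ∉ A → G.Adj i j → i = x ∧ j = y := by
    intro i j hi hj h
    by_cases hij : s(i, j) = e
    · rw [hxy] at hij
      rcases Sym2.eq_iff.1 hij with h | ⟨h, _⟩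
      · exact h
      · exact absurd (h ▸ hi) hy
    · exact absurd ((hclosed i j ((adjH _ _).2 ⟨h, hij⟩)).1 hi) hj
  have hconn1 : (G.induce {x | x ∈ A}).Connected := by
    refine (connected_iff_exists_forall_reachable _).2 ⟨⟨x, hx⟩, ?_⟩
    rintro ⟨z, hz⟩
    have h0 : H.Reachable x z := ((memA _).1 hx).symm.trans ((memA _).1 hz)
    obtain ⟨p⟩ := h0
    have key : ∀ (u v : V) (p : H.Walk u v) (hu : u ∈ A) (hv : v ∈ A),
        (G.induce {x | x ∈ A}).Reachable ⟨u, hu⟩ ⟨v, hv⟩ := by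
      intro u v p
      induction p with
      | nil => intro hu hv; exact Reachable.refl _
      | cons h p ih =>
        intro hu hv
        have hm := (hclosed _ _ h).1 hu
        exact (Adj.reachable (show (G.induce {x | x ∈ A}).Adj ⟨_, hu⟩ ⟨_, hm⟩ from
          ((adjH _ _).1 h).1)).trans (ih hm hv)
    exact key _ _ p hx hz
  have hconn2 : (G.induce {x | x ∉ A}).Connected := by
    refine (connected_iff_exists_forall_reachable _).2 ⟨⟨y, hy⟩, ?_⟩
    rintro ⟨z, hz⟩
    obtain ⟨p, hp⟩ := hG.1.exists_isPath z y
    -- A path that starts outside `A` and ends at `y` cannot enter `A`: the only edge into `A`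
    -- starts at `y`, so `y` would occur twice on the path.
    have key : ∀ (u v : V) (p : G.Walk u v) (hp : p.IsPath) (hu : u ∉ A) (hv : v ∉ A)
        (_ : v = y), (G.induce {x | x ∉ A}).Reachable ⟨u, hu⟩ ⟨v, hv⟩ := by
      intro u v p
      induction p with
      | nil => intro _ hu hv _; exact Reachable.refl _
      | @cons u v' w h p ih =>
        intro hp hu hv hvy
        by_cases hm : v' ∈ A
        · have := hcross v' u hm hu h.symm
          exfalso
          rw [Walk.cons_isPath_iff] at hp
          exact hp.2 (by rw [this.2, ← hvy]; exact p.end_mem_support)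
        · exact (Adj.reachable (show (G.induce {x | x ∉ A}).Adj ⟨_, hu⟩ ⟨_, hm⟩ from h)).trans
            (ih ((Walk.cons_isPath_iff _ _).1 hp).1 hm hv hvy)
    exact (key _ _ p hp hz hy rfl).symm
  refine ⟨A, hr, G.induce {x | x ∈ A}, G.induce {x | x ∉ A}, ⟨x, hx⟩, ⟨y, hy⟩,
    ⟨hconn1, hG.2.induce _⟩, ⟨hconn2, hG.2.induce _⟩, hxy, ?_⟩
  ext i j
  by_cases hi : i ∈ A <;> by_cases hj : j ∈ A
  · exact (glue_adj_left (a := ⟨x, hx⟩) (b := ⟨y, hy⟩) (G₂ := G.induce {x | x ∉ A})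
      (G₁ := G.induce {x | x ∈ A}) ⟨i, hi⟩ ⟨j, hj⟩).symm
  · rw [glue_adj_cross hi hj]
    exact ⟨hcross i j hi hj, by rintro ⟨rfl, rfl⟩; exact hGadj⟩
  · rw [adj_comm, adj_comm _ i j, glue_adj_cross hj hi]
    exact ⟨hcross j i hj hi, by rintro ⟨rfl, rfl⟩; exact hGadj⟩
  · exact (glue_adj_right (a := ⟨x, hx⟩) (b := ⟨y, hy⟩) (G₂ := G.induce {x | x ∉ A})
      (G₁ := G.induce {x | x ∈ A}) ⟨i, hi⟩ ⟨j, hj⟩).symm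

/-- The vertex set of the first part is recovered from the glued graph and its bridge, which is the
heart of injectivity in `glueMap_bijective`. -/
lemma reachable_deleteEdges_glue [Fintype V] (h₁ : G₁.Connected) {r : V} (hr : r ∈ A) (x : V) :
    ((glue A G₁ G₂ a b).deleteEdges {s((a : V), (b : V))}).Reachable r x ↔ x ∈ A := by
  constructor
  · rintro ⟨p⟩
    by_contra hx
    obtain ⟨d, _, hd1, hd2⟩ := p.exists_boundary_dart {x | x ∈ A} hr hx
    have := deleteEdges_adj.1 d.adj
    have h2 := (glue_adj_cross hd1 hd2).1 this.1
    exact this.2 (by simp [h2.1, h2.2])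
  · intro hx
    obtain ⟨p⟩ := h₁ ⟨r, hr⟩ ⟨x, hx⟩
    have key : ∀ (u v : {x // x ∈ A}) (p : G₁.Walk u v),
        ((glue A G₁ G₂ a b).deleteEdges {s((a : V), (b : V))}).Reachable u v := by
      intro u v p
      induction p with
      | nil => exact Reachable.refl _
      | @cons u v w h p ih =>
        refine (Adj.reachable ?_).trans ih
        refine deleteEdges_adj.2 ⟨(glue_adj_left _ _).2 h, fun hs => ?_⟩
        rcases Sym2.eq_iff.1 hs with ⟨_, h⟩ | ⟨h, _⟩
        · exact b.2 (h ▸ v.2)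
        · exact b.2 (h ▸ u.2)
    exact key _ _ p

/-- Trees with a marked edge are pairs of trees on complementary sets of vertices, with a marked
vertex in each. -/
noncomputable def glueMap [Fintype V] (r : V) :
    (Σ A : {A : Finset V // r ∈ A}, {G : SimpleGraph {x // x ∈ A.1} // G.IsTree} ×
      {G : SimpleGraph {x // x ∉ A.1} // G.IsTree} × {x // x ∈ A.1} × {x // x ∉ A.1}) →
    Σ G : {G : SimpleGraph V // G.IsTree}, G.1.edgeSet :=
  fun d => ⟨⟨glue d.1.1 d.2.1.1 d.2.2.1.1 d.2.2.2.1 d.2.2.2.2, glue_isTree d.2.1.2 d.2.2.1.2⟩,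
    bridge _ _ _ _⟩

/-- The condition `r ∈ A` tells apart the two components left by deleting the marked edge, so that
each pair of a tree and an edge is reached exactly once and not twice. -/
lemma glueMap_bijective [Fintype V] (r : V) : Function.Bijective (glueMap r) := by
  classical
  constructor
  · rintro ⟨⟨A, hA⟩, ⟨G₁, h₁⟩, ⟨G₂, h₂⟩, a, b⟩ ⟨⟨A', hA'⟩, ⟨G₁', h₁'⟩, ⟨G₂', h₂'⟩, a', b'⟩ h
    have hg : glue A G₁ G₂ a b = glue A' G₁' G₂' a' b' :=
      congrArg (fun t : Σ G : {G : SimpleGraph V // G.IsTree}, G.1.edgeSet => t.1.1) h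
    have hs : s((a : V), (b : V)) = s((a' : V), (b' : V)) :=
      congrArg (fun t : Σ G : {G : SimpleGraph V // G.IsTree}, G.1.edgeSet => (t.2 : Sym2 V)) h
    have hAA : A = A' := by
      ext x
      rw [← reachable_deleteEdges_glue (G₁ := G₁) (G₂ := G₂) (a := a) (b := b) h₁.1 hA x,
        ← reachable_deleteEdges_glue (G₁ := G₁') (G₂ := G₂') (a := a') (b := b') h₁'.1 hA' x,
        hg, hs]
    subst hAA
    have e1 : G₁ = G₁' := by
      ext i j
      rw [← glue_adj_left (G₁ := G₁) (G₂ := G₂) (a := a) (b := b), hg, glue_adj_left]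
    have e2 : G₂ = G₂' := by
      ext i j
      rw [← glue_adj_right (G₁ := G₁) (G₂ := G₂) (a := a) (b := b), hg, glue_adj_right]
    have e3 : a = a' ∧ b = b' := by
      rcases Sym2.eq_iff.1 hs with ⟨h, h'⟩ | ⟨h, h'⟩
      · exact ⟨Subtype.ext h, Subtype.ext h'⟩
      · exact absurd (h ▸ a.2) b'.2
    obtain ⟨rfl, rfl⟩ := e3
    subst e1 e2
    rfl
  · rintro ⟨⟨G, hG⟩, ⟨e, he⟩⟩
    obtain ⟨A, hA, G₁, G₂, a, b, h₁, h₂, rfl, rfl⟩ := exists_eq_glue hG r he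
    exact ⟨⟨⟨A, hA⟩, ⟨G₁, h₁⟩, ⟨G₂, h₂⟩, a, b⟩, rfl⟩

end Glue

end NVector

namespace NVector

/-! ### Splitting a cube according to the smallest coordinate -/

section Pyramid

variable {E : Type} [DecidableEq E]

/-- The function with value `m` at `e` and given values elsewhere. -/
def joinAt (e : E) (m : ℝ) (w : {e' // ¬ e' = e} → ℝ) : E → ℝ :=
  fun e' => if h : e' = e then m else w ⟨e', h⟩

@[simp] lemma joinAt_self (e : E) (m : ℝ) (w) : joinAt e m w e = m := by simp [joinAt]

@[simp] lemma joinAt_coe (e : E) (m : ℝ) (w) (e' : {e' // ¬ e' = e}) :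
    joinAt e m w e' = w e' := by simp [joinAt, e'.2]

variable [Fintype E]

lemma measurePreserving_joinAt (e : E) :
    MeasurePreserving (fun q : ℝ × ({e' // ¬ e' = e} → ℝ) => joinAt e q.1 q.2) := by
  have h1 := (volume_preserving_piEquivPiSubtypeProd (fun _ : E => ℝ) (fun e' => e' = e)).symm
  have h2 : MeasurePreserving (Prod.map (MeasurableEquiv.funUnique {e' // e' = e} ℝ).symm id :
      ℝ × ({e' // ¬ e' = e} → ℝ) → _) volume volume :=
    (volume_preserving_funUnique {e' // e' = e} ℝ).symm.prod (MeasurePreserving.id volume)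
  rw [Subsingleton.elim (Fintype.subtypeEq e) (Subtype.fintype fun e' => e' = e)] at h2
  have h3 := h1.comp h2
  have hfun : (fun q : ℝ × ({e' // ¬ e' = e} → ℝ) => joinAt e q.1 q.2) =
      (MeasurableEquiv.piEquivPiSubtypeProd (fun _ : E => ℝ) (fun e' => e' = e)).symm ∘
        Prod.map (MeasurableEquiv.funUnique {e' // e' = e} ℝ).symm id := by
    funext q e'
    by_cases h : e' = e
    · subst h; simp [MeasurableEquiv.piEquivPiSubtypeProd, Equiv.piEquivPiSubtypeProd,
        MeasurableEquiv.funUnique]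
    · simp [joinAt, h, MeasurableEquiv.piEquivPiSubtypeProd, Equiv.piEquivPiSubtypeProd]
  rw [hfun]
  exact h3

-- Coincidences between coordinates fill finitely many proper hyperplanes, which are null. Hence the
-- position of the smallest coordinate is almost everywhere unique.
omit [DecidableEq E] in
lemma ae_injective_pi : ∀ᵐ w : E → ℝ, Function.Injective w := by
  have : ∀ᵐ w : E → ℝ, ∀ e e' : E, e ≠ e' → w e ≠ w e' := by
    rw [ae_all_iff]; intro e
    rw [ae_all_iff]; intro e'
    by_cases hne : e = e'
    · simp [hne]
    · let S : Submodule ℝ (E → ℝ) := LinearMap.ker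
        ((LinearMap.proj e : (E → ℝ) →ₗ[ℝ] ℝ) - LinearMap.proj e')
      have hS : S ≠ ⊤ := by
        intro h
        classical
        have : Pi.single e (1 : ℝ) ∈ S := h ▸ Submodule.mem_top
        simp [S, Ne.symm hne] at this
      have h0 := Measure.addHaar_submodule (volume : Measure (E → ℝ)) S hS
      rw [ae_iff]
      refine measure_mono_null ?_ h0
      intro w hw
      simp only [Set.mem_ofPred_eq, not_forall, not_not] at hw
      obtain ⟨_, hw⟩ := hw
      simp [S, hw]
  filter_upwards [this] with w hw e e' h
  by_contra hne
  exact hw e e' hne h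

/-- The integral over a cube is the sum over the position of the smallest coordinate. -/
lemma lintegral_cube_eq_sum [Nonempty E] (s : ℝ) {f : (E → ℝ) → ENNReal} (hf : Measurable f) :
    ∫⁻ w in Set.univ.pi (fun _ => Set.Icc s 1), f w =
      ∑ e : E, ∫⁻ m in Set.Icc s 1,
        ∫⁻ w in Set.univ.pi (fun _ => Set.Icc m 1), f (joinAt e m w) := by
  set C : Set (E → ℝ) := Set.univ.pi (fun _ => Set.Icc s 1) with hC
  have hCm : MeasurableSet C := MeasurableSet.univ_pi fun _ => measurableSet_Icc
  let M : E → Set (E → ℝ) := fun e => {w | ∀ e', w e ≤ w e'}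
  have hM : ∀ e, MeasurableSet (M e) := fun e => by
    have : M e = ⋂ e', {w | w e ≤ w e'} := by ext; simp [M]
    rw [this]
    exact MeasurableSet.iInter fun e' => measurableSet_le (measurable_pi_apply e)
      (measurable_pi_apply e')
  have h1 : ∫⁻ w in C, f w = ∑ e : E, ∫⁻ w, (C ∩ M e).indicator f w := by
    rw [← lintegral_indicator hCm, ← lintegral_finsetSum _
      fun e _ => hf.indicator (hCm.inter (hM e))]
    refine lintegral_congr_ae ?_
    filter_upwards [ae_injective_pi] with w hw
    obtain ⟨e, he⟩ := Finite.exists_min w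
    rw [Finset.sum_eq_single e]
    · by_cases hwC : w ∈ C
      · rw [Set.indicator_of_mem hwC, Set.indicator_of_mem (s := C ∩ M e) ⟨hwC, he⟩]
      · rw [Set.indicator_of_notMem hwC, Set.indicator_of_notMem fun h => hwC h.1]
    · intro e' _ hne
      refine Set.indicator_of_notMem (fun h => hne (hw (le_antisymm (h.2 e) (he e')))) _
    · simp
  rw [h1]
  refine Finset.sum_congr rfl fun e _ => ?_
  -- In the coordinates (value `m` at `e`, other values `w`), the region of the cube where `e` is
  -- the smallest is a pyramid: `m ∈ [s,1]`, the others in `[m,1]`.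
  have hmem : ∀ m w, joinAt e m w ∈ C ∩ M e ↔
      m ∈ Set.Icc s 1 ∧ w ∈ Set.univ.pi (fun _ : {e' // ¬ e' = e} => Set.Icc m 1) := by
    intro m w
    simp only [hC, M, Set.mem_inter_iff, Set.mem_univ_pi, Set.mem_ofPred_eq, joinAt_self]
    constructor
    · rintro ⟨h1, h2⟩
      refine ⟨by simpa using h1 e, fun e' => ⟨by simpa using h2 e', by simpa using (h1 e').2⟩⟩
    · rintro ⟨h1, h2⟩
      constructor
      · intro e'
        by_cases h : e' = e
        · subst h; simpa using h1
        · have := h2 ⟨e', h⟩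
          simp only [joinAt, h, dite_false]
          exact ⟨h1.1.trans this.1, this.2⟩
      · intro e'
        by_cases h : e' = e
        · subst h; simp
        · simpa only [joinAt, h, dite_false] using (h2 ⟨e', h⟩).1
  have hg : Measurable ((C ∩ M e).indicator f) := hf.indicator (hCm.inter (hM e))
  rw [← (measurePreserving_joinAt e).lintegral_comp hg]
  rw [Measure.volume_eq_prod, lintegral_prod
    (fun q => (C ∩ M e).indicator f (joinAt e q.1 q.2))
    (hg.comp (measurePreserving_joinAt e).measurable).aemeasurable,
    ← lintegral_indicator measurableSet_Icc]
  refine lintegral_congr fun m => ?_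
  by_cases hm : m ∈ Set.Icc s 1
  · rw [Set.indicator_of_mem hm, ← lintegral_indicator
      (MeasurableSet.univ_pi fun _ => measurableSet_Icc)]
    refine lintegral_congr fun w => ?_
    by_cases hw : w ∈ Set.univ.pi (fun _ : {e' // ¬ e' = e} => Set.Icc m 1)
    · rw [Set.indicator_of_mem hw, Set.indicator_of_mem ((hmem m w).2 ⟨hm, hw⟩)]
    · rw [Set.indicator_of_notMem hw, Set.indicator_of_notMem fun h => hw ((hmem m w).1 h).2]
  · rw [Set.indicator_of_notMem hm]
    simp only
    rw [← lintegral_zero]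
    refine lintegral_congr fun w => ?_
    rw [Set.indicator_of_notMem fun h => hm ((hmem m w).1 h).1]

end Pyramid

/-! ### The matrix of path infima -/

section PathInf

open SimpleGraph

variable {V : Type}

open Classical in
/-- `1` on the diagonal, and the infimum of `w` over the edges of the paths from `i` to `j`. -/
noncomputable def pathInf (G : SimpleGraph V) (w : G.edgeSet → ℝ) (i j : V) : ℝ :=
  if i = j then 1 else
    ⨅ e : {e : G.edgeSet // ∃ p : G.Walk i j, p.IsPath ∧ (e : Sym2 V) ∈ p.edges}, w e

lemma PlaneTree.X_eq_pathInf {n : ℕ} (T : PlaneTree n) (w : T.Edge → ℝ) (i j : Fin (n + 1)) :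
    T.X w i j = pathInf T.graph w i j := by
  unfold PlaneTree.X pathInf
  by_cases h : i = j <;> simp [h]

variable {G : SimpleGraph V} {w : G.edgeSet → ℝ} {i j k : V} {s : ℝ}

@[simp] lemma pathInf_self : pathInf G w i i = 1 := by simp [pathInf]

lemma measurable_pathInf [Fintype V] : Measurable fun w : G.edgeSet → ℝ => pathInf G w i j := by
  unfold pathInf
  split_ifs
  · exact measurable_const
  · exact Measurable.iInf fun e => measurable_pi_apply _

lemma pathInf_eq_iInf (hG : G.IsAcyclic) (hij : i ≠ j) {p : G.Walk i j} (hp : p.IsPath) :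
    pathInf G w i j = ⨅ e : {e : G.edgeSet // (e : Sym2 V) ∈ p.edges}, w e := by
  rw [pathInf, if_neg hij]
  refine Equiv.iInf_congr (Equiv.subtypeEquivRight fun e => ?_) fun e => rfl
  constructor
  · rintro ⟨q, hq, he⟩
    have := (hG.subsingleton_path i j).elim ⟨p, hp⟩ ⟨q, hq⟩
    rw [Subtype.mk.injEq] at this
    exact this ▸ he
  · exact fun he => ⟨p, hp, he⟩

lemma nonempty_edges {p : G.Walk i j} (hij : i ≠ j) :
    Nonempty {e : G.edgeSet // (e : Sym2 V) ∈ p.edges} := by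
  cases p with
  | nil => exact absurd rfl hij
  | @cons _ v _ h p => exact ⟨⟨⟨s(i, v), h⟩, by simp⟩⟩

lemma pathInf_comm (hG : G.IsTree) : pathInf G w i j = pathInf G w j i := by
  by_cases hij : i = j
  · rw [hij]
  · obtain ⟨p, hp⟩ := hG.1.exists_isPath i j
    rw [pathInf_eq_iInf hG.2 hij hp, pathInf_eq_iInf hG.2 (Ne.symm hij) hp.reverse]
    exact Equiv.iInf_congr (Equiv.subtypeEquivRight fun e => by simp) fun e => rfl

lemma pathInf_mem_Icc [Fintype V] (hG : G.IsTree) (hs : s ≤ 1) (hw : ∀ e, w e ∈ Set.Icc s 1) :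
    pathInf G w i j ∈ Set.Icc s 1 := by
  by_cases hij : i = j
  · subst hij; simpa using hs
  · obtain ⟨p, hp⟩ := hG.1.exists_isPath i j
    rw [pathInf_eq_iInf hG.2 hij hp]
    have hne := nonempty_edges (p := p) hij
    refine ⟨le_ciInf fun e => (hw e).1, ?_⟩
    obtain ⟨e⟩ := hne
    exact (ciInf_le (Set.finite_range _).bddBelow e).trans (hw e).2

variable {A : Finset V} {G₁ : SimpleGraph {x // x ∈ A}} {G₂ : SimpleGraph {x // x ∉ A}}
  {a : {x // x ∈ A}} {b : {x // x ∉ A}}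

/-- An injective homomorphism sends the path of a tree to the path between the images. Applied to
the two parts of a glued tree: a path between vertices of one part stays inside it. -/
lemma pathInf_map {V' : Type} {G' : SimpleGraph V'} (hG : G.IsTree) (hG' : G'.IsAcyclic)
    (f : G →g G') (hf : Function.Injective f) (w : G'.edgeSet → ℝ) (i j : V) :
    pathInf G' w (f i) (f j) = pathInf G (fun e => w (f.mapEdgeSet e)) i j := by
  by_cases hij : i = j
  · subst hij; simp
  · obtain ⟨p, hp⟩ := hG.1.exists_isPath i j
    rw [pathInf_eq_iInf hG.2 hij hp, pathInf_eq_iInf hG' (hf.ne hij) (hp.map hf)]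
    have hmem : ∀ e : {e : G.edgeSet // (e : Sym2 V) ∈ p.edges},
        (f.mapEdgeSet e.1 : Sym2 V') ∈ (p.map f).edges := fun e => by
      rw [Walk.edges_map]; exact List.mem_map_of_mem e.2
    symm
    refine Function.Surjective.iInf_congr (fun e => ⟨f.mapEdgeSet e.1, hmem e⟩) ?_ fun e => rfl
    rintro ⟨⟨e, he⟩, hep⟩
    rw [Walk.edges_map] at hep
    obtain ⟨e', he', rfl⟩ := List.mem_map.1 hep
    exact ⟨⟨⟨e', p.edges_subset_edgeSet he'⟩, he'⟩, rfl⟩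

/-- A path from one part to the other must use the bridge, which carries the smallest parameter. -/
lemma pathInf_glue_cross [Fintype V] (h₁ : G₁.IsTree) (h₂ : G₂.IsTree)
    {w : (glue A G₁ G₂ a b).edgeSet → ℝ} (hw : ∀ e, w (bridge G₁ G₂ a b) ≤ w e)
    (hi : i ∈ A) (hj : j ∉ A) : pathInf (glue A G₁ G₂ a b) w i j = w (bridge G₁ G₂ a b) := by
  have hG := glue_isTree (a := a) (b := b) h₁ h₂
  have hij : i ≠ j := fun h => hj (h ▸ hi)
  obtain ⟨p, hp⟩ := hG.1.exists_isPath i j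
  rw [pathInf_eq_iInf hG.2 hij hp]
  obtain ⟨d, hd, hd1, hd2⟩ := p.exists_boundary_dart {x | x ∈ A} hi hj
  have h2 := (glue_adj_cross hd1 hd2).1 d.adj
  have hne := nonempty_edges (p := p) hij
  have hb : ((bridge G₁ G₂ a b : (glue A G₁ G₂ a b).edgeSet) : Sym2 V) ∈ p.edges := by
    have := List.mem_map_of_mem (f := Dart.edge) hd
    rw [Walk.edges]
    convert this using 1
    exact (Sym2.eq_iff.2 (Or.inl ⟨h2.1, h2.2⟩)).symm
  refine le_antisymm ?_ (le_ciInf fun e => hw e)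
  exact ciInf_le (f := fun e : {e : (glue A G₁ G₂ a b).edgeSet // (e : Sym2 V) ∈ p.edges} =>
    w e) (Set.finite_range _).bddBelow ⟨bridge G₁ G₂ a b, hb⟩

/-- The quadratic form `∑ βᵢ (Xᵢⱼ - s) βⱼ`. -/
noncomputable def energy [Fintype V] (G : SimpleGraph V) (w : G.edgeSet → ℝ) (s : ℝ) (β : V → ℝ) :
    ℝ := ∑ i, ∑ j, β i * β j * (pathInf G w i j - s)

lemma measurable_energy [Fintype V] :
    Measurable fun q : (V → ℝ) × (G.edgeSet → ℝ) => energy G q.2 s q.1 := by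
  unfold energy
  refine Finset.measurable_sum _ fun i _ => Finset.measurable_sum _ fun j _ => ?_
  have : Measurable fun q : (V → ℝ) × (G.edgeSet → ℝ) => pathInf G q.2 i j :=
    measurable_pathInf.comp measurable_snd
  have hi : Measurable fun q : (V → ℝ) × (G.edgeSet → ℝ) => q.1 i :=
    (measurable_pi_apply i).comp measurable_fst
  have hj : Measurable fun q : (V → ℝ) × (G.edgeSet → ℝ) => q.1 j :=
    (measurable_pi_apply j).comp measurable_fst
  exact (hi.mul hj).mul (this.sub_const s)

/-- Between the two parts `X` is constantly `m`, the parameter of the bridge. So `X - s` is `m - s`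
times the all-ones matrix plus a block-diagonal matrix with blocks `X₁ - m` and `X₂ - m`. The
parameter `s` of `energy` is there to make this recursion close. -/
lemma energy_glue [Fintype V] [DecidableEq V] (h₁ : G₁.IsTree) (h₂ : G₂.IsTree)
    {w : (glue A G₁ G₂ a b).edgeSet → ℝ} (hw : ∀ e, w (bridge G₁ G₂ a b) ≤ w e) (s : ℝ)
    (β : V → ℝ) :
    energy (glue A G₁ G₂ a b) w s β =
      (w (bridge G₁ G₂ a b) - s) * (∑ i, β i) ^ 2 +
      energy G₁ (fun e => w ((glueLeft G₁ G₂ a b).mapEdgeSet e)) (w (bridge G₁ G₂ a b))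
        (fun i => β i) +
      energy G₂ (fun e => w ((glueRight G₁ G₂ a b).mapEdgeSet e)) (w (bridge G₁ G₂ a b))
        (fun i => β i) := by
  have hG := glue_isTree (a := a) (b := b) h₁ h₂
  have hL : ∀ i j : {x // x ∈ A}, pathInf (glue A G₁ G₂ a b) w i j =
      pathInf G₁ (fun e => w ((glueLeft G₁ G₂ a b).mapEdgeSet e)) i j := fun i j =>
    pathInf_map h₁ hG.2 (glueLeft G₁ G₂ a b) Subtype.val_injective w i j
  have hR : ∀ i j : {x // x ∉ A}, pathInf (glue A G₁ G₂ a b) w i j =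
      pathInf G₂ (fun e => w ((glueRight G₁ G₂ a b).mapEdgeSet e)) i j := fun i j =>
    pathInf_map h₂ hG.2 (glueRight G₁ G₂ a b) Subtype.val_injective w i j
  have hX : ∀ (i : {x // x ∈ A}) (j : {x // x ∉ A}), pathInf (glue A G₁ G₂ a b) w i j =
      w (bridge G₁ G₂ a b) := fun i j => pathInf_glue_cross h₁ h₂ hw i.2 j.2
  have hX' : ∀ (i : {x // x ∉ A}) (j : {x // x ∈ A}), pathInf (glue A G₁ G₂ a b) w i j =
      w (bridge G₁ G₂ a b) := fun i j => by
    rw [pathInf_comm hG]; exact pathInf_glue_cross h₁ h₂ hw j.2 i.2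
  set m := w (bridge G₁ G₂ a b)
  have split : ∀ f : V → ℝ, ∑ i, f i = ∑ i : {x // x ∈ A}, f i + ∑ i : {x // x ∉ A}, f i :=
    fun f => by convert (Fintype.sum_subtype_add_sum_subtype (fun x => x ∈ A) f).symm
  have h1 : energy (glue A G₁ G₂ a b) w s β = (m - s) * (∑ i, β i) ^ 2 +
      ∑ i, ∑ j, β i * β j * (pathInf (glue A G₁ G₂ a b) w i j - m) := by
    rw [energy, sq, Finset.sum_mul_sum, Finset.mul_sum, ← Finset.sum_add_distrib]
    refine Finset.sum_congr rfl fun i _ => ?_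
    rw [Finset.mul_sum, ← Finset.sum_add_distrib]
    exact Finset.sum_congr rfl fun j _ => by ring
  rw [h1, add_assoc]
  congr 1
  rw [split]
  congr 1
  · refine Finset.sum_congr rfl fun i _ => ?_
    rw [split]
    simp [hL, hX]
  · refine Finset.sum_congr rfl fun i _ => ?_
    rw [split]
    simp [hR, hX']

end PathInf

end NVector

namespace NVector

/-! ### Sums over labelled trees -/

section TreeSum

open SimpleGraph
open scoped ENNReal

lemma lintegral_pi_sum {ι₁ ι₂ ι : Type} [Fintype ι₁] [Fintype ι₂] [Fintype ι] (ε : ι₁ ⊕ ι₂ ≃ ι)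
    (S : Set ℝ) {H : (ι₁ → ℝ) → (ι₂ → ℝ) → ℝ≥0∞} (hH : Measurable (Function.uncurry H)) :
    ∫⁻ w in Set.univ.pi (fun _ : ι => S), H (fun e => w (ε (Sum.inl e))) (fun e => w (ε (Sum.inr e)))
      = ∫⁻ w₁ in Set.univ.pi (fun _ : ι₁ => S), ∫⁻ w₂ in Set.univ.pi (fun _ : ι₂ => S), H w₁ w₂ := by
  have hr : ∀ (κ : Type) [Fintype κ], (volume : Measure (κ → ℝ)).restrict (Set.univ.pi fun _ => S) =
      Measure.pi fun _ => (volume : Measure ℝ).restrict S := fun κ _ => by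
    rw [volume_pi, Measure.restrict_pi_pi]
  rw [hr, hr]
  simp_rw [hr]
  have h1 := (measurePreserving_piCongrLeft (fun _ : ι => (volume : Measure ℝ).restrict S) ε).symm
  have h2 := measurePreserving_sumPiEquivProdPi
    (fun _ : ι₁ ⊕ ι₂ => (volume : Measure ℝ).restrict S)
  have h3 := h2.comp h1
  have h4 := h3.lintegral_comp hH
  rw [lintegral_prod _ hH.aemeasurable] at h4
  rw [show (∫⁻ w₁, ∫⁻ w₂, H w₁ w₂ ∂Measure.pi (fun _ : ι₂ => (volume : Measure ℝ).restrict S)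
    ∂Measure.pi (fun _ : ι₁ => (volume : Measure ℝ).restrict S)) = _ from h4.symm]
  rfl

variable {V : Type} [Fintype V]

noncomputable instance (G : SimpleGraph V) : Fintype G.edgeSet := Fintype.ofFinite _

noncomputable instance : Fintype {G : SimpleGraph V // G.IsTree} := Fintype.ofFinite _

/-- The number of children of a vertex, in a tree with a given root. -/
noncomputable def childCount (G : SimpleGraph V) (r i : V) : ℕ :=
  (G.neighborSet i).ncard - (open Classical in if i = r then 0 else 1)

/-- `∏ βᵢ ^ (number of children of i)`. -/
noncomputable def treeWeight (G : SimpleGraph V) (r : V) (β : V → ℝ) : ℝ :=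
  ∏ i, β i ^ childCount G r i

/-- The integral of `exp (x/2 ∑ βᵢ (Xᵢⱼ(w) - s) βⱼ)` over the cube `[s,1]^{edges}`. -/
noncomputable def treeAmp (x : ℝ) (G : SimpleGraph V) (s : ℝ) (β : V → ℝ) : ℝ≥0∞ :=
  ∫⁻ w in Set.univ.pi (fun _ : G.edgeSet => Set.Icc s 1),
    ENNReal.ofReal (Real.exp (x / 2 * energy G w s β))

variable {x : ℝ}

section glueing

variable [DecidableEq V] {A : Finset V} {G₁ : SimpleGraph {x // x ∈ A}}
  {G₂ : SimpleGraph {x // x ∉ A}} {a : {x // x ∈ A}} {b : {x // x ∉ A}}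

omit [Fintype V] [DecidableEq V] in
lemma neighborSet_glue_left (i : {x // x ∈ A}) (hi : i ≠ a) :
    (glue A G₁ G₂ a b).neighborSet i = Subtype.val '' G₁.neighborSet i := by
  ext j
  by_cases hj : j ∈ A
  · rw [mem_neighborSet, glue_adj_left i ⟨j, hj⟩]
    simp [hj]
  · rw [mem_neighborSet, glue_adj_cross i.2 hj]
    simp only [Subtype.val_inj, hi, false_and, false_iff]
    rintro ⟨j', _, rfl⟩
    exact hj j'.2

omit [Fintype V] [DecidableEq V] in
lemma neighborSet_glue_left_self :
    (glue A G₁ G₂ a b).neighborSet a = insert (b : V) (Subtype.val '' G₁.neighborSet a) := by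
  ext j
  by_cases hj : j ∈ A
  · rw [mem_neighborSet, glue_adj_left a ⟨j, hj⟩]
    have : j ≠ b := fun h => b.2 (h ▸ hj)
    simp [hj, this]
  · rw [mem_neighborSet, glue_adj_cross a.2 hj]
    simp [hj]

omit [Fintype V] [DecidableEq V] in
lemma neighborSet_glue_right (i : {x // x ∉ A}) (hi : i ≠ b) :
    (glue A G₁ G₂ a b).neighborSet i = Subtype.val '' G₂.neighborSet i := by
  ext j
  by_cases hj : j ∈ A
  · rw [mem_neighborSet, adj_comm, glue_adj_cross hj i.2]
    simp only [Subtype.val_inj, hi, and_false, false_iff]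
    rintro ⟨j', _, rfl⟩
    exact j'.2 hj
  · rw [mem_neighborSet, glue_adj_right i ⟨j, hj⟩]
    simp [hj]

omit [Fintype V] [DecidableEq V] in
lemma neighborSet_glue_right_self :
    (glue A G₁ G₂ a b).neighborSet b = insert (a : V) (Subtype.val '' G₂.neighborSet b) := by
  ext j
  by_cases hj : j ∈ A
  · rw [mem_neighborSet, adj_comm, glue_adj_cross hj b.2]
    simp [hj]
  · rw [mem_neighborSet, glue_adj_right b ⟨j, hj⟩]
    have : j ≠ a := fun h => hj (h ▸ a.2)
    simp [hj, this]

/-- The bridge makes `b` a new child of `a`, whence the factor `β a`. In the second tree `b` serves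
as root: its missing parent edge is the bridge. -/
lemma treeWeight_glue (h₁ : G₁.IsTree) {r : V} (hr : r ∈ A) (β : V → ℝ) :
    treeWeight (glue A G₁ G₂ a b) r β =
      β a * treeWeight G₁ ⟨r, hr⟩ (fun i => β i) * treeWeight G₂ b (fun i => β i) := by
  have hL : ∀ i : {x // x ∈ A}, i ≠ a →
      childCount (glue A G₁ G₂ a b) r i = childCount G₁ ⟨r, hr⟩ i := by
    intro i hi
    unfold childCount
    rw [neighborSet_glue_left i hi, Set.ncard_image_of_injective _ Subtype.val_injective]
    simp only [Subtype.ext_iff]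
    congr
  have hLa : childCount (glue A G₁ G₂ a b) r a = childCount G₁ ⟨r, hr⟩ a + 1 := by
    unfold childCount
    rw [neighborSet_glue_left_self, Set.ncard_insert_of_notMem,
      Set.ncard_image_of_injective _ Subtype.val_injective]
    · by_cases har : a = ⟨r, hr⟩
      · simp [har]
      · have har' : ¬ (a : V) = r := fun h => har (Subtype.ext h)
        -- A non-root vertex `a` has a neighbour already in `G₁`, so the truncated subtraction in
        -- `childCount` is a genuine one and the count does increase by one.
        have hne : (G₁.neighborSet a).ncard ≠ 0 := by
          have : Nontrivial {x // x ∈ A} := ⟨⟨_, _, har⟩⟩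
          obtain ⟨j, hj⟩ := h₁.1.preconnected.exists_adj_of_nontrivial a
          exact Set.ncard_ne_zero_of_mem (a := j) hj
        simp only [har, har', if_false]
        omega
    · rintro ⟨j, _, hj⟩
      exact b.2 (hj ▸ j.2)
  have hR : ∀ i : {x // x ∉ A},
      childCount (glue A G₁ G₂ a b) r i = childCount G₂ b i := by
    intro i
    have hir : ¬ (i : V) = r := fun h => i.2 (h ▸ hr)
    unfold childCount
    by_cases hi : i = b
    · subst hi
      rw [neighborSet_glue_right_self, Set.ncard_insert_of_notMem,
        Set.ncard_image_of_injective _ Subtype.val_injective]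
      · simp [hir]
      · rintro ⟨j, _, hj⟩
        exact j.2 (hj ▸ a.2)
    · rw [neighborSet_glue_right i hi, Set.ncard_image_of_injective _ Subtype.val_injective]
      simp [hir, hi]
  unfold treeWeight
  rw [show ∏ i, β i ^ childCount (glue A G₁ G₂ a b) r i =
    (∏ i : {x // x ∈ A}, β i ^ childCount (glue A G₁ G₂ a b) r i) *
      ∏ i : {x // x ∉ A}, β i ^ childCount (glue A G₁ G₂ a b) r i by
    convert (Fintype.prod_subtype_mul_prod_subtype (fun x => x ∈ A) _).symm]
  congr 1
  · rw [← Finset.mul_prod_erase _ _ (Finset.mem_univ a), hLa,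
      ← Finset.mul_prod_erase (a := a) Finset.univ (fun i : {x // x ∈ A} =>
        β i ^ childCount G₁ ⟨r, hr⟩ i) (Finset.mem_univ a), pow_succ']
    rw [mul_assoc]
    congr 2
    exact Finset.prod_congr rfl fun i hi => by rw [hL i (Finset.ne_of_mem_erase hi)]
  · exact Finset.prod_congr rfl fun i _ => by rw [hR i]

omit [DecidableEq V] in
lemma measurable_exp_energy_right (x s : ℝ) (G : SimpleGraph V) (γ : V → ℝ) :
    Measurable fun w : G.edgeSet → ℝ => ENNReal.ofReal (Real.exp (x / 2 * energy G w s γ)) := by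
  have h : Measurable fun w : G.edgeSet → ℝ => energy G w s γ :=
    Measurable.comp (g := fun q : (V → ℝ) × (G.edgeSet → ℝ) => energy G q.2 s q.1)
      (f := fun w => (γ, w)) measurable_energy measurable_prodMk_left
  exact ((h.const_mul _).exp).ennreal_ofReal

/-- Once the bridge carries the smallest parameter `m`, `energy_glue` makes the exponent a sum of a
constant and of terms in the parameters of either part alone, so the integral over `[m,1]^{edges}`
factorises. -/
lemma lintegral_joinAt_bridge (h₁ : G₁.IsTree) (h₂ : G₂.IsTree) (s m : ℝ) (β : V → ℝ) :
    ∫⁻ w in Set.univ.pi (fun _ => Set.Icc m 1), ENNReal.ofReal (Real.exp (x / 2 *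
      energy (glue A G₁ G₂ a b) (joinAt (bridge G₁ G₂ a b) m w) s β)) =
    ENNReal.ofReal (Real.exp (x / 2 * (m - s) * (∑ i, β i) ^ 2)) *
      (treeAmp x G₁ m (fun i => β i) * treeAmp x G₂ m (fun i => β i)) := by
  have hmeas : ∀ {W : Type} [Fintype W] (G : SimpleGraph W) (γ : W → ℝ), Measurable
      fun w : G.edgeSet → ℝ => ENNReal.ofReal (Real.exp (x / 2 * energy G w m γ)) :=
    fun G γ => measurable_exp_energy_right x m G γ
  have h0 : ∀ w ∈ Set.univ.pi (fun _ : {e // ¬ e = bridge G₁ G₂ a b} => Set.Icc m 1),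
      ENNReal.ofReal (Real.exp (x / 2 *
        energy (glue A G₁ G₂ a b) (joinAt (bridge G₁ G₂ a b) m w) s β)) =
      ENNReal.ofReal (Real.exp (x / 2 * (m - s) * (∑ i, β i) ^ 2)) *
      (ENNReal.ofReal (Real.exp (x / 2 * energy G₁
        (fun e => w (glueEdges G₁ G₂ a b (Sum.inl e))) m (fun i => β i))) *
      ENNReal.ofReal (Real.exp (x / 2 * energy G₂
        (fun e => w (glueEdges G₁ G₂ a b (Sum.inr e))) m (fun i => β i)))) := by
    intro w hw
    rw [energy_glue h₁ h₂, joinAt_self]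
    · rw [← ENNReal.ofReal_mul (Real.exp_nonneg _), ← ENNReal.ofReal_mul (Real.exp_nonneg _),
        ← Real.exp_add, ← Real.exp_add]
      have e1 : (fun e => joinAt (bridge G₁ G₂ a b) m w ((glueLeft G₁ G₂ a b).mapEdgeSet e)) =
          fun e => w (glueEdges G₁ G₂ a b (Sum.inl e)) := by
        funext e; exact joinAt_coe _ m w (glueEdges G₁ G₂ a b (Sum.inl e))
      have e2 : (fun e => joinAt (bridge G₁ G₂ a b) m w ((glueRight G₁ G₂ a b).mapEdgeSet e)) =
          fun e => w (glueEdges G₁ G₂ a b (Sum.inr e)) := by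
        funext e; exact joinAt_coe _ m w (glueEdges G₁ G₂ a b (Sum.inr e))
      rw [e1, e2]
      congr 2
      ring
    · intro e
      rw [joinAt_self]
      by_cases h : e = bridge G₁ G₂ a b
      · rw [h, joinAt_self]
      · rw [joinAt_coe _ _ _ ⟨e, h⟩]
        exact (hw ⟨e, h⟩ (Set.mem_univ _)).1
  rw [setLIntegral_congr_fun (MeasurableSet.univ_pi fun _ => measurableSet_Icc) h0,
    lintegral_const_mul' _ _ ENNReal.ofReal_ne_top]
  congr 1
  have h5 := lintegral_pi_sum (glueEdges G₁ G₂ a b) (Set.Icc m 1) (H := fun w₁ w₂ =>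
    ENNReal.ofReal (Real.exp (x / 2 * energy G₁ w₁ m (fun i => β i))) *
    ENNReal.ofReal (Real.exp (x / 2 * energy G₂ w₂ m (fun i => β i))))
    (((hmeas G₁ _).comp measurable_fst).mul ((hmeas G₂ _).comp measurable_snd))
  refine h5.trans ?_
  simp_rw [lintegral_const_mul' _ _ ENNReal.ofReal_ne_top]
  rw [lintegral_mul_const _ (hmeas G₁ _)]
  rfl

end glueing

end TreeSum

end NVector

namespace NVector

/-! ### The recursion for the tree sums, by cutting at the edge with the smallest parameter -/

section TreeIntegral

open SimpleGraph
open scoped ENNReal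

lemma lintegral_Ioi_conv {u v G : ℝ → ℝ≥0∞} (hu : Measurable u) (hv : Measurable v)
    (hG : Measurable G) :
    ∫⁻ B in Set.Ioi 0, G B * ∫⁻ y in Set.Ioo 0 B, u y * v (B - y) =
      ∫⁻ y in Set.Ioi 0, u y * ∫⁻ z in Set.Ioi 0, G (y + z) * v z := by
  let U : ℝ → ℝ≥0∞ := (Set.Ioi 0).indicator u
  let W : ℝ → ℝ≥0∞ := (Set.Ioi 0).indicator v
  have hU : Measurable U := hu.indicator measurableSet_Ioi
  have hW : Measurable W := hv.indicator measurableSet_Ioi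
  have h1 : ∫⁻ B in Set.Ioi 0, G B * ∫⁻ y in Set.Ioo 0 B, u y * v (B - y) =
      ∫⁻ B, ∫⁻ y, G B * (U y * W (B - y)) := by
    rw [← lintegral_indicator measurableSet_Ioi]
    refine lintegral_congr fun B => ?_
    have hUW : Measurable fun y => U y * W (B - y) :=
      hU.mul (hW.comp (measurable_const.sub measurable_id))
    rw [lintegral_const_mul _ hUW]
    have h2 : ∫⁻ y, U y * W (B - y) = ∫⁻ y in Set.Ioo 0 B, u y * v (B - y) := by
      rw [← lintegral_indicator measurableSet_Ioo]
      refine lintegral_congr fun y => ?_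
      simp only [U, W, Set.indicator_apply, Set.mem_Ioi, Set.mem_Ioo, sub_pos]
      by_cases h3 : 0 < y <;> by_cases h4 : y < B <;> simp [h3, h4]
    rw [h2]
    by_cases hB : 0 < B
    · rw [Set.indicator_of_mem (Set.mem_Ioi.2 hB)]
    · rw [Set.indicator_of_notMem (by simpa using hB), Set.Ioo_eq_empty hB]
      simp
  have hm : Measurable (Function.uncurry fun B y => G B * (U y * W (B - y))) :=
    (hG.comp measurable_fst).mul ((hU.comp measurable_snd).mul
      (hW.comp (measurable_fst.sub measurable_snd)))
  rw [h1, lintegral_lintegral_swap hm.aemeasurable, ← lintegral_indicator measurableSet_Ioi]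
  refine lintegral_congr fun y => ?_
  have h5 : ∫⁻ B, G B * (U y * W (B - y)) = ∫⁻ z, U y * (G (y + z) * W z) := by
    rw [← lintegral_add_left_eq_self _ y]
    refine lintegral_congr fun z => ?_
    rw [add_sub_cancel_left]
    ring
  have h6 : Measurable fun z => G (y + z) * W z :=
    (hG.comp (measurable_const.add measurable_id)).mul hW
  rw [h5, lintegral_const_mul _ h6]
  have h7 : ∫⁻ z, G (y + z) * W z = ∫⁻ z in Set.Ioi 0, G (y + z) * v z := by
    rw [← lintegral_indicator measurableSet_Ioi]
    refine lintegral_congr fun z => ?_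
    simp only [W, Set.indicator_apply]
    split_ifs <;> simp
  rw [h7]
  simp only [U, Set.indicator_apply]
  split_ifs <;> simp

variable {V : Type} [Fintype V] {x : ℝ}

lemma measurable_treeAmp (x : ℝ) (G : SimpleGraph V) :
    Measurable fun q : ℝ × (V → ℝ) => treeAmp x G q.1 q.2 := by
  have h1 : ∀ q : ℝ × (V → ℝ), treeAmp x G q.1 q.2 = ∫⁻ w : G.edgeSet → ℝ,
      {p : (ℝ × (V → ℝ)) × (G.edgeSet → ℝ) | ∀ e, p.1.1 ≤ p.2 e ∧ p.2 e ≤ 1}.indicator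
        (fun p => ENNReal.ofReal (Real.exp (x / 2 * energy G p.2 p.1.1 p.1.2))) (q, w) := by
    intro q
    rw [treeAmp, ← lintegral_indicator (MeasurableSet.univ_pi fun _ => measurableSet_Icc)]
    refine lintegral_congr fun w => ?_
    by_cases h : w ∈ Set.univ.pi fun _ => Set.Icc q.1 1
    · rw [Set.indicator_of_mem h, Set.indicator_of_mem]
      exact fun e => h e (Set.mem_univ e)
    · rw [Set.indicator_of_notMem h, Set.indicator_of_notMem]
      exact fun h' => h fun e _ => h' e
  simp_rw [h1]
  refine Measurable.lintegral_prod_right' (f := fun p => Set.indicator _ _ p) ?_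
  refine Measurable.indicator ?_ ?_
  · have : ∀ p : (ℝ × (V → ℝ)) × (G.edgeSet → ℝ), energy G p.2 p.1.1 p.1.2 =
        energy G p.2 0 p.1.2 - p.1.1 * (∑ i, p.1.2 i) ^ 2 := by
      intro p
      unfold energy
      rw [sq, Finset.sum_mul_sum, Finset.mul_sum, ← Finset.sum_sub_distrib]
      refine Finset.sum_congr rfl fun i _ => ?_
      rw [Finset.mul_sum, ← Finset.sum_sub_distrib]
      exact Finset.sum_congr rfl fun j _ => by ring
    simp_rw [this]
    have h2 : Measurable fun p : (ℝ × (V → ℝ)) × (G.edgeSet → ℝ) => energy G p.2 0 p.1.2 :=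
      Measurable.comp (g := fun q : (V → ℝ) × (G.edgeSet → ℝ) => energy G q.2 0 q.1)
        (f := fun p : (ℝ × (V → ℝ)) × (G.edgeSet → ℝ) => (p.1.2, p.2)) measurable_energy
        ((measurable_snd.comp measurable_fst).prodMk measurable_snd)
    have h3 : Measurable fun p : (ℝ × (V → ℝ)) × (G.edgeSet → ℝ) =>
        p.1.1 * (∑ i, p.1.2 i) ^ 2 :=
      (measurable_fst.comp measurable_fst).mul ((Finset.measurable_sum _ fun i _ =>
        (measurable_pi_apply i).comp (measurable_snd.comp measurable_fst)).pow_const 2)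
    have h4 : Measurable fun p : (ℝ × (V → ℝ)) × (G.edgeSet → ℝ) => x / 2 *
        (energy G p.2 0 p.1.2 - p.1.1 * (∑ i, p.1.2 i) ^ 2) := (h2.sub h3).const_mul _
    exact h4.exp.ennreal_ofReal
  · have : {p : (ℝ × (V → ℝ)) × (G.edgeSet → ℝ) | ∀ e, p.1.1 ≤ p.2 e ∧ p.2 e ≤ 1} =
        ⋂ e, {p | p.1.1 ≤ p.2 e} ∩ {p | p.2 e ≤ 1} := by ext; simp
    rw [this]
    have he : ∀ e, Measurable fun p : (ℝ × (V → ℝ)) × (G.edgeSet → ℝ) => p.2 e := fun e =>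
      (measurable_pi_apply e).comp measurable_snd
    exact MeasurableSet.iInter fun e =>
      (measurableSet_le (measurable_fst.comp measurable_fst) (he e)).inter
        (measurableSet_le (he e) measurable_const)

/-- The sum over the labelled trees of the weights and amplitudes. -/
noncomputable def treeDensity (x : ℝ) (r : V) (s : ℝ) (β : V → ℝ) : ℝ≥0∞ :=
  ∑ G : {G : SimpleGraph V // G.IsTree}, ENNReal.ofReal (treeWeight G.1 r β) * treeAmp x G.1 s β

lemma measurable_treeDensity (x : ℝ) (r : V) :
    Measurable fun q : ℝ × (V → ℝ) => treeDensity x r q.1 q.2 := by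
  unfold treeDensity
  refine Finset.measurable_sum _ fun G _ => ?_
  refine Measurable.mul ?_ (measurable_treeAmp x G.1)
  refine Measurable.ennreal_ofReal ?_
  unfold treeWeight
  fun_prop

/-- Integrating a function of `∑ βᵢ` against the sum over labelled trees. -/
noncomputable def treeIntegral (x : ℝ) (r : V) (s : ℝ) (g : ℝ → ℝ≥0∞) : ℝ≥0∞ :=
  ∫⁻ β in Set.univ.pi (fun _ : V => Set.Ioi 0), g (∑ i, β i) * treeDensity x r s β

lemma treeWeight_nonneg {G : SimpleGraph V} {r : V} {β : V → ℝ} (hβ : ∀ i, 0 < β i) :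
    0 ≤ treeWeight G r β := Finset.prod_nonneg fun i _ => pow_nonneg (hβ i).le _

lemma sum_mul_mul_sum_sum {ι₁ ι₂ ι₃ ι₄ R : Type} [Fintype ι₁] [Fintype ι₂] [Fintype ι₃]
    [Fintype ι₄] [CommSemiring R] (f : ι₁ → R) (P : ι₂ → R) (Q : ι₃ → ι₄ → R) :
    ∑ b, ∑ c, ∑ a, ∑ d, f a * P b * Q c d = (∑ a, f a) * (∑ b, P b) * ∑ d, ∑ c, Q c d := by
  simp only [← Finset.mul_sum, ← Finset.sum_mul]
  rw [Finset.sum_comm]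

/-- The contribution to the amplitude of the region where the given edge carries the smallest
parameter. -/
noncomputable def treePiece [DecidableEq V] (x : ℝ) (G : SimpleGraph V) (e : G.edgeSet) (s : ℝ)
    (β : V → ℝ) : ℝ≥0∞ :=
  ∫⁻ m in Set.Icc s 1, ∫⁻ w in Set.univ.pi (fun _ => Set.Icc m 1),
    ENNReal.ofReal (Real.exp (x / 2 * energy G (joinAt e m w) s β))

lemma treeAmp_eq_sum [DecidableEq V] (G : SimpleGraph V) [Nonempty G.edgeSet] (s : ℝ)
    (β : V → ℝ) : treeAmp x G s β = ∑ e, treePiece x G e s β := by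
  rw [treeAmp, lintegral_cube_eq_sum s (measurable_exp_energy_right x s G β)]
  rfl

lemma treePiece_glue [DecidableEq V] {A : Finset V} {G₁ : SimpleGraph {x // x ∈ A}}
    {G₂ : SimpleGraph {x // x ∉ A}} {a : {x // x ∈ A}} {b : {x // x ∉ A}} (h₁ : G₁.IsTree)
    (h₂ : G₂.IsTree) (s : ℝ) (β : V → ℝ) :
    treePiece x (glue A G₁ G₂ a b) (bridge G₁ G₂ a b) s β = ∫⁻ m in Set.Icc s 1,
      ENNReal.ofReal (Real.exp (x / 2 * (m - s) * (∑ i, β i) ^ 2)) *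
      (treeAmp x G₁ m (fun i => β i) * treeAmp x G₂ m (fun i => β i)) :=
  lintegral_congr fun m => lintegral_joinAt_bridge h₁ h₂ s m β

/-- The sum over trees and over the edge with the smallest parameter is, by `glueMap_bijective`, a
sum over the set `A`, two trees and the two ends `a`, `b` of the bridge. Summing `β a` over `a`
gives `∑_{i ∈ A} βᵢ`; summing over `b` runs through all roots of the second tree. -/
lemma treeDensity_eq [DecidableEq V] [Nontrivial V] (r : V) (s : ℝ) {β : V → ℝ}
    (hβ : ∀ i, 0 < β i) :
    treeDensity x r s β = ∑ A : {A : Finset V // r ∈ A}, ∫⁻ m in Set.Icc s 1,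
      ENNReal.ofReal (Real.exp (x / 2 * (m - s) * (∑ i, β i) ^ 2)) *
      ((ENNReal.ofReal (∑ i : {i // i ∈ A.1}, β i) *
        treeDensity x (⟨r, A.2⟩ : {i // i ∈ A.1}) m (fun i => β i)) *
      ∑ b : {i // i ∉ A.1}, treeDensity x b m (fun i => β i)) := by
  have h1 : treeDensity x r s β = ∑ d : (Σ G : {G : SimpleGraph V // G.IsTree}, G.1.edgeSet),
      ENNReal.ofReal (treeWeight d.1.1 r β) * treePiece x d.1.1 d.2 s β := by
    rw [treeDensity, Fintype.sum_sigma]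
    refine Finset.sum_congr rfl fun G _ => ?_
    have : Nonempty G.1.edgeSet := by
      obtain ⟨j, hj⟩ := G.2.1.preconnected.exists_adj_of_nontrivial r
      exact ⟨⟨s(r, j), hj⟩⟩
    rw [treeAmp_eq_sum, Finset.mul_sum]
  rw [h1, ← (glueMap_bijective r).sum_comp (fun d : (Σ G : {G : SimpleGraph V // G.IsTree},
    G.1.edgeSet) => ENNReal.ofReal (treeWeight d.1.1 r β) * treePiece x d.1.1 d.2 s β),
    Fintype.sum_sigma]
  refine Finset.sum_congr rfl fun A _ => ?_
  have hamp : ∀ {W : Type} [Fintype W] (G : SimpleGraph W) (γ : W → ℝ),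
      Measurable fun m => treeAmp x G m γ := fun G γ =>
    Measurable.comp (g := fun q : ℝ × _ => treeAmp x G q.1 q.2) (f := fun m => (m, γ))
      (measurable_treeAmp x G) (measurable_id.prodMk measurable_const)
  have hE : Measurable fun m =>
      ENNReal.ofReal (Real.exp (x / 2 * (m - s) * (∑ i, β i) ^ 2)) := by fun_prop
  have h2 : ∀ d : {G : SimpleGraph {x // x ∈ A.1} // G.IsTree} ×
      {G : SimpleGraph {x // x ∉ A.1} // G.IsTree} × {x // x ∈ A.1} × {x // x ∉ A.1},
      ENNReal.ofReal (treeWeight (glueMap r ⟨A, d⟩).1.1 r β) *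
        treePiece x (glueMap r ⟨A, d⟩).1.1 (glueMap r ⟨A, d⟩).2 s β =
      ∫⁻ m in Set.Icc s 1, ENNReal.ofReal (Real.exp (x / 2 * (m - s) * (∑ i, β i) ^ 2)) *
        ((ENNReal.ofReal (β d.2.2.1) * (ENNReal.ofReal (treeWeight d.1.1 ⟨r, A.2⟩ fun i => β i) *
          treeAmp x d.1.1 m fun i => β i)) *
          (ENNReal.ofReal (treeWeight d.2.1.1 d.2.2.2 fun i => β i) *
            treeAmp x d.2.1.1 m fun i => β i)) := by
    rintro ⟨⟨G₁, h₁⟩, ⟨G₂, h₂⟩, a, b⟩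
    change ENNReal.ofReal (treeWeight (glue A.1 G₁ G₂ a b) r β) *
      treePiece x (glue A.1 G₁ G₂ a b) (bridge G₁ G₂ a b) s β = _
    rw [treePiece_glue h₁ h₂ s, ← lintegral_const_mul' _ _ ENNReal.ofReal_ne_top]
    refine lintegral_congr fun m => ?_
    rw [treeWeight_glue h₁ A.2, ENNReal.ofReal_mul, ENNReal.ofReal_mul (hβ a).le]
    · ring
    · exact mul_nonneg (hβ a).le (treeWeight_nonneg fun i => hβ i)
  simp_rw [h2]
  rw [← lintegral_finsetSum]
  · refine lintegral_congr fun m => ?_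
    rw [← Finset.mul_sum]
    congr 1
    rw [Fintype.sum_prod_type]
    simp_rw [Fintype.sum_prod_type]
    rw [show ENNReal.ofReal (∑ i : {i // i ∈ A.1}, β i) =
      ∑ i : {i // i ∈ A.1}, ENNReal.ofReal (β i) from
        ENNReal.ofReal_sum_of_nonneg fun i _ => (hβ i).le]
    exact sum_mul_mul_sum_sum _ _ _
  · intro d _
    exact hE.mul (((measurable_const.mul (measurable_const.mul (hamp _ _)))).mul
      (measurable_const.mul (hamp _ _)))

end TreeIntegral

end NVector

namespace NVector

/-! ### Reduction of the tree sums to one-variable integrals over `∑ βᵢ` -/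

section TreeKernel

open SimpleGraph
open scoped ENNReal

/-- The densities of the sums over trees with a given number of ordinary vertices, as functions of
`∑ βᵢ`: they are determined by splitting a tree at the edge with the smallest parameter. -/
structure IsTreeKernel (x : ℝ) (κ : ℕ → ℝ → ℝ → ℝ≥0∞) : Prop where
  measurable : ∀ n, Measurable fun q : ℝ × ℝ => κ n q.1 q.2
  zero : ∀ s B, κ 0 s B = ENNReal.ofReal (Real.exp (x / 2 * (1 - s) * B ^ 2))
  succ : ∀ n, ∀ s ∈ Set.Icc (0 : ℝ) 1, ∀ B, 0 < B → κ (n + 1) s B = ∫⁻ m in Set.Icc s 1,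
    ENNReal.ofReal (Real.exp (x / 2 * (m - s) * B ^ 2)) * ∑ p ∈ Finset.HasAntidiagonal.antidiagonal n,
      ∫⁻ y in Set.Ioo 0 B, ENNReal.ofReal y * κ p.1 m y * κ p.2 m (B - y)

variable {x : ℝ} {κ : ℕ → ℝ → ℝ → ℝ≥0∞}

/-- The contribution of the splittings into trees with `a` and `b` ordinary vertices. -/
noncomputable def splitIntegral (x : ℝ) (κ : ℕ → ℝ → ℝ → ℝ≥0∞) (s : ℝ) (g : ℝ → ℝ≥0∞)
    (a b : ℕ) : ℝ≥0∞ :=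
  ∫⁻ m in Set.Icc s 1, ∫⁻ y in Set.Ioi 0, ENNReal.ofReal y * κ a m y *
    ∫⁻ z in Set.Ioi 0, g (y + z) * ENNReal.ofReal (Real.exp (x / 2 * (m - s) * (y + z) ^ 2)) *
      κ b m z

/-- Tonelli and the substitution `B = y + z`, where `y` and `z` are the values of `∑ βᵢ` on the two
parts. -/
lemma IsTreeKernel.lintegral_succ (hκ : IsTreeKernel x κ) {s : ℝ} (hs : s ∈ Set.Icc (0 : ℝ) 1)
    {g : ℝ → ℝ≥0∞} (hg : Measurable g) (n : ℕ) :
    ∫⁻ B in Set.Ioi 0, g B * κ (n + 1) s B =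
      ∑ p ∈ Finset.HasAntidiagonal.antidiagonal n, splitIntegral x κ s g p.1 p.2 := by
  have hκm : ∀ n m, Measurable (κ n m) := fun n m =>
    Measurable.comp (g := fun q : ℝ × ℝ => κ n q.1 q.2) (f := fun B => (m, B))
      (hκ.measurable n) (measurable_const.prodMk measurable_id)
  have hconv : ∀ p : ℕ × ℕ, Measurable fun q : ℝ × ℝ => ∫⁻ y in Set.Ioo 0 q.2,
      ENNReal.ofReal y * κ p.1 q.1 y * κ p.2 q.1 (q.2 - y) := by
    intro p
    have h1 : ∀ q : ℝ × ℝ, (∫⁻ y in Set.Ioo 0 q.2,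
      ENNReal.ofReal y * κ p.1 q.1 y * κ p.2 q.1 (q.2 - y)) = ∫⁻ y,
        {t : (ℝ × ℝ) × ℝ | 0 < t.2 ∧ t.2 < t.1.2}.indicator (fun t =>
          ENNReal.ofReal t.2 * κ p.1 t.1.1 t.2 * κ p.2 t.1.1 (t.1.2 - t.2)) (q, y) := by
      intro q
      rw [← lintegral_indicator measurableSet_Ioo]
      rfl
    simp_rw [h1]
    refine Measurable.lintegral_prod_right' (f := fun p => Set.indicator _ _ p) ?_
    refine Measurable.indicator ?_ ((measurableSet_lt measurable_const measurable_snd).inter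
      (measurableSet_lt measurable_snd (measurable_snd.comp measurable_fst)))
    have e1 : Measurable fun t : (ℝ × ℝ) × ℝ => κ p.1 t.1.1 t.2 :=
      Measurable.comp (g := fun q : ℝ × ℝ => κ p.1 q.1 q.2) (f := fun t : (ℝ × ℝ) × ℝ =>
        (t.1.1, t.2)) (hκ.measurable _) (by fun_prop)
    have e2 : Measurable fun t : (ℝ × ℝ) × ℝ => κ p.2 t.1.1 (t.1.2 - t.2) :=
      Measurable.comp (g := fun q : ℝ × ℝ => κ p.2 q.1 q.2) (f := fun t : (ℝ × ℝ) × ℝ =>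
        (t.1.1, t.1.2 - t.2)) (hκ.measurable _) (by fun_prop)
    exact (measurable_snd.ennreal_ofReal.mul e1).mul e2
  have hE : Measurable fun q : ℝ × ℝ =>
      ENNReal.ofReal (Real.exp (x / 2 * (q.1 - s) * q.2 ^ 2)) := by fun_prop
  have hEs : ∀ m, Measurable fun B : ℝ =>
      ENNReal.ofReal (Real.exp (x / 2 * (m - s) * B ^ 2)) := fun m => by fun_prop
  have h1 : ∀ B ∈ Set.Ioi (0 : ℝ), g B * κ (n + 1) s B = ∑ p ∈ Finset.HasAntidiagonal.antidiagonal n,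
      ∫⁻ m in Set.Icc s 1, g B * (ENNReal.ofReal (Real.exp (x / 2 * (m - s) * B ^ 2)) *
        ∫⁻ y in Set.Ioo 0 B, ENNReal.ofReal y * κ p.1 m y * κ p.2 m (B - y)) := by
    intro B hB
    have hm : ∀ p : ℕ × ℕ, Measurable fun m =>
        ENNReal.ofReal (Real.exp (x / 2 * (m - s) * B ^ 2)) *
        ∫⁻ y in Set.Ioo 0 B, ENNReal.ofReal y * κ p.1 m y * κ p.2 m (B - y) := fun p =>
      Measurable.comp (g := fun q : ℝ × ℝ => ENNReal.ofReal (Real.exp (x / 2 * (q.1 - s) * q.2 ^ 2))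
        * ∫⁻ y in Set.Ioo 0 q.2, ENNReal.ofReal y * κ p.1 q.1 y * κ p.2 q.1 (q.2 - y))
        (f := fun m => (m, B)) (hE.mul (hconv p)) (measurable_id.prodMk measurable_const)
    rw [hκ.succ n s hs B hB]
    simp_rw [Finset.mul_sum]
    rw [lintegral_finsetSum _ fun p _ => hm p, Finset.mul_sum]
    exact Finset.sum_congr rfl fun p _ => (lintegral_const_mul _ (hm p)).symm
  have hmeas : ∀ p : ℕ × ℕ, Measurable (Function.uncurry fun B m =>
      g B * (ENNReal.ofReal (Real.exp (x / 2 * (m - s) * B ^ 2)) *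
        ∫⁻ y in Set.Ioo 0 B, ENNReal.ofReal y * κ p.1 m y * κ p.2 m (B - y))) := fun p =>
    (hg.comp measurable_fst).mul (Measurable.comp (g := fun q : ℝ × ℝ =>
      ENNReal.ofReal (Real.exp (x / 2 * (q.1 - s) * q.2 ^ 2))
        * ∫⁻ y in Set.Ioo 0 q.2, ENNReal.ofReal y * κ p.1 q.1 y * κ p.2 q.1 (q.2 - y))
      (f := fun t : ℝ × ℝ => (t.2, t.1)) (hE.mul (hconv p)) measurable_swap)
  rw [setLIntegral_congr_fun measurableSet_Ioi h1,
    lintegral_finsetSum _ fun p _ => (hmeas p).lintegral_prod_right]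
  refine Finset.sum_congr rfl fun p _ => ?_
  rw [lintegral_lintegral_swap (hmeas p).aemeasurable]
  refine lintegral_congr fun m => ?_
  simp_rw [← mul_assoc]
  exact lintegral_Ioi_conv (u := fun y => ENNReal.ofReal y * κ p.1 m y)
    (G := fun B => g B * ENNReal.ofReal (Real.exp (x / 2 * (m - s) * B ^ 2)))
    (measurable_id.ennreal_ofReal.mul (hκm _ m)) (hκm _ m) (hg.mul (hEs m))


/-- Trees on one vertex. -/
lemma treeIntegral_of_card_eq_one (hκ : IsTreeKernel x κ) {V : Type} [Fintype V]
    (hV : Fintype.card V = 1) (r : V) (s : ℝ) {g : ℝ → ℝ≥0∞} (hg : Measurable g) :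
    treeIntegral x r s g = ∫⁻ B in Set.Ioi 0, g B * κ 0 s B := by
  classical
  have hsub : Subsingleton V := Fintype.card_le_one_iff_subsingleton.1 hV.le
  let _ : Unique V := ⟨⟨r⟩, fun a => Subsingleton.elim _ _⟩
  have hG : ∀ G : SimpleGraph V, G = ⊥ := fun G => Subsingleton.elim _ _
  have hT : (⊥ : SimpleGraph V).IsTree := by
    have : Nonempty V := ⟨r⟩
    exact IsTree.of_subsingleton
  let _ : Unique {G : SimpleGraph V // G.IsTree} := ⟨⟨⟨⊥, hT⟩⟩, fun a => Subtype.ext (hG a.1)⟩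
  have hd : ∀ β : V → ℝ, treeDensity x r s β = κ 0 s (∑ i, β i) := by
    intro β
    have e1 : treeWeight (⊥ : SimpleGraph V) r β = 1 := by
      unfold treeWeight
      refine Finset.prod_eq_one fun i _ => ?_
      have : childCount (⊥ : SimpleGraph V) r i = 0 := by
        simp [childCount]
      rw [this, pow_zero]
    have e2 : ∀ G : SimpleGraph V, IsEmpty G.edgeSet → treeAmp x G s β = κ 0 s (∑ i, β i) := by
      intro G hE
      have e3 : ∀ w : G.edgeSet → ℝ, energy G w s β = (1 - s) * (∑ i, β i) ^ 2 := by
        intro w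
        have : ∀ i j : V, pathInf G w i j = 1 := fun i j => by
          rw [Subsingleton.elim i j, pathInf_self]
        simp_rw [energy, this]
        rw [sq, Finset.sum_mul_sum, Finset.mul_sum]
        refine Finset.sum_congr rfl fun i _ => ?_
        rw [Finset.mul_sum]
        exact Finset.sum_congr rfl fun j _ => by ring
      unfold treeAmp
      simp_rw [e3]
      rw [hκ.zero, lintegral_const, Measure.restrict_apply MeasurableSet.univ, Set.univ_inter]
      rw [volume_pi, Measure.pi_pi]
      simp [mul_assoc]
    rw [treeDensity, Fintype.sum_unique]
    change ENNReal.ofReal (treeWeight (⊥ : SimpleGraph V) r β) * treeAmp x ⊥ s β = _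
    rw [e1, e2 _ (by simp)]; simp
  rw [treeIntegral]
  simp_rw [hd]
  have hmp : MeasurePreserving (MeasurableEquiv.funUnique V ℝ) volume volume := by
    convert volume_preserving_funUnique V ℝ
  have hmeas : Measurable ((Set.Ioi (0:ℝ)).indicator fun B => g B * κ 0 s B) :=
    (hg.mul (Measurable.comp (g := fun q : ℝ × ℝ => κ 0 q.1 q.2) (f := fun B => (s, B))
      (hκ.measurable 0) (measurable_const.prodMk measurable_id))).indicator measurableSet_Ioi
  rw [← lintegral_indicator measurableSet_Ioi, ← hmp.lintegral_comp hmeas,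
    ← lintegral_indicator (MeasurableSet.univ_pi fun _ => measurableSet_Ioi)]
  refine lintegral_congr fun β => ?_
  simp [Set.indicator_apply, MeasurableEquiv.funUnique, Unique.forall_iff]

/-- Integrals over the parameters of the sum over the labelled trees reduce to integrals over one
variable. -/
theorem treeIntegral_eq (hκ : IsTreeKernel x κ) (n : ℕ) : ∀ {V : Type} [Fintype V]
    (_ : Fintype.card V = n + 1) (r : V), ∀ s ∈ Set.Icc (0 : ℝ) 1, ∀ g : ℝ → ℝ≥0∞, Measurable g →
    treeIntegral x r s g = n.factorial * ∫⁻ B in Set.Ioi 0, g B * κ n s B := by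
  induction n using Nat.strong_induction_on with | _ n ih
  rcases n with _ | n
  · intro V _ hV r s _ g hg
    rw [treeIntegral_of_card_eq_one hκ hV r s hg]; simp
  intro V _ hV r s hs g hg
  classical
  have hnt : Nontrivial V := Fintype.one_lt_card_iff_nontrivial.1 (by omega)
  have hκm : ∀ n m, Measurable (κ n m) := fun n m =>
    Measurable.comp (g := fun q : ℝ × ℝ => κ n q.1 q.2) (f := fun B => (m, B))
      (hκ.measurable n) (measurable_const.prodMk measurable_id)
  have hDm : ∀ {W : Type} [Fintype W] (b : W) (m : ℝ), Measurable (treeDensity x b m) :=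
    fun b m => Measurable.comp (g := fun q : ℝ × _ => treeDensity x b q.1 q.2)
      (f := fun β => (m, β)) (measurable_treeDensity x b) (measurable_const.prodMk measurable_id)
  have hEs : ∀ m, Measurable fun B : ℝ =>
      ENNReal.ofReal (Real.exp (x / 2 * (m - s) * B ^ 2)) := fun m => by fun_prop
  have hFA : ∀ A : {A : Finset V // r ∈ A}, Measurable fun q : (V → ℝ) × ℝ =>
      ENNReal.ofReal (Real.exp (x / 2 * (q.2 - s) * (∑ i, q.1 i) ^ 2)) *
      ((ENNReal.ofReal (∑ i : {i // i ∈ A.1}, q.1 i) *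
        treeDensity x (⟨r, A.2⟩ : {i // i ∈ A.1}) q.2 (fun i => q.1 i)) *
      ∑ b : {i // i ∉ A.1}, treeDensity x b q.2 (fun i => q.1 i)) := by
    intro A
    have hEm : Measurable fun q : (V → ℝ) × ℝ =>
        ENNReal.ofReal (Real.exp (x / 2 * (q.2 - s) * (∑ i, q.1 i) ^ 2)) := by fun_prop
    have hL : Measurable fun q : (V → ℝ) × ℝ =>
        treeDensity x (⟨r, A.2⟩ : {i // i ∈ A.1}) q.2 (fun i => q.1 i) :=
      Measurable.comp (g := fun q : ℝ × _ => treeDensity x (⟨r, A.2⟩ : {i // i ∈ A.1}) q.1 q.2)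
        (f := fun q : (V → ℝ) × ℝ => (q.2, fun i : {i // i ∈ A.1} => q.1 i))
        (measurable_treeDensity x _) (by fun_prop)
    have hR : ∀ b : {i // i ∉ A.1}, Measurable fun q : (V → ℝ) × ℝ =>
        treeDensity x b q.2 (fun i => q.1 i) := fun b =>
      Measurable.comp (g := fun q : ℝ × _ => treeDensity x b q.1 q.2)
        (f := fun q : (V → ℝ) × ℝ => (q.2, fun i : {i // i ∉ A.1} => q.1 i))
        (measurable_treeDensity x _) (by fun_prop)
    exact hEm.mul (((Measurable.ennreal_ofReal (by fun_prop)).mul hL).mul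
      (Finset.measurable_sum _ fun b _ => hR b))
  -- the contribution of one set of labels
  have hA : ∀ A : {A : Finset V // r ∈ A},
      ∫⁻ β in Set.univ.pi (fun _ : V => Set.Ioi 0), g (∑ i, β i) * ∫⁻ m in Set.Icc s 1,
        ENNReal.ofReal (Real.exp (x / 2 * (m - s) * (∑ i, β i) ^ 2)) *
        ((ENNReal.ofReal (∑ i : {i // i ∈ A.1}, β i) *
          treeDensity x (⟨r, A.2⟩ : {i // i ∈ A.1}) m (fun i => β i)) *
        ∑ b : {i // i ∉ A.1}, treeDensity x b m (fun i => β i)) =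
      ((n + 2 - A.1.card).factorial * (A.1.card - 1).factorial *
        if A.1.card = n + 2 then 0 else splitIntegral x κ s g (A.1.card - 1) (n + 1 - A.1.card)) := by
    intro A
    have hF := hFA A
    have hgF := (hg.comp (show Measurable fun q : (V → ℝ) × ℝ => ∑ i, q.1 i by fun_prop)).mul hF
    have hswap : ∫⁻ β in Set.univ.pi (fun _ : V => Set.Ioi 0), g (∑ i, β i) * ∫⁻ m in Set.Icc s 1,
        ENNReal.ofReal (Real.exp (x / 2 * (m - s) * (∑ i, β i) ^ 2)) *
        ((ENNReal.ofReal (∑ i : {i // i ∈ A.1}, β i) *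
          treeDensity x (⟨r, A.2⟩ : {i // i ∈ A.1}) m (fun i => β i)) *
        ∑ b : {i // i ∉ A.1}, treeDensity x b m (fun i => β i)) =
        ∫⁻ m in Set.Icc s 1, ∫⁻ β in Set.univ.pi (fun _ : V => Set.Ioi 0), g (∑ i, β i) *
        (ENNReal.ofReal (Real.exp (x / 2 * (m - s) * (∑ i, β i) ^ 2)) *
        ((ENNReal.ofReal (∑ i : {i // i ∈ A.1}, β i) *
          treeDensity x (⟨r, A.2⟩ : {i // i ∈ A.1}) m (fun i => β i)) *
        ∑ b : {i // i ∉ A.1}, treeDensity x b m (fun i => β i))) := by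
      rw [← lintegral_lintegral_swap hgF.aemeasurable]
      refine lintegral_congr fun β => ?_
      exact (lintegral_const_mul _ (hF.comp measurable_prodMk_left)).symm
    have hcard : Fintype.card {i // i ∉ A.1} = n + 2 - A.1.card := by
      rw [Fintype.card_subtype_compl, hV, Fintype.card_coe]
    have hApos : 0 < A.1.card := Finset.card_pos.2 ⟨r, A.2⟩
    have hAle : A.1.card ≤ n + 2 := hV ▸ Finset.card_le_univ A.1
    rw [hswap]
    -- If `A` contains every vertex there is no vertex `b` left, and the sum over the roots of the
    -- second tree is empty.
    by_cases hA2 : A.1.card = n + 2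
    · have : IsEmpty {i // i ∉ A.1} := Fintype.card_eq_zero_iff.1 (by omega)
      simp [hA2]
    rw [if_neg hA2, splitIntegral, ← lintegral_const_mul']
    swap
    · exact ENNReal.mul_ne_top (ENNReal.natCast_ne_top _) (ENNReal.natCast_ne_top _)
    refine setLIntegral_congr_fun measurableSet_Icc fun m hm => ?_
    have hm01 : m ∈ Set.Icc (0 : ℝ) 1 := ⟨hs.1.trans hm.1, hm.2⟩
    set gm : ℝ → ℝ≥0∞ := fun B => g B * ENNReal.ofReal (Real.exp (x / 2 * (m - s) * B ^ 2)) with hgm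
    have hgmm : Measurable gm := hg.mul (hEs m)
    have hinner : Measurable fun y : ℝ => ∫⁻ z in Set.Ioi 0, gm (y + z) * κ (n + 1 - A.1.card) m z := by
      refine Measurable.lintegral_prod_right' (f := fun q : ℝ × ℝ =>
        gm (q.1 + q.2) * κ (n + 1 - A.1.card) m q.2) ?_
      exact (hgmm.comp (measurable_fst.add measurable_snd)).mul ((hκm _ m).comp measurable_snd)
    have hsplit := lintegral_pi_sum (Equiv.sumCompl fun i => i ∈ A.1) (Set.Ioi 0)
      (H := fun β₁ β₂ => gm (∑ i, β₁ i + ∑ i, β₂ i) * ((ENNReal.ofReal (∑ i, β₁ i) *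
        treeDensity x (⟨r, A.2⟩ : {i // i ∈ A.1}) m β₁) * ∑ b, treeDensity x b m β₂)) (by
        refine (hgmm.comp (by fun_prop)).mul (((Measurable.ennreal_ofReal (by fun_prop)).mul
          ((hDm _ m).comp measurable_fst)).mul (Finset.measurable_sum _ fun b _ =>
            (hDm b m).comp measurable_snd)))
    have hsum : ∀ β : V → ℝ, ∑ i, β i = ∑ i : {i // i ∈ A.1}, β i + ∑ i : {i // i ∉ A.1}, β i :=
      fun β => by convert (Fintype.sum_subtype_add_sum_subtype (fun i => i ∈ A.1) β).symm
    simp only [Equiv.sumCompl_apply_inl, Equiv.sumCompl_apply_inr] at hsplit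
    have h3 : (∫⁻ β in Set.univ.pi (fun _ : V => Set.Ioi 0), g (∑ i, β i) *
        (ENNReal.ofReal (Real.exp (x / 2 * (m - s) * (∑ i, β i) ^ 2)) *
        ((ENNReal.ofReal (∑ i : {i // i ∈ A.1}, β i) *
          treeDensity x (⟨r, A.2⟩ : {i // i ∈ A.1}) m (fun i => β i)) *
        ∑ b : {i // i ∉ A.1}, treeDensity x b m (fun i => β i)))) =
        ∫⁻ β₁ in Set.univ.pi (fun _ : {i // i ∈ A.1} => Set.Ioi 0),
          ∫⁻ β₂ in Set.univ.pi (fun _ : {i // i ∉ A.1} => Set.Ioi 0),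
          gm (∑ i, β₁ i + ∑ i, β₂ i) * ((ENNReal.ofReal (∑ i, β₁ i) *
            treeDensity x (⟨r, A.2⟩ : {i // i ∈ A.1}) m β₁) * ∑ b, treeDensity x b m β₂) := by
      simp_rw [hsum]
      rw [← hsplit]
      exact lintegral_congr fun β => (mul_assoc _ _ _).symm
    rw [h3]
    have h4 : ∀ β₁ : {i // i ∈ A.1} → ℝ, ∫⁻ β₂ in Set.univ.pi (fun _ : {i // i ∉ A.1} => Set.Ioi 0),
        gm (∑ i, β₁ i + ∑ i, β₂ i) * ((ENNReal.ofReal (∑ i, β₁ i) *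
        treeDensity x (⟨r, A.2⟩ : {i // i ∈ A.1}) m β₁) * ∑ b, treeDensity x b m β₂) =
        ((n + 2 - A.1.card).factorial : ℝ≥0∞) * ((ENNReal.ofReal (∑ i, β₁ i) *
          ∫⁻ z in Set.Ioi 0, gm (∑ i, β₁ i + z) * κ (n + 1 - A.1.card) m z) *
        treeDensity x (⟨r, A.2⟩ : {i // i ∈ A.1}) m β₁) := by
      intro β₁
      have hgb : Measurable fun z => gm (∑ i, β₁ i + z) :=
        hgmm.comp (measurable_const.add measurable_id)
      have hb : ∀ b : {i // i ∉ A.1}, ∫⁻ β₂ in Set.univ.pi (fun _ : {i // i ∉ A.1} => Set.Ioi 0),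
          gm (∑ i, β₁ i + ∑ i, β₂ i) * treeDensity x b m β₂ =
          (n + 1 - A.1.card).factorial *
            ∫⁻ z in Set.Ioi 0, gm (∑ i, β₁ i + z) * κ (n + 1 - A.1.card) m z := fun b =>
        ih (n + 1 - A.1.card) (by omega) (by omega) b m hm01 (fun z => gm (∑ i, β₁ i + z)) hgb
      have e1 : ∀ β₂ : {i // i ∉ A.1} → ℝ, gm (∑ i, β₁ i + ∑ i, β₂ i) *
          ((ENNReal.ofReal (∑ i, β₁ i) *
          treeDensity x (⟨r, A.2⟩ : {i // i ∈ A.1}) m β₁) * ∑ b, treeDensity x b m β₂) =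
          (ENNReal.ofReal (∑ i, β₁ i) * treeDensity x (⟨r, A.2⟩ : {i // i ∈ A.1}) m β₁) *
          ∑ b, gm (∑ i, β₁ i + ∑ i, β₂ i) * treeDensity x b m β₂ := by
        intro β₂
        rw [← Finset.mul_sum]; ring
      have hbm : ∀ b : {i // i ∉ A.1}, Measurable fun β₂ : {i // i ∉ A.1} → ℝ =>
          gm (∑ i, β₁ i + ∑ i, β₂ i) * treeDensity x b m β₂ := fun b =>
        (hgmm.comp (by fun_prop)).mul (hDm b m)
      simp_rw [e1]
      rw [lintegral_const_mul _ (Finset.measurable_sum _ fun b _ => hbm b),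
        lintegral_finsetSum _ fun b _ => hbm b]
      simp_rw [hb]
      -- Each of the `n + 2 - |A|` choices of the root `b` contributes the same amount, which
      -- completes `(n + 1 - |A|)!` to `(n + 2 - |A|)!`.
      rw [Finset.sum_const, Finset.card_univ, hcard,
        show n + 2 - A.1.card = (n + 1 - A.1.card) + 1 by omega, Nat.factorial_succ]
      rw [nsmul_eq_mul]
      push_cast
      ring
    simp_rw [h4]
    rw [lintegral_const_mul' _ _ (ENNReal.natCast_ne_top _)]
    have h5 := ih (A.1.card - 1) (by omega) (V := {i // i ∈ A.1})
      (by rw [Fintype.card_coe]; omega) ⟨r, A.2⟩ m hm01 (fun y => ENNReal.ofReal y *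
        ∫⁻ z in Set.Ioi 0, gm (y + z) * κ (n + 1 - A.1.card) m z)
      (measurable_id.ennreal_ofReal.mul hinner)
    rw [treeIntegral] at h5
    rw [h5, ← mul_assoc]
    congr 1
    refine lintegral_congr fun y => ?_
    ring
  have h6 : treeIntegral x r s g = ∑ A : {A : Finset V // r ∈ A},
      ((n + 2 - A.1.card).factorial * (A.1.card - 1).factorial *
        if A.1.card = n + 2 then 0 else splitIntegral x κ s g (A.1.card - 1) (n + 1 - A.1.card)) := by
    simp_rw [← hA]
    rw [← lintegral_finsetSum', treeIntegral]
    · refine setLIntegral_congr_fun (MeasurableSet.univ_pi fun _ => measurableSet_Ioi) fun β hβ => ?_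
      rw [← Finset.mul_sum]
      exact congrArg _ (treeDensity_eq r s fun i => hβ i (Set.mem_univ i))
    · exact fun A _ => ((hg.comp (by fun_prop)).mul (hFA A).lintegral_prod_right').aemeasurable
  rw [h6, hκ.lintegral_succ hs hg n]
  -- Removing the root from `A` leaves an arbitrary subset of the other `n + 1` vertices. There are
  -- `choose (n + 1) k` of size `k`, and `choose (n + 1) k * k! * (n + 1 - k)! = (n + 1)!` is the
  -- required prefactor.
  have h7 : ∑ A : {A : Finset V // r ∈ A},
      (((n + 2 - A.1.card).factorial * (A.1.card - 1).factorial : ℝ≥0∞) *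
        if A.1.card = n + 2 then 0 else splitIntegral x κ s g (A.1.card - 1) (n + 1 - A.1.card)) =
      ∑ A ∈ (Finset.univ.erase r : Finset V).powerset,
      (((n + 1 - A.card).factorial * A.card.factorial : ℝ≥0∞) *
        if A.card = n + 1 then 0 else splitIntegral x κ s g A.card (n - A.card)) := by
    refine Finset.sum_bij' (fun A _ => A.1.erase r)
      (fun A _ => ⟨insert r A, Finset.mem_insert_self r A⟩) ?_ ?_ ?_ ?_ ?_
    · intro A _
      exact Finset.mem_powerset.2 (Finset.erase_subset_erase r (Finset.subset_univ _))
    · intro A _; exact Finset.mem_univ _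
    · intro A _; exact Subtype.ext (Finset.insert_erase A.2)
    · intro A hA
      exact Finset.erase_insert fun h => Finset.notMem_erase r _ (Finset.mem_powerset.1 hA h)
    · intro A _
      have hApos : 0 < A.1.card := Finset.card_pos.2 ⟨r, A.2⟩
      obtain ⟨k, hk⟩ : ∃ k, A.1.card = k + 1 := ⟨A.1.card - 1, by omega⟩
      rw [Finset.card_erase_of_mem A.2, hk]
      simp [show n + 2 - (k + 1) = n + 1 - k by omega, show n + 1 - (k + 1) = n - k by omega]
  rw [h7, Finset.sum_powerset_apply_card (fun k => ((n + 1 - k).factorial * k.factorial : ℝ≥0∞) *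
        if k = n + 1 then 0 else splitIntegral x κ s g k (n - k)),
    Finset.card_erase_of_mem (Finset.mem_univ r), Finset.card_univ, hV]
  rw [Finset.Nat.sum_antidiagonal_eq_sum_range_succ (fun a b => splitIntegral x κ s g a b),
    Finset.mul_sum, show n + 1 + 1 - 1 + 1 = n + 1 + 1 from rfl, Finset.sum_range_succ]
  simp only [if_true, mul_zero, smul_zero, add_zero]
  refine Finset.sum_congr rfl fun k hk => ?_
  have hk' : k ≤ n := by simpa [Nat.lt_succ_iff] using hk
  rw [if_neg (by omega), nsmul_eq_mul, ← mul_assoc]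
  congr 1
  rw [show n + 1 + 1 - 1 = n + 1 from rfl]
  rw [← Nat.choose_mul_factorial_mul_factorial (show k ≤ n + 1 by omega)]
  push_cast
  ring

end TreeKernel

end NVector

namespace NVector

/-! ### The coefficients of the perturbation series -/

section Coefficients

open Finset

/-- The coefficient of `N⁻ˡ` in the coefficient of order `n + l` of the perturbation series. -/
def mapCoeff : ℕ → ℕ → ℕ
  | 0, 0 => 1
  | 0, l + 1 => (2 * l + 1) * mapCoeff 0 l
  | n + 1, 0 => ∑ i : Fin (n + 1), mapCoeff i 0 * mapCoeff (n - i) 0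
  | n + 1, l + 1 => (2 * (n + 1 + l) + 1) * mapCoeff (n + 1) l +
      ∑ i : Fin (n + 1), ∑ j : Fin (l + 2), mapCoeff i j * mapCoeff (n - i) (l + 1 - j)
termination_by n l => n + l
decreasing_by all_goals omega

/-- The splitting term in the recursion for the coefficients. -/
def splitCoeff (n l : ℕ) : ℕ :=
  ∑ p ∈ HasAntidiagonal.antidiagonal n, ∑ r ∈ HasAntidiagonal.antidiagonal l,
    mapCoeff p.1 r.1 * mapCoeff p.2 r.2

lemma splitCoeff_eq_sum_fin (n l : ℕ) : splitCoeff n l =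
    ∑ i : Fin (n + 1), ∑ j : Fin (l + 1), mapCoeff i j * mapCoeff (n - i) (l - j) := by
  rw [splitCoeff, Nat.sum_antidiagonal_eq_sum_range_succ (fun a b =>
    ∑ r ∈ HasAntidiagonal.antidiagonal l, mapCoeff a r.1 * mapCoeff b r.2), sum_range]
  refine sum_congr rfl fun i _ => ?_
  rw [Nat.sum_antidiagonal_eq_sum_range_succ (fun a b =>
    mapCoeff i a * mapCoeff (n - i) b), sum_range]

lemma mapCoeff_zero_zero : mapCoeff 0 0 = 1 := by rw [mapCoeff]

lemma mapCoeff_zero_succ (l : ℕ) : mapCoeff 0 (l + 1) = (2 * l + 1) * mapCoeff 0 l := by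
  rw [mapCoeff]

lemma mapCoeff_succ_zero (n : ℕ) : mapCoeff (n + 1) 0 = splitCoeff n 0 := by
  rw [mapCoeff, splitCoeff_eq_sum_fin]; simp

lemma mapCoeff_succ_succ (n l : ℕ) : mapCoeff (n + 1) (l + 1) =
    (2 * (n + 1 + l) + 1) * mapCoeff (n + 1) l + splitCoeff n (l + 1) := by
  rw [mapCoeff, splitCoeff_eq_sum_fin]

lemma mapCoeff_eq_catalan (n : ℕ) : mapCoeff n 0 = catalan n := by
  induction n using Nat.strong_induction_on with | _ n ih
  cases n with
  | zero => rw [mapCoeff_zero_zero, catalan_zero]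
  | succ n =>
    rw [mapCoeff_succ_zero, catalan_succ', splitCoeff]
    refine sum_congr rfl fun p hp => ?_
    have := mem_antidiagonal.1 hp
    simp [ih p.1 (by omega), ih p.2 (by omega)]

variable {R : Type*} [CommSemiring R]

/-- The coefficients of the perturbation series, as functions of `t = 1 / N`. -/
def seriesCoeff (t : R) (q : ℕ) : R :=
  ∑ p ∈ HasAntidiagonal.antidiagonal q, (mapCoeff p.1 p.2 : R) * t ^ p.2

lemma seriesCoeff_zero (t : R) : seriesCoeff t 0 = 1 := by
  simp [seriesCoeff, mapCoeff_zero_zero]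

lemma sum_splitCoeff (t : R) (q : ℕ) :
    ∑ p ∈ HasAntidiagonal.antidiagonal q, (splitCoeff p.1 p.2 : R) * t ^ p.2 =
      ∑ p ∈ HasAntidiagonal.antidiagonal q, seriesCoeff t p.1 * seriesCoeff t p.2 := by
  simp only [splitCoeff, seriesCoeff, Nat.cast_sum, Nat.cast_mul]
  simp_rw [sum_mul_sum, sum_mul]
  simp only [← sum_product', sum_sigma']
  refine sum_bij' (fun x _ => ⟨(x.2.1.1 + x.2.2.1, x.2.1.2 + x.2.2.2),
      ((x.2.1.1, x.2.2.1), (x.2.1.2, x.2.2.2))⟩)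
    (fun x _ => ⟨(x.2.1.1 + x.2.2.1, x.2.1.2 + x.2.2.2),
      ((x.2.1.1, x.2.2.1), (x.2.1.2, x.2.2.2))⟩) ?_ ?_ ?_ ?_ ?_
  · rintro ⟨⟨n, l⟩, ⟨⟨a, b⟩, ⟨c, d⟩⟩⟩ h
    simp only [mem_sigma, mem_product, HasAntidiagonal.mem_antidiagonal] at h ⊢
    exact ⟨by omega, trivial, trivial⟩
  · rintro ⟨⟨n, l⟩, ⟨⟨a, b⟩, ⟨c, d⟩⟩⟩ h
    simp only [mem_sigma, mem_product, HasAntidiagonal.mem_antidiagonal] at h ⊢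
    exact ⟨by omega, trivial, trivial⟩
  · rintro ⟨⟨n, l⟩, ⟨⟨a, b⟩, ⟨c, d⟩⟩⟩ h
    simp only [mem_sigma, mem_product, HasAntidiagonal.mem_antidiagonal] at h
    obtain ⟨_, rfl, rfl⟩ := h
    rfl
  · rintro ⟨⟨n, l⟩, ⟨⟨a, b⟩, ⟨c, d⟩⟩⟩ h
    simp only [mem_sigma, mem_product, HasAntidiagonal.mem_antidiagonal] at h
    obtain ⟨_, rfl, rfl⟩ := h
    rfl
  · rintro ⟨⟨n, l⟩, ⟨⟨a, b⟩, ⟨c, d⟩⟩⟩ h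
    simp only [mem_sigma, mem_product, HasAntidiagonal.mem_antidiagonal] at h
    obtain ⟨_, rfl, rfl⟩ := h
    simp only
    ring

/-- The Riccati equation of the perturbation series, coefficient by coefficient. The two terms of
the recursion of `mapCoeff` raise `l`, respectively `n`, by one; `P` and `Q` collect them. -/
lemma seriesCoeff_succ (t : R) (q : ℕ) : seriesCoeff t (q + 1) = (2 * q + 1) * t * seriesCoeff t q +
    ∑ p ∈ HasAntidiagonal.antidiagonal q, seriesCoeff t p.1 * seriesCoeff t p.2 := by
  let P : ℕ → ℕ → ℕ := fun n l => match l with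
    | 0 => 0
    | l + 1 => (2 * (n + l) + 1) * mapCoeff n l
  let Q : ℕ → ℕ → ℕ := fun n l => match n with
    | 0 => 0
    | n + 1 => splitCoeff n l
  have hPQ : ∀ p ∈ HasAntidiagonal.antidiagonal (q + 1), mapCoeff p.1 p.2 = P p.1 p.2 + Q p.1 p.2 := by
    rintro ⟨n, l⟩ h
    rw [HasAntidiagonal.mem_antidiagonal] at h
    rcases n with _ | n <;> rcases l with _ | l
    · simp at h
    · simp [P, Q, mapCoeff_zero_succ]
    · simp [P, Q, mapCoeff_succ_zero]
    · simp [P, Q, mapCoeff_succ_succ]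
  rw [seriesCoeff, sum_congr rfl fun p hp => by rw [hPQ p hp, Nat.cast_add, add_mul], sum_add_distrib]
  congr 1
  · rw [Nat.sum_antidiagonal_succ']
    rw [show ((P (q + 1, 0).1 (q + 1, 0).2 : ℕ) : R) = 0 from Nat.cast_zero, zero_mul, zero_add]
    rw [seriesCoeff, mul_sum]
    refine sum_congr rfl fun p hp => ?_
    rw [HasAntidiagonal.mem_antidiagonal] at hp
    rw [← hp, show P p.1 (p.2 + 1) = (2 * (p.1 + p.2) + 1) * mapCoeff p.1 p.2 from rfl]
    push_cast
    ring
  · rw [Nat.sum_antidiagonal_succ, ← sum_splitCoeff]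
    simp [Q]

/-- By `p! (q - p)! ≤ q!` the `q + 1` terms of the quadratic part are each at most `3^q q!`, and
`(2q + 1) + (q + 1) ≤ 3(q + 1)`. -/
lemma seriesCoeff_one_le (q : ℕ) : seriesCoeff (1 : ℕ) q ≤ 3 ^ q * q.factorial := by
  induction q using Nat.strong_induction_on with | _ q ih
  cases q with
  | zero => simp [seriesCoeff_zero]
  | succ q =>
    rw [seriesCoeff_succ]
    have h1 : ∑ p ∈ HasAntidiagonal.antidiagonal q, seriesCoeff (1 : ℕ) p.1 * seriesCoeff 1 p.2 ≤
        ∑ _p ∈ HasAntidiagonal.antidiagonal q, 3 ^ q * q.factorial := by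
      refine sum_le_sum fun p hp => ?_
      have hp := HasAntidiagonal.mem_antidiagonal.1 hp
      calc seriesCoeff (1 : ℕ) p.1 * seriesCoeff 1 p.2
          ≤ (3 ^ p.1 * p.1.factorial) * (3 ^ p.2 * p.2.factorial) :=
            Nat.mul_le_mul (ih p.1 (by omega)) (ih p.2 (by omega))
        _ = 3 ^ q * (p.1.factorial * p.2.factorial) := by rw [← hp, pow_add]; ring
        _ ≤ 3 ^ q * q.factorial := by
            gcongr
            rw [← hp]
            exact Nat.le_of_dvd (Nat.factorial_pos _) (Nat.factorial_mul_factorial_dvd_factorial_add _ _)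
    rw [sum_const, Nat.card_antidiagonal, smul_eq_mul] at h1
    have h2 := ih q (by omega)
    have h3 : (2 * (q : ℕ) + 1) * 1 * seriesCoeff (1 : ℕ) q ≤ (2 * q + 1) * (3 ^ q * q.factorial) := by
      rw [mul_one]; gcongr
    simp only [Nat.cast_id]
    rw [Nat.factorial_succ, pow_succ]
    nlinarith [Nat.zero_le (3 ^ q * q.factorial)]

lemma mapCoeff_le (n l : ℕ) : mapCoeff n l ≤ 3 ^ (n + l) * (n + l).factorial := by
  refine le_trans ?_ (seriesCoeff_one_le (n + l))
  have := single_le_sum (f := fun p : ℕ × ℕ => mapCoeff p.1 p.2 * 1 ^ p.2) (s := HasAntidiagonal.antidiagonal (n + l))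
    (fun _ _ => Nat.zero_le _) (a := (n, l)) (by simp)
  simpa [seriesCoeff] using this

end Coefficients

end NVector

namespace NVector

/-! ### Convolutions of power series -/

/-- Euler's Beta integral. Integration by parts moves one power at a time from `B - y` to `y`. -/
lemma integral_pow_mul_sub_pow (B : ℝ) (m k : ℕ) :
    ∫ y in (0 : ℝ)..B, y ^ m / m.factorial * ((B - y) ^ k / k.factorial) =
      B ^ (m + k + 1) / (m + k + 1).factorial := by
  induction k generalizing m with
  | zero =>
    simp [integral_pow, Nat.factorial_succ]
    field_simp
  | succ k ih =>
    have hd : ∀ y ∈ Set.uIcc 0 B, HasDerivAt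
        (fun y : ℝ => y ^ (m + 1) / (m + 1).factorial * ((B - y) ^ (k + 1) / (k + 1).factorial))
        (y ^ m / m.factorial * ((B - y) ^ (k + 1) / (k + 1).factorial) -
          y ^ (m + 1) / (m + 1).factorial * ((B - y) ^ k / k.factorial)) y := by
      intro y _
      have h1 := ((hasDerivAt_pow (m + 1) y).div_const ((m + 1).factorial : ℝ)).mul
        (((hasDerivAt_pow (k + 1) (B - y)).comp y ((hasDerivAt_id y).const_sub B)).div_const
          ((k + 1).factorial : ℝ))
      refine h1.congr_deriv ?_
      simp only [Nat.factorial_succ, Function.comp, Nat.add_sub_cancel]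
      push_cast
      field_simp
      ring
    have hi := intervalIntegral.integral_eq_sub_of_hasDerivAt hd
      (Continuous.intervalIntegrable (by fun_prop) _ _)
    rw [intervalIntegral.integral_sub (Continuous.intervalIntegrable (by fun_prop) _ _)
      (Continuous.intervalIntegrable (by fun_prop) _ _), ih] at hi
    simp only [sub_self, ne_eq, Nat.add_eq_zero_iff, one_ne_zero, and_false, not_false_eq_true,
      zero_pow, zero_div, mul_zero, zero_mul] at hi
    rw [sub_eq_zero.1 hi]
    congr 2 <;> ring_nf

lemma integral_ofReal_pow_mul_sub_pow (B : ℝ) (m k : ℕ) :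
    ∫ y in (0 : ℝ)..B, (y : ℂ) ^ m / m.factorial * (((B - y : ℝ) : ℂ) ^ k / k.factorial) =
      (B : ℂ) ^ (m + k + 1) / (m + k + 1).factorial := by
  have := congrArg (fun r : ℝ => (r : ℂ)) (integral_pow_mul_sub_pow B m k)
  simp only [← intervalIntegral.integral_ofReal] at this
  push_cast at this ⊢
  exact this

lemma norm_mul_pow_div_factorial_le {B y : ℝ} (hy : y ∈ Set.Icc 0 B) (a : ℂ) (m : ℕ) :
    ‖a * ((y : ℂ) ^ m / m.factorial)‖ ≤ ‖a‖ * B ^ m / m.factorial := by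
  rw [norm_mul, norm_div, norm_pow, Complex.norm_real, Real.norm_of_nonneg hy.1,
    Complex.norm_natCast, mul_div_assoc]
  have := hy.1
  have := hy.2
  gcongr

/-- Termwise convolution of two power series. -/
lemma hasSum_convolution {ι ι' : Type*} [Countable ι] [Countable ι'] {a : ι → ℂ} {b : ι' → ℂ}
    {m : ι → ℕ} {k : ι' → ℕ} {B : ℝ} (hB : 0 ≤ B)
    (ha : Summable fun i => ‖a i‖ * B ^ m i / (m i).factorial)
    (hb : Summable fun i => ‖b i‖ * B ^ k i / (k i).factorial) :
    HasSum (fun p : ι × ι' => a p.1 * b p.2 *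
        ((B : ℂ) ^ (m p.1 + k p.2 + 1) / (m p.1 + k p.2 + 1).factorial))
      (∫ y in (0 : ℝ)..B, (∑' i, a i * ((y : ℂ) ^ m i / (m i).factorial)) *
        ∑' i, b i * (((B - y : ℝ) : ℂ) ^ k i / (k i).factorial)) := by
  let α : ι → ℝ → ℂ := fun i y => a i * ((y : ℂ) ^ m i / (m i).factorial)
  let β : ι' → ℝ → ℂ := fun i y => b i * (((B - y : ℝ) : ℂ) ^ k i / (k i).factorial)
  let α' : ι → ℝ := fun i => ‖a i‖ * B ^ m i / (m i).factorial
  let β' : ι' → ℝ := fun i => ‖b i‖ * B ^ k i / (k i).factorial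
  have hI : ∀ y ∈ Set.uIoc 0 B, y ∈ Set.Icc 0 B := fun y hy => by
    rw [Set.uIoc_of_le hB] at hy; exact ⟨hy.1.le, hy.2⟩
  have hα : ∀ i, ∀ y ∈ Set.uIoc 0 B, ‖α i y‖ ≤ α' i := fun i y hy =>
    norm_mul_pow_div_factorial_le (hI y hy) _ _
  have hβ : ∀ i, ∀ y ∈ Set.uIoc 0 B, ‖β i y‖ ≤ β' i := fun i y hy =>
    norm_mul_pow_div_factorial_le ⟨by linarith [(hI y hy).2], by linarith [(hI y hy).1]⟩ _ _
  have hαc : ∀ i, Continuous (α i) := fun i => by fun_prop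
  have hβc : ∀ i, Continuous (β i) := fun i => by fun_prop
  have hα' : ∀ i, 0 ≤ α' i := fun i => by positivity
  have hβ' : ∀ i, 0 ≤ β' i := fun i => by positivity
  have h' : ∀ p : ι × ι', ∫ y in (0 : ℝ)..B, α p.1 y * β p.2 y =
      a p.1 * b p.2 * ((B : ℂ) ^ (m p.1 + k p.2 + 1) / (m p.1 + k p.2 + 1).factorial) := fun p => by
    rw [← integral_ofReal_pow_mul_sub_pow, ← intervalIntegral.integral_const_mul]
    refine intervalIntegral.integral_congr fun y _ => ?_
    simp only [α, β]
    ring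
  change HasSum _ (∫ y in (0 : ℝ)..B, (∑' i, α i y) * ∑' i, β i y)
  simp_rw [← h']
  change Summable α' at ha
  change Summable β' at hb
  clear_value α β α' β'
  refine intervalIntegral.hasSum_integral_of_dominated_convergence (fun p _ => α' p.1 * β' p.2)
    (fun p => ((hαc p.1).mul (hβc p.2)).aestronglyMeasurable)
    (fun p => ae_of_all _ fun y hy => ?_)
    (ae_of_all _ fun y _ => ha.mul_of_nonneg hb hα' hβ')
    intervalIntegrable_const (ae_of_all _ fun y hy => ?_)
  · rw [norm_mul]
    exact mul_le_mul (hα _ y hy) (hβ _ y hy) (norm_nonneg _) (hα' _)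
  · have h1 := Summable.of_nonneg_of_le (fun _ => norm_nonneg _) (fun i => hα i y hy) ha
    have h2 := Summable.of_nonneg_of_le (fun _ => norm_nonneg _) (fun i => hβ i y hy) hb
    have h3 : Summable fun p : ι × ι' => α p.1 y * β p.2 y :=
      summable_mul_of_summable_norm (f := fun i => α i y) (g := fun i => β i y) h1 h2
    rw [tsum_mul_tsum_of_summable_norm h1 h2]
    exact h3.hasSum

end NVector

namespace NVector

/-! ### Entire functions `∑ a_q u^q / (2q)!` -/

/-- Factorial bounds on the coefficients. -/
def FactorialBound (a : ℕ → ℂ) : Prop := ∃ M : ℝ, 0 ≤ M ∧ ∀ q, ‖a q‖ ≤ M ^ q * q.factorial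

/-- The series `∑ a_q u^q / (2q)!`. -/
noncomputable def evenSeries (a : ℕ → ℂ) (u : ℂ) : ℂ := ∑' q, a q * (u ^ q / (2 * q).factorial)

lemma factorial_mul_factorial_le (q : ℕ) : q.factorial * q.factorial ≤ (2 * q).factorial := by
  rw [two_mul]
  exact Nat.le_of_dvd (Nat.factorial_pos _) (Nat.factorial_mul_factorial_dvd_factorial_add _ _)

lemma two_mul_add_one_le_three_pow (q : ℕ) : 2 * q + 1 ≤ 3 ^ q := by
  induction q with
  | zero => simp
  | succ q ih => rw [pow_succ]; omega

variable {a b : ℕ → ℂ}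

/-- Since `(q!)² ≤ (2q)!`, dividing coefficients of growth `M^q q!` by `(2q)!` still leaves a factor
`1/q!`. -/
lemma FactorialBound.summable (ha : FactorialBound a) {R : ℝ} (hR : 0 ≤ R) :
    Summable fun q : ℕ => (2 * q + 1) * ‖a q‖ * (R ^ q / (2 * q).factorial) := by
  obtain ⟨M, hM, h⟩ := ha
  refine Summable.of_nonneg_of_le (fun q => by positivity) (fun q => ?_)
    (Real.summable_pow_div_factorial (3 * M * R))
  have h1 : (2 * (q : ℝ) + 1) ≤ 3 ^ q := by exact_mod_cast two_mul_add_one_le_three_pow q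
  have h2 : (q.factorial : ℝ) * q.factorial ≤ (2 * q).factorial := by
    exact_mod_cast factorial_mul_factorial_le q
  have h3 : (0 : ℝ) < q.factorial := by exact_mod_cast q.factorial_pos
  calc (2 * q + 1) * ‖a q‖ * (R ^ q / (2 * q).factorial)
      ≤ 3 ^ q * (M ^ q * q.factorial) * (R ^ q / (q.factorial * q.factorial)) := by
        gcongr
        exact h q
    _ = (3 * M * R) ^ q / q.factorial := by
        rw [mul_pow, mul_pow]; field_simp

lemma FactorialBound.summable_norm (ha : FactorialBound a) {R : ℝ} (hR : 0 ≤ R) :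
    Summable fun q : ℕ => ‖a q‖ * (R ^ q / (2 * q).factorial) := by
  refine Summable.of_nonneg_of_le (fun q => by positivity) (fun q => ?_) (ha.summable hR)
  rw [mul_assoc]
  refine le_mul_of_one_le_left (by positivity) ?_
  have : (0 : ℝ) ≤ q := by positivity
  linarith

lemma norm_evenSeries_term (q : ℕ) (u : ℂ) :
    ‖a q * (u ^ q / (2 * q).factorial)‖ = ‖a q‖ * (‖u‖ ^ q / (2 * q).factorial) := by
  simp

lemma FactorialBound.hasSum (ha : FactorialBound a) (u : ℂ) :
    HasSum (fun q => a q * (u ^ q / (2 * q).factorial)) (evenSeries a u) := by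
  refine Summable.hasSum (Summable.of_norm ?_)
  simpa only [norm_evenSeries_term] using ha.summable_norm (norm_nonneg u)

lemma FactorialBound.hasSum_deriv (ha : FactorialBound a) (u : ℂ) :
    HasSum (fun q : ℕ => (q + 1) * a (q + 1) * (u ^ q / (2 * q + 2).factorial))
      (deriv (evenSeries a) u) := by
  have hu : u ∈ Metric.ball (0 : ℂ) (‖u‖ + 1) := by simp
  have h := Complex.hasSum_deriv_of_summable_norm (ha.summable_norm (R := ‖u‖ + 1) (by positivity))
    (F := fun q u => a q * (u ^ q / (2 * q).factorial))
    (fun q => by fun_prop) Metric.isOpen_ball (fun q w hw => by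
      rw [norm_evenSeries_term]
      have : ‖w‖ ≤ ‖u‖ + 1 := by simpa using (mem_ball_zero_iff.1 hw).le
      gcongr) hu
  change HasSum _ (deriv (evenSeries a) u) at h
  rw [← hasSum_nat_add_iff' 1] at h
  simp only [Finset.range_one, Finset.sum_singleton, pow_zero, deriv_const, sub_zero] at h
  refine h.congr_fun fun q => ?_
  simp only [deriv_const_mul_field', deriv_div_const, deriv_pow_field, Nat.add_sub_cancel]
  rw [show 2 * (q + 1) = 2 * q + 2 from rfl]
  push_cast
  ring

lemma FactorialBound.differentiable (ha : FactorialBound a) : Differentiable ℂ (evenSeries a) := by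
  intro u
  have hu : u ∈ Metric.ball (0 : ℂ) (‖u‖ + 1) := by simp
  have h := Complex.differentiableOn_tsum_of_summable_norm
    (ha.summable_norm (R := ‖u‖ + 1) (by positivity))
    (F := fun q u => a q * (u ^ q / (2 * q).factorial))
    (fun q => by fun_prop) Metric.isOpen_ball (fun q w hw => by
      rw [norm_evenSeries_term]
      have : ‖w‖ ≤ ‖u‖ + 1 := by simpa using (mem_ball_zero_iff.1 hw).le
      gcongr)
  exact h.differentiableAt (Metric.isOpen_ball.mem_nhds hu)

lemma evenSeries_zero (a : ℕ → ℂ) : evenSeries a 0 = a 0 := by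
  rw [evenSeries, tsum_eq_single 0]
  · simp
  · intro q hq; simp [hq]

/-- The convolution of two such series. -/
lemma FactorialBound.hasSum_convolution (ha : FactorialBound a) (hb : FactorialBound b) (σ : ℂ)
    {B : ℝ} (hB : 0 ≤ B) :
    HasSum (fun q : ℕ => (∑ p ∈ Finset.HasAntidiagonal.antidiagonal q,
        (2 * p.1 + 1) * (a p.1 * b p.2)) * (σ ^ q * (B : ℂ) ^ (2 * q + 2) / (2 * q + 2).factorial))
      (∫ y in (0 : ℝ)..B, y * evenSeries a (σ * y ^ 2) * evenSeries b (σ * ((B - y : ℝ) : ℂ) ^ 2)) := by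
  -- The factor `y` under the integral is absorbed by `y · y^{2i}/(2i)! = (2i + 1)
  -- y^{2i+1}/(2i+1)!`; this is where the weight `2 * p.1 + 1` comes from.
  have h := NVector.hasSum_convolution (a := fun i : ℕ => (2 * i + 1) * a i * σ ^ i)
    (b := fun i => b i * σ ^ i) (m := fun i => 2 * i + 1) (k := fun i => 2 * i) hB ?_ ?_
  · have h2 := (Finset.HasAntidiagonal.sigmaAntidiagonalEquivProd.hasSum_iff.2 h).sigma
      (fun q => hasSum_fintype _)
    convert h2 using 1
    · funext q
      simp only [Function.comp]
      rw [Finset.sum_mul, ← Finset.sum_coe_sort]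
      refine Finset.sum_congr rfl fun p _ => ?_
      obtain ⟨⟨i, j⟩, hp⟩ := p
      rw [Finset.HasAntidiagonal.mem_antidiagonal] at hp
      subst hp
      simp only [Finset.HasAntidiagonal.sigmaAntidiagonalEquivProd_apply]
      rw [show 2 * i + 1 + 2 * j + 1 = 2 * (i + j) + 2 by ring]
      ring
    · refine intervalIntegral.integral_congr fun y _ => ?_
      congr 1
      · rw [evenSeries, ← tsum_mul_left]
        refine tsum_congr fun i => ?_
        rw [Nat.factorial_succ, pow_succ]
        push_cast
        have : (2 * (i : ℂ) + 1) ≠ 0 := by exact_mod_cast (2 * i).succ_ne_zero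
        field_simp
        ring
      · rw [evenSeries]
        refine tsum_congr fun i => ?_
        ring
  · refine ((ha.summable_norm (R := ‖σ‖ * B ^ 2) (by positivity)).mul_left B).congr fun q => ?_
    have h1 : ‖(2 * q + 1 : ℂ)‖ = 2 * q + 1 := by
      exact_mod_cast Complex.norm_natCast (2 * q + 1)
    rw [norm_mul, norm_mul, norm_pow, mul_pow, ← pow_mul, Nat.factorial_succ, h1, pow_succ]
    push_cast
    have : (2 * (q : ℝ) + 1) ≠ 0 := by positivity
    field_simp
  · refine (hb.summable_norm (R := ‖σ‖ * B ^ 2) (by positivity)).congr fun q => ?_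
    rw [norm_mul, norm_pow, mul_pow, ← pow_mul]
    ring
end NVector

namespace NVector

/-! ### The contributions of the trees with a given number of vertices -/

section Branch

open Finset

/-- The coefficients `c n (q - n) x ^ (q - n)`. -/
noncomputable def branchCoeff (n : ℕ) (x : ℂ) (q : ℕ) : ℂ :=
  if n ≤ q then mapCoeff n (q - n) * x ^ (q - n) else 0

/-- The entire function `∑ₗ c n l xˡ u^(n + l) / (2 (n + l))!`. -/
noncomputable def branch (n : ℕ) (x u : ℂ) : ℂ := evenSeries (branchCoeff n x) u

lemma branchCoeff_add (n : ℕ) (x : ℂ) (l : ℕ) : branchCoeff n x (n + l) = mapCoeff n l * x ^ l := by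
  simp [branchCoeff]

lemma branchCoeff_of_lt {n q : ℕ} (x : ℂ) (h : q < n) : branchCoeff n x q = 0 := by
  simp [branchCoeff, not_le.2 h]

lemma factorialBound_branchCoeff (n : ℕ) (x : ℂ) : FactorialBound (branchCoeff n x) := by
  refine ⟨3 * (1 + ‖x‖), by positivity, fun q => ?_⟩
  rcases lt_or_ge q n with h | h
  · rw [branchCoeff_of_lt x h, norm_zero]; positivity
  · obtain ⟨l, rfl⟩ := Nat.exists_eq_add_of_le h
    rw [branchCoeff_add, norm_mul, norm_pow, Complex.norm_natCast, mul_pow]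
    have h1 : (mapCoeff n l : ℝ) ≤ 3 ^ (n + l) * (n + l).factorial := by
      exact_mod_cast mapCoeff_le n l
    have h2 : ‖x‖ ^ l ≤ (1 + ‖x‖) ^ (n + l) :=
      (pow_le_pow_left₀ (norm_nonneg _) (by linarith) l).trans
        (pow_le_pow_right₀ (by linarith [norm_nonneg x]) (by omega))
    calc (mapCoeff n l : ℝ) * ‖x‖ ^ l ≤ (3 ^ (n + l) * (n + l).factorial) * (1 + ‖x‖) ^ (n + l) := by
          gcongr
      _ = _ := by ring

lemma sum_branchCoeff_mul (a b l : ℕ) (x : ℂ) :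
    ∑ r ∈ HasAntidiagonal.antidiagonal (a + b + l), branchCoeff a x r.1 * branchCoeff b x r.2 =
      (∑ r ∈ HasAntidiagonal.antidiagonal l, (mapCoeff a r.1 * mapCoeff b r.2 : ℂ)) * x ^ l := by
  rw [sum_mul]
  symm
  refine sum_of_injOn (fun s => (a + s.1, b + s.2)) ?_ ?_ ?_ ?_
  · rintro ⟨i, j⟩ _ ⟨i', j'⟩ _ h
    simpa using h
  · rintro ⟨i, j⟩ h
    simp at h ⊢
    omega
  · rintro ⟨i, j⟩ h h'
    simp only [HasAntidiagonal.mem_antidiagonal] at h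
    rcases lt_or_ge i a with hi | hi
    · rw [branchCoeff_of_lt x hi, zero_mul]
    rcases lt_or_ge j b with hj | hj
    · rw [branchCoeff_of_lt x hj, mul_zero]
    exfalso
    apply h'
    refine ⟨(i - a, j - b), ?_, ?_⟩
    · simp; omega
    · simp; omega
  · rintro ⟨i, j⟩ h
    simp only [HasAntidiagonal.mem_antidiagonal] at h
    rw [branchCoeff_add, branchCoeff_add, ← h, pow_add]
    ring

lemma branchCoeff_succ_succ (n : ℕ) (x : ℂ) (q : ℕ) : branchCoeff (n + 1) x (q + 1) =
    (2 * q + 1) * x * branchCoeff (n + 1) x q + ∑ p ∈ HasAntidiagonal.antidiagonal n,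
      ∑ r ∈ HasAntidiagonal.antidiagonal q, branchCoeff p.1 x r.1 * branchCoeff p.2 x r.2 := by
  rcases lt_or_ge q n with h | h
  · rw [branchCoeff_of_lt x (by omega), branchCoeff_of_lt x (by omega), mul_zero, zero_add]
    symm
    refine sum_eq_zero fun p hp => sum_eq_zero fun r hr => ?_
    rw [HasAntidiagonal.mem_antidiagonal] at hp hr
    rcases lt_or_ge r.1 p.1 with h1 | h1
    · rw [branchCoeff_of_lt x h1, zero_mul]
    · rw [branchCoeff_of_lt x (by omega : r.2 < p.2), mul_zero]
  · obtain ⟨l, rfl⟩ := Nat.exists_eq_add_of_le h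
    have h1 : ∑ p ∈ HasAntidiagonal.antidiagonal n, ∑ r ∈ HasAntidiagonal.antidiagonal (n + l),
        branchCoeff p.1 x r.1 * branchCoeff p.2 x r.2 = splitCoeff n l * x ^ l := by
      rw [splitCoeff]
      push_cast
      rw [sum_mul]
      refine sum_congr rfl fun p hp => ?_
      rw [HasAntidiagonal.mem_antidiagonal] at hp
      rw [← hp, sum_branchCoeff_mul]
    rw [h1, show n + l + 1 = n + 1 + l by ring, branchCoeff_add]
    rcases l with _ | l
    · rw [branchCoeff_of_lt x (by omega), mapCoeff_succ_zero]
      simp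
    · rw [show n + (l + 1) = n + 1 + l by ring, branchCoeff_add, mapCoeff_succ_succ, pow_succ]
      push_cast
      ring

lemma branchCoeff_succ_zero (n : ℕ) (x : ℂ) : branchCoeff (n + 1) x 0 = 0 :=
  branchCoeff_of_lt x (by omega)

lemma mapCoeff_zero_mul (q : ℕ) : mapCoeff 0 q * (2 ^ q * q.factorial) = (2 * q).factorial := by
  induction q with
  | zero => simp [mapCoeff_zero_zero]
  | succ q ih =>
    rw [mapCoeff_zero_succ, show 2 * (q + 1) = 2 * q + 1 + 1 from rfl, Nat.factorial_succ q,
      Nat.factorial_succ (2 * q + 1), Nat.factorial_succ (2 * q), ← ih, pow_succ]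
    ring

/-- `mapCoeff 0 q` is the double factorial `(2q - 1)!!`, and `(2q)! = 2^q q! (2q - 1)!!`. -/
lemma branch_zero (x u : ℂ) : branch 0 x u = Complex.exp (x * u / 2) := by
  rw [branch, evenSeries, Complex.exp_eq_exp_ℂ, NormedSpace.exp_eq_tsum_div]
  refine tsum_congr fun q => ?_
  have h : (mapCoeff 0 q : ℂ) * (2 ^ q * q.factorial) = (2 * q).factorial := by
    exact_mod_cast mapCoeff_zero_mul q
  have h1 : (q.factorial : ℂ) ≠ 0 := by exact_mod_cast q.factorial_ne_zero
  have h2 : ((2 * q).factorial : ℂ) ≠ 0 := by exact_mod_cast (2 * q).factorial_ne_zero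
  rw [show branchCoeff 0 x q = mapCoeff 0 q * x ^ q by simpa using branchCoeff_add 0 x q, div_pow,
    mul_pow]
  field_simp
  linear_combination (x ^ q * u ^ q) * h

lemma branch_succ_zero (n : ℕ) (x : ℂ) : branch (n + 1) x 0 = 0 := by
  rw [branch, evenSeries_zero, branchCoeff_succ_zero]

lemma differentiable_branch (n : ℕ) (x : ℂ) : Differentiable ℂ (branch n x) :=
  (factorialBound_branchCoeff n x).differentiable

/-- The convolution in the recursion for `branch`. -/
noncomputable def branchConv (n : ℕ) (x σ : ℂ) (B : ℝ) : ℂ :=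
  ∑ p ∈ HasAntidiagonal.antidiagonal n,
    ∫ y in (0 : ℝ)..B, y * branch p.1 x (σ * y ^ 2) * branch p.2 x (σ * ((B - y : ℝ) : ℂ) ^ 2)

/-- The unweighted sum is symmetric under exchange of the two factors, so `2 * r.1 + 1` may be
replaced by its mean with `2 * r.2 + 1`, which is `q + 1`. -/
lemma sum_weighted_eq (n : ℕ) (x : ℂ) (q : ℕ) :
    ∑ p ∈ HasAntidiagonal.antidiagonal n, ∑ r ∈ HasAntidiagonal.antidiagonal q,
      (2 * r.1 + 1) * (branchCoeff p.1 x r.1 * branchCoeff p.2 x r.2) =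
    (q + 1) * ∑ p ∈ HasAntidiagonal.antidiagonal n, ∑ r ∈ HasAntidiagonal.antidiagonal q,
      branchCoeff p.1 x r.1 * branchCoeff p.2 x r.2 := by
  have h : ∑ p ∈ HasAntidiagonal.antidiagonal n, ∑ r ∈ HasAntidiagonal.antidiagonal q,
      (2 * (r.1 : ℂ) + 1) * (branchCoeff p.1 x r.1 * branchCoeff p.2 x r.2) =
      ∑ p ∈ HasAntidiagonal.antidiagonal n, ∑ r ∈ HasAntidiagonal.antidiagonal q,
      (2 * (r.2 : ℂ) + 1) * (branchCoeff p.1 x r.1 * branchCoeff p.2 x r.2) := by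
    rw [← Nat.sum_antidiagonal_swap]
    refine sum_congr rfl fun p _ => ?_
    rw [← Nat.sum_antidiagonal_swap]
    refine sum_congr rfl fun r _ => ?_
    simp only [Prod.fst_swap, Prod.snd_swap]
    ring
  have h2 : (∑ p ∈ HasAntidiagonal.antidiagonal n, ∑ r ∈ HasAntidiagonal.antidiagonal q,
      (2 * (r.1 : ℂ) + 1) * (branchCoeff p.1 x r.1 * branchCoeff p.2 x r.2)) +
      ∑ p ∈ HasAntidiagonal.antidiagonal n, ∑ r ∈ HasAntidiagonal.antidiagonal q,
      (2 * (r.2 : ℂ) + 1) * (branchCoeff p.1 x r.1 * branchCoeff p.2 x r.2) =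
      2 * ((q + 1) * ∑ p ∈ HasAntidiagonal.antidiagonal n, ∑ r ∈ HasAntidiagonal.antidiagonal q,
      branchCoeff p.1 x r.1 * branchCoeff p.2 x r.2) := by
    rw [← sum_add_distrib, mul_sum, mul_sum]
    refine sum_congr rfl fun p _ => ?_
    rw [← sum_add_distrib, mul_sum, mul_sum]
    refine sum_congr rfl fun r hr => ?_
    rw [HasAntidiagonal.mem_antidiagonal] at hr
    rw [← hr]
    push_cast
    ring
  rw [← h] at h2
  linear_combination h2 / 2

/-- The coefficient recursion rewritten as a differential equation: the convolution of lower
branches is `B² (f' - (x/2) f)` at `σB²`, with `f` the branch of index `n + 1`. -/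
lemma branchConv_eq (n : ℕ) (x σ : ℂ) {B : ℝ} (hB : 0 ≤ B) : branchConv n x σ B =
    B ^ 2 * deriv (branch (n + 1) x) (σ * B ^ 2) - x * B ^ 2 / 2 * branch (n + 1) x (σ * B ^ 2) := by
  have h1 := hasSum_sum (s := HasAntidiagonal.antidiagonal n) fun p _ =>
    (factorialBound_branchCoeff p.1 x).hasSum_convolution (factorialBound_branchCoeff p.2 x) σ hB
  have h2 := ((factorialBound_branchCoeff (n + 1) x).hasSum_deriv (σ * B ^ 2)).mul_left ((B : ℂ) ^ 2)
  have h3 := ((factorialBound_branchCoeff (n + 1) x).hasSum (σ * B ^ 2)).mul_left (x * (B : ℂ) ^ 2 / 2)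
  refine h1.unique ((h2.sub h3).congr_fun fun q => ?_)
  rw [← sum_mul, sum_weighted_eq, branchCoeff_succ_succ, Nat.factorial_succ, Nat.factorial_succ]
  have h4 : ((2 * q).factorial : ℂ) ≠ 0 := by exact_mod_cast (2 * q).factorial_ne_zero
  have h5 : (2 * (q : ℂ) + 1) ≠ 0 := by exact_mod_cast (2 * q).succ_ne_zero
  have h6 : ((q : ℂ) + 1) ≠ 0 := by exact_mod_cast q.succ_ne_zero
  have h7 : ((2 * q + 1 + 1 : ℕ) : ℂ) = 2 * (q + 1) := by push_cast; ring
  rw [Nat.cast_mul, h7, Nat.cast_mul, Nat.cast_succ, Nat.cast_mul, Nat.cast_ofNat]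
  generalize 2 * (q : ℂ) + 1 = d at *
  field_simp
  ring

/-- The recursion for `branch`, with `m` the smallest edge parameter. -/
lemma branch_succ_eq (n : ℕ) (x : ℂ) (s : ℝ) {B : ℝ} (hB : 0 ≤ B) :
    branch (n + 1) x ((1 - s) * B ^ 2) =
      ∫ m in s..1, Complex.exp (x / 2 * (m - s) * B ^ 2) * branchConv n x (1 - m) B := by
  have hb := differentiable_branch (n + 1) x
  -- The differential equation of `branchConv_eq` exhibits a primitive of the integrand. Its value
  -- at `m = 1` vanishes because `branch (n + 1) x 0 = 0`.
  have hd : ∀ m ∈ Set.uIcc s 1, HasDerivAt (fun m : ℝ => -(Complex.exp (x / 2 * (m - s) * B ^ 2) *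
      branch (n + 1) x ((1 - m) * B ^ 2)))
      (Complex.exp (x / 2 * (m - s) * B ^ 2) * branchConv n x (1 - m) B) m := by
    intro m _
    have h0 : HasDerivAt (fun m : ℝ => (m : ℂ)) 1 m := Complex.ofRealCLM.hasDerivAt
    have h1 := (((h0.sub_const (s : ℂ)).const_mul (x / 2)).mul_const ((B : ℂ) ^ 2)).cexp
    have h2 := (hb ((1 - m) * B ^ 2)).hasDerivAt.comp m ((h0.const_sub 1).mul_const ((B : ℂ) ^ 2))
    refine (h1.mul h2).neg.congr_deriv ?_
    rw [branchConv_eq n x _ hB]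
    simp only [Function.comp]
    ring
  have hc : Continuous fun m : ℝ => Complex.exp (x / 2 * (m - s) * B ^ 2) * branchConv n x (1 - m) B := by
    simp_rw [branchConv_eq n x _ hB]
    have h1 : Continuous (deriv (branch (n + 1) x)) :=
      (hb.contDiff (n := 1)).continuous_deriv le_rfl
    have h2 := hb.continuous
    fun_prop
  rw [intervalIntegral.integral_eq_sub_of_hasDerivAt hd (hc.intervalIntegrable _ _)]
  simp [branch_succ_zero]

end Branch

end NVector

namespace NVector

/-! ### Functions on the left half-plane whose Taylor remainders are bounded by the next term -/

section TaylorMaj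

open Finset

/-- On the left half-plane every Taylor remainder of `F` is bounded by the next term. -/
def TaylorMaj (F : ℂ → ℂ) (γ : ℕ → ℝ) : Prop :=
  (∀ l, 0 ≤ γ l) ∧ ∀ x : ℂ, x.re ≤ 0 → ∀ m, ‖F x - ∑ l ∈ range m, γ l * x ^ l‖ ≤ γ m * ‖x‖ ^ m

variable {F G : ℂ → ℂ} {γ δ : ℕ → ℝ}

lemma TaylorMaj.norm_le (h : TaylorMaj F γ) {x : ℂ} (hx : x.re ≤ 0) : ‖F x‖ ≤ γ 0 := by
  simpa using h.2 x hx 0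

/-- The remainder of order `m + 1` is the integral over `t ∈ [0,1]` of `w` times the remainder of
order `m` at `tw`, and `tw` remains in the left half-plane. -/
lemma norm_exp_sub_sum_le {w : ℂ} (hw : w.re ≤ 0) (m : ℕ) :
    ‖Complex.exp w - ∑ l ∈ range m, w ^ l / l.factorial‖ ≤ ‖w‖ ^ m / m.factorial := by
  induction m generalizing w with
  | zero => simp [Complex.norm_exp, hw]
  | succ m ih =>
    have hd : ∀ t ∈ Set.uIcc (0 : ℝ) 1, HasDerivAt
        (fun t : ℝ => Complex.exp (t * w) - ∑ l ∈ range (m + 1), (t * w) ^ l / l.factorial)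
        (w * (Complex.exp (t * w) - ∑ l ∈ range m, (t * w) ^ l / l.factorial)) t := by
      intro t _
      have h0 : HasDerivAt (fun t : ℝ => (t : ℂ) * w) w t := by
        simpa using (Complex.ofRealCLM.hasDerivAt (x := t)).mul_const w
      have h1 := h0.cexp.sub (HasDerivAt.fun_sum (u := range (m + 1)) fun l _ =>
        (h0.pow l).div_const (l.factorial : ℂ))
      refine h1.congr_deriv ?_
      rw [sum_range_succ', mul_sub, mul_sum]
      simp only [Nat.cast_zero, zero_mul, zero_div, add_zero, Nat.add_sub_cancel]
      congr 1
      · ring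
      · refine sum_congr rfl fun l _ => ?_
        rw [Nat.factorial_succ]
        push_cast
        have : ((l : ℂ) + 1) ≠ 0 := by exact_mod_cast l.succ_ne_zero
        field_simp
    have hi := intervalIntegral.integral_eq_sub_of_hasDerivAt hd
      (Continuous.intervalIntegrable (by fun_prop) _ _)
    have h0 : ∑ l ∈ range (m + 1), (((0 : ℝ) : ℂ) * w) ^ l / l.factorial = 1 := by
      rw [sum_range_succ']; simp
    rw [h0] at hi
    simp only [Complex.ofReal_one, one_mul, Complex.ofReal_zero, zero_mul, Complex.exp_zero, sub_self,
      sub_zero] at hi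
    rw [← hi]
    have h2 : ∫ t in (0 : ℝ)..1, ‖w‖ ^ (m + 1) / m.factorial * t ^ m =
        ‖w‖ ^ (m + 1) / (m + 1).factorial := by
      rw [intervalIntegral.integral_const_mul, integral_pow, Nat.factorial_succ]
      simp
      field_simp
    rw [← h2]
    refine intervalIntegral.norm_integral_le_of_norm_le zero_le_one (ae_of_all _ fun t ht => ?_)
      (Continuous.intervalIntegrable (by fun_prop) _ _)
    have ht0 : 0 ≤ t := ht.1.le
    have := ih (w := t * w) (by simp; exact mul_nonpos_of_nonneg_of_nonpos ht0 hw)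
    rw [norm_mul]
    calc ‖w‖ * _ ≤ ‖w‖ * (‖(t : ℂ) * w‖ ^ m / m.factorial) := by gcongr
      _ = _ := by rw [norm_mul, Complex.norm_real, Real.norm_of_nonneg ht0, mul_pow]; ring

lemma taylorMaj_exp {v : ℝ} (hv : 0 ≤ v) :
    TaylorMaj (fun x => Complex.exp (x * v)) (fun l => v ^ l / l.factorial) := by
  refine ⟨fun l => by positivity, fun x hx m => ?_⟩
  have := norm_exp_sub_sum_le (w := x * v) (by simp; exact mul_nonpos_of_nonpos_of_nonneg hx hv) m
  convert this using 1
  · congr 2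
    refine sum_congr rfl fun l _ => ?_
    push_cast
    ring
  · rw [norm_mul, Complex.norm_real, Real.norm_of_nonneg hv]
    ring

lemma TaylorMaj.const_mul (h : TaylorMaj F γ) {c : ℝ} (hc : 0 ≤ c) :
    TaylorMaj (fun x => c * F x) (fun l => c * γ l) := by
  refine ⟨fun l => mul_nonneg hc (h.1 l), fun x hx m => ?_⟩
  have h1 : (c : ℂ) * F x - ∑ l ∈ range m, ((c * γ l : ℝ) : ℂ) * x ^ l =
      c * (F x - ∑ l ∈ range m, γ l * x ^ l) := by
    rw [mul_sub, mul_sum]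
    push_cast
    simp only [mul_assoc]
  rw [h1, norm_mul, Complex.norm_real, Real.norm_of_nonneg hc, mul_assoc]
  exact mul_le_mul_of_nonneg_left (h.2 x hx m) hc

lemma TaylorMaj.sum {ι : Type*} {s : Finset ι} {F : ι → ℂ → ℂ} {γ : ι → ℕ → ℝ}
    (h : ∀ i ∈ s, TaylorMaj (F i) (γ i)) :
    TaylorMaj (fun x => ∑ i ∈ s, F i x) (fun l => ∑ i ∈ s, γ i l) := by
  refine ⟨fun l => sum_nonneg fun i hi => (h i hi).1 l, fun x hx m => ?_⟩
  have h1 : ∑ i ∈ s, F i x - ∑ l ∈ range m, ((∑ i ∈ s, γ i l : ℝ) : ℂ) * x ^ l =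
      ∑ i ∈ s, (F i x - ∑ l ∈ range m, γ i l * x ^ l) := by
    rw [sum_sub_distrib, sum_comm]
    congr 1
    refine sum_congr rfl fun l _ => ?_
    push_cast
    rw [sum_mul]
  rw [h1, sum_mul]
  exact norm_sum_le_of_le _ fun i hi => (h i hi).2 x hx m

/-- The remainder of the product is `∑_{j<m} δ_j x^j (F - F_{<m-j}) + F (G - G_{<m})`, a subscript
`< k` meaning truncation at order `k`. Bounding each factor by its next term reproduces exactly the
Cauchy product coefficient of order `m`. -/
lemma TaylorMaj.mul (hF : TaylorMaj F γ) (hG : TaylorMaj G δ) :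
    TaylorMaj (fun x => F x * G x)
      (fun l => ∑ p ∈ HasAntidiagonal.antidiagonal l, γ p.1 * δ p.2) := by
  refine ⟨fun l => sum_nonneg fun p _ => mul_nonneg (hF.1 _) (hG.1 _), fun x hx m => ?_⟩
  have h1 : ∑ l ∈ range m, ((∑ p ∈ HasAntidiagonal.antidiagonal l, γ p.1 * δ p.2 : ℝ) : ℂ) * x ^ l =
      ∑ j ∈ range m, δ j * x ^ j * ∑ i ∈ range (m - j), γ i * x ^ i := by
    push_cast
    simp_rw [mul_sum, sum_mul]
    rw [sum_sigma', sum_sigma']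
    refine sum_bij' (fun p _ => ⟨p.2.2, p.2.1⟩) (fun p _ => ⟨p.2 + p.1, (p.2, p.1)⟩) ?_ ?_ ?_ ?_ ?_
    · rintro ⟨l, i, j⟩ h
      simp at h ⊢
      omega
    · rintro ⟨j, i⟩ h
      simp at h ⊢
      omega
    · rintro ⟨l, i, j⟩ h
      simp only [mem_sigma, HasAntidiagonal.mem_antidiagonal] at h
      obtain ⟨_, rfl⟩ := h
      rfl
    · rintro ⟨j, i⟩ h
      rfl
    · rintro ⟨l, i, j⟩ h
      simp only [mem_sigma, HasAntidiagonal.mem_antidiagonal] at h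
      obtain ⟨_, rfl⟩ := h
      simp only [pow_add]
      ring
  have h2 : F x * G x - ∑ j ∈ range m, δ j * x ^ j * ∑ i ∈ range (m - j), γ i * x ^ i =
      ∑ j ∈ range m, δ j * x ^ j * (F x - ∑ i ∈ range (m - j), γ i * x ^ i) +
        F x * (G x - ∑ j ∈ range m, δ j * x ^ j) := by
    rw [sum_congr rfl fun j _ => mul_sub (δ j * x ^ j) (F x) _, sum_sub_distrib, ← sum_mul]
    ring
  rw [h1, h2]
  have h3 : (∑ p ∈ HasAntidiagonal.antidiagonal m, γ p.1 * δ p.2) * ‖x‖ ^ m =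
      ∑ j ∈ range m, δ j * ‖x‖ ^ j * (γ (m - j) * ‖x‖ ^ (m - j)) + γ 0 * (δ m * ‖x‖ ^ m) := by
    rw [← Nat.sum_antidiagonal_swap, Nat.sum_antidiagonal_eq_sum_range_succ_mk, sum_range_succ,
      add_mul, sum_mul]
    congr 1
    · refine sum_congr rfl fun j hj => ?_
      rw [mem_range] at hj
      simp only [Prod.fst_swap, Prod.snd_swap]
      rw [← Nat.add_sub_cancel' hj.le, pow_add, Nat.add_sub_cancel_left]
      ring
    · simp [mul_assoc]
  rw [h3]
  refine (norm_add_le _ _).trans (add_le_add (norm_sum_le_of_le _ fun j _ => ?_) ?_)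
  · rw [norm_mul, norm_mul, norm_pow, Complex.norm_real, Real.norm_of_nonneg (hG.1 j)]
    exact mul_le_mul_of_nonneg_left (hF.2 x hx _) (mul_nonneg (hG.1 j) (by positivity))
  · rw [norm_mul]
    exact mul_le_mul (hF.norm_le hx) (hG.2 x hx m) (norm_nonneg _) (hF.1 0)

lemma TaylorMaj.integral {a b : ℝ} (hab : a ≤ b) {F : ℝ → ℂ → ℂ} {γ : ℝ → ℕ → ℝ}
    (h : ∀ t ∈ Set.Icc a b, TaylorMaj (F t) (γ t))
    (hF : ∀ x, Continuous fun t => F t x) (hγ : ∀ l, Continuous fun t => γ t l) :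
    TaylorMaj (fun x => ∫ t in a..b, F t x) (fun l => ∫ t in a..b, γ t l) := by
  refine ⟨fun l => intervalIntegral.integral_nonneg hab fun t ht => (h t ht).1 l, fun x hx m => ?_⟩
  have h1 : (∫ t in a..b, F t x) - ∑ l ∈ range m, ((∫ t in a..b, γ t l : ℝ) : ℂ) * x ^ l =
      ∫ t in a..b, (F t x - ∑ l ∈ range m, γ t l * x ^ l) := by
    rw [intervalIntegral.integral_sub ((hF x).intervalIntegrable _ _)
      (Continuous.intervalIntegrable (by fun_prop) _ _), intervalIntegral.integral_finsetSum
        fun l _ => Continuous.intervalIntegrable (by fun_prop) _ _]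
    congr 1
    refine sum_congr rfl fun l _ => ?_
    rw [intervalIntegral.integral_mul_const, intervalIntegral.integral_ofReal]
  rw [h1, ← intervalIntegral.integral_mul_const]
  exact intervalIntegral.norm_integral_le_of_norm_le hab
    (ae_of_all _ fun t ht => (h t ⟨ht.1.le, ht.2⟩).2 x hx m)
    (Continuous.intervalIntegrable (by fun_prop) _ _)

/-- The majorising coefficients are the Taylor coefficients. -/
lemma TaylorMaj.eq_coeff (h : TaylorMaj F γ) {c : ℕ → ℂ} (hc : Summable fun l => ‖c l‖)
    (hF : ∀ x, F x = ∑' l, c l * x ^ l) (l : ℕ) : (γ l : ℂ) = c l := by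
  induction l using Nat.strong_induction_on with | _ m ih
  set M := γ (m + 1) + ∑' l, ‖c (l + (m + 1))‖ with hM
  have hsum : ∀ x : ℂ, ‖x‖ ≤ 1 → Summable fun l => ‖c l * x ^ l‖ := fun x hx =>
    Summable.of_nonneg_of_le (fun _ => norm_nonneg _) (fun l => by
      rw [norm_mul, norm_pow]
      exact mul_le_of_le_one_right (norm_nonneg _) (pow_le_one₀ (norm_nonneg _) hx)) hc
  -- On the negative real axis both expansions are accurate to order `m + 1` and agree below order
  -- `m`. Hence `|γ m - c m| r^m ≤ M r^{m+1}` with `M` independent of `r`, and `r → 0` concludes.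
  have key : ∀ r : ℝ, 0 < r → r ≤ 1 → ‖(γ m : ℂ) - c m‖ ≤ M * r := by
    intro r hr hr1
    set x : ℂ := -(r : ℂ) with hx
    have hxn : ‖x‖ = r := by rw [hx, norm_neg, Complex.norm_real, Real.norm_of_nonneg hr.le]
    have h1 := h.2 x (by simp [hx, hr.le]) (m + 1)
    have h2 : F x = ∑ l ∈ range (m + 1), c l * x ^ l + ∑' l, c (l + (m + 1)) * x ^ (l + (m + 1)) := by
      rw [hF, (hsum x (by rw [hxn]; exact hr1)).of_norm.sum_add_tsum_nat_add]
    have h3 : ‖∑' l, c (l + (m + 1)) * x ^ (l + (m + 1))‖ ≤ (∑' l, ‖c (l + (m + 1))‖) * r ^ (m + 1) := by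
      rw [← tsum_mul_right]
      refine tsum_of_norm_bounded (((summable_nat_add_iff (m + 1)).2 hc).mul_right _).hasSum fun l => ?_
      rw [norm_mul, norm_pow, hxn]
      gcongr ?_ * ?_
      exact pow_le_pow_of_le_one hr.le hr1 (by omega)
    have h4 : ((γ m : ℂ) - c m) * x ^ m = ∑' l, c (l + (m + 1)) * x ^ (l + (m + 1)) -
        (F x - ∑ l ∈ range (m + 1), γ l * x ^ l) := by
      rw [h2, sum_range_succ, sum_range_succ, sum_congr rfl fun l hl => by
        rw [← ih l (mem_range.1 hl)]]
      ring
    have h5 : ‖(γ m : ℂ) - c m‖ * r ^ m ≤ M * r * r ^ m := by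
      rw [← hxn, ← norm_pow, ← norm_mul, h4, hxn]
      refine (norm_sub_le _ _).trans ?_
      rw [hxn] at h1
      rw [hM]
      calc _ ≤ (∑' l, ‖c (l + (m + 1))‖) * r ^ (m + 1) + γ (m + 1) * r ^ (m + 1) := add_le_add h3 h1
        _ = _ := by rw [norm_pow, hxn]; ring
    exact le_of_mul_le_mul_right h5 (by positivity)
  have hM0 : 0 ≤ M := add_nonneg (h.1 _) (tsum_nonneg fun _ => norm_nonneg _)
  rw [← sub_eq_zero, ← norm_le_zero_iff]
  have ht : Tendsto (fun r : ℝ => M * r) (𝓝[>] 0) (𝓝 0) := by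
    have : Tendsto (fun r : ℝ => M * r) (𝓝 0) (𝓝 (M * 0)) := (continuous_const_mul M).tendsto 0
    rw [mul_zero] at this
    exact this.mono_left nhdsWithin_le_nhds
  refine ge_of_tendsto ht ?_
  filter_upwards [Ioc_mem_nhdsGT (zero_lt_one' ℝ)] with r hr
  exact key r hr.1 hr.2

end TaylorMaj

end NVector

namespace NVector

/-! ### Bounds on the contributions of fixed `n` in the left half-plane -/

section BranchBounds

open Finset
open scoped ENNReal

lemma TaylorMaj.congr_coeff {F : ℂ → ℂ} {γ c : ℕ → ℝ} (h : TaylorMaj F γ)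
    (hF : ∀ x, HasSum (fun l => (c l : ℂ) * x ^ l) (F x)) : TaylorMaj F c := by
  have : γ = c := by
    funext l
    have h1 := h.eq_coeff (c := fun l => (c l : ℂ)) (summable_norm_iff.2 (by simpa using (hF 1).summable))
      (fun x => (hF x).tsum_eq.symm) l
    exact_mod_cast h1
  rwa [← this]

lemma TaylorMaj.congr {F G : ℂ → ℂ} {γ : ℕ → ℝ} (h : TaylorMaj F γ) (hFG : ∀ x, G x = F x) :
    TaylorMaj G γ := by
  have : G = F := funext hFG
  rwa [this]

/-- The Taylor coefficients of `branch n x u` in `x`. -/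
noncomputable def branchWeight (n : ℕ) (u : ℝ) (l : ℕ) : ℝ :=
  mapCoeff n l * (u ^ (n + l) / (2 * (n + l)).factorial)

lemma hasSum_branch (n : ℕ) (x u : ℂ) :
    HasSum (fun l => mapCoeff n l * (u ^ (n + l) / (2 * (n + l)).factorial) * x ^ l) (branch n x u) := by
  have h := (factorialBound_branchCoeff n x).hasSum u
  rw [← hasSum_nat_add_iff' n, sum_eq_zero fun q hq => by
    rw [branchCoeff_of_lt x (mem_range.1 hq), zero_mul], sub_zero] at h
  refine h.congr_fun fun l => ?_
  rw [add_comm l n, branchCoeff_add]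
  ring

lemma hasSum_branch_ofReal (n : ℕ) (x : ℂ) (u : ℝ) :
    HasSum (fun l => (branchWeight n u l : ℂ) * x ^ l) (branch n x u) := by
  refine (hasSum_branch n x u).congr_fun fun l => ?_
  rw [branchWeight]
  push_cast
  ring

lemma hasSum_branchConv (n : ℕ) (x σ : ℂ) {B : ℝ} (hB : 0 ≤ B) :
    HasSum (fun l : ℕ => splitCoeff n l * ((n + l + 1) * (σ ^ (n + l) * (B : ℂ) ^ (2 * (n + l) + 2) /
      (2 * (n + l) + 2).factorial)) * x ^ l) (branchConv n x σ B) := by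
  have h := hasSum_sum (s := HasAntidiagonal.antidiagonal n) fun p _ =>
    (factorialBound_branchCoeff p.1 x).hasSum_convolution (factorialBound_branchCoeff p.2 x) σ hB
  simp_rw [← sum_mul, sum_weighted_eq] at h
  change HasSum _ (branchConv n x σ B) at h
  rw [← hasSum_nat_add_iff' n, sum_eq_zero fun q hq => ?_, sub_zero] at h
  · refine h.congr_fun fun l => ?_
    rw [add_comm l n]
    have h1 : ∑ p ∈ HasAntidiagonal.antidiagonal n, ∑ r ∈ HasAntidiagonal.antidiagonal (n + l),
        branchCoeff p.1 x r.1 * branchCoeff p.2 x r.2 = splitCoeff n l * x ^ l := by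
      rw [splitCoeff]
      push_cast
      rw [sum_mul]
      refine sum_congr rfl fun p hp => ?_
      rw [HasAntidiagonal.mem_antidiagonal] at hp
      rw [← hp, sum_branchCoeff_mul]
    rw [h1]
    push_cast
    ring
  · rw [mem_range] at hq
    rw [sum_eq_zero, mul_zero, zero_mul]
    refine fun p hp => sum_eq_zero fun r hr => ?_
    rw [HasAntidiagonal.mem_antidiagonal] at hp hr
    rcases lt_or_ge r.1 p.1 with h1 | h1
    · rw [branchCoeff_of_lt x h1, zero_mul]
    · rw [branchCoeff_of_lt x (by omega : r.2 < p.2), mul_zero]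

/-- `branch 0` is an exponential, and `branch_succ_eq` builds each further branch from lower ones by
products, sums and integrals with nonnegative weights, all of which preserve `TaylorMaj`. The
majorants obtained this way need not be computed: by uniqueness (`congr_coeff`) they are the Taylor
coefficients. -/
lemma taylorMaj_branch (n : ℕ) {u : ℝ} (hu : 0 ≤ u) :
    TaylorMaj (fun x => branch n x u) (branchWeight n u) := by
  induction n using Nat.strong_induction_on generalizing u with | _ n ih
  rcases n with _ | n
  · refine TaylorMaj.congr_coeff (((taylorMaj_exp (v := u / 2) (by positivity)).congr fun x => ?_))
      fun x => hasSum_branch_ofReal 0 x u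
    rw [branch_zero]
    push_cast
    ring_nf
  have hconv : ∀ σ : ℝ, 0 ≤ σ → ∀ B : ℝ, 0 ≤ B → TaylorMaj (fun x => branchConv n x σ B)
      (fun l => splitCoeff n l * ((n + l + 1) * (σ ^ (n + l) * B ^ (2 * (n + l) + 2) /
        (2 * (n + l) + 2).factorial))) := by
    intro σ hσ B hB
    have h1 : TaylorMaj (fun x => branchConv n x σ B) (fun l =>
        ∑ p ∈ HasAntidiagonal.antidiagonal n, ∫ y in (0 : ℝ)..B, y *
        ∑ r ∈ HasAntidiagonal.antidiagonal l, branchWeight p.1 (σ * y ^ 2) r.1 *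
          branchWeight p.2 (σ * (B - y) ^ 2) r.2) := by
      refine TaylorMaj.sum fun p hp => TaylorMaj.integral hB (γ := fun y l => y *
        ∑ r ∈ HasAntidiagonal.antidiagonal l, branchWeight p.1 (σ * y ^ 2) r.1 *
          branchWeight p.2 (σ * (B - y) ^ 2) r.2) (fun y hy => ?_) (fun x => ?_) (fun l => ?_)
      · rw [HasAntidiagonal.mem_antidiagonal] at hp
        refine (((ih p.1 (by omega) (u := σ * y ^ 2) (by positivity)).mul
          (ih p.2 (by omega) (u := σ * (B - y) ^ 2) (by positivity))).const_mul hy.1).congr fun x => ?_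
        push_cast
        ring
      · have h2 := (differentiable_branch p.1 x).continuous
        have h3 := (differentiable_branch p.2 x).continuous
        fun_prop
      · unfold branchWeight
        fun_prop
    refine h1.congr_coeff fun x => ?_
    refine (hasSum_branchConv n x σ hB).congr_fun fun l => ?_
    push_cast
    ring
  -- The recursion is used with `s = 0` and `B = √u`, so that `(1 - s) B² = u`.
  have h1 := TaylorMaj.integral (a := 0) (b := 1) zero_le_one
    (F := fun m x => Complex.exp (x / 2 * (m - (0 : ℝ)) * (Real.sqrt u : ℝ) ^ 2) *
      branchConv n x (1 - m) (Real.sqrt u))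
    (γ := fun m l => ∑ r ∈ HasAntidiagonal.antidiagonal l, (m * u / 2) ^ r.1 / r.1.factorial *
      (splitCoeff n r.2 * ((n + r.2 + 1) * ((1 - m) ^ (n + r.2) * (Real.sqrt u) ^ (2 * (n + r.2) + 2) /
        (2 * (n + r.2) + 2).factorial))))
    (fun m hm => ?_) (fun x => ?_) (fun l => by fun_prop)
  · refine (h1.congr fun x => ?_).congr_coeff fun x => hasSum_branch_ofReal (n + 1) x u
    rw [← branch_succ_eq n x 0 (Real.sqrt_nonneg u)]
    congr 1
    rw [← Complex.ofReal_pow, Real.sq_sqrt hu]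
    simp
  · refine ((taylorMaj_exp (v := m * u / 2) (by have := hm.1; positivity)).mul
      (hconv (1 - m) (by linarith [hm.2]) (Real.sqrt u) (Real.sqrt_nonneg u))).congr fun x => ?_
    rw [← Complex.ofReal_pow, Real.sq_sqrt hu]
    push_cast
    ring_nf
  · simp_rw [branchConv_eq n x _ (Real.sqrt_nonneg u)]
    have hb := differentiable_branch (n + 1) x
    have h1 : Continuous (deriv (branch (n + 1) x)) :=
      (hb.contDiff (n := 1)).continuous_deriv le_rfl
    have h2 := hb.continuous
    fun_prop

/-- The remainder bound of order zero: the branch is at most its value at `x = 0`, where only the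
Catalan number `mapCoeff n 0` survives. -/
lemma norm_branch_le (n : ℕ) {x : ℂ} (hx : x.re ≤ 0) {u : ℝ} (hu : 0 ≤ u) :
    ‖branch n x u‖ ≤ catalan n * (u ^ n / (2 * n).factorial) := by
  simpa [branchWeight, mapCoeff_eq_catalan] using (taylorMaj_branch n hu).norm_le hx

lemma exists_branch_eq_ofReal (n : ℕ) {x u : ℝ} (hx : 0 ≤ x) (hu : 0 ≤ u) :
    0 ≤ (branch n x u).re ∧ branch n x u = ((branch n x u).re : ℂ) := by
  have h := hasSum_branch_ofReal n x u
  have h' : ∀ l, (branchWeight n u l : ℂ) * (x : ℂ) ^ l = ((branchWeight n u l * x ^ l : ℝ) : ℂ) :=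
    fun l => by push_cast; ring
  simp_rw [h'] at h
  have h2 : HasSum (fun l => branchWeight n u l * x ^ l) (branch n x u).re := by
    simpa only [Complex.ofReal_re] using Complex.hasSum_re h
  exact ⟨h2.nonneg fun l => by unfold branchWeight; positivity,
    h.unique (Complex.hasSum_ofReal.2 h2)⟩

/-- The kernel of the sums over trees. -/
noncomputable def branchKernel (x : ℝ) (n : ℕ) (s B : ℝ) : ℝ≥0∞ :=
  ENNReal.ofReal (branch n x (((1 - s) * B ^ 2 : ℝ) : ℂ)).re

lemma ofReal_intervalIntegral_eq_lintegral {a b : ℝ} (hab : a ≤ b) {g : ℝ → ℝ}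
    (hg : ContinuousOn g (Set.Icc a b)) (h0 : ∀ y ∈ Set.Icc a b, 0 ≤ g y) :
    ENNReal.ofReal (∫ y in a..b, g y) = ∫⁻ y in Set.Icc a b, ENNReal.ofReal (g y) := by
  rw [intervalIntegral.integral_of_le hab, ← integral_Icc_eq_integral_Ioc,
    ofReal_integral_eq_lintegral_ofReal hg.integrableOn_Icc
      (ae_restrict_of_forall_mem measurableSet_Icc h0)]

/-- For `x ≥ 0` the branches have nonnegative coefficients, hence are real and nonnegative, and
`branch_succ_eq` becomes the tree recursion between nonnegative integrals. -/
lemma isTreeKernel_branchKernel {x : ℝ} (hx : 0 ≤ x) : IsTreeKernel x (branchKernel x) where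
  measurable n := by
    have h := (differentiable_branch n x).continuous
    refine ENNReal.measurable_ofReal.comp (Continuous.measurable ?_)
    fun_prop
  zero s B := by
    rw [branchKernel, branch_zero, ← Complex.ofReal_mul, ← Complex.ofReal_ofNat, ← Complex.ofReal_div,
      ← Complex.ofReal_exp, Complex.ofReal_re]
    ring_nf
  succ n s hs B hB := by
    have hb : ∀ k, Continuous fun u : ℂ => branch k x u := fun k => (differentiable_branch k x).continuous
    let ρ : ℕ → ℝ → ℝ := fun k u => (branch k x u).re
    have hρ : ∀ k (u : ℝ), 0 ≤ u → branch k x u = (ρ k u : ℂ) := fun k u hu =>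
      (exists_branch_eq_ofReal k hx hu).2
    have hρ0 : ∀ k (u : ℝ), 0 ≤ u → 0 ≤ ρ k u := fun k u hu => (exists_branch_eq_ofReal k hx hu).1
    have hρc : ∀ k, Continuous (ρ k) := fun k => by
      have := hb k
      fun_prop
    clear_value ρ
    let c : ℕ × ℕ → ℝ → ℝ := fun p m =>
      ∫ y in (0 : ℝ)..B, y * ρ p.1 ((1 - m) * y ^ 2) * ρ p.2 ((1 - m) * (B - y) ^ 2)
    have hc : ∀ p, Continuous (c p) := fun p =>
      intervalIntegral.continuous_parametric_intervalIntegral_of_continuous'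
        (f := fun m y => y * ρ p.1 ((1 - m) * y ^ 2) * ρ p.2 ((1 - m) * (B - y) ^ 2))
        (by have := hρc p.1; have := hρc p.2; fun_prop) _ _
    have hc0 : ∀ p, ∀ m ∈ Set.Icc s 1, 0 ≤ c p m := fun p m hm =>
      intervalIntegral.integral_nonneg hB.le fun y hy => mul_nonneg (mul_nonneg hy.1
        (hρ0 _ _ (mul_nonneg (by linarith [hm.2]) (by positivity))))
        (hρ0 _ _ (mul_nonneg (by linarith [hm.2]) (by positivity)))
    have hconv : ∀ m ∈ Set.Icc s 1, branchConv n x (1 - m) B =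
        ((∑ p ∈ HasAntidiagonal.antidiagonal n, c p m : ℝ) : ℂ) := by
      intro m hm
      rw [branchConv, Complex.ofReal_sum]
      refine sum_congr rfl fun p _ => ?_
      rw [← intervalIntegral.integral_ofReal]
      refine intervalIntegral.integral_congr fun y hy => ?_
      rw [Set.uIcc_of_le hB.le] at hy
      have h1 := hρ p.1 ((1 - m) * y ^ 2) (mul_nonneg (by linarith [hm.2]) (by positivity))
      have h2 := hρ p.2 ((1 - m) * (B - y) ^ 2) (mul_nonneg (by linarith [hm.2]) (by positivity))
      push_cast at h1 h2 ⊢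
      rw [h1, h2]
    have hmain : (branch (n + 1) x (((1 - s) * B ^ 2 : ℝ) : ℂ)).re =
        ∫ m in s..1, Real.exp (x / 2 * (m - s) * B ^ 2) *
          ∑ p ∈ HasAntidiagonal.antidiagonal n, c p m := by
      have h1 := branch_succ_eq n x s hB.le
      push_cast
      rw [h1, ← Complex.ofReal_re (∫ m in s..1, _), ← intervalIntegral.integral_ofReal]
      congr 1
      refine intervalIntegral.integral_congr fun m hm => ?_
      rw [Set.uIcc_of_le hs.2] at hm
      rw [hconv m hm]
      push_cast
      rfl
    rw [branchKernel, hmain, ofReal_intervalIntegral_eq_lintegral hs.2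
      (Continuous.continuousOn (by fun_prop)) fun m hm =>
        mul_nonneg (Real.exp_pos _).le (sum_nonneg fun p _ => hc0 p m hm)]
    refine setLIntegral_congr_fun measurableSet_Icc fun m hm => ?_
    rw [ENNReal.ofReal_mul (Real.exp_pos _).le, ENNReal.ofReal_sum_of_nonneg fun p _ => hc0 p m hm]
    congr 1
    refine sum_congr rfl fun p _ => ?_
    have hm1 : 0 ≤ 1 - m := by linarith [hm.2]
    rw [ofReal_intervalIntegral_eq_lintegral hB.le
      (Continuous.continuousOn (by have := hρc p.1; have := hρc p.2; fun_prop))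
      fun y hy => mul_nonneg (mul_nonneg hy.1 (hρ0 _ _ (by positivity))) (hρ0 _ _ (by positivity)),
      ← Measure.restrict_congr_set Ioo_ae_eq_Icc]
    refine setLIntegral_congr_fun measurableSet_Ioo fun y hy => ?_
    rw [ENNReal.ofReal_mul (mul_nonneg hy.1.le (hρ0 _ _ (by positivity))), ENNReal.ofReal_mul hy.1.le]
    rw [branchKernel, branchKernel, hρ _ _ (mul_nonneg hm1 (sq_nonneg y)),
      hρ _ _ (mul_nonneg hm1 (sq_nonneg (B - y))), Complex.ofReal_re, Complex.ofReal_re]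

end BranchBounds

end NVector

namespace NVector

/-! ### The entire function whose Laplace transform is the two-point function -/

section Kernel

open Finset

/-- The Borel-type transform `∑ a_q y^q / (2q)!` of the perturbation series, with `t = 1 / N`. -/
noncomputable def seriesKernel (t : ℝ) (y : ℂ) : ℂ := evenSeries (fun q => seriesCoeff (t : ℂ) q) y

/-- The majorant `∑ Cₙ yⁿ / (2n)!`, with the Catalan numbers `Cₙ`. -/
noncomputable def catalanMajorant (y : ℝ) : ℝ := ∑' n, (catalan n : ℝ) * (y ^ n / (2 * n).factorial)

lemma norm_seriesCoeff_le {t : ℂ} (ht : ‖t‖ ≤ 1) (q : ℕ) : 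
    ‖seriesCoeff t q‖ ≤ ((seriesCoeff (1 : ℕ) q : ℕ) : ℝ) := by
  rw [seriesCoeff, seriesCoeff]
  push_cast
  refine norm_sum_le_of_le _ fun p _ => ?_
  rw [norm_mul, norm_pow, Complex.norm_natCast]
  simpa using mul_le_of_le_one_right (Nat.cast_nonneg _) (pow_le_one₀ (norm_nonneg _) ht)

lemma norm_seriesCoeff_le' {t : ℂ} (ht : ‖t‖ ≤ 1) (q : ℕ) : ‖seriesCoeff t q‖ ≤ 3 ^ q * q.factorial :=
  (norm_seriesCoeff_le ht q).trans (by exact_mod_cast seriesCoeff_one_le q)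

lemma norm_ofReal_le_one {t : ℝ} (ht : t ∈ Set.Icc (0 : ℝ) 1) : ‖(t : ℂ)‖ ≤ 1 := by
  rw [Complex.norm_real, Real.norm_of_nonneg ht.1]; exact ht.2

lemma factorialBound_seriesCoeff {t : ℝ} (ht : t ∈ Set.Icc (0 : ℝ) 1) :
    FactorialBound (fun q => seriesCoeff (t : ℂ) q) :=
  ⟨3, by norm_num, norm_seriesCoeff_le' (norm_ofReal_le_one ht)⟩

lemma differentiable_seriesKernel {t : ℝ} (ht : t ∈ Set.Icc (0 : ℝ) 1) :
    Differentiable ℂ (seriesKernel t) :=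
  (factorialBound_seriesCoeff ht).differentiable

lemma hasSum_seriesKernel {t : ℝ} (ht : t ∈ Set.Icc (0 : ℝ) 1) (y : ℂ) :
    HasSum (fun q => seriesCoeff (t : ℂ) q * (y ^ q / (2 * q).factorial)) (seriesKernel t y) :=
  (factorialBound_seriesCoeff ht).hasSum y

lemma catalan_le_four_pow (n : ℕ) : catalan n ≤ 4 ^ n := by
  rw [catalan_eq_centralBinom_div]
  exact (Nat.div_le_self _ _).trans (Nat.centralBinom_le_four_pow n)

lemma summable_catalanMajorant (y : ℝ) :
    Summable fun n => (catalan n : ℝ) * (y ^ n / (2 * n).factorial) := by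
  have h : FactorialBound (fun n => (catalan n : ℂ)) := ⟨4, by norm_num, fun q => by
    rw [Complex.norm_natCast]
    have h1 : (catalan q : ℝ) ≤ 4 ^ q := by exact_mod_cast catalan_le_four_pow q
    have h2 : (1 : ℝ) ≤ q.factorial := by exact_mod_cast q.factorial_pos
    nlinarith [show (0 : ℝ) < 4 ^ q by positivity]⟩
  refine Summable.of_norm ((h.summable_norm (abs_nonneg y)).congr fun n => ?_)
  simp

/-- Resummation according to the number of ordinary vertices. -/
lemma hasSum_branch_seriesKernel {t : ℝ} (ht : t ∈ Set.Icc (0 : ℝ) 1) (z u : ℂ) :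
    HasSum (fun n => z ^ n * branch n (z * t) u) (seriesKernel t (z * u)) := by
  let f : ℕ × ℕ → ℂ := fun p => (mapCoeff p.1 p.2 : ℂ) * t ^ p.2 *
    ((z * u) ^ (p.1 + p.2) / (2 * (p.1 + p.2)).factorial)
  have hf : Summable f := by
    refine Summable.of_norm ?_
    rw [← HasAntidiagonal.sigmaAntidiagonalEquivProd.summable_iff]
    refine (summable_sigma_of_nonneg
      (f := fun x => ‖f (HasAntidiagonal.sigmaAntidiagonalEquivProd x)‖) fun _ => norm_nonneg _).2 ?_
    refine ⟨fun q => (hasSum_fintype _).summable, ?_⟩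
    have h1 : FactorialBound (fun q => ((seriesCoeff (1 : ℕ) q : ℕ) : ℂ)) :=
      ⟨3, by norm_num, fun q => by
        rw [Complex.norm_natCast]; exact_mod_cast seriesCoeff_one_le q⟩
    refine Summable.of_nonneg_of_le (fun q => tsum_nonneg fun _ => norm_nonneg _) (fun q => ?_)
      (h1.summable_norm (norm_nonneg (z * u)))
    rw [tsum_fintype, Complex.norm_natCast, seriesCoeff, Nat.cast_sum, sum_mul, ← sum_coe_sort
      (HasAntidiagonal.antidiagonal q)]
    refine sum_le_sum fun p _ => ?_
    obtain ⟨⟨n, l⟩, hp⟩ := p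
    rw [HasAntidiagonal.mem_antidiagonal] at hp
    subst hp
    simp only [f, HasAntidiagonal.sigmaAntidiagonalEquivProd_apply, norm_mul,
      norm_pow, norm_div, Complex.norm_natCast, one_pow, mul_one, Nat.cast_id]
    gcongr
    exact mul_le_of_le_one_right (Nat.cast_nonneg _) (pow_le_one₀ (norm_nonneg _) (norm_ofReal_le_one ht))
  have h1 := hf.hasSum
  have h2 := ((HasAntidiagonal.sigmaAntidiagonalEquivProd.hasSum_iff.2 h1).sigma
    fun q => hasSum_fintype _)
  have h3 : tsum f = seriesKernel t (z * u) := by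
    refine h2.unique ((hasSum_seriesKernel ht (z * u)).congr_fun fun q => ?_)
    rw [seriesCoeff, sum_mul, ← sum_coe_sort (HasAntidiagonal.antidiagonal q)]
    refine sum_congr rfl fun p _ => ?_
    obtain ⟨⟨n, l⟩, hp⟩ := p
    rw [HasAntidiagonal.mem_antidiagonal] at hp
    subst hp
    rfl
  rw [← h3]
  refine h1.prod_fiberwise fun n => ?_
  refine ((hasSum_branch n (z * t) u).mul_left (z ^ n)).congr_fun fun l => ?_
  simp only [f, mul_pow, pow_add]
  ring

/-- Grouping by `n` before taking norms is essential. The coefficients `a_q` grow factorially for `t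
> 0`, but in the left half-plane each group costs only a Catalan number, uniformly in `t`. -/
lemma norm_seriesKernel_le {t : ℝ} (ht : t ∈ Set.Icc (0 : ℝ) 1) {z : ℂ} (hz : (z * t).re ≤ 0)
    {u : ℝ} (hu : 0 ≤ u) : ‖seriesKernel t (z * u)‖ ≤ catalanMajorant (‖z‖ * u) := by
  rw [← (hasSum_branch_seriesKernel ht z u).tsum_eq]
  refine tsum_of_norm_bounded (summable_catalanMajorant _).hasSum fun n => ?_
  rw [norm_mul, norm_pow, mul_pow]
  calc ‖z‖ ^ n * ‖branch n (z * t) u‖ ≤ ‖z‖ ^ n * (catalan n * (u ^ n / (2 * n).factorial)) := by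
        gcongr
        exact norm_branch_le n hz hu
    _ = _ := by ring

/-- Truncating at total order `p` means truncating the group `n < p` at order `p - n` in `x`, with
error at most the next term, and dropping the groups `n ≥ p` entirely. The next terms add up to at
most `a_p(1) ≤ 3^p p!`; the dropped groups form a Catalan tail. -/
lemma norm_seriesKernel_sub_le {t : ℝ} (ht : t ∈ Set.Icc (0 : ℝ) 1) {z : ℂ} (hz : (z * t).re ≤ 0)
    {u : ℝ} (hu : 0 ≤ u) (p : ℕ) :
    ‖seriesKernel t (z * u) - ∑ q ∈ range p, seriesCoeff (t : ℂ) q * ((z * u) ^ q / (2 * q).factorial)‖ ≤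
      3 ^ p * p.factorial * ((‖z‖ * u) ^ p / (2 * p).factorial) +
        ∑' n, catalan (n + p) * ((‖z‖ * u) ^ (n + p) / (2 * (n + p)).factorial) := by
  have h1 : ∑ q ∈ range p, seriesCoeff (t : ℂ) q * ((z * u) ^ q / (2 * q).factorial) =
      ∑ n ∈ range p, z ^ n * ∑ l ∈ range (p - n), branchWeight n u l * (z * t) ^ l := by
    simp_rw [seriesCoeff, sum_mul, mul_sum]
    rw [sum_sigma', sum_sigma']
    refine sum_bij' (fun x _ => ⟨x.2.1, x.2.2⟩) (fun x _ => ⟨x.1 + x.2, (x.1, x.2)⟩) ?_ ?_ ?_ ?_ ?_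
    · rintro ⟨q, n, l⟩ h
      simp at h ⊢
      omega
    · rintro ⟨n, l⟩ h
      simp at h ⊢
      omega
    · rintro ⟨q, n, l⟩ h
      simp only [mem_sigma, HasAntidiagonal.mem_antidiagonal] at h
      obtain ⟨_, rfl⟩ := h
      rfl
    · rintro ⟨n, l⟩ h
      rfl
    · rintro ⟨q, n, l⟩ h
      simp only [mem_sigma, HasAntidiagonal.mem_antidiagonal] at h
      obtain ⟨_, rfl⟩ := h
      simp only [branchWeight]
      push_cast
      simp only [mul_pow, pow_add]
      ring
  have h2 := (hasSum_branch_seriesKernel ht z u).sub (hasSum_sum_of_ne_finset_zero (s := range p)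
    (f := fun n => z ^ n * ∑ l ∈ range (p - n), branchWeight n u l * (z * t) ^ l)
    fun n hn => by
      rw [mem_range, not_lt] at hn
      simp [Nat.sub_eq_zero_of_le hn])
  have htn := norm_ofReal_le_one ht
  let b : ℕ → ℝ := fun n => if n < p then mapCoeff n (p - n) * ((‖z‖ * u) ^ p / (2 * p).factorial)
    else catalan n * ((‖z‖ * u) ^ n / (2 * n).factorial)
  have hb1 : ∀ n, b (n + p) = catalan (n + p) * ((‖z‖ * u) ^ (n + p) / (2 * (n + p)).factorial) :=
    fun n => if_neg (by omega)
  have hbs : Summable b := by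
    rw [← summable_nat_add_iff p]
    exact ((summable_nat_add_iff p).2 (summable_catalanMajorant (‖z‖ * u))).congr fun n => (hb1 n).symm
  have h3 : ‖seriesKernel t (z * u) - ∑ n ∈ range p, z ^ n * ∑ l ∈ range (p - n),
      branchWeight n u l * (z * t) ^ l‖ ≤ ∑' n, b n := by
    rw [← h2.tsum_eq]
    refine tsum_of_norm_bounded hbs.hasSum fun n => ?_
    rw [← mul_sub, norm_mul, norm_pow]
    refine (mul_le_mul_of_nonneg_left ((taylorMaj_branch n hu).2 (z * t) hz (p - n))
      (by positivity)).trans ?_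
    by_cases hn : n < p
    · simp only [b, if_pos hn, branchWeight]
      rw [norm_mul, mul_pow, Nat.add_sub_cancel' hn.le, mul_pow ‖z‖ u p]
      have h4 : ‖z‖ ^ p = ‖z‖ ^ n * ‖z‖ ^ (p - n) := by rw [← pow_add, Nat.add_sub_cancel' hn.le]
      rw [h4]
      have h5 : ‖(t : ℂ)‖ ^ (p - n) ≤ 1 := pow_le_one₀ (norm_nonneg _) htn
      calc _ = (mapCoeff n (p - n) * ((‖z‖ ^ n * ‖z‖ ^ (p - n)) * u ^ p / (2 * p).factorial)) *
            ‖(t : ℂ)‖ ^ (p - n) := by ring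
        _ ≤ _ := mul_le_of_le_one_right (by positivity) h5
    · simp only [b, if_neg hn, branchWeight, Nat.sub_eq_zero_of_le (not_lt.1 hn),
        mapCoeff_eq_catalan, add_zero, pow_zero, mul_one, mul_pow]
      apply le_of_eq
      ring
  rw [h1]
  refine h3.trans ?_
  rw [← hbs.sum_add_tsum_nat_add p]
  refine add_le_add ?_ (le_of_eq (tsum_congr hb1))
  rw [sum_congr rfl fun n hn => if_pos (mem_range.1 hn), ← sum_mul]
  refine mul_le_mul_of_nonneg_right ?_ (by positivity)
  have h6 : ∑ n ∈ range p, mapCoeff n (p - n) ≤ seriesCoeff (1 : ℕ) p := by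
    rw [seriesCoeff, Nat.sum_antidiagonal_eq_sum_range_succ_mk, sum_range_succ]
    simp
  exact_mod_cast h6.trans (seriesCoeff_one_le p)

end Kernel

end NVector

namespace NVector

/-! ### Laplace transforms -/

section Laplace

lemma integral_pow_mul_exp_neg_mul_Ioi (k : ℕ) {c : ℝ} (hc : 0 < c) :
    ∫ t in Set.Ioi (0 : ℝ), t ^ k * Real.exp (-(c * t)) = k.factorial / c ^ (k + 1) := by
  have h := Real.integral_rpow_mul_exp_neg_mul_Ioi (a := k + 1) (r := c) (by positivity) hc
  rw [Real.Gamma_nat_eq_factorial, add_sub_cancel_right] at h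
  simp_rw [Real.rpow_natCast] at h
  rw [h, show (k : ℝ) + 1 = ((k + 1 : ℕ) : ℝ) by push_cast; rfl, Real.rpow_natCast, one_div, inv_pow]
  field_simp

lemma integrableOn_pow_mul_exp_neg_mul (k : ℕ) {c : ℝ} (hc : 0 < c) :
    IntegrableOn (fun t : ℝ => t ^ k * Real.exp (-(c * t))) (Set.Ioi 0) := by
  refine Integrable.of_integral_ne_zero ?_
  rw [integral_pow_mul_exp_neg_mul_Ioi k hc]
  positivity

lemma integrableOn_pow_mul_cexp_neg_mul (k : ℕ) {c : ℂ} (hc : 0 < c.re) :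
    IntegrableOn (fun t : ℝ => (t : ℂ) ^ k * Complex.exp (-(c * t))) (Set.Ioi 0) := by
  refine Integrable.mono (integrableOn_pow_mul_exp_neg_mul k hc)
    (Continuous.aestronglyMeasurable (by fun_prop)) (ae_of_all _ fun t => ?_)
  simp [Complex.norm_exp]

lemma integral_pow_mul_cexp_neg_mul_Ioi (k : ℕ) {c : ℂ} (hc : 0 < c.re) :
    ∫ t in Set.Ioi (0 : ℝ), (t : ℂ) ^ k * Complex.exp (-(c * t)) = k.factorial / c ^ (k + 1) := by
  have hc0 : c ≠ 0 := by rintro rfl; simp at hc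
  have hlim : ∀ k : ℕ, Tendsto (fun t : ℝ => (t : ℂ) ^ k * Complex.exp (-(c * t))) atTop (𝓝 0) := by
    intro k
    rw [tendsto_zero_iff_norm_tendsto_zero]
    have h1 := (Real.tendsto_pow_mul_exp_neg_atTop_nhds_zero k).comp
      (tendsto_id.const_mul_atTop hc)
    have h2 := h1.const_mul ((c.re ^ k)⁻¹)
    rw [mul_zero] at h2
    refine h2.congr' ?_
    filter_upwards [eventually_ge_atTop 0] with t ht
    have : c.re ^ k ≠ 0 := by positivity
    simp only [Function.comp, id, norm_mul, norm_pow, Complex.norm_real, Real.norm_of_nonneg ht,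
      Complex.norm_exp, Complex.neg_re, Complex.re_mul_ofReal, mul_pow]
    field_simp
  have hd : ∀ k : ℕ, ∀ t : ℝ, HasDerivAt (fun t : ℝ => (t : ℂ) ^ k * Complex.exp (-(c * t)))
      (k * ((t : ℂ) ^ (k - 1) * Complex.exp (-(c * t))) - c * ((t : ℂ) ^ k * Complex.exp (-(c * t)))) t := by
    intro k t
    have h0 : HasDerivAt (fun t : ℝ => (t : ℂ)) 1 t := Complex.ofRealCLM.hasDerivAt
    refine ((h0.fun_pow k).mul (h0.const_mul c).fun_neg.cexp).congr_deriv ?_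
    ring
  have hi : ∀ k : ℕ, (∫ t in Set.Ioi (0 : ℝ), (k * ((t : ℂ) ^ (k - 1) * Complex.exp (-(c * t))) -
      c * ((t : ℂ) ^ k * Complex.exp (-(c * t))))) = 0 - (0 : ℂ) ^ k := fun k => by
    have := integral_Ioi_of_hasDerivAt_of_tendsto' (a := 0) (fun t _ => hd k t)
      (((integrableOn_pow_mul_cexp_neg_mul (k - 1) hc).const_mul (k : ℂ)).sub
        ((integrableOn_pow_mul_cexp_neg_mul k hc).const_mul c)) (hlim k)
    simpa using this
  have hi' : ∀ k : ℕ, k * (∫ t in Set.Ioi (0 : ℝ), (t : ℂ) ^ (k - 1) * Complex.exp (-(c * t))) -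
      c * ∫ t in Set.Ioi (0 : ℝ), (t : ℂ) ^ k * Complex.exp (-(c * t)) = 0 - (0 : ℂ) ^ k := fun k => by
    rw [← hi k, integral_sub ((integrableOn_pow_mul_cexp_neg_mul (k - 1) hc).const_mul (k : ℂ))
        ((integrableOn_pow_mul_cexp_neg_mul k hc).const_mul c), integral_const_mul, integral_const_mul]
  induction k with
  | zero =>
    have := hi' 0
    simp only [Nat.cast_zero, zero_mul, pow_zero, one_mul, zero_sub, neg_inj] at this
    simp only [pow_zero, one_mul, Nat.factorial_zero, Nat.cast_one, zero_add, pow_one]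
    rw [eq_div_iff hc0, mul_comm]
    exact this
  | succ k ih =>
    have := hi' (k + 1)
    rw [Nat.add_sub_cancel, ih] at this
    simp only [ne_eq, Nat.add_eq_zero_iff, one_ne_zero, and_false, not_false_eq_true, zero_pow,
      sub_zero] at this
    rw [← mul_right_inj' hc0, ← sub_eq_zero.1 this, Nat.factorial_succ, pow_succ c (k + 1)]
    push_cast
    field_simp

variable {c : ℕ → ℝ}

lemma factorialBound_of_le_four_pow (h0 : ∀ n, 0 ≤ c n) (h4 : ∀ n, c n ≤ 4 ^ n) :
    FactorialBound (fun n => (c n : ℂ)) := ⟨4, by norm_num, fun q => by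
  rw [Complex.norm_real, Real.norm_of_nonneg (h0 q)]
  exact (h4 q).trans (le_mul_of_one_le_right (by positivity) (by exact_mod_cast q.factorial_pos))⟩

lemma hasSum_even_majorant (h0 : ∀ n, 0 ≤ c n) (h4 : ∀ n, c n ≤ 4 ^ n) (y : ℝ) :
    HasSum (fun n => c n * (y ^ n / (2 * n).factorial)) (evenSeries (fun n => (c n : ℂ)) y).re := by
  have h := Complex.hasSum_re ((factorialBound_of_le_four_pow h0 h4).hasSum y)
  refine h.congr_fun fun n => ?_
  rw [← Complex.ofReal_re (c n * (y ^ n / (2 * n).factorial))]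
  push_cast
  rfl

lemma continuous_even_majorant (h0 : ∀ n, 0 ≤ c n) (h4 : ∀ n, c n ≤ 4 ^ n) :
    Continuous fun y : ℝ => ∑' n, c n * (y ^ n / (2 * n).factorial) := by
  simp_rw [fun y => (hasSum_even_majorant h0 h4 y).tsum_eq]
  have := (factorialBound_of_le_four_pow h0 h4).differentiable.continuous
  fun_prop

/-- Termwise comparison with the series of `cosh (2√a t)`. -/
lemma even_majorant_le_exp (h0 : ∀ n, 0 ≤ c n) (h4 : ∀ n, c n ≤ 4 ^ n) {a t : ℝ} (ha : 0 ≤ a)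
    (ht : 0 ≤ t) : ∑' n, c n * ((a * t ^ 2) ^ n / (2 * n).factorial) ≤
      Real.exp (2 * Real.sqrt a * t) := by
  have h1 : Real.cosh (2 * Real.sqrt a * t) ≤ Real.exp (2 * Real.sqrt a * t) := by
    rw [Real.cosh_eq]
    have := Real.exp_le_exp.2 (show -(2 * Real.sqrt a * t) ≤ 2 * Real.sqrt a * t by
      have : 0 ≤ 2 * Real.sqrt a * t := by positivity
      linarith)
    linarith
  refine le_trans ?_ h1
  refine hasSum_le (fun n => ?_) (hasSum_even_majorant h0 h4 _).summable.hasSum (Real.hasSum_cosh _)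
  have h2 : (2 * Real.sqrt a * t) ^ (2 * n) = 4 ^ n * (a * t ^ 2) ^ n := by
    rw [pow_mul, mul_pow, mul_pow 2, Real.sq_sqrt ha, ← mul_pow]
    ring
  rw [h2, mul_div_assoc]
  exact mul_le_mul_of_nonneg_right (h4 n) (by positivity)

lemma sqrt_lt_of_four_mul_lt_sq {a b : ℝ} (hb : 0 < b) (h : 4 * a < b ^ 2) : 2 * Real.sqrt a < b := by
  have h1 : Real.sqrt (4 * a) < b := (Real.sqrt_lt' hb).2 h
  rwa [Real.sqrt_mul (by norm_num), show Real.sqrt 4 = 2 by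
    rw [show (4 : ℝ) = 2 ^ 2 by norm_num]; exact Real.sqrt_sq (by norm_num)] at h1

lemma integrableOn_exp_neg_mul {b : ℝ} (hb : 0 < b) :
    IntegrableOn (fun t : ℝ => Real.exp (-(b * t))) (Set.Ioi 0) := by
  simpa using integrableOn_pow_mul_exp_neg_mul 0 hb

lemma integrableOn_even_majorant (h0 : ∀ n, 0 ≤ c n) (h4 : ∀ n, c n ≤ 4 ^ n) {a b : ℝ} (ha : 0 ≤ a)
    (hb : 0 < b) (hab : 4 * a < b ^ 2) :
    IntegrableOn (fun t : ℝ => Real.exp (-(b * t)) *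
      ∑' n, c n * ((a * t ^ 2) ^ n / (2 * n).factorial)) (Set.Ioi 0) := by
  have h := continuous_even_majorant h0 h4
  have hm : Continuous fun t : ℝ => Real.exp (-(b * t)) *
      ∑' n, c n * ((a * t ^ 2) ^ n / (2 * n).factorial) :=
    (by fun_prop : Continuous fun t : ℝ => Real.exp (-(b * t))).mul
      (h.comp (by fun_prop : Continuous fun t : ℝ => a * t ^ 2))
  have h2 := integrableOn_exp_neg_mul (b := b - 2 * Real.sqrt a)
    (by linarith [sqrt_lt_of_four_mul_lt_sq hb hab])
  refine Integrable.mono' h2 hm.aestronglyMeasurable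
    ((ae_restrict_iff' measurableSet_Ioi).2 (ae_of_all _ fun t ht => ?_))
  rw [Set.mem_Ioi] at ht
  rw [Real.norm_of_nonneg (mul_nonneg (Real.exp_pos _).le (tsum_nonneg fun n => mul_nonneg (h0 n)
    (by positivity)))]
  calc _ ≤ Real.exp (-(b * t)) * Real.exp (2 * Real.sqrt a * t) := by
        gcongr
        exact even_majorant_le_exp h0 h4 ha ht.le
    _ = _ := by rw [← Real.exp_add]; ring_nf

lemma integral_exp_mul_even_term (n : ℕ) (x a : ℝ) {b : ℝ} (hb : 0 < b) :
    ∫ t in Set.Ioi (0 : ℝ), Real.exp (-(b * t)) * (x * ((a * t ^ 2) ^ n / (2 * n).factorial)) =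
      x * a ^ n / b ^ (2 * n + 1) := by
  have h2 := integral_pow_mul_exp_neg_mul_Ioi (2 * n) hb
  have h3 : ∀ t : ℝ, Real.exp (-(b * t)) * (x * ((a * t ^ 2) ^ n / (2 * n).factorial)) =
    (x * a ^ n / (2 * n).factorial) * (t ^ (2 * n) * Real.exp (-(b * t))) := fun t => by
      rw [mul_pow, ← pow_mul]; ring
  simp_rw [h3]
  rw [integral_const_mul, h2]
  have : ((2 * n).factorial : ℝ) ≠ 0 := by positivity
  field_simp

/-- Termwise integration, justified by the geometric ratio `4a/b² < 1`. -/
lemma hasSum_laplace_even_majorant (h0 : ∀ n, 0 ≤ c n) (h4 : ∀ n, c n ≤ 4 ^ n) {a b : ℝ} (ha : 0 ≤ a)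
    (hb : 0 < b) (hab : 4 * a < b ^ 2) :
    HasSum (fun n => c n * a ^ n / b ^ (2 * n + 1)) (∫ t in Set.Ioi (0 : ℝ), Real.exp (-(b * t)) *
      ∑' n, c n * ((a * t ^ 2) ^ n / (2 * n).factorial)) := by
  have h1 := fun n => integral_exp_mul_even_term n (c n) a hb
  have hI : ∀ n, IntegrableOn (fun t : ℝ => Real.exp (-(b * t)) *
      (c n * ((a * t ^ 2) ^ n / (2 * n).factorial))) (Set.Ioi 0) := fun n => by
    refine ((integrableOn_pow_mul_exp_neg_mul (2 * n) hb).const_mul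
      (c n * a ^ n / (2 * n).factorial)).congr (ae_of_all _ fun t => ?_)
    simp only
    rw [mul_pow, ← pow_mul]; ring
  have hs : Summable fun n => c n * a ^ n / b ^ (2 * n + 1) := by
    have hq : 4 * a / b ^ 2 < 1 := (div_lt_one (by positivity)).2 hab
    refine Summable.of_nonneg_of_le (fun n => div_nonneg (mul_nonneg (h0 n) (by positivity))
      (by positivity)) (fun n => ?_)
      ((summable_geometric_of_lt_one (by positivity) hq).mul_right b⁻¹)
    calc c n * a ^ n / b ^ (2 * n + 1) ≤ 4 ^ n * a ^ n / b ^ (2 * n + 1) := by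
          gcongr
          exact h4 n
      _ = _ := by rw [div_pow, mul_pow, ← pow_mul, pow_succ]; field_simp
  have h := hasSum_integral_of_summable_integral_norm hI (by
    refine hs.congr fun n => ?_
    rw [← h1 n]
    refine integral_congr_ae (ae_of_all _ fun t => ?_)
    exact (Real.norm_of_nonneg (mul_nonneg (Real.exp_pos _).le
      (mul_nonneg (h0 n) (by positivity)))).symm)
  simp_rw [h1, tsum_mul_left] at h
  exact h

end Laplace

/-! ### Integrals over rays -/

section Ray

variable {t : ℝ} {z : ℂ} {ψ : ℝ}

/-- The integrand `e^{iψ} exp(-e^{iψ} s) E(z e^{2iψ} s²)`. -/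
noncomputable def rayIntegrand (t ψ : ℝ) (z : ℂ) (s : ℝ) : ℂ :=
  Complex.exp (ψ * Complex.I) * (Complex.exp (-(Complex.exp (ψ * Complex.I) * s)) *
    seriesKernel t (z * (Complex.exp (ψ * Complex.I)) ^ 2 * (s ^ 2 : ℝ)))

/-- The Laplace transform of the series kernel along the ray of direction `e^{iψ}`. -/
noncomputable def rayIntegral (t ψ : ℝ) (z : ℂ) : ℂ := ∫ s in Set.Ioi (0 : ℝ), rayIntegrand t ψ z s

lemma norm_exp_ray (ψ s : ℝ) : ‖Complex.exp (-(Complex.exp (ψ * Complex.I) * s))‖ =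
    Real.exp (-(Real.cos ψ * s)) := by
  rw [Complex.norm_exp, Complex.neg_re, Complex.re_mul_ofReal, Complex.exp_ofReal_mul_I_re]

lemma norm_rayIntegrand_le (ht : t ∈ Set.Icc (0 : ℝ) 1)
    (hz : (z * (Complex.exp (ψ * Complex.I)) ^ 2 * t).re ≤ 0) (s : ℝ) :
    ‖rayIntegrand t ψ z s‖ ≤ Real.exp (-(Real.cos ψ * s)) * catalanMajorant (‖z‖ * s ^ 2) := by
  rw [rayIntegrand, norm_mul, Complex.norm_exp_ofReal_mul_I, one_mul, norm_mul, norm_exp_ray]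
  gcongr
  have := norm_seriesKernel_le ht hz (sq_nonneg s)
  rwa [norm_mul, norm_pow, Complex.norm_exp_ofReal_mul_I, one_pow, mul_one] at this

lemma continuous_rayIntegrand (ht : t ∈ Set.Icc (0 : ℝ) 1) (ψ : ℝ) (z : ℂ) :
    Continuous (rayIntegrand t ψ z) := by
  have := (differentiable_seriesKernel ht).continuous
  unfold rayIntegrand
  fun_prop

lemma catalan_nonneg' (n : ℕ) : (0 : ℝ) ≤ catalan n := Nat.cast_nonneg _

lemma catalan_le_four_pow' (n : ℕ) : (catalan n : ℝ) ≤ 4 ^ n := by exact_mod_cast catalan_le_four_pow n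

lemma integrableOn_catalanMajorant {a b : ℝ} (ha : 0 ≤ a) (hb : 0 < b) (hab : 4 * a < b ^ 2) :
    IntegrableOn (fun s : ℝ => Real.exp (-(b * s)) * catalanMajorant (a * s ^ 2)) (Set.Ioi 0) :=
  integrableOn_even_majorant catalan_nonneg' catalan_le_four_pow' ha hb hab

lemma integrableOn_rayIntegrand (ht : t ∈ Set.Icc (0 : ℝ) 1)
    (hz : (z * (Complex.exp (ψ * Complex.I)) ^ 2 * t).re ≤ 0) (hψ : 0 < Real.cos ψ)
    (h : 4 * ‖z‖ < Real.cos ψ ^ 2) : IntegrableOn (rayIntegrand t ψ z) (Set.Ioi 0) :=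
  Integrable.mono' (integrableOn_catalanMajorant (norm_nonneg z) hψ h)
    (continuous_rayIntegrand ht ψ z).aestronglyMeasurable (ae_of_all _ (norm_rayIntegrand_le ht hz))

lemma norm_rayIntegral_le (ht : t ∈ Set.Icc (0 : ℝ) 1)
    (hz : (z * (Complex.exp (ψ * Complex.I)) ^ 2 * t).re ≤ 0) (hψ : 0 < Real.cos ψ)
    (h : 4 * ‖z‖ < Real.cos ψ ^ 2) :
    ‖rayIntegral t ψ z‖ ≤ ∑' n, (catalan n : ℝ) * ‖z‖ ^ n / Real.cos ψ ^ (2 * n + 1) := by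
  rw [(hasSum_laplace_even_majorant catalan_nonneg' catalan_le_four_pow' (norm_nonneg z) hψ h).tsum_eq]
  exact norm_integral_le_of_norm_le (integrableOn_catalanMajorant (norm_nonneg z) hψ h)
    (ae_of_all _ (norm_rayIntegrand_le ht hz))

end Ray

end NVector

/-! ### Holomorphy of the ray integrals and rotation of the contour -/

namespace NVector

/-- Holomorphic dependence of an integral on a parameter, from a locally uniform bound. -/
lemma differentiableAt_integral_of_bound {α : Type*} [MeasurableSpace α] {μ : Measure α} {u₀ : ℂ}
    {V : Set ℂ} (hV : V ∈ 𝓝 u₀) {f : ℂ → α → ℂ} {b : α → ℝ}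
    (hm : ∀ u ∈ V, AEStronglyMeasurable (f u) μ)
    (hd : ∀ᵐ a ∂μ, DifferentiableOn ℂ (fun u => f u a) V)
    (hb : Integrable b μ) (hfb : ∀ᵐ a ∂μ, ∀ u ∈ V, ‖f u a‖ ≤ b a) :
    DifferentiableAt ℂ (fun u => ∫ a, f u a ∂μ) u₀ := by
  obtain ⟨ε, hε, hεV⟩ := Metric.mem_nhds_iff.1 hV
  set r := ε / 2 with hr
  have hr0 : 0 < r := by positivity
  -- Circles of radius `r = ε/2` about points of the smaller ball stay in `V`, so Cauchy's estimate
  -- bounds the derivative there by `b a / r`.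
  have hsub : ∀ v ∈ Metric.ball u₀ r, Metric.closedBall v r ⊆ Metric.ball u₀ ε := fun v hv w hw => by
    rw [Metric.mem_ball] at hv ⊢
    rw [Metric.mem_closedBall] at hw
    calc dist w u₀ ≤ dist w v + dist v u₀ := dist_triangle _ _ _
      _ < r + r := by linarith
      _ = ε := by rw [hr]; ring
  have hball : Metric.ball u₀ r ⊆ V := (Metric.ball_subset_ball (by rw [hr]; linarith)).trans hεV
  have hmem : u₀ ∈ V := mem_of_mem_nhds hV
  have hda : ∀ᵐ a ∂μ, ∀ v ∈ Metric.ball u₀ r, HasDerivAt (fun u => f u a) (deriv (fun u => f u a) v) v := by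
    filter_upwards [hd] with a ha v hv
    exact (ha.differentiableAt (mem_of_superset (Metric.isOpen_ball.mem_nhds hv) hball)).hasDerivAt
  have hmeas : AEStronglyMeasurable (fun a => deriv (fun u => f u a) u₀) μ := by
    -- The derivative is measurable in `a` as an almost everywhere limit of difference quotients
    -- along the steps `e n → 0`, which stay below `r`.
    let e : ℕ → ℝ := fun n => r / 2 * (1 / ((n : ℝ) + 1))
    have he0 : ∀ n, 0 < e n := fun n => by positivity
    have her : ∀ n, e n < r := fun n => by
      have : 1 / ((n : ℝ) + 1) ≤ 1 := by
        rw [div_le_one (by positivity)]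
        linarith [n.cast_nonneg (α := ℝ)]
      simp only [e]
      nlinarith
    have hlim : Tendsto (fun n => (e n : ℂ)) atTop (𝓝 0) := by
      have h1 := (tendsto_one_div_add_atTop_nhds_zero_nat (𝕜 := ℝ)).const_mul (r / 2)
      rw [mul_zero] at h1
      have h2 := (Complex.continuous_ofReal.tendsto 0).comp h1
      rwa [Complex.ofReal_zero] at h2
    have hne : ∀ n, (e n : ℂ) ≠ 0 := fun n => by exact_mod_cast (he0 n).ne'
    have hin : ∀ n, u₀ + (e n : ℂ) ∈ Metric.ball u₀ r := fun n => by
      rw [Metric.mem_ball, dist_eq_norm, add_sub_cancel_left, Complex.norm_real,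
        Real.norm_of_nonneg (he0 n).le]
      exact her n
    refine aestronglyMeasurable_of_tendsto_ae atTop
      (f := fun n a => (e n : ℂ)⁻¹ • (f (u₀ + (e n : ℂ)) a - f u₀ a))
      (fun n => ((hm _ (hball (hin n))).fun_sub (hm _ hmem)).fun_const_smul _) ?_
    filter_upwards [hda] with a ha
    have h3 := (hasDerivAt_iff_tendsto_slope_zero.1 (ha u₀ (Metric.mem_ball_self hr0)))
    exact h3.comp (tendsto_nhdsWithin_iff.2 ⟨hlim, Eventually.of_forall hne⟩)
  refine (hasDerivAt_integral_of_dominated_loc_of_deriv_le (bound := fun a => b a / r)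
    (F' := fun v a => deriv (fun u => f u a) v) (Metric.ball_mem_nhds u₀ hr0)
    (eventually_of_mem hV hm) ?_ hmeas ?_ (hb.div_const r) hda).2.differentiableAt
  · exact hb.mono' (hm _ hmem) (hfb.mono fun a ha => ha _ hmem)
  · filter_upwards [hd, hfb] with a ha hba v hv
    refine Complex.norm_deriv_le_of_forall_mem_sphere_norm_le hr0 ?_ fun w hw =>
      hba w (hεV (hsub v hv (Metric.sphere_subset_closedBall hw)))
    refine DifferentiableOn.diffContOnCl (ha.mono ?_)
    rw [closure_ball v hr0.ne']
    exact (hsub v hv).trans hεV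

lemma catalanMajorant_mono {a b : ℝ} (ha : 0 ≤ a) (h : a ≤ b) : catalanMajorant a ≤ catalanMajorant b := by
  refine (summable_catalanMajorant a).tsum_le_tsum (fun n => ?_) (summable_catalanMajorant b)
  gcongr

/-- Analyticity of the ray integral in `z`. -/
lemma differentiableAt_rayIntegral {t ψ : ℝ} (ht : t ∈ Set.Icc (0 : ℝ) 1) (hψ : 0 < Real.cos ψ) {z : ℂ}
    (hz : (z * (Complex.exp (ψ * Complex.I)) ^ 2).re < 0) (h : 4 * ‖z‖ < Real.cos ψ ^ 2) :
    DifferentiableAt ℂ (rayIntegral t ψ) z := by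
  -- Room is left between `‖z‖` and `cos² ψ / 4`, so that the majorant at radius `ρ` is integrable
  -- and dominates a whole neighbourhood of `z`.
  obtain ⟨ρ, h1, h2⟩ := exists_between (show ‖z‖ < Real.cos ψ ^ 2 / 4 by linarith)
  have hρ : 0 ≤ ρ := (norm_nonneg z).trans h1.le
  have hV : {w : ℂ | (w * (Complex.exp (ψ * Complex.I)) ^ 2).re < 0 ∧ ‖w‖ < ρ} ∈ 𝓝 z := by
    refine IsOpen.mem_nhds ?_ ⟨hz, h1⟩
    exact (isOpen_lt (Complex.continuous_re.comp (continuous_mul_const _)) continuous_const).inter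
      (isOpen_lt continuous_norm continuous_const)
  refine differentiableAt_integral_of_bound hV (b := fun s => Real.exp (-(Real.cos ψ * s)) *
    catalanMajorant (ρ * s ^ 2)) (fun w _ => (continuous_rayIntegrand ht ψ w).aestronglyMeasurable)
    (ae_of_all _ fun s => ?_) (integrableOn_catalanMajorant hρ hψ (by linarith))
    (ae_of_all _ fun s w hw => ?_)
  · have := differentiable_seriesKernel ht
    unfold rayIntegrand
    refine Differentiable.differentiableOn ?_
    fun_prop
  · refine (norm_rayIntegrand_le ht ?_ s).trans ?_
    · rw [Complex.re_mul_ofReal]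
      exact mul_nonpos_of_nonpos_of_nonneg hw.1.le ht.1
    · gcongr
      exact catalanMajorant_mono (by positivity) (by have := hw.2.le; gcongr)

/-- The ray integral does not depend on the direction of the ray. -/
lemma rayIntegral_eq_of_forall {t : ℝ} (ht : t ∈ Set.Icc (0 : ℝ) 1) {z : ℂ} {ψ₁ ψ₂ : ℝ} (h12 : ψ₁ ≤ ψ₂)
    {c : ℝ} (hc : 0 < c) (hzc : 4 * ‖z‖ < c ^ 2)
    (h : ∀ ψ ∈ Set.Icc ψ₁ ψ₂, c ≤ Real.cos ψ ∧ (z * (Complex.exp (ψ * Complex.I)) ^ 2 * t).re ≤ 0) :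
    rayIntegral t ψ₁ z = rayIntegral t ψ₂ z := by
  -- All rays integrate the same entire function `g`, restricted to different half-lines.
  set g : ℂ → ℂ := fun s => Complex.exp (-s) * seriesKernel t (z * s ^ 2) with hg
  have hgd : Differentiable ℂ g := by
    have := differentiable_seriesKernel ht
    fun_prop
  have hprim : ∀ R : ℝ, 0 < R → ∃ H : ℂ → ℂ, ∀ s ∈ Metric.ball (0 : ℂ) R, HasDerivAt H (g s) s := by
    intro R hR
    obtain ⟨H, hH⟩ := (hgd.differentiableOn (s := Metric.ball 0 R)).isExactOn_ball
    exact ⟨H, hH⟩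
  have hray : ∀ ψ s : ℝ, rayIntegrand t ψ z s =
      Complex.exp (ψ * Complex.I) * g (Complex.exp (ψ * Complex.I) * s) := by
    intro ψ s
    rw [rayIntegrand, hg]
    simp only
    congr 3
    push_cast
    ring
  have hcos : ∀ ψ ∈ Set.Icc ψ₁ ψ₂, 4 * ‖z‖ < Real.cos ψ ^ 2 := fun ψ hψ =>
    hzc.trans_le (pow_le_pow_left₀ hc.le (h ψ hψ).1 2)
  have hlim : ∀ ψ ∈ Set.Icc ψ₁ ψ₂, Tendsto (fun R : ℝ => ∫ s in (0 : ℝ)..R, rayIntegrand t ψ z s) atTop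
      (𝓝 (rayIntegral t ψ z)) := fun ψ hψ =>
    intervalIntegral_tendsto_integral_Ioi 0 (integrableOn_rayIntegrand ht (h ψ hψ).2
      (hc.trans_le (h ψ hψ).1) (hcos ψ hψ)) tendsto_id
  -- Net decay rate of the integrand on every ray of the sector: at least `c` from the exponential,
  -- minus the growth rate `2√‖z‖` of the kernel.
  set δ := c - 2 * Real.sqrt ‖z‖ with hδ
  have hδ0 : 0 < δ := by linarith [sqrt_lt_of_four_mul_lt_sq hc hzc]
  have hbound : ∀ R : ℝ, 0 < R → ‖(∫ s in (0 : ℝ)..R, rayIntegrand t ψ₂ z s) -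
      ∫ s in (0 : ℝ)..R, rayIntegrand t ψ₁ z s‖ ≤ R * Real.exp (-(δ * R)) * (ψ₂ - ψ₁) := by
    intro R hR
    obtain ⟨H, hH⟩ := hprim (R + 1) (by linarith)
    have hnorm : ∀ ψ s : ℝ, s ∈ Set.Icc 0 R →
        Complex.exp (ψ * Complex.I) * s ∈ Metric.ball (0 : ℂ) (R + 1) := fun ψ s hs => by
      rw [mem_ball_zero_iff, norm_mul, Complex.norm_exp_ofReal_mul_I, one_mul, Complex.norm_real,
        Real.norm_of_nonneg hs.1]
      linarith [hs.2]
    have hI : ∀ ψ, ∫ s in (0 : ℝ)..R, rayIntegrand t ψ z s =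
        H (Complex.exp (ψ * Complex.I) * R) - H 0 := by
      intro ψ
      have hd : ∀ s ∈ Set.uIcc 0 R, HasDerivAt (fun s : ℝ => H (Complex.exp (ψ * Complex.I) * s))
          (rayIntegrand t ψ z s) s := by
        intro s hs
        rw [Set.uIcc_of_le hR.le] at hs
        have h0 : HasDerivAt (fun s : ℝ => (s : ℂ)) 1 s := Complex.ofRealCLM.hasDerivAt
        refine ((hH _ (hnorm ψ s hs)).comp s (h0.const_mul (Complex.exp (ψ * Complex.I)))).congr_deriv ?_
        rw [hray]
        ring
      rw [intervalIntegral.integral_eq_sub_of_hasDerivAt hd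
        ((continuous_rayIntegrand ht ψ z).intervalIntegrable _ _)]
      simp
    rw [hI, hI, sub_sub_sub_cancel_right]
    -- The partial integrals along two rays differ by the increment of a primitive along an arc of
    -- radius `R`; the mean value inequality bounds it by the arc length times `e^{-δR}`.
    have harc := (convex_Icc ψ₁ ψ₂).norm_image_sub_le_of_norm_hasDerivWithin_le
      (f := fun ψ : ℝ => H (Complex.exp (ψ * Complex.I) * R))
      (f' := fun ψ : ℝ => g (Complex.exp (ψ * Complex.I) * R) * (Complex.exp (ψ * Complex.I) * Complex.I * R))
      (C := R * Real.exp (-(δ * R))) (x := ψ₁) (y := ψ₂) (fun ψ hψ => ?_) (fun ψ hψ => ?_)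
      (Set.left_mem_Icc.2 h12) (Set.right_mem_Icc.2 h12)
    · rwa [Real.norm_of_nonneg (sub_nonneg.2 h12)] at harc
    · have h0 : HasDerivAt (fun s : ℝ => (s : ℂ)) 1 ψ := Complex.ofRealCLM.hasDerivAt
      refine (((hH _ (hnorm ψ R ⟨hR.le, le_rfl⟩)).comp ψ
        (((h0.mul_const Complex.I).cexp).mul_const (R : ℂ))).congr_deriv ?_).hasDerivWithinAt
      ring
    · have h1 := norm_rayIntegrand_le ht (h ψ hψ).2 R
      rw [hray, norm_mul, Complex.norm_exp_ofReal_mul_I, one_mul] at h1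
      rw [norm_mul (g _), norm_mul (_ * Complex.I), norm_mul _ Complex.I, Complex.norm_exp_ofReal_mul_I,
        Complex.norm_I, one_mul, one_mul, Complex.norm_real, Real.norm_of_nonneg hR.le, mul_comm]
      refine mul_le_mul_of_nonneg_left (h1.trans ?_) hR.le
      calc _ ≤ Real.exp (-(c * R)) * Real.exp (2 * Real.sqrt ‖z‖ * R) := by
            gcongr
            · exact tsum_nonneg fun n => by positivity
            · exact (h ψ hψ).1
            · exact even_majorant_le_exp catalan_nonneg' catalan_le_four_pow' (norm_nonneg z) hR.le
        _ = _ := by rw [← Real.exp_add, hδ]; ring_nf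
  have h0 : Tendsto (fun R : ℝ => R * Real.exp (-(δ * R)) * (ψ₂ - ψ₁)) atTop (𝓝 0) := by
    have h1 := (Real.tendsto_pow_mul_exp_neg_atTop_nhds_zero 1).comp (tendsto_id.const_mul_atTop hδ0)
    have h2 := h1.mul_const (δ⁻¹ * (ψ₂ - ψ₁))
    rw [zero_mul] at h2
    refine h2.congr fun R => ?_
    simp only [Function.comp, id, pow_one]
    field_simp
  have h3 := (hlim ψ₂ (Set.right_mem_Icc.2 h12)).sub (hlim ψ₁ (Set.left_mem_Icc.2 h12))
  have h4 : Tendsto (fun R : ℝ => (∫ s in (0 : ℝ)..R, rayIntegrand t ψ₂ z s) -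
      ∫ s in (0 : ℝ)..R, rayIntegrand t ψ₁ z s) atTop (𝓝 0) := by
    refine squeeze_zero_norm' ?_ h0
    filter_upwards [eventually_gt_atTop 0] with R hR using hbound R hR
  exact (sub_eq_zero.1 (tendsto_nhds_unique h3 h4)).symm

end NVector

namespace NVector

/-! ### The analytic continuation to the extended cardioid -/

/-- The directions of the rays on which `β`-integrals at the point `u` can be taken. -/
def ValidAngle (u : ℂ) (ψ : ℝ) : Prop :=
  |ψ| < Real.pi / 2 ∧ |u.im + 2 * ψ| ≤ Real.pi / 2 ∧ 4 * ‖zOf u‖ < Real.cos ψ ^ 2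

lemma norm_zOf (u : ℂ) : ‖zOf u‖ = Real.exp u.re := by rw [zOf, norm_neg, Complex.norm_exp]

lemma zOf_ne_zero (u : ℂ) : zOf u ≠ 0 := neg_ne_zero.2 (Complex.exp_ne_zero u)

lemma zOf_mul_exp_sq (u : ℂ) (ψ : ℝ) :
    zOf u * Complex.exp (ψ * Complex.I) ^ 2 =
      -(Real.exp u.re * Complex.exp ((u.im + 2 * ψ : ℝ) * Complex.I)) := by
  rw [zOf, ← Complex.exp_nat_mul, neg_mul, ← Complex.exp_add, Complex.ofReal_exp, ← Complex.exp_add]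
  congr 2
  nth_rewrite 1 [← Complex.re_add_im u]
  push_cast
  ring

lemma zOf_mul_exp_sq_re (u : ℂ) (ψ : ℝ) :
    (zOf u * Complex.exp (ψ * Complex.I) ^ 2).re = -(Real.exp u.re * Real.cos (u.im + 2 * ψ)) := by
  rw [zOf_mul_exp_sq, Complex.neg_re, Complex.re_ofReal_mul, Complex.exp_ofReal_mul_I_re]

lemma ValidAngle.cos_pos {u : ℂ} {ψ : ℝ} (h : ValidAngle u ψ) : 0 < Real.cos ψ :=
  Real.cos_pos_of_mem_Ioo (abs_lt.1 h.1)

lemma re_nonpos_of_abs_le {u : ℂ} {ψ : ℝ} (h : |u.im + 2 * ψ| ≤ Real.pi / 2) {t : ℝ} (ht : 0 ≤ t) :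
    (zOf u * Complex.exp (ψ * Complex.I) ^ 2 * t).re ≤ 0 := by
  rw [Complex.re_mul_ofReal, zOf_mul_exp_sq_re]
  have := Real.cos_nonneg_of_mem_Icc (abs_le.1 h)
  have h2 : 0 ≤ Real.exp u.re * Real.cos (u.im + 2 * ψ) := by positivity
  nlinarith

/-- The admissible directions form an interval: the condition on `u.im + 2ψ` is convex, and `cos`,
being concave on `[-π/2, π/2]`, is smallest at an endpoint of `[ψ₁, ψ₂]`. -/
lemma rayIntegral_eq_of_validAngle_of_le {t : ℝ} (ht : t ∈ Set.Icc (0 : ℝ) 1) {u : ℂ} {ψ₁ ψ₂ : ℝ}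
    (h₁ : ValidAngle u ψ₁) (h₂ : ValidAngle u ψ₂) (h12 : ψ₁ ≤ ψ₂) :
    rayIntegral t ψ₁ (zOf u) = rayIntegral t ψ₂ (zOf u) := by
  refine rayIntegral_eq_of_forall ht h12 (c := min (Real.cos ψ₁) (Real.cos ψ₂))
    (lt_min h₁.cos_pos h₂.cos_pos) ?_ fun ψ hψ => ⟨?_, ?_⟩
  · rcases min_choice (Real.cos ψ₁) (Real.cos ψ₂) with h | h <;> rw [h]
    exacts [h₁.2.2, h₂.2.2]
  · have a1 := abs_lt.1 h₁.1
    have a2 := abs_lt.1 h₂.1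
    exact strictConcaveOn_cos_Icc.concaveOn.min_le_of_mem_Icc ⟨a1.1.le, a1.2.le⟩ ⟨a2.1.le, a2.2.le⟩ hψ
  · refine re_nonpos_of_abs_le (abs_le.2 ?_) ht.1
    have a1 := abs_le.1 h₁.2.1
    have a2 := abs_le.1 h₂.2.1
    constructor <;> linarith [hψ.1, hψ.2]

lemma rayIntegral_eq_of_validAngle {t : ℝ} (ht : t ∈ Set.Icc (0 : ℝ) 1) {u : ℂ} {ψ₁ ψ₂ : ℝ}
    (h₁ : ValidAngle u ψ₁) (h₂ : ValidAngle u ψ₂) :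
    rayIntegral t ψ₁ (zOf u) = rayIntegral t ψ₂ (zOf u) := by
  rcases le_total ψ₁ ψ₂ with h | h
  · exact rayIntegral_eq_of_validAngle_of_le ht h₁ h₂ h
  · exact (rayIntegral_eq_of_validAngle_of_le ht h₂ h₁ h).symm

open Classical in
/-- The analytic continuation of the two-point function. -/
noncomputable def continuation (N : ℕ) (u : ℂ) : ℂ :=
  if h : ∃ ψ, ValidAngle u ψ then rayIntegral (N : ℝ)⁻¹ h.choose (zOf u) else 0

lemma inv_natCast_mem_Icc (N : ℕ) : (N : ℝ)⁻¹ ∈ Set.Icc (0 : ℝ) 1 := by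
  refine ⟨by positivity, ?_⟩
  rcases Nat.eq_zero_or_pos N with rfl | h
  · simp
  · exact inv_le_one_of_one_le₀ (by exact_mod_cast h)

lemma continuation_eq (N : ℕ) {u : ℂ} {ψ : ℝ} (h : ValidAngle u ψ) :
    continuation N u = rayIntegral (N : ℝ)⁻¹ ψ (zOf u) := by
  have h' : ∃ ψ, ValidAngle u ψ := ⟨ψ, h⟩
  rw [continuation, dif_pos h']
  exact rayIntegral_eq_of_validAngle (inv_natCast_mem_Icc N) h'.choose_spec h

lemma exists_angle_of_mem_plus {u : ℂ} (hu : u ∈ extendedCardioidPlus) :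
    ∃ ψ : ℝ, |ψ| < Real.pi / 2 ∧ |u.im + 2 * ψ| < Real.pi / 2 ∧ 4 * ‖zOf u‖ < Real.cos ψ ^ 2 := by
  have hpi := Real.pi_pos
  rcases hu with ⟨h1, h2, h3⟩ | ⟨h1, h2, h3⟩
  · refine ⟨0, by simpa using by positivity, ?_, by simpa using h3⟩
    rw [mul_zero, add_zero, abs_of_nonneg h1]
    exact h2
  -- `ψ₀` is the direction with `u.im + 2ψ₀ = π/2`, the limit of what is allowed. The cosine
  -- condition is open, so a slightly smaller `ψ` makes all inequalities strict; this is what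
  -- analyticity near `u` requires.
  · set ψ₀ := -(u.im / 2 - Real.pi / 4) with hψ₀
    have h4 : ∀ᶠ ψ in 𝓝 ψ₀, 4 * ‖zOf u‖ < Real.cos ψ ^ 2 := by
      refine (by fun_prop : ContinuousAt (fun ψ => Real.cos ψ ^ 2) ψ₀).eventually (lt_mem_nhds ?_)
      simp only
      rw [hψ₀, Real.cos_neg]
      exact h3
    have h5 : ∀ᶠ ψ in 𝓝 ψ₀, -(Real.pi / 2) < ψ := lt_mem_nhds (by rw [hψ₀]; linarith)
    have h6 : ∀ᶠ ψ in 𝓝 ψ₀, ψ₀ - Real.pi / 2 < ψ := lt_mem_nhds (by linarith)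
    obtain ⟨ψ, ⟨⟨h7, h8⟩, h9⟩, h10⟩ := ((((h4.and h5).and h6).filter_mono nhdsWithin_le_nhds).and
      (self_mem_nhdsWithin (a := ψ₀) (s := Set.Iio ψ₀))).exists
    replace h10 : ψ < ψ₀ := h10
    refine ⟨ψ, abs_lt.2 ⟨h8, by linarith⟩, abs_lt.2 ⟨by linarith, by linarith⟩, h7⟩

lemma exists_angle_of_mem {u : ℂ} (hu : u ∈ extendedCardioid) :
    ∃ ψ : ℝ, |ψ| < Real.pi / 2 ∧ |u.im + 2 * ψ| < Real.pi / 2 ∧ 4 * ‖zOf u‖ < Real.cos ψ ^ 2 := by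
  rcases hu with hu | hu
  · exact exists_angle_of_mem_plus hu
  · obtain ⟨ψ, h1, h2, h3⟩ := exists_angle_of_mem_plus hu
    refine ⟨-ψ, by rwa [abs_neg], ?_, ?_⟩
    · rw [Complex.conj_im] at h2
      rw [← abs_neg]
      convert h2 using 2
      ring
    · rw [norm_zOf] at h3 ⊢
      rw [Real.cos_neg]
      simpa using h3

lemma exists_validAngle_of_mem {u : ℂ} (hu : u ∈ extendedCardioid) : ∃ ψ, ValidAngle u ψ := by
  obtain ⟨ψ, h1, h2, h3⟩ := exists_angle_of_mem hu
  exact ⟨ψ, h1, h2.le, h3⟩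

lemma differentiable_zOf : Differentiable ℂ zOf := by unfold zOf; fun_prop

/-- A direction satisfying the strict inequalities at `u` remains valid near `u`, so the
continuation is locally a single ray integral in spite of the arbitrary choice in its definition. -/
lemma analyticOnNhd_continuation (N : ℕ) : AnalyticOnNhd ℂ (continuation N) extendedCardioid := by
  intro u hu
  obtain ⟨ψ, h1, h2, h3⟩ := exists_angle_of_mem hu
  have hO : ∀ᶠ v in 𝓝 u, |v.im + 2 * ψ| < Real.pi / 2 ∧ 4 * ‖zOf v‖ < Real.cos ψ ^ 2 := by
    have hc := differentiable_zOf.continuous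
    have hi := Complex.continuous_im
    exact (ContinuousAt.eventually_lt (by fun_prop) (by fun_prop) h2).and
      (ContinuousAt.eventually_lt (by fun_prop) (by fun_prop) h3)
  have hcos : 0 < Real.cos ψ := Real.cos_pos_of_mem_Ioo (abs_lt.1 h1)
  rw [Complex.analyticAt_iff_eventually_differentiableAt]
  filter_upwards [hO.eventually_nhds] with v hv
  have h4 : DifferentiableAt ℂ (fun v => rayIntegral (N : ℝ)⁻¹ ψ (zOf v)) v := by
    have h5 := hv.self_of_nhds
    refine DifferentiableAt.comp (g := rayIntegral (N : ℝ)⁻¹ ψ) v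
      (differentiableAt_rayIntegral (inv_natCast_mem_Icc N) hcos ?_ h5.2) (differentiable_zOf v)
    rw [zOf_mul_exp_sq_re]
    have := Real.cos_pos_of_mem_Ioo (abs_lt.1 h5.1)
    have : 0 < Real.exp v.re * Real.cos (v.im + 2 * ψ) := by positivity
    linarith
  refine h4.congr_of_eventuallyEq ?_
  filter_upwards [hv] with w hw
  exact continuation_eq N ⟨h1, hw.1.le, hw.2⟩

lemma norm_continuation_le (N : ℕ) {u : ℂ} {ψ : ℝ} (h : ValidAngle u ψ) :
    ‖continuation N u‖ ≤ ∑' n : ℕ, (catalan n : ℝ) * ‖zOf u‖ ^ n / Real.cos ψ ^ (2 * n + 1) := by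
  rw [continuation_eq N h]
  exact norm_rayIntegral_le (inv_natCast_mem_Icc N)
    (re_nonpos_of_abs_le h.2.1 (inv_natCast_mem_Icc N).1) h.cos_pos h.2.2

/-! ### The limit of large `N` -/

lemma tendsto_seriesKernel (y : ℂ) :
    Tendsto (fun N : ℕ => seriesKernel (N : ℝ)⁻¹ y) atTop (𝓝 (seriesKernel 0 y)) := by
  have h1 : FactorialBound (fun q => ((3 ^ q * q.factorial : ℝ) : ℂ)) := ⟨3, by norm_num, fun q => by
    rw [Complex.norm_real, Real.norm_of_nonneg (by positivity)]⟩
  refine tendsto_tsum_of_dominated_convergence (h1.summable_norm (norm_nonneg y)) (fun q => ?_)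
    (Eventually.of_forall fun N q => ?_)
  · refine Tendsto.mul_const _ ?_
    have hc : Continuous fun t : ℝ => seriesCoeff (t : ℂ) q := by unfold seriesCoeff; fun_prop
    exact (hc.tendsto 0).comp tendsto_inv_atTop_nhds_zero_nat
  · rw [norm_evenSeries_term (a := fun q => seriesCoeff (((N : ℝ)⁻¹ : ℝ) : ℂ) q) q y]
    gcongr
    rw [Complex.norm_real, Real.norm_of_nonneg (by positivity)]
    exact norm_seriesCoeff_le' (norm_ofReal_le_one (inv_natCast_mem_Icc N)) q

lemma tendsto_rayIntegral {u : ℂ} {ψ : ℝ} (h : ValidAngle u ψ) :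
    Tendsto (fun N : ℕ => rayIntegral (N : ℝ)⁻¹ ψ (zOf u)) atTop (𝓝 (rayIntegral 0 ψ (zOf u))) := by
  refine tendsto_integral_of_dominated_convergence _
    (fun N => (continuous_rayIntegrand (inv_natCast_mem_Icc N) ψ _).aestronglyMeasurable)
    (integrableOn_catalanMajorant (norm_nonneg (zOf u)) h.cos_pos h.2.2)
    (fun N => ae_of_all _ (norm_rayIntegrand_le (inv_natCast_mem_Icc N)
      (re_nonpos_of_abs_le h.2.1 (inv_natCast_mem_Icc N).1)))
    (ae_of_all _ fun s => ?_)
  exact ((tendsto_seriesKernel _).const_mul _).const_mul _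

lemma seriesCoeff_zero_left (q : ℕ) : seriesCoeff (0 : ℂ) q = catalan q := by
  rw [seriesCoeff, Finset.sum_eq_single (q, 0)]
  · simp [mapCoeff_eq_catalan]
  · rintro ⟨n, l⟩ h h'
    rw [Finset.HasAntidiagonal.mem_antidiagonal] at h
    rcases l with _ | l
    · exact absurd (by simpa using h) (fun h => h' (by simp [h]))
    · simp
  · simp

/-- At `t = 0` only Catalan numbers remain. Termwise integration then gives a power series in `z` in
which the direction of the ray no longer appears. -/
lemma rayIntegral_zero {ψ : ℝ} (hψ : 0 < Real.cos ψ) {z : ℂ} (h : 4 * ‖z‖ < Real.cos ψ ^ 2) :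
    rayIntegral 0 ψ z = ∑' n, (catalan n : ℂ) * z ^ n := by
  set e := Complex.exp (ψ * Complex.I) with he
  have hre : e.re = Real.cos ψ := Complex.exp_ofReal_mul_I_re ψ
  have he0 : e ≠ 0 := Complex.exp_ne_zero _
  let F : ℕ → ℝ → ℂ := fun n s => e * (Complex.exp (-(e * s)) *
    (catalan n * ((z * e ^ 2 * (s ^ 2 : ℝ)) ^ n / (2 * n).factorial)))
  have hF : ∀ n s, F n s = (e * catalan n * (z * e ^ 2) ^ n / (2 * n).factorial) *
      ((s : ℂ) ^ (2 * n) * Complex.exp (-(e * s))) := fun n s => by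
    simp only [F]
    rw [mul_pow _ ((s ^ 2 : ℝ) : ℂ), Complex.ofReal_pow, ← pow_mul]
    ring
  have hn : ∀ n s, ‖F n s‖ = Real.exp (-(Real.cos ψ * s)) *
      (catalan n * ((‖z‖ * s ^ 2) ^ n / (2 * n).factorial)) := fun n s => by
    simp only [F]
    rw [norm_mul, norm_mul, he, norm_exp_ray, Complex.norm_exp_ofReal_mul_I]
    simp [Complex.norm_exp_ofReal_mul_I]
  have hI : ∀ n, IntegrableOn (F n) (Set.Ioi 0) := fun n => by
    rw [funext (hF n)]
    exact (integrableOn_pow_mul_cexp_neg_mul (2 * n) (by rw [hre]; exact hψ)).const_mul _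
  have hs := hasSum_integral_of_summable_integral_norm (F := F) hI (by
    refine (hasSum_laplace_even_majorant catalan_nonneg' catalan_le_four_pow' (norm_nonneg z) hψ
      h).summable.congr fun n => ?_
    rw [← integral_exp_mul_even_term _ _ _ hψ]
    exact integral_congr_ae (ae_of_all _ fun s => (hn n s).symm))
  have h1 : ∀ n, ∫ s in Set.Ioi (0 : ℝ), F n s = catalan n * z ^ n := fun n => by
    simp_rw [hF]
    rw [integral_const_mul, integral_pow_mul_cexp_neg_mul_Ioi (2 * n) (by rw [hre]; exact hψ)]
    have : ((2 * n).factorial : ℂ) ≠ 0 := by exact_mod_cast (2 * n).factorial_ne_zero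
    rw [mul_pow, ← pow_mul, pow_succ]
    field_simp
  simp_rw [h1] at hs
  rw [hs.tsum_eq, rayIntegral]
  refine integral_congr_ae (ae_of_all _ fun s => ?_)
  change _ = ∑' i, F i s
  simp only [F]
  rw [tsum_mul_left, tsum_mul_left, rayIntegrand, seriesKernel, evenSeries]
  simp_rw [Complex.ofReal_zero, seriesCoeff_zero_left]
  rfl

/-! ### The generating function of the Catalan numbers -/

lemma summable_catalan_mul_pow {r : ℝ} (h0 : 0 ≤ r) (h : 4 * r < 1) :
    Summable fun n => (catalan n : ℝ) * r ^ n := by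
  refine Summable.of_nonneg_of_le (fun n => by positivity) (fun n => ?_)
    (summable_geometric_of_lt_one (by positivity) h)
  rw [mul_pow]
  gcongr
  exact catalan_le_four_pow' n

/-- By the Catalan recursion the partial sums satisfy `S_{m+1} ≤ 1 + r S_m² ≤ 1 + 4r ≤ 2`. -/
lemma sum_catalan_le_two {r : ℝ} (h0 : 0 ≤ r) (h : 4 * r ≤ 1) (m : ℕ) :
    ∑ n ∈ Finset.range m, (catalan n : ℝ) * r ^ n ≤ 2 := by
  induction m with
  | zero => simp
  | succ m ih =>
    have h1 : ∑ n ∈ Finset.range m, (catalan (n + 1) : ℝ) * r ^ n ≤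
        (∑ n ∈ Finset.range m, (catalan n : ℝ) * r ^ n) * ∑ n ∈ Finset.range m, (catalan n : ℝ) * r ^ n := by
      have h2 : ∀ n ∈ Finset.range m, (catalan (n + 1) : ℝ) * r ^ n =
          ∑ p ∈ Finset.HasAntidiagonal.antidiagonal n, ((catalan p.1 : ℝ) * r ^ p.1) * (catalan p.2 * r ^ p.2) := by
        intro n _
        rw [catalan_succ', Nat.cast_sum, Finset.sum_mul]
        refine Finset.sum_congr rfl fun p hp => ?_
        rw [← Finset.HasAntidiagonal.mem_antidiagonal.1 hp, pow_add]
        push_cast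
        ring
      rw [Finset.sum_congr rfl h2, Finset.sum_mul_sum, ← Finset.sum_product', Finset.sum_sigma']
      rw [← Finset.sum_image (f := fun p : ℕ × ℕ => ((catalan p.1 : ℝ) * r ^ p.1) *
        (catalan p.2 * r ^ p.2)) (g := fun x : (_ : ℕ) × ℕ × ℕ => x.2)]
      · refine Finset.sum_le_sum_of_subset_of_nonneg (fun p hp => ?_) fun _ _ _ => by positivity
        simp at hp ⊢
        omega
      · rintro ⟨n, p⟩ h ⟨n', p'⟩ h' (h2 : p = p')
        simp only [Finset.coe_sigma, Set.mem_sigma_iff, Finset.mem_coe,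
          Finset.HasAntidiagonal.mem_antidiagonal] at h h'
        subst h2
        rw [← h.2, ← h'.2]
    rw [Finset.sum_range_succ']
    have h3 : ∑ n ∈ Finset.range m, (catalan (n + 1) : ℝ) * r ^ (n + 1) =
        r * ∑ n ∈ Finset.range m, (catalan (n + 1) : ℝ) * r ^ n := by
      rw [Finset.mul_sum]
      exact Finset.sum_congr rfl fun n _ => by ring
    rw [h3]
    have h4 : 0 ≤ ∑ n ∈ Finset.range m, (catalan n : ℝ) * r ^ n :=
      Finset.sum_nonneg fun n _ => by positivity
    simp only [catalan_zero, pow_zero, Nat.cast_one, mul_one]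
    nlinarith

/-- From `g = 1 + zg²` follows `(1 - 2zg)² = 1 - 4z`. The bound `|g| ≤ 2` gives `|2zg| < 1`, so `1 -
2zg` has positive real part and is the principal root. -/
lemma tsum_catalan_eq {z : ℂ} (hz0 : z ≠ 0) (hz : 4 * ‖z‖ < 1) :
    ∑' n, (catalan n : ℂ) * z ^ n = (1 - (1 - 4 * z) ^ (1 / 2 : ℂ)) / (2 * z) := by
  set g := ∑' n, (catalan n : ℂ) * z ^ n with hg
  have hs := summable_catalan_mul_pow (norm_nonneg z) hz
  have hs' : Summable fun n => ‖(catalan n : ℂ) * z ^ n‖ := by simpa using hs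
  have h1 : g = 1 + z * g ^ 2 := by
    rw [sq, hg, tsum_mul_tsum_eq_tsum_sum_antidiagonal_of_summable_norm hs' hs', ← tsum_mul_left,
      hs'.of_norm.tsum_eq_zero_add]
    simp only [catalan_zero, pow_zero, Nat.cast_one, mul_one]
    congr 1
    refine tsum_congr fun n => ?_
    rw [catalan_succ', Nat.cast_sum, Finset.sum_mul, Finset.mul_sum]
    refine Finset.sum_congr rfl fun p hp => ?_
    rw [← Finset.HasAntidiagonal.mem_antidiagonal.1 hp, pow_succ, pow_add]
    push_cast
    ring
  have h2 : ‖g‖ ≤ 2 := by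
    refine (norm_tsum_le_tsum_norm hs').trans (Real.tsum_le_of_sum_range_le (fun _ => norm_nonneg _) fun m => ?_)
    simpa using sum_catalan_le_two (norm_nonneg z) hz.le m
  have h3 : 0 < (1 - 2 * z * g).re := by
    have h4 : ‖2 * z * g‖ < 1 := by
      rw [norm_mul, norm_mul, show ‖(2 : ℂ)‖ = 2 by simp]
      nlinarith [norm_nonneg z]
    have := (Complex.re_le_norm (2 * z * g)).trans_lt h4
    simp only [Complex.sub_re, Complex.one_re]
    linarith
  have h5 : (1 - 4 * z) = (1 - 2 * z * g) ^ 2 := by linear_combination (4 * z) * h1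
  rw [h5, one_div, Complex.sq_cpow_two_inv h3]
  field_simp
  ring

lemma tendsto_continuation {u : ℂ} (hu : u ∈ extendedCardioid) :
    Tendsto (fun N : ℕ => continuation N u) atTop
      (𝓝 ((1 - (1 - 4 * zOf u) ^ (1 / 2 : ℂ)) / (2 * zOf u))) := by
  obtain ⟨ψ, h⟩ := exists_validAngle_of_mem hu
  have h1 : 4 * ‖zOf u‖ < 1 := h.2.2.trans_le (Real.cos_sq_le_one ψ)
  simp_rw [fun N => continuation_eq N h]
  rw [← tsum_catalan_eq (zOf_ne_zero u) h1, ← rayIntegral_zero h.cos_pos h.2.2]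
  exact tendsto_rayIntegral h

end NVector

namespace NVector

/-! ### Polar coordinates -/

section Polar

variable {N : ℕ}

lemma sqNorm_eq (φ : Fin N → ℂ) : sqNorm φ = ‖WithLp.toLp 2 φ‖ ^ 2 := by
  rw [EuclideanSpace.norm_sq_eq, sqNorm]
  simp [Complex.normSq_eq_norm_sq]

/-- The image of Lebesgue measure on the Euclidean space. -/
noncomputable def euclideanVolume (N : ℕ) : Measure (EuclideanSpace ℂ (Fin N)) :=
  (volume : Measure (Fin N → ℂ)).map (PiLp.continuousLinearEquiv 2 ℝ (fun _ : Fin N => ℂ)).symm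

instance : (euclideanVolume N).IsAddHaarMeasure := by
  unfold euclideanVolume
  infer_instance

lemma integrable_sqNorm_iff_norm (f : ℝ → ℂ) : Integrable (fun φ : Fin N → ℂ => f (sqNorm φ)) ↔
    Integrable (fun x : EuclideanSpace ℂ (Fin N) => f (‖x‖ ^ 2)) (euclideanVolume N) := by
  rw [euclideanVolume]
  refine Iff.trans ?_ ((PiLp.continuousLinearEquiv 2 ℝ (fun _ : Fin N =>
    ℂ)).symm.toHomeomorph.toMeasurableEquiv.measurableEmbedding.integrable_map_iff).symm
  exact integrable_congr (ae_of_all _ fun φ => congrArg f (sqNorm_eq φ))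

lemma integral_sqNorm_eq_norm (f : ℝ → ℂ) : ∫ φ : Fin N → ℂ, f (sqNorm φ) =
    ∫ x : EuclideanSpace ℂ (Fin N), f (‖x‖ ^ 2) ∂(euclideanVolume N) := by
  rw [euclideanVolume]
  refine Eq.trans ?_ ((PiLp.continuousLinearEquiv 2 ℝ (fun _ : Fin N =>
    ℂ)).symm.toHomeomorph.toMeasurableEquiv.measurableEmbedding.integral_map _).symm
  exact integral_congr_ae (ae_of_all _ fun φ => congrArg f (sqNorm_eq φ))

lemma finrank_euclidean : Module.finrank ℝ (EuclideanSpace ℂ (Fin N)) = 2 * N := by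
  rw [finrank_real_of_complex]
  simp

lemma radial_substitution (hN : 1 ≤ N) (f : ℝ → ℂ) (y : ℝ) :
    y ^ (2 * N - 1) • f (y ^ 2) =
      (1 / 2 : ℝ) • (((2 : ℝ) * y ^ ((2 : ℝ) - 1)) • (((y ^ (2 : ℝ)) ^ (N - 1) : ℝ) * f (y ^ (2 : ℝ)))) := by
  obtain ⟨k, rfl⟩ := Nat.exists_eq_add_of_le' hN
  have h1 : y ^ (2 : ℝ) = y ^ 2 := by exact_mod_cast Real.rpow_natCast y 2
  rw [h1, show (2 : ℝ) - 1 = 1 by norm_num, Real.rpow_one, show 2 * (k + 1) - 1 = 2 * k + 1 by omega,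
    Nat.add_sub_cancel]
  simp only [Complex.real_smul]
  push_cast
  ring

lemma integrable_sqNorm_iff (hN : 1 ≤ N) (f : ℝ → ℂ) :
    Integrable (fun φ : Fin N → ℂ => f (sqNorm φ)) ↔
      IntegrableOn (fun r : ℝ => (r ^ (N - 1) : ℝ) * f r) (Set.Ioi 0) := by
  have : Nonempty (Fin N) := ⟨⟨0, hN⟩⟩
  rw [integrable_sqNorm_iff_norm, integrable_fun_norm_addHaar (euclideanVolume N) (f := fun y => f (y ^ 2)),
    finrank_euclidean, ← integrableOn_Ioi_comp_rpow_iff (fun r : ℝ => ((r ^ (N - 1) : ℝ) : ℂ) * f r)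
      (two_ne_zero (α := ℝ)), funext (radial_substitution hN f)]
  rw [abs_of_pos (two_pos (α := ℝ))]
  exact integrable_smul_iff (c := (1 / 2 : ℝ)) (by norm_num) _

/-- Polar coordinates and `r = y²` give the formula up to a constant `K`. Testing on `e^{-r}`, where
the left side is a product of one-dimensional complex Gaussians, determines `K`. -/
lemma integral_sqNorm (hN : 1 ≤ N) (f : ℝ → ℂ) :
    ∫ φ : Fin N → ℂ, f (sqNorm φ) =
      (Real.pi ^ N / (N - 1).factorial : ℝ) * ∫ r in Set.Ioi (0 : ℝ), (r ^ (N - 1) : ℝ) * f r := by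
  have : Nonempty (Fin N) := ⟨⟨0, hN⟩⟩
  have key : ∃ K : ℝ, ∀ f : ℝ → ℂ, ∫ φ : Fin N → ℂ, f (sqNorm φ) =
      K * ∫ r in Set.Ioi (0 : ℝ), (r ^ (N - 1) : ℝ) * f r := by
    refine ⟨(2 * N : ℕ) * (euclideanVolume N).real (Metric.ball 0 1) * (1 / 2), fun f => ?_⟩
    rw [integral_sqNorm_eq_norm, integral_fun_norm_addHaar (euclideanVolume N) (fun y => f (y ^ 2)),
      finrank_euclidean, funext (radial_substitution hN f), integral_smul,
      integral_comp_rpow_Ioi_of_pos (g := fun r : ℝ => ((r ^ (N - 1) : ℝ) : ℂ) * f r) two_pos]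
    simp only [Complex.real_smul, nsmul_eq_mul]
    push_cast
    ring
  obtain ⟨K, hK⟩ := key
  have h1 := hK fun r => (Real.exp (-r) : ℝ)
  have h2 : ∫ φ : Fin N → ℂ, ((Real.exp (-sqNorm φ) : ℝ) : ℂ) = ((Real.pi ^ N : ℝ) : ℂ) := by
    rw [integral_complex_ofReal]
    congr 1
    have h3 : ∀ φ : Fin N → ℂ, Real.exp (-sqNorm φ) = ∏ p, Real.exp (-‖φ p‖ ^ (2 : ℝ)) := fun φ => by
      rw [← Real.exp_sum, sqNorm, ← Finset.sum_neg_distrib]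
      congr 1
      refine Finset.sum_congr rfl fun p _ => ?_
      rw [Complex.normSq_eq_norm_sq, Real.rpow_two]
    simp_rw [h3]
    rw [integral_fintype_prod_volume_eq_prod (f := fun (_ : Fin N) (w : ℂ) => Real.exp (-‖w‖ ^ (2 : ℝ)))]
    rw [Complex.integral_exp_neg_rpow (by norm_num)]
    norm_num
  have h4 : ∫ r in Set.Ioi (0 : ℝ), ((r ^ (N - 1) : ℝ) : ℂ) * (Real.exp (-r) : ℝ) = ((N - 1).factorial : ℝ) := by
    have := integral_pow_mul_exp_neg_mul_Ioi (N - 1) one_pos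
    simp only [one_mul, one_pow, div_one] at this
    rw [← this, ← integral_complex_ofReal]
    push_cast
    rfl
  rw [h2, h4] at h1
  have h5 : ((N - 1).factorial : ℂ) ≠ 0 := by exact_mod_cast (N - 1).factorial_ne_zero
  rw [hK f]
  congr 1
  push_cast at h1 ⊢
  rw [h1]
  field_simp

end Polar

end NVector

namespace NVector

/-! ### The perturbation series -/

section Perturbation

open PowerSeries

variable {N : ℕ}

lemma freeMoment_eq (hN : 1 ≤ N) (k : ℕ) :
    freeMoment N k = (N - 1 + k).factorial / (N - 1).factorial := by
  have h1 := integral_sqNorm hN fun r => ((r ^ k * Real.exp (-r) / Real.pi ^ N : ℝ) : ℂ)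
  rw [integral_complex_ofReal] at h1
  have h2 := integral_pow_mul_exp_neg_mul_Ioi (N - 1 + k) one_pos
  simp only [one_mul, one_pow, div_one] at h2
  have h3 : ∫ r in Set.Ioi (0 : ℝ), ((r ^ (N - 1) : ℝ) : ℂ) * ((r ^ k * Real.exp (-r) / Real.pi ^ N : ℝ) : ℂ) =
      (((N - 1 + k).factorial / Real.pi ^ N : ℝ) : ℂ) := by
    rw [← h2, ← integral_div, ← integral_complex_ofReal]
    refine integral_congr_ae (ae_of_all _ fun r => ?_)
    simp only
    push_cast
    ring
  rw [h3, ← Complex.ofReal_mul, Complex.ofReal_inj] at h1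
  rw [freeMoment, h1]
  have := Real.pi_pos
  field_simp

/-- The coefficients of `Z`. -/
noncomputable def momentCoeff (N q : ℕ) : ℂ :=
  (N - 1 + 2 * q).factorial / (N - 1).factorial / (q.factorial * (2 * (N : ℂ)) ^ q)

lemma coeff_partitionSeries (hN : 1 ≤ N) (q : ℕ) : coeff q (partitionSeries N) = momentCoeff N q := by
  rw [partitionSeries, coeff_mk, freeMoment_eq hN, momentCoeff]
  push_cast
  rfl

lemma natCast_ne_zero_of_one_le (hN : 1 ≤ N) : (N : ℂ) ≠ 0 := by
  exact_mod_cast (Nat.one_le_iff_ne_zero.1 hN)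

lemma coeff_twoPointNumeratorSeries (hN : 1 ≤ N) (q : ℕ) :
    coeff q (twoPointNumeratorSeries N) = (N + 2 * q) / N * momentCoeff N q := by
  rw [twoPointNumeratorSeries, coeff_mk, freeMoment_eq hN, momentCoeff,
    show N - 1 + (2 * q + 1) = N - 1 + 2 * q + 1 by ring, Nat.factorial_succ,
    show N - 1 + 2 * q + 1 = N + 2 * q by omega]
  push_cast
  ring

lemma momentCoeff_zero (N : ℕ) : momentCoeff N 0 = 1 := by
  have : ((N - 1).factorial : ℂ) ≠ 0 := by exact_mod_cast (N - 1).factorial_ne_zero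
  simp [momentCoeff, this]

lemma momentCoeff_succ (hN : 1 ≤ N) (q : ℕ) :
    2 * (q + 1) * momentCoeff N (q + 1) = (N + 1 + 2 * q) * ((N + 2 * q) / N * momentCoeff N q) := by
  rw [momentCoeff, momentCoeff, show N - 1 + 2 * (q + 1) = N - 1 + 2 * q + 1 + 1 by ring,
    Nat.factorial_succ, Nat.factorial_succ, Nat.factorial_succ,
    show N - 1 + 2 * q + 1 = N + 2 * q by omega]
  have h1 : ((N - 1).factorial : ℂ) ≠ 0 := by exact_mod_cast (N - 1).factorial_ne_zero
  have h2 : (q.factorial : ℂ) ≠ 0 := by exact_mod_cast q.factorial_ne_zero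
  have h3 : (q : ℂ) + 1 ≠ 0 := by exact_mod_cast q.succ_ne_zero
  have h4 := natCast_ne_zero_of_one_le hN
  push_cast
  field_simp
  ring

/-- First Schwinger–Dyson equation: analytically, the integral of `d/dr (r^N e^{-r + zr²/(2N)})`
vanishes. -/
lemma twoPointNumeratorSeries_eq (hN : 1 ≤ N) : twoPointNumeratorSeries N =
    partitionSeries N + C (2 / (N : ℂ)) * X * d⁄dX ℂ (partitionSeries N) := by
  have h4 := natCast_ne_zero_of_one_le hN
  ext q
  rw [coeff_twoPointNumeratorSeries hN, map_add, coeff_partitionSeries hN, mul_assoc, coeff_C_mul]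
  rcases q with _ | q
  · simp [momentCoeff_zero, h4]
  · rw [coeff_succ_X_mul, coeff_derivative, coeff_partitionSeries hN]
    push_cast
    field_simp

/-- Second Schwinger–Dyson equation, corresponding to `d/dr (r^{N+1} e^{-r + zr²/(2N)})`. -/
lemma two_mul_derivative_partitionSeries (hN : 1 ≤ N) : C 2 * d⁄dX ℂ (partitionSeries N) =
    C ((N : ℂ) + 1) * twoPointNumeratorSeries N + C 2 * X * d⁄dX ℂ (twoPointNumeratorSeries N) := by
  ext q
  rw [coeff_C_mul, coeff_derivative, coeff_partitionSeries hN, map_add, coeff_C_mul, mul_assoc, coeff_C_mul,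
    coeff_twoPointNumeratorSeries hN]
  have h := momentCoeff_succ hN q
  rcases q with _ | q
  · simp only [Nat.cast_zero, mul_zero, add_zero, zero_add, coeff_zero_X_mul, mul_one] at h ⊢
    linear_combination h
  · rw [coeff_succ_X_mul, coeff_derivative, coeff_twoPointNumeratorSeries hN]
    push_cast at h ⊢
    linear_combination h

lemma perturbativeCoeff_eq (hN : 1 ≤ N) (q : ℕ) :
    perturbativeCoeff N q = seriesCoeff (((N : ℝ)⁻¹ : ℝ) : ℂ) q := by
  have h4 := natCast_ne_zero_of_one_le hN
  set Z := partitionSeries N with hZ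
  set P := twoPointNumeratorSeries N * Z⁻¹ with hP
  have hZ0 : constantCoeff Z ≠ 0 := by
    rw [← coeff_zero_eq_constantCoeff_apply, hZ, coeff_partitionSeries hN, momentCoeff_zero]
    exact one_ne_zero
  have hZne : Z ≠ 0 := fun h => hZ0 (by rw [h, map_zero])
  have hPZ : twoPointNumeratorSeries N = P * Z := by
    rw [hP, mul_assoc, PowerSeries.inv_mul_cancel _ hZ0, mul_one]
  change coeff q P = _
  clear_value P
  have e1 := twoPointNumeratorSeries_eq hN
  have e2 := two_mul_derivative_partitionSeries hN
  rw [hPZ, ← hZ] at e1 e2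
  rw [Derivation.leibniz] at e2
  simp only [smul_eq_mul] at e2
  have hC2 : (C 2 : PowerSeries ℂ) = 2 := map_ofNat C 2
  -- Eliminating the derivative of `Z` between the two equations and dividing by `Z` leaves a
  -- Riccati equation for the quotient `P` alone. Its coefficients obey the recursion of
  -- `seriesCoeff_succ`.
  have e3 : P - 1 = X * (C ((N : ℂ)⁻¹) * P + C (2 * (N : ℂ)⁻¹) * X * d⁄dX ℂ P + P * P) := by
    have hCi : C ((N : ℂ)⁻¹) * C (N : ℂ) = (1 : PowerSeries ℂ) := by
      rw [← map_mul, inv_mul_cancel₀ h4, map_one]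
    apply mul_right_cancel₀ hZne
    rw [map_mul, hC2]
    rw [div_eq_mul_inv, map_mul, hC2] at e1
    rw [hC2, map_add, map_one] at e2
    have e1' : C (N : ℂ) * (P - 1) * Z = 2 * X * d⁄dX ℂ Z := by
      linear_combination C (N : ℂ) * e1 + (2 * X * d⁄dX ℂ Z) * hCi
    linear_combination (C ((N : ℂ)⁻¹) - C ((N : ℂ)⁻¹) * X * P) * e1' + (X * C ((N : ℂ)⁻¹)) * e2 -
      ((P - 1) * Z - X * P ^ 2 * Z) * hCi
  have hco : ∀ q, coeff q P = seriesCoeff (((N : ℝ)⁻¹ : ℝ) : ℂ) q := by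
    intro q
    induction q using Nat.strong_induction_on with | _ q ih
    rcases q with _ | q
    · have := congrArg (coeff 0) e3
      rw [map_sub, coeff_zero_X_mul, coeff_zero_one] at this
      rw [seriesCoeff_zero, sub_eq_zero.1 this]
    · have h5 : coeff q (X * d⁄dX ℂ P) = q * coeff q P := by
        rcases q with _ | q
        · simp
        · rw [coeff_succ_X_mul, coeff_derivative]
          push_cast
          ring
      have := congrArg (coeff (q + 1)) e3
      rw [map_sub, coeff_succ_X_mul, coeff_one, if_neg q.succ_ne_zero, sub_zero, map_add, map_add,
        coeff_C_mul, mul_assoc, coeff_C_mul, h5, coeff_mul q P P] at this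
      rw [this, seriesCoeff_succ, ih q (by omega), Finset.sum_congr rfl fun p hp => by
        have := Finset.HasAntidiagonal.mem_antidiagonal.1 hp
        rw [ih p.1 (by omega), ih p.2 (by omega)]]
      congr 1
      push_cast
      ring
  exact hco q

end Perturbation

end NVector

namespace NVector

/-! ### The two-point function as a Laplace transform -/

section TwoPoint

variable {N : ℕ} {z : ℂ}

/-- The density `e^{z B² / (2N)} B^{N-1} / (N-1)!` of the interacting measure in polar coordinates. -/
noncomputable def radialDensity (N : ℕ) (z : ℂ) (B : ℝ) : ℂ :=
  Complex.exp (z / (2 * N) * B ^ 2) * (B ^ (N - 1) / (N - 1).factorial)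

lemma continuous_radialDensity (N : ℕ) (z : ℂ) : Continuous (radialDensity N z) := by
  unfold radialDensity
  fun_prop

lemma radialDensity_eq_tsum (N : ℕ) (z : ℂ) (B : ℝ) : radialDensity N z B =
    ∑' k, momentCoeff N k * z ^ k * ((B : ℂ) ^ (N - 1 + 2 * k) / (N - 1 + 2 * k).factorial) := by
  rw [radialDensity, Complex.exp_eq_exp_ℂ, NormedSpace.exp_eq_tsum_div, ← tsum_mul_right]
  refine tsum_congr fun k => ?_
  have h : ((N - 1 + 2 * k).factorial : ℂ) ≠ 0 := by exact_mod_cast (N - 1 + 2 * k).factorial_ne_zero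
  rw [momentCoeff, mul_pow, div_pow, pow_add, ← pow_mul]
  field_simp

lemma summable_radialDensity (N : ℕ) (z : ℂ) {B : ℝ} (_hB : 0 ≤ B) : Summable fun k =>
    ‖momentCoeff N k * z ^ k‖ * B ^ (N - 1 + 2 * k) / (N - 1 + 2 * k).factorial := by
  refine ((Real.summable_pow_div_factorial (‖z‖ / (2 * N) * B ^ 2)).mul_right
    (B ^ (N - 1) / (N - 1).factorial)).congr fun k => ?_
  have h : ((N - 1 + 2 * k).factorial : ℝ) ≠ 0 := by exact_mod_cast (N - 1 + 2 * k).factorial_ne_zero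
  rw [momentCoeff, mul_pow, div_pow, pow_add, ← pow_mul]
  simp only [norm_mul, norm_div, norm_pow, Complex.norm_natCast, Complex.norm_ofNat]
  field_simp

lemma sum_seriesCoeff_mul_momentCoeff (hN : 1 ≤ N) (s : ℕ) :
    ∑ p ∈ Finset.HasAntidiagonal.antidiagonal s,
      seriesCoeff (((N : ℝ)⁻¹ : ℝ) : ℂ) p.1 * momentCoeff N p.2 = (N + 2 * s) / N * momentCoeff N s := by
  rw [← coeff_twoPointNumeratorSeries hN]
  have h : twoPointNumeratorSeries N =
      (twoPointNumeratorSeries N * (partitionSeries N)⁻¹) * partitionSeries N := by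
    rw [mul_assoc, PowerSeries.inv_mul_cancel, mul_one]
    rw [← PowerSeries.coeff_zero_eq_constantCoeff_apply, coeff_partitionSeries hN, momentCoeff_zero]
    exact one_ne_zero
  rw [h, PowerSeries.coeff_mul]
  refine Finset.sum_congr rfl fun p _ => ?_
  rw [← perturbativeCoeff_eq hN, coeff_partitionSeries hN, perturbativeCoeff]

lemma hasSum_antidiagonal {f : ℕ × ℕ → ℂ} {c : ℂ} (h : HasSum f c) :
    HasSum (fun s : ℕ => ∑ p ∈ Finset.HasAntidiagonal.antidiagonal s, f p) c := by
  have h2 := (Finset.HasAntidiagonal.sigmaAntidiagonalEquivProd.hasSum_iff.2 h).sigma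
      (fun q => hasSum_fintype _)
  refine h2.congr_fun fun s => ?_
  rw [← Finset.sum_coe_sort]
  rfl

lemma sum_convolution_term (hN : 1 ≤ N) (z B : ℂ) (s : ℕ) :
    ∑ p ∈ Finset.HasAntidiagonal.antidiagonal s,
      (seriesCoeff (((N : ℝ)⁻¹ : ℝ) : ℂ) p.1 * z ^ p.1) * (momentCoeff N p.2 * z ^ p.2) *
        (B ^ (2 * p.1 + (N - 1 + 2 * p.2) + 1) / (2 * p.1 + (N - 1 + 2 * p.2) + 1).factorial) =
    B / N * (momentCoeff N s * z ^ s * (B ^ (N - 1 + 2 * s) / (N - 1 + 2 * s).factorial)) := by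
  have hN0 := natCast_ne_zero_of_one_le hN
  have h1 : ∀ p ∈ Finset.HasAntidiagonal.antidiagonal s,
      (seriesCoeff (((N : ℝ)⁻¹ : ℝ) : ℂ) p.1 * z ^ p.1) * (momentCoeff N p.2 * z ^ p.2) *
        (B ^ (2 * p.1 + (N - 1 + 2 * p.2) + 1) / (2 * p.1 + (N - 1 + 2 * p.2) + 1).factorial) =
      (seriesCoeff (((N : ℝ)⁻¹ : ℝ) : ℂ) p.1 * momentCoeff N p.2) *
        (z ^ s * (B ^ (N - 1 + 2 * s + 1) / (N - 1 + 2 * s + 1).factorial)) := by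
    intro p hp
    rw [Finset.HasAntidiagonal.mem_antidiagonal] at hp
    rw [show 2 * p.1 + (N - 1 + 2 * p.2) + 1 = N - 1 + 2 * s + 1 by omega, ← hp, pow_add z]
    ring
  have h2 : ((N - 1 + 2 * s + 1 : ℕ) : ℂ) = N + 2 * s := by
    rw [show N - 1 + 2 * s + 1 = N + 2 * s by omega]
    push_cast
    ring
  have h3 : (N : ℂ) + 2 * s ≠ 0 := by
    have : N + 2 * s ≠ 0 := by omega
    exact_mod_cast this
  have h4 : ((N - 1 + 2 * s).factorial : ℂ) ≠ 0 := by exact_mod_cast (N - 1 + 2 * s).factorial_ne_zero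
  rw [Finset.sum_congr rfl h1, ← Finset.sum_mul, sum_seriesCoeff_mul_momentCoeff hN, Nat.factorial_succ,
    Nat.cast_mul, h2]
  generalize N - 1 + 2 * s = m at *
  generalize ((m.factorial : ℕ) : ℂ) = M at *
  rw [pow_succ]
  field_simp

lemma hasSum_radialDensity (N : ℕ) (z : ℂ) (B : ℝ) : HasSum
    (fun k => momentCoeff N k * z ^ k * ((B : ℂ) ^ (N - 1 + 2 * k) / (N - 1 + 2 * k).factorial))
    (radialDensity N z B) := by
  rw [radialDensity_eq_tsum]
  refine (Summable.of_norm ?_).hasSum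
  refine (summable_radialDensity N z (abs_nonneg B)).congr fun k => ?_
  rw [norm_mul (momentCoeff N k * z ^ k), norm_div, norm_pow, Complex.norm_real, Complex.norm_natCast,
    Real.norm_eq_abs, mul_div_assoc]

/-- The identity numerator `= P · Z` between series, read through the Beta integral: dividing the
coefficients by factorials turns the Cauchy product into a convolution, and the factor `(N + 2s)/N`
of the numerator turns into `B/N`. -/
lemma convolution_radialDensity (hN : 1 ≤ N) (z : ℂ) {B : ℝ} (hB : 0 ≤ B) :
    N * ∫ y in (0 : ℝ)..B, seriesKernel (N : ℝ)⁻¹ (z * (y : ℂ) ^ 2) * radialDensity N z (B - y) =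
      B * radialDensity N z B := by
  have hN0 := natCast_ne_zero_of_one_le hN
  have hs : Summable fun q : ℕ => ‖seriesCoeff (((N : ℝ)⁻¹ : ℝ) : ℂ) q * z ^ q‖ * B ^ (2 * q) /
      (2 * q).factorial := by
    refine ((factorialBound_seriesCoeff (inv_natCast_mem_Icc N)).summable_norm (R := ‖z‖ * B ^ 2)
      (by positivity)).congr fun q => ?_
    rw [norm_mul, norm_pow, mul_pow, ← pow_mul]
    ring
  have h := hasSum_antidiagonal (NVector.hasSum_convolution hB hs (summable_radialDensity N z hB))
  have h3 := (hasSum_radialDensity N z B).mul_left ((B : ℂ) / N)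
  have h4 := h.unique (h3.congr_fun fun s => sum_convolution_term hN z B s)
  have h5 : ∀ y : ℝ, seriesKernel (N : ℝ)⁻¹ (z * (y : ℂ) ^ 2) * radialDensity N z (B - y) =
      (∑' q : ℕ, seriesCoeff (((N : ℝ)⁻¹ : ℝ) : ℂ) q * z ^ q * ((y : ℂ) ^ (2 * q) / (2 * q).factorial)) *
        ∑' k, momentCoeff N k * z ^ k *
          (((B - y : ℝ) : ℂ) ^ (N - 1 + 2 * k) / (N - 1 + 2 * k).factorial) := by
    intro y
    rw [radialDensity_eq_tsum, seriesKernel, evenSeries]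
    congr 1
    refine tsum_congr fun q => ?_
    rw [mul_pow, ← pow_mul]
    ring
  simp_rw [h5]
  rw [h4]
  field_simp

lemma norm_exp_le_one_of_re_nonpos {w : ℂ} (hw : w.re ≤ 0) : ‖Complex.exp w‖ ≤ 1 := by
  rw [Complex.norm_exp]; exact Real.exp_le_one_iff.2 hw

lemma re_div_mul_sq_nonpos (hz : z.re ≤ 0) (N : ℕ) (B : ℝ) : (z / (2 * N) * (B : ℂ) ^ 2).re ≤ 0 := by
  have h : z / (2 * N) * (B : ℂ) ^ 2 = z * ((B ^ 2 / (2 * N) : ℝ) : ℂ) := by push_cast; ring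
  rw [h, Complex.re_mul_ofReal]
  exact mul_nonpos_of_nonpos_of_nonneg hz (by positivity)

lemma norm_radialDensity_le (hz : z.re ≤ 0) {B : ℝ} (hB : 0 ≤ B) :
    ‖radialDensity N z B‖ ≤ B ^ (N - 1) := by
  rw [radialDensity, norm_mul, norm_div, norm_pow, Complex.norm_real, Real.norm_of_nonneg hB,
    Complex.norm_natCast]
  have h1 := norm_exp_le_one_of_re_nonpos (re_div_mul_sq_nonpos hz N B)
  have h2 : (1 : ℝ) ≤ (N - 1).factorial := by exact_mod_cast (N - 1).factorial_pos
  calc _ ≤ 1 * (B ^ (N - 1) / 1) := by gcongr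
    _ = _ := by ring

/-- The Laplace transform of the radial density. -/
noncomputable def radialLaplace (N : ℕ) (z : ℂ) (l : ℝ) : ℂ :=
  ∫ B in Set.Ioi (0 : ℝ), Complex.exp (-(l * B)) * radialDensity N z B

lemma norm_exp_neg_ofReal_mul (l B : ℝ) : ‖Complex.exp (-(l * B))‖ = Real.exp (-(l * B)) := by
  rw [Complex.norm_exp]
  simp

lemma integrableOn_pow_mul_radialDensity (hz : z.re ≤ 0) (k : ℕ) {l : ℝ} (hl : 0 < l) :
    IntegrableOn (fun B : ℝ => Complex.exp (-(l * B)) * ((B : ℂ) ^ k * radialDensity N z B)) (Set.Ioi 0) := by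
  have := continuous_radialDensity N z
  refine Integrable.mono' (integrableOn_pow_mul_exp_neg_mul (k + (N - 1)) hl)
    (Continuous.aestronglyMeasurable (by fun_prop))
    ((ae_restrict_iff' measurableSet_Ioi).2 (ae_of_all _ fun B hB => ?_))
  rw [Set.mem_Ioi] at hB
  rw [norm_mul, norm_mul, norm_exp_neg_ofReal_mul, norm_pow, Complex.norm_real,
    Real.norm_of_nonneg hB.le, pow_add]
  calc _ ≤ Real.exp (-(l * B)) * (B ^ k * B ^ (N - 1)) := by
        gcongr
        exact norm_radialDensity_le hz hB.le
    _ = _ := by ring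

lemma integrableOn_radialDensity (hz : z.re ≤ 0) {l : ℝ} (hl : 0 < l) :
    IntegrableOn (fun B : ℝ => Complex.exp (-(l * B)) * radialDensity N z B) (Set.Ioi 0) := by
  simpa using integrableOn_pow_mul_radialDensity (N := N) hz 0 hl

lemma hasDerivAt_radialLaplace (hz : z.re ≤ 0) {l : ℝ} (hl : 0 < l) :
    HasDerivAt (radialLaplace N z)
      (-∫ B in Set.Ioi (0 : ℝ), Complex.exp (-(l * B)) * (B * radialDensity N z B)) l := by
  have hc := continuous_radialDensity N z
  have h := (hasDerivAt_integral_of_dominated_loc_of_deriv_le (μ := volume.restrict (Set.Ioi 0))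
    (F := fun (l : ℝ) (B : ℝ) => Complex.exp (-(l * B)) * radialDensity N z B) (x₀ := l)
    (F' := fun (l : ℝ) (B : ℝ) => -(Complex.exp (-(l * B)) * (B * radialDensity N z B)))
    (bound := fun B => B ^ (1 + (N - 1)) * Real.exp (-(l / 2 * B)))
    (Ioi_mem_nhds (half_lt_self hl)) (Eventually.of_forall fun l =>
      Continuous.aestronglyMeasurable (by fun_prop)) (integrableOn_radialDensity hz hl)
    (Continuous.aestronglyMeasurable (by fun_prop)) ?_
    (integrableOn_pow_mul_exp_neg_mul (1 + (N - 1)) (by positivity)) ?_).2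
  · rwa [integral_neg] at h
  · refine (ae_restrict_iff' measurableSet_Ioi).2 (ae_of_all _ fun B hB x hx => ?_)
    rw [Set.mem_Ioi] at hB hx
    rw [norm_neg, norm_mul, norm_mul, norm_exp_neg_ofReal_mul, Complex.norm_real,
      Real.norm_of_nonneg hB.le, pow_add, pow_one]
    calc _ ≤ Real.exp (-(l / 2 * B)) * (B * B ^ (N - 1)) := by
          gcongr
          exact norm_radialDensity_le hz hB.le
      _ = _ := by ring
  · refine ae_of_all _ fun B x _ => ?_
    have h0 : HasDerivAt (fun s : ℝ => (s : ℂ)) 1 x := Complex.ofRealCLM.hasDerivAt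
    refine (((h0.mul_const (B : ℂ)).fun_neg.cexp).mul_const (radialDensity N z B)).congr_deriv ?_
    ring

/-- The Laplace transform of the series kernel. -/
noncomputable def kernelLaplace (N : ℕ) (z : ℂ) (l : ℝ) : ℂ :=
  ∫ B in Set.Ioi (0 : ℝ), Complex.exp (-(l * B)) * seriesKernel (N : ℝ)⁻¹ (z * (B : ℂ) ^ 2)

lemma norm_seriesKernel_sq_le (hz : z.re ≤ 0) (B : ℝ) :
    ‖seriesKernel (N : ℝ)⁻¹ (z * (B : ℂ) ^ 2)‖ ≤ catalanMajorant (‖z‖ * B ^ 2) := by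
  have := norm_seriesKernel_le (inv_natCast_mem_Icc N) (z := z) (u := B ^ 2) (by
    rw [Complex.re_mul_ofReal]
    exact mul_nonpos_of_nonpos_of_nonneg hz (by positivity)) (sq_nonneg B)
  exact_mod_cast this

lemma integrableOn_kernelLaplace (hz : z.re ≤ 0) {l : ℝ} (hl : 0 < l) (h : 4 * ‖z‖ < l ^ 2) :
    IntegrableOn (fun B : ℝ => Complex.exp (-(l * B)) * seriesKernel (N : ℝ)⁻¹ (z * (B : ℂ) ^ 2))
      (Set.Ioi 0) := by
  have := (differentiable_seriesKernel (inv_natCast_mem_Icc N)).continuous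
  refine Integrable.mono' (integrableOn_catalanMajorant (norm_nonneg z) hl h)
    (Continuous.aestronglyMeasurable (by fun_prop)) (ae_of_all _ fun B => ?_)
  rw [norm_mul, norm_exp_neg_ofReal_mul]
  gcongr
  exact norm_seriesKernel_sq_le hz B

lemma norm_kernelLaplace_le (hz : z.re ≤ 0) (h : 4 * ‖z‖ < 1) {l : ℝ} (hl : 1 ≤ l) :
    ‖kernelLaplace N z l‖ ≤ ∫ B in Set.Ioi (0 : ℝ), Real.exp (-(1 * B)) * catalanMajorant (‖z‖ * B ^ 2) := by
  refine norm_integral_le_of_norm_le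
    (integrableOn_catalanMajorant (norm_nonneg z) one_pos (by simpa using h)) ?_
  refine (ae_restrict_iff' measurableSet_Ioi).2 (ae_of_all _ fun B hB => ?_)
  rw [Set.mem_Ioi] at hB
  rw [norm_mul, norm_exp_neg_ofReal_mul]
  gcongr
  exact norm_seriesKernel_sq_le hz B

/-- The Laplace transform of a convolution is a product, so `convolution_radialDensity` becomes the
linear differential equation `-L' = N K L`. -/
lemma integral_mul_radialDensity (hN : 1 ≤ N) (hz : z.re ≤ 0) {l : ℝ} (hl : 0 < l)
    (h : 4 * ‖z‖ < l ^ 2) :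
    ∫ B in Set.Ioi (0 : ℝ), Complex.exp (-(l * B)) * (B * radialDensity N z B) =
      N * kernelLaplace N z l * radialLaplace N z l := by
  have h1 := integral_posConvolution (integrableOn_kernelLaplace (N := N) hz hl h)
    (integrableOn_radialDensity (N := N) hz hl) (ContinuousLinearMap.mul ℝ ℂ)
  simp only [ContinuousLinearMap.mul_apply'] at h1
  rw [mul_assoc, kernelLaplace, radialLaplace, ← h1, ← integral_const_mul]
  refine setIntegral_congr_fun measurableSet_Ioi fun B hB => ?_
  rw [← convolution_radialDensity hN z (le_of_lt hB), mul_left_comm, ← intervalIntegral.integral_const_mul]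
  congr 1
  refine intervalIntegral.integral_congr fun y _ => ?_
  rw [show -((l : ℂ) * B) = -(l * y) + -(l * ((B - y : ℝ) : ℂ)) by push_cast; ring, Complex.exp_add]
  ring

/-- If `L(1)` were zero, the equation `L' = -N K L`, with `K` bounded on `[1, ∞)`, would force `L =
0` on all of `[1, ∞)`. But for large `l` the interaction is negligible and `L(l)` is close to
`l^{-N}`. -/
lemma radialLaplace_ne_zero (hN : 1 ≤ N) (hz : z.re ≤ 0) (h : 4 * ‖z‖ < 1) : radialLaplace N z 1 ≠ 0 := by
  intro h0
  set K := ∫ B in Set.Ioi (0 : ℝ), Real.exp (-(1 * B)) * catalanMajorant (‖z‖ * B ^ 2) with hK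
  have hzero : ∀ l : ℝ, 1 ≤ l → radialLaplace N z l = 0 := by
    intro l hl
    refine eq_zero_of_abs_deriv_le_mul_abs_self_of_eq_zero_right (a := 1) (b := l) (K := N * K)
      (f' := fun l => -∫ B in Set.Ioi (0 : ℝ), Complex.exp (-(l * B)) * (B * radialDensity N z B))
      (fun x hx => (hasDerivAt_radialLaplace hz (by linarith [hx.1])).continuousAt.continuousWithinAt)
      (fun x hx => (hasDerivAt_radialLaplace hz (by linarith [hx.1])).hasDerivWithinAt) h0
      (fun x hx => ?_) l ⟨hl, le_rfl⟩
    rw [norm_neg, integral_mul_radialDensity hN hz (by linarith [hx.1]) (by nlinarith [hx.1]), norm_mul,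
      norm_mul, Complex.norm_natCast]
    gcongr
    exact norm_kernelLaplace_le hz h hx.1
  -- Large enough: the error relative to the free value `l^{-N}` is at most `‖z‖ (N + 1)/(2l²)`,
  -- which is less than `1` here.
  set l : ℝ := N + 2 with hl
  have hl1 : 1 ≤ l := by rw [hl]; linarith [N.cast_nonneg (α := ℝ)]
  have hl0 : 0 < l := by linarith
  have h1 := hzero l hl1
  have hmain : ∫ B in Set.Ioi (0 : ℝ), (B : ℂ) ^ (N - 1) * Complex.exp (-(l * B)) = (N - 1).factorial / l ^ N := by
    have := integral_pow_mul_cexp_neg_mul_Ioi (N - 1) (c := (l : ℂ)) (by simpa using hl0)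
    rwa [Nat.sub_add_cancel hN] at this
  have hi1 := integrableOn_pow_mul_cexp_neg_mul (N - 1) (c := (l : ℂ)) (by simpa using hl0)
  have hdiff : ‖radialLaplace N z l - ((N - 1).factorial : ℂ)⁻¹ *
      ∫ B in Set.Ioi (0 : ℝ), (B : ℂ) ^ (N - 1) * Complex.exp (-(l * B))‖ ≤
      ‖z‖ / (2 * N) / (N - 1).factorial * ((N - 1 + 2).factorial / l ^ (N - 1 + 2 + 1)) := by
    rw [radialLaplace, ← integral_const_mul, ← integral_sub (integrableOn_radialDensity hz hl0)
      (hi1.const_mul _), ← integral_pow_mul_exp_neg_mul_Ioi (N - 1 + 2) hl0, ← integral_const_mul]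
    refine norm_integral_le_of_norm_le ((integrableOn_pow_mul_exp_neg_mul (N - 1 + 2) hl0).const_mul _)
      ((ae_restrict_iff' measurableSet_Ioi).2 (ae_of_all _ fun B hB => ?_))
    rw [Set.mem_Ioi] at hB
    have h3 := norm_exp_sub_sum_le (re_div_mul_sq_nonpos hz N B) 1
    simp only [Finset.range_one, Finset.sum_singleton, pow_zero, Nat.factorial_zero, Nat.cast_one, div_one,
      pow_one, Nat.factorial_one] at h3
    have h4 : Complex.exp (-(l * B)) * radialDensity N z B - ((N - 1).factorial : ℂ)⁻¹ *
        ((B : ℂ) ^ (N - 1) * Complex.exp (-(l * B))) = Complex.exp (-(l * B)) *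
        ((B : ℂ) ^ (N - 1) / (N - 1).factorial) * (Complex.exp (z / (2 * N) * (B : ℂ) ^ 2) - 1) := by
      rw [radialDensity]
      ring
    rw [h4, norm_mul, norm_mul, norm_exp_neg_ofReal_mul, norm_div, norm_pow, Complex.norm_real,
      Real.norm_of_nonneg hB.le, Complex.norm_natCast]
    calc _ ≤ Real.exp (-(l * B)) * (B ^ (N - 1) / (N - 1).factorial) * ‖z / (2 * N) * (B : ℂ) ^ 2‖ := by gcongr
      _ = _ := by
        rw [norm_mul, norm_div, norm_mul, norm_pow, Complex.norm_real, Real.norm_of_nonneg hB.le,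
          Complex.norm_natCast, Complex.norm_ofNat, pow_add B]
        ring
  have hfac : ((N - 1).factorial : ℂ) ≠ 0 := by exact_mod_cast (N - 1).factorial_ne_zero
  rw [h1, hmain, zero_sub, norm_neg, show ((N - 1).factorial : ℂ)⁻¹ * ((N - 1).factorial / (l : ℂ) ^ N) =
    ((l ^ N)⁻¹ : ℝ) by push_cast; field_simp, Complex.norm_real, Real.norm_of_nonneg (by positivity),
    show N - 1 + 2 = N - 1 + 1 + 1 from rfl, Nat.factorial_succ, Nat.factorial_succ, Nat.sub_add_cancel hN,
    show N + 1 + 1 = N + 2 from rfl, pow_add] at hdiff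
  have hf : (0 : ℝ) < (N - 1).factorial := by exact_mod_cast (N - 1).factorial_pos
  have hNp : (0 : ℝ) < N := by exact_mod_cast hN
  have hlN : 0 < l ^ N := by positivity
  have : ‖z‖ / (2 * N) / (N - 1).factorial * (((N + 1) * (N * (N - 1).factorial) : ℕ) / (l ^ N * l ^ 2)) =
      (‖z‖ * (N + 1) / (2 * l ^ 2)) * (l ^ N)⁻¹ := by
    push_cast
    field_simp
  rw [this] at hdiff
  have h5 : 1 ≤ ‖z‖ * (N + 1) / (2 * l ^ 2) := by
    by_contra hlt
    push Not at hlt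
    have := mul_lt_mul_of_pos_right hlt (inv_pos.2 hlN)
    linarith
  rw [le_div_iff₀ (by positivity)] at h5
  nlinarith [norm_nonneg z]

lemma pow_mul_weight_eq (N : ℕ) (z : ℂ) (r : ℝ) : ((r ^ (N - 1) : ℝ) : ℂ) *
    (Complex.exp (-(r : ℂ) + z / (2 * N) * (r : ℂ) ^ 2) / (Real.pi : ℂ) ^ N) =
      ((N - 1).factorial / (Real.pi : ℂ) ^ N) * (Complex.exp (-(((1 : ℝ) : ℂ) * r)) * radialDensity N z r) := by
  have hfac : ((N - 1).factorial : ℂ) ≠ 0 := by exact_mod_cast (N - 1).factorial_ne_zero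
  rw [radialDensity, Complex.exp_add]
  push_cast
  field_simp

lemma integrable_weight (hN : 1 ≤ N) (hz : z.re ≤ 0) : Integrable (weight N z) := by
  refine (integrable_sqNorm_iff hN fun r => Complex.exp (-(r : ℂ) + z / (2 * N) * (r : ℂ) ^ 2) /
    (Real.pi : ℂ) ^ N).2 ?_
  simp_rw [pow_mul_weight_eq]
  exact (integrableOn_radialDensity hz one_pos).const_mul _

lemma pow_mul_sq_weight_eq (N : ℕ) (z : ℂ) (r : ℝ) : ((r ^ (N - 1) : ℝ) : ℂ) * ((r : ℂ) / N *
    (Complex.exp (-(r : ℂ) + z / (2 * N) * (r : ℂ) ^ 2) / (Real.pi : ℂ) ^ N)) =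
      ((N - 1).factorial / (Real.pi : ℂ) ^ N / N) *
        (Complex.exp (-(((1 : ℝ) : ℂ) * r)) * (r * radialDensity N z r)) := by
  rw [mul_left_comm, pow_mul_weight_eq]
  ring

lemma integrable_sqNorm_mul_weight (hN : 1 ≤ N) (hz : z.re ≤ 0) :
    Integrable (fun φ : Fin N → ℂ => (sqNorm φ : ℂ) / (N : ℂ) * weight N z φ) := by
  refine (integrable_sqNorm_iff hN fun r => (r : ℂ) / N * (Complex.exp (-(r : ℂ) + z / (2 * N) *
    (r : ℂ) ^ 2) / (Real.pi : ℂ) ^ N)).2 ?_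
  simp_rw [pow_mul_sq_weight_eq]
  have h := integrableOn_pow_mul_radialDensity (N := N) hz 1 one_pos
  simp only [pow_one] at h
  exact h.const_mul _

lemma partitionFunction_eq (hN : 1 ≤ N) (z : ℂ) : partitionFunction N z = radialLaplace N z 1 := by
  have h := integral_sqNorm hN fun r => Complex.exp (-(r : ℂ) + z / (2 * N) * (r : ℂ) ^ 2) /
    (Real.pi : ℂ) ^ N
  simp_rw [pow_mul_weight_eq] at h
  rw [integral_const_mul] at h
  have hfac : ((N - 1).factorial : ℂ) ≠ 0 := by exact_mod_cast (N - 1).factorial_ne_zero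
  have hpi : (Real.pi : ℂ) ≠ 0 := by exact_mod_cast Real.pi_pos.ne'
  refine h.trans ?_
  rw [radialLaplace]
  push_cast
  field_simp

lemma integral_sqNorm_mul_weight (hN : 1 ≤ N) (z : ℂ) :
    ∫ φ : Fin N → ℂ, (sqNorm φ : ℂ) / (N : ℂ) * weight N z φ =
      (N : ℂ)⁻¹ * ∫ B in Set.Ioi (0 : ℝ), Complex.exp (-(((1 : ℝ) : ℂ) * B)) * (B * radialDensity N z B) := by
  have h := integral_sqNorm hN fun r => (r : ℂ) / N * (Complex.exp (-(r : ℂ) + z / (2 * N) *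
    (r : ℂ) ^ 2) / (Real.pi : ℂ) ^ N)
  simp_rw [pow_mul_sq_weight_eq] at h
  rw [integral_const_mul] at h
  have hfac : ((N - 1).factorial : ℂ) ≠ 0 := by exact_mod_cast (N - 1).factorial_ne_zero
  have hpi : (Real.pi : ℂ) ≠ 0 := by exact_mod_cast Real.pi_pos.ne'
  refine h.trans ?_
  push_cast
  field_simp

lemma partitionFunction_ne_zero (hN : 1 ≤ N) (hz : z.re ≤ 0) (h : 4 * ‖z‖ < 1) :
    partitionFunction N z ≠ 0 := by
  rw [partitionFunction_eq hN]
  exact radialLaplace_ne_zero hN hz h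

lemma twoPoint_eq (hN : 1 ≤ N) (hz : z.re ≤ 0) (h : 4 * ‖z‖ < 1) :
    twoPoint N z = kernelLaplace N z 1 := by
  have h0 := radialLaplace_ne_zero hN hz h
  have hN0 := natCast_ne_zero_of_one_le hN
  rw [twoPoint, partitionFunction_eq hN, integral_sqNorm_mul_weight hN,
    integral_mul_radialDensity hN hz one_pos (by simpa using h)]
  field_simp

lemma kernelLaplace_eq_rayIntegral (N : ℕ) (z : ℂ) : kernelLaplace N z 1 = rayIntegral (N : ℝ)⁻¹ 0 z := by
  refine integral_congr_ae (ae_of_all _ fun s => ?_)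
  simp [rayIntegrand]

lemma continuation_eq_twoPoint (hN : 1 ≤ N) {u : ℂ} (hu : |u.im| ≤ Real.pi / 2) (h : 4 * ‖zOf u‖ < 1) :
    continuation N u = twoPoint N (zOf u) := by
  have hv : ValidAngle u 0 := ⟨by simpa using Real.pi_pos, by simpa using hu, by simpa using h⟩
  have hre := re_nonpos_of_abs_le hv.2.1 zero_le_one
  rw [continuation_eq N hv, ← kernelLaplace_eq_rayIntegral, twoPoint_eq hN (by simpa using hre) h]

end TwoPoint

end NVector

namespace NVector

/-! ### Taylor estimates -/

section Taylor

variable {N : ℕ} {z : ℂ}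

lemma tsum_ite_lt_eq (p : ℕ) (f : ℕ → ℝ) : ∑' n, (if n < p then 0 else f n) = ∑' n, f (n + p) := by
  rw [← (add_left_injective p).tsum_eq (f := fun n => if n < p then 0 else f n)]
  · exact tsum_congr fun n => by simp
  · intro n hn
    rw [Function.mem_support] at hn
    have : p ≤ n := by
      by_contra h
      exact hn (if_pos (not_le.1 h))
    exact ⟨n - p, Nat.sub_add_cancel this⟩

/-- The Catalan numbers with the first `p` of them removed. -/
noncomputable def catalanTail (p n : ℕ) : ℝ := if n < p then 0 else catalan n

lemma catalanTail_nonneg (p n : ℕ) : 0 ≤ catalanTail p n := by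
  unfold catalanTail; split_ifs <;> positivity

lemma catalanTail_le (p n : ℕ) : catalanTail p n ≤ 4 ^ n := by
  unfold catalanTail
  split_ifs
  · positivity
  · exact catalan_le_four_pow' n

lemma tsum_catalanTail (p : ℕ) (y : ℝ) : ∑' n, catalanTail p n * (y ^ n / (2 * n).factorial) =
    ∑' n, (catalan (n + p) : ℝ) * (y ^ (n + p) / (2 * (n + p)).factorial) := by
  rw [← tsum_ite_lt_eq p fun n => (catalan n : ℝ) * (y ^ n / (2 * n).factorial)]
  refine tsum_congr fun n => ?_
  rw [catalanTail]
  split_ifs <;> simp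

lemma tsum_catalanTail_mul_pow_le (p : ℕ) {r : ℝ} (h0 : 0 ≤ r) (h : 16 * r < 1) :
    ∑' n, catalanTail p n * r ^ n / 1 ^ (2 * n + 1) ≤ 2 * 4 ^ p * r ^ p := by
  have h1 : ∀ n, catalanTail p n * r ^ n / 1 ^ (2 * n + 1) = if n < p then 0 else (catalan n : ℝ) * r ^ n := by
    intro n
    rw [catalanTail, one_pow, div_one]
    split_ifs <;> simp
  simp_rw [h1]
  rw [tsum_ite_lt_eq p fun n => (catalan n : ℝ) * r ^ n]
  have h2 := (hasSum_geometric_of_lt_one (show 0 ≤ 4 * r by positivity) (by linarith)).mul_left ((4 * r) ^ p)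
  have h3 : ∀ n, (catalan (n + p) : ℝ) * r ^ (n + p) ≤ (4 * r) ^ p * (4 * r) ^ n := by
    intro n
    rw [← pow_add, add_comm p n, mul_pow]
    gcongr
    exact catalan_le_four_pow' _
  refine (Summable.tsum_le_of_sum_le (Summable.of_nonneg_of_le (fun n => by positivity) h3 h2.summable)
    fun s => (Finset.sum_le_sum fun n _ => h3 n).trans
      (h2.summable.sum_le_tsum s fun n _ => by positivity)).trans ?_
  rw [h2.tsum_eq, mul_pow]
  have h4 : (1 - 4 * r)⁻¹ ≤ 2 := by
    rw [inv_le_comm₀ (by linarith) (by norm_num)]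
    linarith
  calc _ ≤ 4 ^ p * r ^ p * 2 := by gcongr
    _ = _ := by ring

lemma integral_exp_mul_seriesKernel_term (a : ℂ) (z : ℂ) (q : ℕ) :
    IntegrableOn (fun B : ℝ => Complex.exp (-(((1 : ℝ) : ℂ) * B)) *
      (a * ((z * ((B ^ 2 : ℝ) : ℂ)) ^ q / (2 * q).factorial))) (Set.Ioi 0) ∧
    ∫ B in Set.Ioi (0 : ℝ), Complex.exp (-(((1 : ℝ) : ℂ) * B)) *
      (a * ((z * ((B ^ 2 : ℝ) : ℂ)) ^ q / (2 * q).factorial)) = a * z ^ q := by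
  have h : ∀ B : ℝ, Complex.exp (-(((1 : ℝ) : ℂ) * B)) *
      (a * ((z * ((B ^ 2 : ℝ) : ℂ)) ^ q / (2 * q).factorial)) =
      (a * z ^ q / (2 * q).factorial) * ((B : ℂ) ^ (2 * q) * Complex.exp (-(((1 : ℝ) : ℂ) * B))) := by
    intro B
    push_cast
    rw [mul_pow, ← pow_mul]
    ring
  simp_rw [h]
  have hc : 0 < (((1 : ℝ) : ℂ)).re := by simp
  refine ⟨(integrableOn_pow_mul_cexp_neg_mul (2 * q) hc).const_mul _, ?_⟩
  rw [integral_const_mul, integral_pow_mul_cexp_neg_mul_Ioi (2 * q) hc]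
  have : ((2 * q).factorial : ℂ) ≠ 0 := by exact_mod_cast (2 * q).factorial_ne_zero
  simp only [Complex.ofReal_one, one_pow, div_one]
  field_simp

/-- The pointwise bound `norm_seriesKernel_sub_le` is integrated against `e^{-B}`, which removes the
`1/(2q)!`. With `16‖z‖ < 1` the Catalan tail sums to at most `2 (4‖z‖)^p`. -/
lemma norm_kernelLaplace_sub_le (N : ℕ) (hz : z.re ≤ 0) (h : 16 * ‖z‖ < 1) (p : ℕ) :
    ‖kernelLaplace N z 1 - ∑ q ∈ Finset.range p, seriesCoeff (((N : ℝ)⁻¹ : ℝ) : ℂ) q * z ^ q‖ ≤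
      (3 ^ p * p.factorial + 2 * 4 ^ p) * ‖z‖ ^ p := by
  have h4 : 4 * ‖z‖ < 1 ^ 2 := by linarith [norm_nonneg z]
  have hterm := fun q => integral_exp_mul_seriesKernel_term (seriesCoeff (((N : ℝ)⁻¹ : ℝ) : ℂ) q) z q
  have hsum := integral_finsetSum (μ := volume.restrict (Set.Ioi (0 : ℝ))) (Finset.range p)
    (fun q _ => (hterm q).1)
  have hmaj := hasSum_laplace_even_majorant (catalanTail_nonneg p) (catalanTail_le p) (norm_nonneg z) one_pos h4
  have hmajI := integrableOn_even_majorant (catalanTail_nonneg p) (catalanTail_le p) (norm_nonneg z) one_pos h4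
  have hE := integral_exp_mul_even_term p (3 ^ p * p.factorial) ‖z‖ one_pos
  have hEI : IntegrableOn (fun t : ℝ => Real.exp (-(1 * t)) *
      ((3 ^ p * p.factorial : ℝ) * ((‖z‖ * t ^ 2) ^ p / (2 * p).factorial))) (Set.Ioi 0) := by
    refine ((integrableOn_pow_mul_exp_neg_mul (2 * p) one_pos).const_mul
      ((3 ^ p * p.factorial : ℝ) * ‖z‖ ^ p / (2 * p).factorial)).congr (ae_of_all _ fun t => ?_)
    simp only
    rw [mul_pow, ← pow_mul]
    ring
  have hb : (3 ^ p * p.factorial * ‖z‖ ^ p / 1 ^ (2 * p + 1) + ∑' n, catalanTail p n * ‖z‖ ^ n / 1 ^ (2 * n + 1)) ≤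
      (3 ^ p * p.factorial + 2 * 4 ^ p) * ‖z‖ ^ p := by
    have := tsum_catalanTail_mul_pow_le p (norm_nonneg z) h
    rw [one_pow, div_one, add_mul]
    gcongr
  refine le_trans ?_ hb
  rw [hmaj.tsum_eq, ← hE, ← integral_add hEI hmajI, ← Finset.sum_congr rfl fun q _ => (hterm q).2, ← hsum,
    kernelLaplace, ← integral_sub (integrableOn_kernelLaplace hz one_pos h4)
      (integrable_finsetSum _ fun q _ => (hterm q).1)]
  refine norm_integral_le_of_norm_le (hEI.add hmajI) (ae_of_all _ fun B => ?_)
  have h1 := norm_seriesKernel_sub_le (inv_natCast_mem_Icc N) (z := z) (by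
    rw [Complex.re_mul_ofReal]
    exact mul_nonpos_of_nonpos_of_nonneg hz (by positivity)) (sq_nonneg B) p
  rw [← Finset.mul_sum, ← Complex.ofReal_pow, ← mul_sub, norm_mul, norm_exp_neg_ofReal_mul,
    tsum_catalanTail, ← mul_add]
  gcongr

lemma norm_twoPoint_sub_le (hN : 1 ≤ N) (hz : z.re ≤ 0) (h : 16 * ‖z‖ < 1) (p : ℕ) :
    ‖twoPoint N z - ∑ q ∈ Finset.range p, perturbativeCoeff N q * z ^ q‖ ≤
      (3 ^ p * p.factorial + 2 * 4 ^ p) * ‖z‖ ^ p := by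
  rw [twoPoint_eq hN hz (by linarith [norm_nonneg z])]
  simp_rw [perturbativeCoeff_eq hN]
  exact norm_kernelLaplace_sub_le N hz h p

lemma taylor_constant_le (p : ℕ) : (3 ^ p * p.factorial + 2 * 4 ^ p : ℝ) ≤ 3 * 12 ^ p * p.factorial := by
  have h1 : (1 : ℝ) ≤ p.factorial := by exact_mod_cast p.factorial_pos
  have h2 : (3 : ℝ) ^ p ≤ 12 ^ p := pow_le_pow_left₀ (by norm_num) (by norm_num) p
  have h3 : (4 : ℝ) ^ p ≤ 12 ^ p := pow_le_pow_left₀ (by norm_num) (by norm_num) p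
  have h4 : (4 : ℝ) ^ p ≤ 12 ^ p * p.factorial := h3.trans (le_mul_of_one_le_right (by positivity) h1)
  have h5 : (3 : ℝ) ^ p * p.factorial ≤ 12 ^ p * p.factorial := by gcongr
  linarith

lemma taylor_constant_le' {p : ℕ} (hp : 1 ≤ p) : (3 ^ p * p.factorial + 2 * 4 ^ p : ℝ) ≤ 36 ^ p * p.factorial := by
  refine (taylor_constant_le p).trans ?_
  -- This is where `p ≥ 1` matters: the prefactor `3` is absorbed into the base, `36 = 3 · 12`.
  have h : (3 : ℝ) ≤ 3 ^ p := le_self_pow₀ (by norm_num) (by omega)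
  calc (3 * 12 ^ p * p.factorial : ℝ) ≤ 3 ^ p * 12 ^ p * p.factorial := by gcongr
    _ = _ := by rw [← mul_pow]; norm_num

lemma isOpen_borelDisk {R : ℝ} (hR : 0 < R) : IsOpen (borelDisk R) := by
  -- The disk in a form that is visibly open. The convention `0⁻¹ = 0` keeps the origin out of
  -- `borelDisk R`, and it satisfies neither inequality.
  have h : borelDisk R = {x : ℂ | ‖x‖ ^ 2 < R * x.re} := by
    ext x
    simp only [borelDisk, Set.mem_ofPred_eq, Complex.inv_re, ← Complex.normSq_eq_norm_sq]
    rcases eq_or_ne x 0 with rfl | hx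
    · simp [hR.le]
    · rw [lt_div_iff₀ (Complex.normSq_pos.2 hx), inv_mul_lt_iff₀ hR]
  rw [h]
  exact isOpen_lt (by fun_prop) (by fun_prop)

lemma re_pos_of_mem_borelDisk {R : ℝ} (hR : 0 < R) {x : ℂ} (hx : x ∈ borelDisk R) : 0 < x.re := by
  have h : 0 < (x⁻¹).re := (inv_pos.2 hR).trans hx
  rw [Complex.inv_re] at h
  by_contra h2
  exact absurd h (not_lt.2 (div_nonpos_of_nonpos_of_nonneg (not_lt.1 h2) (Complex.normSq_nonneg x)))

lemma norm_lt_of_mem_borelDisk {R : ℝ} (hR : 0 < R) {x : ℂ} (hx : x ∈ borelDisk R) : ‖x‖ < R := by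
  have h : R⁻¹ < ‖x‖⁻¹ := by
    rw [← norm_inv]
    exact lt_of_lt_of_le hx (Complex.re_le_norm _)
  have hx0 : x ≠ 0 := by
    rintro rfl
    simpa using re_pos_of_mem_borelDisk hR hx
  exact (inv_lt_inv₀ hR (norm_pos_iff.2 hx0)).1 h

lemma analyticOnNhd_twoPoint_neg (hN : 1 ≤ N) :
    AnalyticOnNhd ℂ (fun x => twoPoint N (-x)) (borelDisk (1 / 16)) := by
  have hR : (0 : ℝ) < 1 / 16 := by norm_num
  refine DifferentiableOn.analyticOnNhd (fun x hx => ?_) (isOpen_borelDisk hR)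
  have h1 : ∀ y ∈ borelDisk (1 / 16), twoPoint N (-y) = rayIntegral (N : ℝ)⁻¹ 0 (-y) := by
    intro y hy
    have := re_pos_of_mem_borelDisk hR hy
    have := norm_lt_of_mem_borelDisk hR hy
    rw [twoPoint_eq hN (by simp; linarith) (by rw [norm_neg]; linarith), kernelLaplace_eq_rayIntegral]
  have h2 := re_pos_of_mem_borelDisk hR hx
  have h3 := norm_lt_of_mem_borelDisk hR hx
  have h4 : DifferentiableAt ℂ (rayIntegral (N : ℝ)⁻¹ 0) (-x) :=
    differentiableAt_rayIntegral (inv_natCast_mem_Icc N) (by simp) (by simpa using h2)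
      (by rw [norm_neg, Real.cos_zero]; linarith)
  exact (DifferentiableAt.comp (g := rayIntegral (N : ℝ)⁻¹ 0) x h4 differentiableAt_id.neg).differentiableWithinAt.congr
    h1 (h1 x hx)

lemma borelSummable_twoPoint (hN : 1 ≤ N) : BorelSummable (1 / 16) 3 12 (fun x => twoPoint N (-x))
    (fun k => (-1) ^ k * perturbativeCoeff N k) := by
  refine ⟨analyticOnNhd_twoPoint_neg hN, fun p x hx => ?_⟩
  have hR : (0 : ℝ) < 1 / 16 := by norm_num
  have h2 := re_pos_of_mem_borelDisk hR hx
  have h3 := norm_lt_of_mem_borelDisk hR hx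
  have h := norm_twoPoint_sub_le hN (z := -x) (by simpa using h2.le) (by rw [norm_neg]; linarith) p
  rw [norm_neg] at h
  have h5 : ∀ k, (-1) ^ k * perturbativeCoeff N k * x ^ k = perturbativeCoeff N k * (-x) ^ k := fun k => by
    rw [neg_pow x]; ring
  simp_rw [h5]
  refine h.trans ?_
  gcongr
  exact taylor_constant_le p

end Taylor

end NVector

namespace NVector

/-! ### The exponential law as a mixture of Gaussian laws -/

/-- The standard exponential law. -/
noncomputable def expLaw : Measure ℝ :=
  (volume.restrict (Set.Ioi 0)).withDensity fun τ => ENNReal.ofReal (Real.exp (-τ))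

/-- The standard Gaussian law. -/
noncomputable abbrev stdGauss : Measure ℝ := ProbabilityTheory.gaussianReal 0 1

lemma integral_expLaw (f : ℝ → ℂ) :
    ∫ τ, f τ ∂expLaw = ∫ τ in Set.Ioi (0 : ℝ), Complex.exp (-(((1 : ℝ) : ℂ) * τ)) * f τ := by
  rw [expLaw, integral_withDensity_eq_integral_toReal_smul (by fun_prop)
    (ae_of_all _ fun _ => ENNReal.ofReal_lt_top)]
  refine integral_congr_ae (ae_of_all _ fun τ => ?_)
  simp only
  rw [ENNReal.toReal_ofReal (Real.exp_pos _).le, Complex.real_smul, Complex.ofReal_exp]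
  simp

lemma integrable_expLaw_iff {f : ℝ → ℂ} : Integrable f expLaw ↔
    IntegrableOn (fun τ : ℝ => Complex.exp (-(((1 : ℝ) : ℂ) * τ)) * f τ) (Set.Ioi 0) := by
  rw [expLaw, integrable_withDensity_iff_integrable_smul' (by fun_prop)
    (ae_of_all _ fun _ => ENNReal.ofReal_lt_top)]
  refine integrable_congr (ae_of_all _ fun τ => ?_)
  simp only
  rw [ENNReal.toReal_ofReal (Real.exp_pos _).le, Complex.real_smul, Complex.ofReal_exp]
  simp

instance isFiniteMeasure_expLaw : IsFiniteMeasure expLaw := by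
  have h : Integrable (fun _ : ℝ => (1 : ℂ)) expLaw := by
    rw [integrable_expLaw_iff]
    simpa using integrableOn_pow_mul_cexp_neg_mul 0 (c := 1) (by simp)
  exact (integrable_const_iff_isFiniteMeasure one_ne_zero).1 h

lemma ae_pos_expLaw : ∀ᵐ τ ∂expLaw, 0 < τ :=
  (withDensity_absolutelyContinuous _ _).ae_le ((ae_restrict_iff' measurableSet_Ioi).2
    (ae_of_all _ fun _ h => h))

lemma integral_cexp_expLaw {c : ℂ} (hc : -1 < c.re) : ∫ τ : ℝ, Complex.exp (-(c * τ)) ∂expLaw = 1 / (1 + c) := by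
  rw [integral_expLaw]
  have h := integral_pow_mul_cexp_neg_mul_Ioi 0 (c := 1 + c) (by simp; linarith)
  simp only [pow_zero, one_mul, Nat.factorial_zero, Nat.cast_one, zero_add, pow_one] at h
  rw [← h]
  refine integral_congr_ae (ae_of_all _ fun τ => ?_)
  simp only
  rw [← Complex.exp_add]
  congr 1
  push_cast
  ring

/-- The random variable `√(2τ) v`. -/
noncomputable def mixture (p : ℝ × ℝ) : ℝ := Real.sqrt 2 * p.1 * Real.sqrt p.2

lemma measurable_mixture : Measurable mixture := by unfold mixture; fun_prop

/-- Given `τ`, the variable is Gaussian of variance `2τ`, with characteristic function `e^{-ξ²τ}`;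
averaging over the exponential law yields `1/(1 + ξ²)`. -/
lemma charFun_mixture (ξ : ℝ) :
    charFun ((stdGauss.prod expLaw).map mixture) ξ = 1 / (1 + (ξ : ℂ) ^ 2) := by
  have hm := measurable_mixture
  rw [charFun_apply_real, integral_map hm.aemeasurable (Continuous.aestronglyMeasurable (by fun_prop)),
    integral_prod_symm]
  · rw [← integral_cexp_expLaw (c := (ξ : ℂ) ^ 2) (by
      rw [← Complex.ofReal_pow, Complex.ofReal_re]; nlinarith [sq_nonneg ξ])]
    refine integral_congr_ae (ae_pos_expLaw.mono fun τ hτ => ?_)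
    simp only
    have h := ProbabilityTheory.charFun_gaussianReal (μ := 0) (v := 1) (ξ * Real.sqrt 2 * Real.sqrt τ)
    rw [charFun_apply_real] at h
    have h2 : ∀ v : ℝ, Complex.exp (ξ * ((mixture (v, τ) : ℝ) : ℂ) * Complex.I) =
        Complex.exp (((ξ * Real.sqrt 2 * Real.sqrt τ : ℝ) : ℂ) * v * Complex.I) := fun v => by
      rw [mixture]
      congr 1
      push_cast
      ring
    simp_rw [h2]
    rw [h]
    congr 1
    have h3 : ((ξ * Real.sqrt 2 * Real.sqrt τ : ℝ) : ℂ) ^ 2 = ((ξ ^ 2 * 2 * τ : ℝ) : ℂ) := by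
      rw [← Complex.ofReal_pow, mul_pow, mul_pow, Real.sq_sqrt (by norm_num), Real.sq_sqrt hτ.le]
    rw [h3]
    push_cast
    ring
  · refine Integrable.of_bound (Measurable.aestronglyMeasurable (by fun_prop)) 1 (ae_of_all _ fun p => ?_)
    rw [← Complex.ofReal_mul, Complex.norm_exp_ofReal_mul_I]

lemma integrable_cexp_mul_I (μ : Measure ℝ) [IsFiniteMeasure μ] (ξ : ℝ) :
    Integrable (fun x : ℝ => Complex.exp (ξ * x * Complex.I)) μ := by
  refine Integrable.of_bound (Continuous.aestronglyMeasurable (by fun_prop)) 1 (ae_of_all _ fun x => ?_)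
  rw [← Complex.ofReal_mul, Complex.norm_exp_ofReal_mul_I]

/-- Comparison of characteristic functions: `2/(1 + ξ²) = 1/(1 - iξ) + 1/(1 + iξ)`. The mixture is
the symmetrised exponential law, so even functions do not distinguish it from the exponential law
itself. -/
lemma map_mixture_add_self : (stdGauss.prod expLaw).map mixture + (stdGauss.prod expLaw).map mixture =
    expLaw + expLaw.map fun x => -x := by
  refine Measure.ext_of_charFun ?_
  funext ξ
  have h := charFun_mixture ξ
  rw [charFun_apply_real] at h
  rw [charFun_apply_real, charFun_apply_real,
    integral_add_measure (integrable_cexp_mul_I _ _) (integrable_cexp_mul_I _ _),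
    integral_add_measure (integrable_cexp_mul_I _ _) (integrable_cexp_mul_I _ _), h,
    integral_map (by fun_prop) (Continuous.aestronglyMeasurable (by fun_prop))]
  have h1 := integral_cexp_expLaw (c := -(ξ * Complex.I)) (by simp)
  have h2 := integral_cexp_expLaw (c := ξ * Complex.I) (by simp)
  have e1 : ∀ τ : ℝ, Complex.exp (ξ * τ * Complex.I) = Complex.exp (-(-(ξ * Complex.I) * τ)) := fun τ => by
    congr 1; ring
  have e2 : ∀ τ : ℝ, Complex.exp (ξ * ((-τ : ℝ) : ℂ) * Complex.I) = Complex.exp (-((ξ * Complex.I) * τ)) :=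
    fun τ => by congr 1; push_cast; ring
  simp_rw [e2, e1]
  rw [h1, h2]
  have n1 : (1 : ℂ) + -(ξ * Complex.I) ≠ 0 := fun h => by simpa using congrArg Complex.re h
  have n2 : (1 : ℂ) + ξ * Complex.I ≠ 0 := fun h => by simpa using congrArg Complex.re h
  have n3 : (1 : ℂ) + (ξ : ℂ) ^ 2 ≠ 0 := fun h => by
    have := congrArg Complex.re h
    rw [← Complex.ofReal_pow, Complex.add_re, Complex.ofReal_re] at this
    simp at this
    nlinarith [sq_nonneg ξ]
  have h4 : (1 : ℂ) + (ξ : ℂ) ^ 2 = (1 + -(ξ * Complex.I)) * (1 + ξ * Complex.I) := by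
    linear_combination ((ξ : ℂ) ^ 2) * Complex.I_sq
  rw [h4]
  field_simp
  ring

lemma integrable_map_neg {g : ℝ → ℂ} (hg : Continuous g) (he : ∀ x, g (-x) = g x)
    (h : Integrable g expLaw) : Integrable g (expLaw.map fun x => -x) := by
  rw [integrable_map_measure hg.aestronglyMeasurable (by fun_prop)]
  exact h.congr (ae_of_all _ fun x => (he x).symm)

/-- Even functions have the same integral for the exponential law and for the Gaussian mixture. -/
lemma integrable_comp_mixture {g : ℝ → ℂ} (hg : Continuous g) (he : ∀ x, g (-x) = g x)
    (h : Integrable g expLaw) : Integrable (fun p => g (mixture p)) (stdGauss.prod expLaw) := by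
  have h1 : Integrable g ((stdGauss.prod expLaw).map mixture + (stdGauss.prod expLaw).map mixture) := by
    rw [map_mixture_add_self]
    exact h.add_measure (integrable_map_neg hg he h)
  exact (integrable_map_measure hg.aestronglyMeasurable measurable_mixture.aemeasurable).1
    h1.left_of_add_measure

lemma integral_comp_mixture {g : ℝ → ℂ} (hg : Continuous g) (he : ∀ x, g (-x) = g x)
    (h : Integrable g expLaw) : ∫ p, g (mixture p) ∂(stdGauss.prod expLaw) = ∫ x, g x ∂expLaw := by
  have hm : Integrable g ((stdGauss.prod expLaw).map mixture) :=
    (integrable_map_measure hg.aestronglyMeasurable measurable_mixture.aemeasurable).2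
      (integrable_comp_mixture hg he h)
  have h1 : ∫ x, g x ∂((stdGauss.prod expLaw).map mixture + (stdGauss.prod expLaw).map mixture) =
      ∫ x, g x ∂(expLaw + expLaw.map fun x => -x) := by rw [map_mixture_add_self]
  rw [integral_add_measure hm hm, integral_add_measure h (integrable_map_neg hg he h),
    integral_map measurable_mixture.aemeasurable hg.aestronglyMeasurable,
    integral_map (by fun_prop) hg.aestronglyMeasurable] at h1
  simp_rw [he] at h1
  linear_combination h1 / 2

/-- Testing the mixture identity on `x^{2k}` gives `(2k)! = 2^k k! 𝔼 v^{2k}`. -/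
lemma integral_pow_stdGauss (k : ℕ) :
    ∫ v : ℝ, (v : ℂ) ^ (2 * k) ∂stdGauss = (2 * k).factorial / (2 ^ k * k.factorial) := by
  have hpow : ∀ n : ℕ, Integrable (fun x : ℝ => (x : ℂ) ^ n) expLaw ∧
      ∫ x : ℝ, (x : ℂ) ^ n ∂expLaw = n.factorial := by
    intro n
    have h := integral_pow_mul_cexp_neg_mul_Ioi n (c := ((1 : ℝ) : ℂ)) (by simp)
    have h' := integrableOn_pow_mul_cexp_neg_mul n (c := ((1 : ℝ) : ℂ)) (by simp)
    rw [integral_expLaw, integrable_expLaw_iff]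
    simp_rw [mul_comm (Complex.exp _)]
    exact ⟨h', by rw [h]; simp⟩
  have h := integral_comp_mixture (g := fun x => (x : ℂ) ^ (2 * k)) (by fun_prop)
    (fun x => by push_cast; rw [Even.neg_pow (even_two_mul k)]) (hpow _).1
  rw [(hpow _).2] at h
  have h2 : ∫ p, ((mixture p : ℝ) : ℂ) ^ (2 * k) ∂(stdGauss.prod expLaw) =
      ∫ p : ℝ × ℝ, (2 ^ k * (p.1 : ℂ) ^ (2 * k)) * (p.2 : ℂ) ^ k ∂(stdGauss.prod expLaw) := by
    refine integral_congr_ae ?_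
    have hae : ∀ᵐ p ∂(stdGauss.prod expLaw), 0 < p.2 :=
      (Measure.ae_prod_iff_ae_ae (measurableSet_lt (by fun_prop) (by fun_prop))).2
        (ae_of_all _ fun _ => ae_pos_expLaw)
    refine hae.mono fun p hp => ?_
    simp only
    rw [mixture, ← Complex.ofReal_pow, mul_pow, mul_pow, pow_mul, pow_mul (Real.sqrt p.2),
      Real.sq_sqrt (by norm_num), Real.sq_sqrt hp.le]
    push_cast
    ring
  rw [h2, integral_prod_mul (fun v : ℝ => 2 ^ k * (v : ℂ) ^ (2 * k)) (fun τ : ℝ => (τ : ℂ) ^ k), (hpow k).2,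
    integral_const_mul] at h
  rw [← h]
  have : (k.factorial : ℂ) ≠ 0 := by exact_mod_cast k.factorial_ne_zero
  field_simp

lemma integrable_exp_sq_stdGauss : Integrable (fun v : ℝ => Real.exp (v ^ 2 / 4)) stdGauss := by
  rw [stdGauss, ProbabilityTheory.gaussianReal_of_var_ne_zero _ one_ne_zero,
    integrable_withDensity_iff_integrable_smul' (ProbabilityTheory.measurable_gaussianPDF _ _)
    (ae_of_all _ fun _ => ProbabilityTheory.gaussianPDF_lt_top)]
  refine ((integrable_exp_neg_mul_sq (b := 1 / 4) (by norm_num)).const_mul (Real.sqrt (2 * Real.pi))⁻¹).congr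
    (ae_of_all _ fun v => ?_)
  simp only
  rw [ProbabilityTheory.toReal_gaussianPDF, ProbabilityTheory.gaussianPDFReal, smul_eq_mul, mul_assoc,
    ← Real.exp_add]
  simp only [NNReal.coe_one, mul_one, sub_zero]
  congr 2
  ring

end NVector

namespace NVector

/-- Two holomorphic functions on a connected open set which agree on a real half-interval are equal. -/
lemma eqOn_of_eq_ofReal {f g : ℂ → ℂ} {U : Set ℂ} (hf : AnalyticOnNhd ℂ f U) (hg : AnalyticOnNhd ℂ g U)
    (hU : IsPreconnected U) {r : ℝ} (hr : (r : ℂ) ∈ U) (h : ∀ᶠ s : ℝ in 𝓝[>] r, f s = g s) :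
    Set.EqOn f g U := by
  refine hf.eqOn_of_preconnected_of_frequently_eq hg hU hr ?_
  have ht : Tendsto (fun s : ℝ => (s : ℂ)) (𝓝[>] r) (𝓝[≠] (r : ℂ)) := by
    refine tendsto_nhdsWithin_iff.2 ⟨?_, ?_⟩
    · exact (Complex.continuous_ofReal.tendsto r).mono_left nhdsWithin_le_nhds
    · filter_upwards [self_mem_nhdsWithin] with s hs
      rw [Set.mem_compl_singleton_iff]
      exact_mod_cast (ne_of_gt hs)
  exact ht.frequently h.frequently

/-! ### The Borel transform -/

section Borel

variable {N : ℕ}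

/-- The Borel transform of the two-point function (in the variable `x = -z`). -/
noncomputable def borelTransform (N : ℕ) (t : ℂ) : ℂ :=
  ∫ v : ℝ, seriesKernel (N : ℝ)⁻¹ (-t * ((2 * v ^ 2 : ℝ) : ℂ)) ∂stdGauss

/-- The kernel is at most `exp(2√(2‖t‖) |v|)`, and `2√(2‖t‖) |v| ≤ 8‖t‖ + v²/4` by completing a
square. The coefficient `1/4` is below the `1/2` of the Gaussian density. -/
lemma norm_seriesKernel_le_exp_sq {N : ℕ} {t : ℂ} (ht : 0 ≤ t.re) (v : ℝ) :
    ‖seriesKernel (N : ℝ)⁻¹ (-t * ((2 * v ^ 2 : ℝ) : ℂ))‖ ≤ Real.exp (8 * ‖t‖) * Real.exp (v ^ 2 / 4) := by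
  have h1 := norm_seriesKernel_le (inv_natCast_mem_Icc N) (z := -t) (u := 2 * v ^ 2) (by
    rw [Complex.re_mul_ofReal]
    exact mul_nonpos_of_nonpos_of_nonneg (by simpa using ht) (by positivity)) (by positivity)
  have h2 := even_majorant_le_exp catalan_nonneg' catalan_le_four_pow' (a := 2 * ‖t‖) (t := |v|)
    (by positivity) (abs_nonneg v)
  rw [norm_neg, show ‖t‖ * (2 * v ^ 2) = 2 * ‖t‖ * |v| ^ 2 by rw [sq_abs]; ring] at h1
  refine h1.trans (h2.trans ?_)
  rw [← Real.exp_add]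
  refine Real.exp_le_exp.2 ?_
  have h3 := Real.sq_sqrt (show 0 ≤ 2 * ‖t‖ by positivity)
  nlinarith [sq_nonneg (|v| / 2 - 2 * Real.sqrt (2 * ‖t‖)), sq_abs v]

/-- No sign condition on `t` near the origin, so the factorial bound `3^k k!` is used instead; the
radius `1/24` is chosen so that `3 · 2/24 = 1/4`. -/
lemma norm_seriesKernel_term_le (N k : ℕ) {t : ℂ} (ht : ‖t‖ < 1 / 24) (v : ℝ) :
    ‖seriesCoeff (((N : ℝ)⁻¹ : ℝ) : ℂ) k * ((-t * ((2 * v ^ 2 : ℝ) : ℂ)) ^ k / (2 * k).factorial)‖ ≤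
      (v ^ 2 / 4) ^ k / k.factorial := by
  have h1 := norm_seriesCoeff_le' (norm_ofReal_le_one (inv_natCast_mem_Icc N)) k
  have h2 : (k.factorial : ℝ) * k.factorial ≤ (2 * k).factorial := by exact_mod_cast factorial_mul_factorial_le k
  have h3 : (0 : ℝ) < k.factorial := by exact_mod_cast k.factorial_pos
  rw [norm_mul, norm_div, norm_pow, norm_mul, norm_neg, Complex.norm_real, Complex.norm_natCast,
    Real.norm_of_nonneg (by positivity)]
  calc _ ≤ (3 ^ k * k.factorial) * ((1 / 24 * (2 * v ^ 2)) ^ k / (k.factorial * k.factorial)) := by gcongr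
    _ = (3 * (1 / 24 * (2 * v ^ 2))) ^ k / k.factorial := by rw [mul_pow 3]; field_simp
    _ = _ := by congr 2; ring

lemma norm_seriesKernel_le_exp_sq' (N : ℕ) {t : ℂ} (ht : ‖t‖ < 1 / 24) (v : ℝ) :
    ‖seriesKernel (N : ℝ)⁻¹ (-t * ((2 * v ^ 2 : ℝ) : ℂ))‖ ≤ Real.exp (v ^ 2 / 4) := by
  rw [Real.exp_eq_exp_ℝ, NormedSpace.exp_eq_tsum_div]
  exact tsum_of_norm_bounded (Real.summable_pow_div_factorial (v ^ 2 / 4)).hasSum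
    fun k => norm_seriesKernel_term_le N k ht v

/-- The Gaussian average of `(2v²)^k/(2k)!` is `1/k!`, which is why averaging the kernel over `v`
produces the Borel transform. -/
lemma hasSum_borelTransform (hN : 1 ≤ N) {t : ℂ} (ht : ‖t‖ < 1 / 24) :
    HasSum (fun k : ℕ => (-1) ^ k * perturbativeCoeff N k / k.factorial * t ^ k) (borelTransform N t) := by
  have h := hasSum_integral_of_dominated_convergence (μ := stdGauss)
    (F := fun (k : ℕ) (v : ℝ) => seriesCoeff (((N : ℝ)⁻¹ : ℝ) : ℂ) k *
      ((-t * ((2 * v ^ 2 : ℝ) : ℂ)) ^ k / (2 * k).factorial))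
    (f := fun v : ℝ => seriesKernel (N : ℝ)⁻¹ (-t * ((2 * v ^ 2 : ℝ) : ℂ)))
    (fun k v => (v ^ 2 / 4) ^ k / k.factorial)
    (fun k => Continuous.aestronglyMeasurable (by fun_prop))
    (fun k => ae_of_all _ fun v => norm_seriesKernel_term_le N k ht v)
    (ae_of_all _ fun v => Real.summable_pow_div_factorial (v ^ 2 / 4)) ?_
    (ae_of_all _ fun v => hasSum_seriesKernel (inv_natCast_mem_Icc N) _)
  · refine h.congr_fun fun k => ?_
    have h1 : ∀ v : ℝ, seriesCoeff (((N : ℝ)⁻¹ : ℝ) : ℂ) k *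
      ((-t * ((2 * v ^ 2 : ℝ) : ℂ)) ^ k / (2 * k).factorial) =
        (seriesCoeff (((N : ℝ)⁻¹ : ℝ) : ℂ) k * ((-t * 2) ^ k / (2 * k).factorial)) * (v : ℂ) ^ (2 * k) := by
      intro v
      push_cast
      rw [← mul_assoc, mul_pow, ← pow_mul]
      ring
    simp_rw [h1]
    rw [integral_const_mul, integral_pow_stdGauss, perturbativeCoeff_eq hN, mul_pow, neg_pow t]
    have h2 : ((2 * k).factorial : ℂ) ≠ 0 := by exact_mod_cast (2 * k).factorial_ne_zero
    have h3 : (k.factorial : ℂ) ≠ 0 := by exact_mod_cast k.factorial_ne_zero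
    field_simp
  · refine integrable_exp_sq_stdGauss.congr (ae_of_all _ fun v => ?_)
    simp only
    rw [Real.exp_eq_exp_ℝ, NormedSpace.exp_eq_tsum_div]

/-- The domain on which the Borel transform is given by an absolutely convergent integral. -/
def borelDomain : Set ℂ := {t | 0 < t.re} ∪ {t | ‖t‖ < 1 / 24}

lemma isOpen_borelDomain : IsOpen borelDomain :=
  (isOpen_lt continuous_const Complex.continuous_re).union (isOpen_lt continuous_norm continuous_const)

lemma halfStrip_subset_borelDomain : halfStrip (24 : ℝ)⁻¹ ⊆ borelDomain := by
  rintro t ⟨s, hs, h⟩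
  -- If `Re t ≤ 0`, the point of `[0, ∞)` closest to `t` is the origin.
  by_cases ht : 0 < t.re
  · exact Or.inl ht
  · refine Or.inr ?_
    rw [Set.mem_ofPred_eq, one_div]
    refine lt_of_le_of_lt ?_ h
    rw [← sq_le_sq₀ (norm_nonneg _) (norm_nonneg _), ← Complex.normSq_eq_norm_sq, ← Complex.normSq_eq_norm_sq,
      Complex.normSq_apply, Complex.normSq_apply]
    simp only [Complex.sub_re, Complex.ofReal_re, Complex.sub_im, Complex.ofReal_im, sub_zero]
    nlinarith

lemma norm_seriesKernel_le_of_mem {N : ℕ} {t : ℂ} (ht : t ∈ borelDomain) (v : ℝ) :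
    ‖seriesKernel (N : ℝ)⁻¹ (-t * ((2 * v ^ 2 : ℝ) : ℂ))‖ ≤ Real.exp (8 * ‖t‖) * Real.exp (v ^ 2 / 4) := by
  rcases ht with ht | ht
  · exact norm_seriesKernel_le_exp_sq (le_of_lt ht) v
  · refine (norm_seriesKernel_le_exp_sq' N ht v).trans (le_mul_of_one_le_left (Real.exp_pos _).le ?_)
    exact Real.one_le_exp (by positivity)

lemma norm_borelTransform_le (N : ℕ) {t : ℂ} (ht : t ∈ borelDomain) :
    ‖borelTransform N t‖ ≤ (∫ v, Real.exp (v ^ 2 / 4) ∂stdGauss) * Real.exp (8 * ‖t‖) := by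
  rw [mul_comm, ← integral_const_mul]
  exact norm_integral_le_of_norm_le (integrable_exp_sq_stdGauss.const_mul _)
    (ae_of_all _ fun v => norm_seriesKernel_le_of_mem ht v)

lemma analyticOnNhd_borelTransform (N : ℕ) : AnalyticOnNhd ℂ (borelTransform N) borelDomain := by
  have hE := differentiable_seriesKernel (inv_natCast_mem_Icc N)
  refine DifferentiableOn.analyticOnNhd (fun t ht => ?_) isOpen_borelDomain
  refine DifferentiableAt.differentiableWithinAt ?_
  refine differentiableAt_integral_of_bound (V := borelDomain ∩ Metric.ball 0 (‖t‖ + 1))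
    (b := fun v => Real.exp (8 * (‖t‖ + 1)) * Real.exp (v ^ 2 / 4))
    ((isOpen_borelDomain.inter Metric.isOpen_ball).mem_nhds ⟨ht, by simp⟩) (fun u _ => ?_)
    (ae_of_all _ fun v => ?_) (integrable_exp_sq_stdGauss.const_mul _) (ae_of_all _ fun v u hu => ?_)
  · have := hE.continuous
    exact Continuous.aestronglyMeasurable (by fun_prop)
  · exact (hE.comp (g := seriesKernel (N : ℝ)⁻¹) (f := fun u : ℂ => -u * ((2 * v ^ 2 : ℝ) : ℂ))
      (by fun_prop)).differentiableOn
  · refine (norm_seriesKernel_le_of_mem hu.1 v).trans ?_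
    have := hu.2
    rw [mem_ball_zero_iff] at this
    gcongr

lemma ofReal_mem_borelDomain {t : ℝ} (ht : 0 < t) : (t : ℂ) ∈ borelDomain := Or.inl (by simpa using ht)

lemma integrableOn_borelTransform_mul_exp (N : ℕ) {w : ℂ} (hw : 16 < w.re) :
    IntegrableOn (fun t : ℝ => borelTransform N t * Complex.exp (-(t * w))) (Set.Ioi 0) := by
  have hI := (integrableOn_exp_neg_mul (b := 8) (by norm_num)).const_mul
    (∫ v, Real.exp (v ^ 2 / 4) ∂stdGauss)
  refine Integrable.mono' hI ?_ ((ae_restrict_iff' measurableSet_Ioi).2 (ae_of_all _ fun t ht => ?_))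
  · refine ContinuousOn.aestronglyMeasurable (ContinuousOn.mul ?_ (by fun_prop)) measurableSet_Ioi
    exact (analyticOnNhd_borelTransform N).continuousOn.comp Complex.continuous_ofReal.continuousOn
      fun t ht => ofReal_mem_borelDomain ht
  · rw [Set.mem_Ioi] at ht
    rw [norm_mul, Complex.norm_exp, Complex.neg_re, Complex.re_ofReal_mul]
    have h1 := norm_borelTransform_le N (ofReal_mem_borelDomain ht)
    rw [Complex.norm_real, Real.norm_of_nonneg ht.le] at h1
    have h0 : 0 ≤ ∫ v, Real.exp (v ^ 2 / 4) ∂stdGauss := integral_nonneg fun v => (Real.exp_pos _).le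
    calc _ ≤ ((∫ v, Real.exp (v ^ 2 / 4) ∂stdGauss) * Real.exp (8 * t)) * Real.exp (-(t * 16)) := by gcongr
      _ = _ := by rw [mul_assoc, ← Real.exp_add]; congr 2; ring

lemma differentiableAt_borelLaplace (N : ℕ) {w : ℂ} (hw : 16 < w.re) :
    DifferentiableAt ℂ (fun w : ℂ => ∫ t in Set.Ioi (0 : ℝ), borelTransform N t * Complex.exp (-(t * w))) w := by
  have hI := (integrableOn_exp_neg_mul (b := 8) (by norm_num)).const_mul
    (∫ v, Real.exp (v ^ 2 / 4) ∂stdGauss)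
  refine differentiableAt_integral_of_bound (V := {w : ℂ | 16 < w.re})
    ((isOpen_lt continuous_const Complex.continuous_re).mem_nhds hw)
    (fun u hu => (integrableOn_borelTransform_mul_exp N hu).aestronglyMeasurable)
    (ae_of_all _ fun t => ?_) hI ((ae_restrict_iff' measurableSet_Ioi).2 (ae_of_all _ fun t ht u hu => ?_))
  · exact Differentiable.differentiableOn (by fun_prop)
  · rw [Set.mem_Ioi] at ht
    rw [Set.mem_ofPred_eq] at hu
    rw [norm_mul, Complex.norm_exp, Complex.neg_re, Complex.re_ofReal_mul]
    have h1 := norm_borelTransform_le N (ofReal_mem_borelDomain ht)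
    rw [Complex.norm_real, Real.norm_of_nonneg ht.le] at h1
    have h0 : 0 ≤ ∫ v, Real.exp (v ^ 2 / 4) ∂stdGauss := integral_nonneg fun v => (Real.exp_pos _).le
    calc _ ≤ ((∫ v, Real.exp (v ^ 2 / 4) ∂stdGauss) * Real.exp (8 * t)) * Real.exp (-(t * 16)) := by gcongr
      _ = _ := by rw [mul_assoc, ← Real.exp_add]; congr 2; ring

/-- The Laplace integrand is even in `B`, so the exponential variable `B` may be replaced by `√(2τ)
v`. Integrating first over `v` leaves `borelTransform N (yτ)` averaged over `τ`; the substitution `t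
= yτ` finishes. -/
lemma borelLaplace_eq_of_real (hN : 1 ≤ N) {y : ℝ} (hy : 0 < y) (hy' : y < 1 / 16) :
    twoPoint N (-(y : ℂ)) =
      (y : ℂ)⁻¹ * ∫ t in Set.Ioi (0 : ℝ), borelTransform N t * Complex.exp (-(t * (y : ℂ)⁻¹)) := by
  have hz : (-(y : ℂ)).re ≤ 0 := by simpa using hy.le
  have hn : 4 * ‖-(y : ℂ)‖ < 1 := by
    rw [norm_neg, Complex.norm_real, Real.norm_of_nonneg hy.le]; linarith
  have hE := (differentiable_seriesKernel (inv_natCast_mem_Icc N)).continuous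
  have hg : Continuous fun B : ℝ => seriesKernel (N : ℝ)⁻¹ (-(y : ℂ) * (B : ℂ) ^ 2) := by fun_prop
  have hI : Integrable (fun B : ℝ => seriesKernel (N : ℝ)⁻¹ (-(y : ℂ) * (B : ℂ) ^ 2)) expLaw :=
    integrable_expLaw_iff.2 (integrableOn_kernelLaplace hz one_pos (by simpa using hn))
  have he : ∀ B : ℝ, seriesKernel (N : ℝ)⁻¹ (-(y : ℂ) * ((-B : ℝ) : ℂ) ^ 2) =
      seriesKernel (N : ℝ)⁻¹ (-(y : ℂ) * (B : ℂ) ^ 2) := fun B => by push_cast; rw [neg_sq]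
  have h1 := integral_comp_mixture hg he hI
  rw [integral_prod_symm _ (integrable_comp_mixture hg he hI)] at h1
  rw [twoPoint_eq hN hz hn, kernelLaplace, ← integral_expLaw fun B => seriesKernel (N : ℝ)⁻¹ (-(y : ℂ) * (B : ℂ) ^ 2),
    ← h1]
  have h2 : ∀ᵐ τ ∂expLaw, ∫ v, seriesKernel (N : ℝ)⁻¹ (-(y : ℂ) * ((mixture (v, τ) : ℝ) : ℂ) ^ 2) ∂stdGauss =
      borelTransform N ((y * τ : ℝ) : ℂ) := by
    filter_upwards [ae_pos_expLaw] with τ hτ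
    refine integral_congr_ae (ae_of_all _ fun v => ?_)
    simp only
    rw [mixture, ← Complex.ofReal_pow, mul_pow, mul_pow, Real.sq_sqrt (by norm_num), Real.sq_sqrt hτ.le]
    congr 1
    push_cast
    ring
  rw [integral_congr_ae h2, integral_expLaw]
  have h3 := integral_comp_mul_left_Ioi
    (fun t : ℝ => borelTransform N t * Complex.exp (-(t * (y : ℂ)⁻¹))) 0 hy
  rw [mul_zero, Complex.real_smul, Complex.ofReal_inv] at h3
  rw [← h3]
  refine integral_congr_ae (ae_of_all _ fun τ => ?_)
  simp only
  have : (y : ℂ) ≠ 0 := by exact_mod_cast hy.ne'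
  rw [mul_comm]
  congr 2
  push_cast
  field_simp

/-- In the variable `w = 1/x` both sides are holomorphic on the half-plane `Re w > 16`, and they
agree for large real `w`. -/
lemma twoPoint_eq_borelLaplace (hN : 1 ≤ N) {x : ℂ} (hx : x ∈ borelDisk (1 / 16)) :
    twoPoint N (-x) = x⁻¹ * ∫ t in Set.Ioi (0 : ℝ), borelTransform N t * Complex.exp (-(t * x⁻¹)) := by
  have hmem : ∀ w : ℂ, 16 < w.re → w⁻¹ ∈ borelDisk (1 / 16) := fun w hw => by
    rw [borelDisk, Set.mem_ofPred_eq, inv_inv]; simpa using hw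
  have ho : IsOpen {w : ℂ | 16 < w.re} := isOpen_lt continuous_const Complex.continuous_re
  have h1 : AnalyticOnNhd ℂ (fun w => twoPoint N (-w⁻¹)) {w : ℂ | 16 < w.re} := by
    refine DifferentiableOn.analyticOnNhd (fun w hw => ?_) ho
    have hw0 : w ≠ 0 := by rintro rfl; simp at hw; linarith
    exact (DifferentiableAt.comp (g := fun x => twoPoint N (-x)) w
      (analyticOnNhd_twoPoint_neg hN _ (hmem w hw)).differentiableAt
      (differentiableAt_inv hw0)).differentiableWithinAt
  have h2 : AnalyticOnNhd ℂ (fun w : ℂ => w * ∫ t in Set.Ioi (0 : ℝ), borelTransform N t *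
      Complex.exp (-(t * w))) {w : ℂ | 16 < w.re} := by
    refine DifferentiableOn.analyticOnNhd (fun w hw => ?_) ho
    exact (differentiableAt_id.mul (differentiableAt_borelLaplace N hw)).differentiableWithinAt
  have h3 := eqOn_of_eq_ofReal h1 h2 (convex_halfSpace_re_gt 16).isPreconnected (r := 17)
    (by rw [Set.mem_ofPred_eq, Complex.ofReal_re]; norm_num) (by
      filter_upwards [self_mem_nhdsWithin] with s hs
      rw [Set.mem_Ioi] at hs
      have := borelLaplace_eq_of_real hN (y := s⁻¹) (by positivity) (by
        rw [inv_lt_comm₀ (by linarith) (by norm_num)]; norm_num; linarith)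
      push_cast at this
      rwa [inv_inv] at this)
  have h4 := h3 (show x⁻¹ ∈ {w : ℂ | 16 < w.re} by
    have := hx; rw [borelDisk, Set.mem_ofPred_eq] at this; simpa using this)
  simpa using h4

lemma isBorelSum_twoPoint (hN : 1 ≤ N) : IsBorelSum (1 / 16) 24 (∫ v, Real.exp (v ^ 2 / 4) ∂stdGauss)
    (fun x => twoPoint N (-x)) (fun k => (-1) ^ k * perturbativeCoeff N k) := by
  have he : ∀ (x : ℂ) (t : ℝ), -(t : ℂ) / x = -(t * x⁻¹) := fun x t => by rw [neg_div, div_eq_mul_inv]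
  refine ⟨borelTransform N, (analyticOnNhd_borelTransform N).mono halfStrip_subset_borelDomain,
    fun t ht => hasSum_borelTransform hN (by rwa [one_div]), fun t ht => ?_, fun x hx => ⟨?_, ?_⟩⟩
  · refine (norm_borelTransform_le N (halfStrip_subset_borelDomain ht)).trans ?_
    have h0 : 0 ≤ ∫ v, Real.exp (v ^ 2 / 4) ∂stdGauss := integral_nonneg fun v => (Real.exp_pos _).le
    gcongr
    rw [div_div_eq_mul_div, div_one]
    nlinarith [norm_nonneg t]
  · simp_rw [he]
    refine integrableOn_borelTransform_mul_exp N ?_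
    have := hx; rw [borelDisk, Set.mem_ofPred_eq] at this; simpa using this
  · simp_rw [he]
    rw [twoPoint_eq_borelLaplace hN hx, one_div]

end Borel

end NVector

namespace NVector

/-! ### Uniqueness of Borel sums -/

/-- Optimal truncation: with `p` the integer part of `r/(2σ)`, `p! ≤ p^p` bounds the term by
`(σp/r)^p ≤ 2^{-p}`. Rounding down `p` costs the factor `2`. -/
lemma exists_pow_mul_factorial_le {σ : ℝ} (hσ : 0 < σ) {r : ℝ} (hr : 0 < r) :
    ∃ p : ℕ, σ ^ p * p.factorial * (r⁻¹) ^ p ≤ 2 * Real.exp (-(Real.log 2 / (2 * σ) * r)) := by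
  set p := ⌊r / (2 * σ)⌋₊ with hp
  have h1 : (p : ℝ) ≤ r / (2 * σ) := Nat.floor_le (by positivity)
  have h2 : r / (2 * σ) < p + 1 := Nat.lt_floor_add_one _
  refine ⟨p, ?_⟩
  have h3 : (p.factorial : ℝ) ≤ p ^ p := by exact_mod_cast Nat.factorial_le_pow p
  have h4 : σ * p * r⁻¹ ≤ 2⁻¹ := by
    rw [le_div_iff₀ (by positivity)] at h1
    rw [← div_eq_mul_inv, div_le_iff₀ hr]
    linarith
  calc σ ^ p * p.factorial * (r⁻¹) ^ p ≤ σ ^ p * p ^ p * (r⁻¹) ^ p := by gcongr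
    _ = (σ * p * r⁻¹) ^ p := by rw [mul_pow, mul_pow]
    _ ≤ (2⁻¹) ^ p := by gcongr
    _ = Real.exp (-(Real.log 2 * p)) := by
      rw [inv_pow, Real.exp_neg, mul_comm, Real.exp_nat_mul, Real.exp_log (by norm_num)]
    _ ≤ Real.exp (Real.log 2 + -(Real.log 2 / (2 * σ) * r)) := by
      refine Real.exp_le_exp.2 ?_
      have := mul_lt_mul_of_pos_left h2 (Real.log_pos one_lt_two)
      rw [mul_div_assoc'] at this
      rw [div_mul_eq_mul_div]
      linarith
    _ = _ := by rw [Real.exp_add, Real.exp_log (by norm_num)]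

/-- A holomorphic function which decays exponentially in all directions of a half-plane vanishes. -/
lemma eq_zero_of_exponential_decay {d : ℂ → ℂ} (hd : DifferentiableOn ℂ d {v : ℂ | 0 ≤ v.re})
    {M c : ℝ} (hc : 0 < c) (hb : ∀ v : ℂ, 0 ≤ v.re → ‖d v‖ ≤ M * Real.exp (-(c * |v.im|))) :
    ∀ v : ℂ, 0 ≤ v.re → d v = 0 := by
  -- With this `a`, the growth `e^{a |Im v| π/2}` of `exp(-a v log(1 + v))` is exactly paid for by
  -- the decay of `d`. So the product `F` is bounded, and on the positive axis it decays like `e^{-a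
  -- x log(1 + x)}`, faster than any exponential.
  set a : ℝ := 2 * c / Real.pi with ha
  have ha0 : 0 < a := by positivity
  have hM : 0 ≤ M := by simpa using (norm_nonneg _).trans (hb 0 (by simp))
  set F : ℂ → ℂ := fun v => d v * Complex.exp (-(a * (v * Complex.log (1 + v)))) with hF
  have hre : ∀ v : ℂ, (-((a : ℂ) * (v * Complex.log (1 + v)))).re =
      -(a * (v.re * Real.log ‖1 + v‖ - v.im * Complex.arg (1 + v))) := fun v => by
    rw [Complex.neg_re, Complex.re_ofReal_mul, Complex.mul_re, Complex.log_re, Complex.log_im]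
  have hone : ∀ v : ℂ, 0 ≤ v.re → 0 ≤ Real.log ‖1 + v‖ := fun v hv => by
    refine Real.log_nonneg ((?_ : (1 : ℝ) ≤ (1 + v).re).trans (Complex.re_le_norm _))
    simpa using hv
  have hbF : ∀ v : ℂ, 0 ≤ v.re → ‖F v‖ ≤ M := by
    intro v hv
    have h1 : |Complex.arg (1 + v)| ≤ Real.pi / 2 :=
      Complex.abs_arg_le_pi_div_two_iff.2 (by simp; linarith)
    have h2 : v.im * Complex.arg (1 + v) ≤ |v.im| * (Real.pi / 2) := by
      refine (le_abs_self _).trans ?_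
      rw [abs_mul]
      gcongr
    have h3 := mul_nonneg hv (hone v hv)
    have h4 : a * (|v.im| * (Real.pi / 2)) = c * |v.im| := by
      rw [ha]; field_simp
    rw [hF, norm_mul, Complex.norm_exp, hre]
    calc _ ≤ M * Real.exp (-(c * |v.im|)) * Real.exp (c * |v.im|) := by
          gcongr
          · exact hb v hv
          · nlinarith
      _ = M := by rw [mul_assoc, ← Real.exp_add]; simp
  have hdF : DifferentiableOn ℂ F {v : ℂ | 0 ≤ v.re} := by
    refine hd.mul (DifferentiableOn.cexp (DifferentiableOn.fun_neg
      ((differentiableOn_id.mul (DifferentiableOn.clog (by fun_prop) fun v hv => Or.inl ?_)).const_mul _)))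
    rw [Set.mem_ofPred_eq] at hv
    simp
    linarith
  have hF0 : Set.EqOn F 0 {z : ℂ | 0 ≤ z.re} := by
    refine PhragmenLindelof.eq_zero_on_right_half_plane_of_superexponential_decay ?_ ?_ ?_ ?_
    · refine DifferentiableOn.diffContOnCl ?_
      rwa [Complex.closure_setOfPred_lt_re]
    · refine ⟨1, by norm_num, 0, ?_⟩
      refine Asymptotics.IsBigO.of_bound M ?_
      filter_upwards [mem_inf_of_right (mem_principal_self _)] with v hv
      simpa using hbF v (le_of_lt hv)
    · intro n
      have hlim : Tendsto (fun x : ℝ => M * Real.exp (-(x * (a * Real.log (1 + x) - n)))) atTop (𝓝 (M * 0)) := by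
        refine Tendsto.const_mul _ (Real.tendsto_exp_neg_atTop_nhds_zero.comp ?_)
        refine tendsto_id.atTop_mul_atTop₀ ?_
        refine tendsto_atTop_add_const_right _ _ (Tendsto.const_mul_atTop ha0 ?_)
        exact Real.tendsto_log_atTop.comp (tendsto_atTop_add_const_left _ _ tendsto_id)
      rw [mul_zero] at hlim
      refine squeeze_zero' (Eventually.of_forall fun x => by positivity) ?_ hlim
      filter_upwards [eventually_ge_atTop 0] with x hx
      have h1 : ‖(1 : ℂ) + x‖ = 1 + x := by
        rw [← Complex.ofReal_one, ← Complex.ofReal_add, Complex.norm_real, Real.norm_of_nonneg (by linarith)]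
      have h2 := hb x (by simpa using hx)
      rw [Complex.ofReal_im, abs_zero, mul_zero, neg_zero, Real.exp_zero, mul_one] at h2
      rw [hF, norm_mul, Complex.norm_exp, hre, h1, Complex.ofReal_re, Complex.ofReal_im, ← Real.exp_nat_mul]
      calc _ ≤ Real.exp (n * x) * (M * Real.exp (-(a * (x * Real.log (1 + x) - 0 * Complex.arg (1 + x))))) := by
            gcongr
        _ = _ := by
            rw [mul_left_comm, ← Real.exp_add]
            congr 2
            ring
    · exact ⟨M, fun x => hbF _ (by simp)⟩
  intro v hv
  have := hF0 hv
  rw [hF] at this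
  simpa using this

lemma borelDisk_inv_mem {R : ℝ} {w : ℂ} (hw : R⁻¹ < w.re) : w⁻¹ ∈ borelDisk R := by
  rwa [borelDisk, Set.mem_ofPred_eq, inv_inv]

/-- Nevanlinna's uniqueness theorem. -/
lemma BorelSummable.eqOn {R R' A A' σ σ' : ℝ} {f f' : ℂ → ℂ} {a : ℕ → ℂ} (hR : 0 < R) (hσ : 0 < σ)
    (hf : BorelSummable R A σ f a) (hf' : BorelSummable R' A' σ' f' a) :
    Set.EqOn f' f (borelDisk R' ∩ borelDisk R) := by
  rintro x ⟨hx', hx⟩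
  have hx0 : x ≠ 0 := by
    rintro rfl
    rw [borelDisk, Set.mem_ofPred_eq, inv_zero, Complex.zero_re] at hx
    exact absurd hx (not_lt.2 (inv_pos.2 hR).le)
  rw [borelDisk, Set.mem_ofPred_eq] at hx hx'
  -- The closed half-plane `Re w ≥ c` contains `1/x` and lies inside the images of both disks under
  -- `x ↦ 1/x`.
  obtain ⟨c, hc1, hc2⟩ := exists_between (max_lt hx hx')
  rw [max_lt_iff] at hc1
  have hc0 : 0 < c := (inv_pos.2 hR).trans hc1.1
  -- A positive common rate that dominates `σ` and `|σ'|`, so that one truncation order serves both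
  -- functions; `σ'` may have any sign.
  set s : ℝ := |σ'| + σ with hs
  have hs0 : 0 < s := by positivity
  have hbound : ∀ w : ℂ, c ≤ w.re → ‖f' w⁻¹ - f w⁻¹‖ ≤
      ((|A'| + |A|) * 2) * Real.exp (-(Real.log 2 / (2 * s) * ‖w‖)) := by
    intro w hw
    have hw0 : 0 < ‖w‖ := hc0.trans_le (hw.trans (Complex.re_le_norm w))
    obtain ⟨p, hp⟩ := exists_pow_mul_factorial_le hs0 hw0
    have h1 := hf.2 p w⁻¹ (borelDisk_inv_mem (hc1.1.trans_le hw))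
    have h2 := hf'.2 p w⁻¹ (borelDisk_inv_mem (hc1.2.trans_le hw))
    rw [norm_inv] at h1 h2
    have hA : A * σ ^ p * p.factorial * ‖w‖⁻¹ ^ p ≤ |A| * (s ^ p * p.factorial * ‖w‖⁻¹ ^ p) := by
      have : σ ≤ s := by rw [hs]; linarith [abs_nonneg σ']
      calc _ ≤ |A| * s ^ p * p.factorial * ‖w‖⁻¹ ^ p := by
            gcongr
            exact le_abs_self A
        _ = _ := by ring
    have hA' : A' * σ' ^ p * p.factorial * ‖w‖⁻¹ ^ p ≤ |A'| * (s ^ p * p.factorial * ‖w‖⁻¹ ^ p) := by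
      have h3 : A' * σ' ^ p ≤ |A'| * s ^ p := by
        refine (le_abs_self _).trans ?_
        rw [abs_mul, abs_pow]
        gcongr
        rw [hs]; linarith
      calc _ ≤ |A'| * s ^ p * p.factorial * ‖w‖⁻¹ ^ p := by gcongr
        _ = _ := by ring
    calc ‖f' w⁻¹ - f w⁻¹‖ = ‖(f' w⁻¹ - ∑ k ∈ Finset.range p, a k * w⁻¹ ^ k) -
          (f w⁻¹ - ∑ k ∈ Finset.range p, a k * w⁻¹ ^ k)‖ := by rw [sub_sub_sub_cancel_right]
      _ ≤ _ := norm_sub_le _ _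
      _ ≤ |A'| * (s ^ p * p.factorial * ‖w‖⁻¹ ^ p) + |A| * (s ^ p * p.factorial * ‖w‖⁻¹ ^ p) :=
          add_le_add (h2.trans hA') (h1.trans hA)
      _ = (|A'| + |A|) * (s ^ p * p.factorial * ‖w‖⁻¹ ^ p) := by ring
      _ ≤ (|A'| + |A|) * (2 * Real.exp (-(Real.log 2 / (2 * s) * ‖w‖))) := by gcongr
      _ = _ := by ring
  have hlog := Real.log_pos one_lt_two
  have h := eq_zero_of_exponential_decay (d := fun v => f' (v + c)⁻¹ - f (v + c)⁻¹)
    (M := (|A'| + |A|) * 2) (c := Real.log 2 / (2 * s)) ?_ (by positivity) ?_ (x⁻¹ - c) (by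
      rw [Complex.sub_re, Complex.ofReal_re]; linarith)
  · simpa [sub_eq_zero] using h
  · intro v hv
    rw [Set.mem_ofPred_eq] at hv
    have hre : c ≤ (v + c).re := by simpa using hv
    have hne : v + c ≠ 0 := fun h => by rw [h, Complex.zero_re] at hre; linarith
    have hi : DifferentiableAt ℂ (fun v : ℂ => (v + c)⁻¹) v := by fun_prop (disch := exact hne)
    refine (DifferentiableAt.sub
      (DifferentiableAt.comp (g := f') v (hf'.1 _ (borelDisk_inv_mem (hc1.2.trans_le hre))).differentiableAt hi)
      (DifferentiableAt.comp (g := f) v (hf.1 _ (borelDisk_inv_mem (hc1.1.trans_le hre))).differentiableAt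
        hi)).differentiableWithinAt
  · intro v hv
    refine (hbound (v + c) (by simpa using hv)).trans ?_
    gcongr
    have := Complex.abs_im_le_norm (v + c)
    simpa using this

lemma BorelSummable.mono {R A σ σ' : ℝ} {f : ℂ → ℂ} {a : ℕ → ℂ} (h : BorelSummable R A σ f a) (hA : 0 ≤ A)
    (hσ : 0 ≤ σ) (hσ' : σ ≤ σ') : BorelSummable R A σ' f a :=
  ⟨h.1, fun p x hx => (h.2 p x hx).trans (by gcongr)⟩

end NVector

namespace NVector

/-! ### Positivity of the covariance -/

section Positivity

open SimpleGraph

/-- Cutting at the edge with the smallest parameter `m`, `energy_glue` writes the form as `(m - s)(∑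
β)²` plus the forms of two smaller trees with `m` in place of `s`, nonnegative by induction. For `s
= 0` this is positivity of the covariance. -/
lemma energy_nonneg_of_card (n : ℕ) : ∀ {V : Type} [Fintype V] (_ : Fintype.card V = n)
    {G : SimpleGraph V} (_ : G.IsTree) {w : G.edgeSet → ℝ} {s : ℝ} (_ : s ≤ 1)
    (_ : ∀ e, w e ∈ Set.Icc s 1) (β : V → ℝ), 0 ≤ energy G w s β := by
  induction n using Nat.strong_induction_on with | _ n ih
  intro V _ hV G hG w s hs hw β
  classical
  by_cases hne : Nonempty G.edgeSet
  · obtain ⟨e, he⟩ := Finite.exists_min w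
    obtain ⟨r⟩ := hG.1.nonempty
    obtain ⟨A, hr, G₁, G₂, a, b, h₁, h₂, heq, rfl⟩ := exists_eq_glue hG r e.2
    have he' : e = bridge G₁ G₂ a b := Subtype.ext heq
    subst he'
    rw [energy_glue h₁ h₂ he]
    have hA : Fintype.card {x // x ∈ A} < n := by
      rw [← hV]
      exact Fintype.card_subtype_lt (x := (b : V)) b.2
    have hA' : Fintype.card {x // x ∉ A} < n := by
      rw [← hV]
      exact Fintype.card_subtype_lt (x := (a : V)) (not_not.2 a.2)
    have hm := hw (bridge G₁ G₂ a b)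
    refine add_nonneg (add_nonneg (mul_nonneg (sub_nonneg.2 hm.1) (sq_nonneg _)) ?_) ?_
    · exact ih _ hA rfl h₁ hm.2 (fun e => ⟨he _, (hw _).2⟩) _
    · exact ih _ hA' rfl h₂ hm.2 (fun e => ⟨he _, (hw _).2⟩) _
  · have hsub : ∀ i j : V, i = j := by
      intro i j
      by_contra hij
      have : Nontrivial V := ⟨⟨i, j, hij⟩⟩
      obtain ⟨k, hk⟩ := hG.1.preconnected.exists_adj_of_nontrivial i
      exact hne ⟨⟨s(i, k), hk⟩⟩
    have h1 : ∀ i j, β i * β j * (pathInf G w i j - s) = β i * β i * (1 - s) := fun i j => by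
      rw [hsub j i, pathInf_self]
    unfold energy
    simp_rw [h1]
    exact Finset.sum_nonneg fun i _ => Finset.sum_nonneg fun j _ =>
      mul_nonneg (mul_self_nonneg _) (sub_nonneg.2 hs)

lemma posSemidef_pathInf {V : Type} [Fintype V] {G : SimpleGraph V} (hG : G.IsTree) {w : G.edgeSet → ℝ}
    (hw : ∀ e, w e ∈ Set.Icc (0 : ℝ) 1) : (Matrix.of fun i j => pathInf G w i j).PosSemidef := by
  refine Matrix.PosSemidef.of_dotProduct_mulVec_nonneg ?_ fun β => ?_
  · ext i j
    simp [pathInf_comm hG (i := j)]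
  · refine (energy_nonneg_of_card _ rfl hG zero_le_one hw β).trans_eq ?_
    simp only [energy, dotProduct, Matrix.mulVec, Finset.mul_sum, Matrix.of_apply, sub_zero, Pi.star_apply,
      star_trivial]
    exact Finset.sum_congr rfl fun i _ => Finset.sum_congr rfl fun j _ => by ring

lemma PlaneTree.posSemidef_X {n : ℕ} (T : PlaneTree n) {w : T.Edge → ℝ} (hw : w ∈ T.cube) :
    (T.X w).PosSemidef := by
  have h : T.X w = Matrix.of fun i j => pathInf T.graph w i j := by
    ext i j
    exact T.X_eq_pathInf w i j
  rw [h]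
  exact posSemidef_pathInf T.isTree fun e => ⟨hw.1 e, hw.2 e⟩

end Positivity

/-! ### Children in a rooted tree -/

section Children

open SimpleGraph

variable {V : Type} [Fintype V]

/-- The children of a vertex. -/
noncomputable def childSet (G : SimpleGraph V) (r i : V) : Finset V := by
  classical exact Finset.univ.filter fun j => G.Adj i j ∧ G.dist r j = G.dist r i + 1

lemma mem_childSet {G : SimpleGraph V} {r i j : V} :
    j ∈ childSet G r i ↔ G.Adj i j ∧ G.dist r j = G.dist r i + 1 := by
  simp [childSet]

-- A neighbour of `i` closer to `r` starts a shortest path from `i` to `r`; since paths in a tree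
-- are unique, there is only one such neighbour.
omit [Fintype V] in
lemma exists_parent {G : SimpleGraph V} (hG : G.IsTree) {r i : V} (hi : i ≠ r) :
    ∃ k, G.Adj i k ∧ G.dist r i = G.dist r k + 1 ∧
      ∀ j, G.Adj i j → G.dist r i = G.dist r j + 1 → j = k := by
  have key : ∀ k, G.Adj i k → G.dist r i = G.dist r k + 1 →
      ∃ p : G.Walk i r, p.IsPath ∧ p.snd = k := by
    intro k hk hd
    obtain ⟨q, hq⟩ := hG.1.exists_walk_length_eq_dist k r
    refine ⟨Walk.cons hk q, Walk.isPath_of_length_eq_dist _ ?_, by simp⟩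
    rw [Walk.length_cons, hq, dist_comm, ← hd, dist_comm]
  obtain ⟨p, hp, hl⟩ := hG.1.exists_path_of_dist i r
  cases p with
  | nil => exact absurd rfl hi
  | @cons _ k _ hk q =>
    rw [Walk.length_cons] at hl
    have h1 : G.dist r i = G.dist r k + 1 := by
      rcases hG.dist_eq_dist_add_one_of_adj r hk with h | h
      · exact h
      · have h2 := dist_le q
        rw [dist_comm] at h2
        rw [dist_comm] at hl
        omega
    refine ⟨k, hk, h1, fun j hj hd => ?_⟩
    obtain ⟨p₁, hp₁, rfl⟩ := key j hj hd
    obtain ⟨p₂, hp₂, rfl⟩ := key k hk h1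
    have := (hG.2.subsingleton_path i r).elim ⟨p₁, hp₁⟩ ⟨p₂, hp₂⟩
    rw [Subtype.mk.injEq] at this
    rw [this]

lemma card_childSet {G : SimpleGraph V} (hG : G.IsTree) (r i : V) :
    (childSet G r i).card = childCount G r i := by
  classical
  have hch : (childSet G r i : Set V) ⊆ G.neighborSet i := fun j hj => (mem_childSet.1 hj).1
  rw [childCount]
  split_ifs with hir
  · subst hir
    rw [← Set.ncard_coe_finset, Nat.sub_zero]
    congr 1
    refine hch.antisymm fun j hj => mem_childSet.2 ⟨hj, ?_⟩
    rcases hG.dist_eq_dist_add_one_of_adj i hj with h | h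
    · simp at h
    · exact h
  · obtain ⟨k, hk, hd, hu⟩ := exists_parent hG hir
    have h : G.neighborSet i = insert k (childSet G r i : Set V) := by
      ext j
      rw [Set.mem_insert_iff, mem_neighborSet, Finset.mem_coe, mem_childSet]
      constructor
      · intro hj
        rcases hG.dist_eq_dist_add_one_of_adj r hj with h | h
        · exact Or.inl (hu j hj h)
        · exact Or.inr ⟨hj, h⟩
      · rintro (rfl | h)
        · exact hk
        · exact h.1
    rw [h, Set.ncard_insert_of_notMem, Set.ncard_coe_finset, Nat.add_sub_cancel]
    rw [Finset.mem_coe, mem_childSet]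
    omega

end Children

/-! ### Sums over plane trees -/

section PlaneSum

/-- The linear orders on a finite set, as lists. -/
abbrev Ordering {V : Type} (S : Finset V) : Type := {l : List V // l.Nodup ∧ ∀ j, j ∈ l ↔ j ∈ S}

variable {V : Type}

lemma mem_ordering_iff (S : Finset V) (l : List V) :
    (l.Nodup ∧ ∀ j, j ∈ l ↔ j ∈ S) ↔ l ∈ S.toList.permutations := by
  rw [List.mem_permutations]
  constructor
  · rintro ⟨h1, h2⟩
    exact (List.perm_ext_iff_of_nodup h1 S.nodup_toList).2 fun j => by rw [h2, Finset.mem_toList]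
  · intro h
    exact ⟨h.nodup_iff.2 S.nodup_toList, fun j => by rw [h.mem_iff, Finset.mem_toList]⟩

noncomputable instance (S : Finset V) : Fintype (Ordering S) := by
  classical
  exact Fintype.subtype S.toList.permutations.toFinset fun l => by rw [List.mem_toFinset, mem_ordering_iff]

lemma card_ordering (S : Finset V) : Fintype.card (Ordering S) = S.card.factorial := by
  classical
  rw [Fintype.card_of_subtype S.toList.permutations.toFinset fun l => by
      rw [List.mem_toFinset, mem_ordering_iff],
    List.toFinset_card_of_nodup (List.nodup_permutations _ S.nodup_toList), List.length_permutations,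
    Finset.length_toList]

lemma length_ordering {S : Finset V} (l : Ordering S) : l.1.length = S.card := by
  have h := (List.mem_permutations.1 ((mem_ordering_iff S l.1).1 l.2)).length_eq
  rw [h, Finset.length_toList]

variable {n : ℕ}

/-- A plane tree is a tree with an ordering of the children of each vertex. -/
noncomputable def PlaneTree.equiv : PlaneTree n ≃
    Σ G : {G : SimpleGraph (Fin (n + 1)) // G.IsTree}, ∀ i, Ordering (childSet G.1 0 i) where
  toFun T := ⟨⟨T.graph, T.isTree⟩, fun i => ⟨T.children i, T.nodup i, fun j => by
    rw [mem_childSet]; exact T.mem_children i j⟩⟩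
  invFun x := ⟨x.1.1, x.1.2, fun i => (x.2 i).1, fun i => (x.2 i).2.1, fun i j => by
    rw [(x.2 i).2.2, mem_childSet]⟩
  left_inv _ := rfl
  right_inv _ := rfl

noncomputable instance : Fintype (PlaneTree n) := Fintype.ofEquiv _ PlaneTree.equiv.symm

lemma PlaneTree.degree_eq (T : PlaneTree n) (i : Fin (n + 1)) : T.degree i = childCount T.graph 0 i + 1 := by
  rw [PlaneTree.degree, ← card_childSet T.isTree]
  congr 1
  exact length_ordering (S := childSet T.graph 0 i) ⟨T.children i, T.nodup i, fun j => by
    rw [mem_childSet]; exact T.mem_children i j⟩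

/-- A labelled tree carries `∏ (number of children)!` plane structures, exactly cancelled by the
factorials `(d_i - 1)!` of the `β`-representation. -/
lemma sum_planeTree {R : Type*} [Field R] [CharZero R]
    (F : SimpleGraph (Fin (n + 1)) → R) :
    ∑ T : PlaneTree n, (∏ i, (((T.degree i - 1).factorial : ℕ) : R))⁻¹ * F T.graph =
      ∑ G : {G : SimpleGraph (Fin (n + 1)) // G.IsTree}, F G.1 := by
  have h : ∀ T : PlaneTree n, (∏ i, (((T.degree i - 1).factorial : ℕ) : R))⁻¹ * F T.graph =
      (fun x : Σ G : {G : SimpleGraph (Fin (n + 1)) // G.IsTree}, ∀ i, Ordering (childSet G.1 0 i) =>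
        (∏ i, (((childCount x.1.1 0 i).factorial : ℕ) : R))⁻¹ * F x.1.1) (PlaneTree.equiv T) := fun T => by
    simp only [PlaneTree.degree_eq, Nat.add_sub_cancel]
    rfl
  rw [Finset.sum_congr rfl fun T _ => h T]
  have h2 := Equiv.sum_comp (PlaneTree.equiv (n := n)) fun x =>
    (∏ i, (((childCount x.1.1 0 i).factorial : ℕ) : R))⁻¹ * F x.1.1
  refine h2.trans ?_
  rw [Fintype.sum_sigma]
  refine Finset.sum_congr rfl fun G _ => ?_
  simp only [Finset.sum_const, Finset.card_univ, Fintype.card_pi, card_ordering, card_childSet G.2, nsmul_eq_mul]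
  push_cast
  rw [← mul_assoc, mul_inv_cancel₀, one_mul]
  exact Finset.prod_ne_zero_iff.2 fun i _ => by exact_mod_cast (childCount G.1 0 i).factorial_ne_zero

end PlaneSum

end NVector

namespace NVector

/-! ### Sums over labelled trees with a complex coupling -/

section ComplexAmp

open scoped ENNReal

variable {V : Type} [Fintype V]

/-- The integral of `exp (x/2 ∑ βᵢ Xᵢⱼ(w) βⱼ)` over the unit cube, for complex `x`. -/
noncomputable def cubeAmp (x : ℂ) (G : SimpleGraph V) (β : V → ℝ) : ℂ :=
  ∫ w in Set.univ.pi (fun _ : G.edgeSet => Set.Icc (0 : ℝ) 1), Complex.exp (x / 2 * energy G w 0 β)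

instance isProbabilityMeasure_cube {E : Type} [Fintype E] : IsProbabilityMeasure
    ((volume : Measure (E → ℝ)).restrict (Set.univ.pi fun _ => Set.Icc (0 : ℝ) 1)) := by
  constructor
  rw [Measure.restrict_apply_univ, volume_pi_pi]
  simp

lemma mem_cube_iff {E : Type} {w : E → ℝ} :
    w ∈ Set.univ.pi (fun _ : E => Set.Icc (0 : ℝ) 1) ↔ ∀ e, w e ∈ Set.Icc (0 : ℝ) 1 := by rw [Set.mem_univ_pi]

lemma measurableSet_cube {E : Type} [Fintype E] :
    MeasurableSet (Set.univ.pi (fun _ : E => Set.Icc (0 : ℝ) 1)) :=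
  MeasurableSet.univ_pi fun _ => measurableSet_Icc

lemma measurable_energy_left (G : SimpleGraph V) (β : V → ℝ) :
    Measurable fun w : G.edgeSet → ℝ => energy G w 0 β :=
  Measurable.comp (g := fun q : (V → ℝ) × (G.edgeSet → ℝ) => energy G q.2 0 q.1)
    (f := fun w => (β, w)) measurable_energy measurable_prodMk_left

lemma abs_energy_le {G : SimpleGraph V} (hG : G.IsTree) {w : G.edgeSet → ℝ}
    (hw : ∀ e, w e ∈ Set.Icc (0 : ℝ) 1) (β : V → ℝ) : |energy G w 0 β| ≤ (∑ i, |β i|) ^ 2 := by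
  unfold energy
  refine (Finset.abs_sum_le_sum_abs _ _).trans ?_
  rw [sq, Finset.sum_mul_sum]
  refine Finset.sum_le_sum fun i _ => (Finset.abs_sum_le_sum_abs _ _).trans (Finset.sum_le_sum fun j _ => ?_)
  have h := pathInf_mem_Icc (i := i) (j := j) hG zero_le_one hw
  rw [sub_zero, abs_mul, abs_mul, abs_of_nonneg h.1]
  exact mul_le_of_le_one_right (by positivity) h.2

lemma norm_exp_energy_le {G : SimpleGraph V} (hG : G.IsTree) {w : G.edgeSet → ℝ}
    (hw : ∀ e, w e ∈ Set.Icc (0 : ℝ) 1) (x : ℂ) (β : V → ℝ) :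
    ‖Complex.exp (x / 2 * energy G w 0 β)‖ ≤ Real.exp (‖x‖ / 2 * (∑ i, |β i|) ^ 2) := by
  refine (Complex.norm_exp_le_exp_norm _).trans (Real.exp_le_exp.2 ?_)
  rw [norm_mul, norm_div, Complex.norm_real, Complex.norm_ofNat]
  gcongr
  exact abs_energy_le hG hw β

lemma norm_exp_energy_le_one {G : SimpleGraph V} (hG : G.IsTree) {w : G.edgeSet → ℝ}
    (hw : ∀ e, w e ∈ Set.Icc (0 : ℝ) 1) {x : ℂ} (hx : x.re ≤ 0) (β : V → ℝ) :
    ‖Complex.exp (x / 2 * energy G w 0 β)‖ ≤ 1 := by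
  refine norm_exp_le_one_of_re_nonpos ?_
  rw [Complex.re_mul_ofReal]
  refine mul_nonpos_of_nonpos_of_nonneg ?_ (energy_nonneg_of_card _ rfl hG zero_le_one hw β)
  rw [Complex.div_ofNat_re]
  linarith

lemma norm_cubeAmp_le {G : SimpleGraph V} (hG : G.IsTree) (x : ℂ) (β : V → ℝ) :
    ‖cubeAmp x G β‖ ≤ Real.exp (‖x‖ / 2 * (∑ i, |β i|) ^ 2) := by
  have h := norm_integral_le_of_norm_le_const
    (μ := volume.restrict (Set.univ.pi (fun _ : G.edgeSet => Set.Icc (0 : ℝ) 1)))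
    ((ae_restrict_iff' measurableSet_cube).2 (ae_of_all _ fun w hw =>
      norm_exp_energy_le hG (mem_cube_iff.1 hw) x β))
  rw [probReal_univ, mul_one] at h
  exact h

lemma norm_cubeAmp_le_one {G : SimpleGraph V} (hG : G.IsTree) {x : ℂ} (hx : x.re ≤ 0) (β : V → ℝ) :
    ‖cubeAmp x G β‖ ≤ 1 := by
  have h := norm_integral_le_of_norm_le_const
    (μ := volume.restrict (Set.univ.pi (fun _ : G.edgeSet => Set.Icc (0 : ℝ) 1)))
    ((ae_restrict_iff' measurableSet_cube).2 (ae_of_all _ fun w hw =>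
      norm_exp_energy_le_one hG (mem_cube_iff.1 hw) hx β))
  rw [probReal_univ, mul_one] at h
  exact h

lemma stronglyMeasurable_cubeAmp (x : ℂ) (G : SimpleGraph V) : StronglyMeasurable (cubeAmp x G) := by
  have h : Measurable fun q : (V → ℝ) × (G.edgeSet → ℝ) => Complex.exp (x / 2 * energy G q.2 0 q.1) := by
    have := measurable_energy (G := G) (s := 0)
    fun_prop
  exact h.stronglyMeasurable.integral_prod_right

lemma differentiable_cubeAmp {G : SimpleGraph V} (hG : G.IsTree) (β : V → ℝ) :
    Differentiable ℂ fun x => cubeAmp x G β := by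
  intro x
  have hm := measurable_energy_left G β
  refine differentiableAt_integral_of_bound (Metric.ball_mem_nhds x one_pos)
    (b := fun _ => Real.exp ((‖x‖ + 1) / 2 * (∑ i, |β i|) ^ 2))
    (fun y _ => Measurable.aestronglyMeasurable (by fun_prop)) (ae_of_all _ fun w => ?_)
    (integrable_const _) ((ae_restrict_iff' measurableSet_cube).2 (ae_of_all _ fun w hw y hy => ?_))
  · exact Differentiable.differentiableOn (by fun_prop)
  · refine (norm_exp_energy_le hG (mem_cube_iff.1 hw) y β).trans (Real.exp_le_exp.2 ?_)
    have : ‖y‖ ≤ ‖x‖ + 1 := by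
      rw [Metric.mem_ball, dist_eq_norm] at hy
      linarith [norm_le_insert' y x]
    gcongr

lemma toReal_treeAmp {G : SimpleGraph V} (hG : G.IsTree) (x : ℝ) (β : V → ℝ) :
    treeAmp x G 0 β ≠ ∞ ∧ ((treeAmp x G 0 β).toReal : ℂ) = cubeAmp x G β := by
  have hm := measurable_energy_left G β
  have hI : Integrable (fun w => Real.exp (x / 2 * energy G w 0 β))
      (volume.restrict (Set.univ.pi (fun _ : G.edgeSet => Set.Icc (0 : ℝ) 1))) := by
    refine Integrable.mono' (integrable_const (Real.exp (‖x‖ / 2 * (∑ i, |β i|) ^ 2)))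
      (Measurable.aestronglyMeasurable (by fun_prop))
      ((ae_restrict_iff' measurableSet_cube).2 (ae_of_all _ fun w hw => ?_))
    have h := norm_exp_energy_le hG (mem_cube_iff.1 hw) x β
    rw [Complex.norm_real] at h
    refine le_trans (le_of_eq ?_) h
    rw [← Complex.norm_real, Complex.ofReal_exp]
    push_cast
    rfl
  have h := integral_eq_lintegral_of_nonneg_ae (ae_of_all _ fun w => (Real.exp_pos _).le) hI.aestronglyMeasurable
  refine ⟨?_, ?_⟩
  · rw [treeAmp]
    exact (hI.lintegral_lt_top).ne
  · rw [treeAmp, ← h, cubeAmp, ← integral_complex_ofReal]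
    refine integral_congr_ae (ae_of_all _ fun w => ?_)
    push_cast
    rfl

/-- The sum over the labelled trees of the weights and complex amplitudes. -/
noncomputable def treeSum (x : ℂ) (r : V) (β : V → ℝ) : ℂ :=
  ∑ G : {G : SimpleGraph V // G.IsTree}, treeWeight G.1 r β * cubeAmp x G.1 β

/-- The positive orthant. -/
def posOrthant (V : Type) : Set (V → ℝ) := Set.univ.pi fun _ => Set.Ioi 0

lemma measurableSet_posOrthant : MeasurableSet (posOrthant V) := MeasurableSet.univ_pi fun _ => measurableSet_Ioi

omit [Fintype V] in
lemma pos_of_mem_posOrthant {β : V → ℝ} (h : β ∈ posOrthant V) (i : V) : 0 < β i := h i (Set.mem_univ i)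

lemma toReal_treeDensity (x : ℝ) (r : V) {β : V → ℝ} (hβ : β ∈ posOrthant V) :
    treeDensity x r 0 β ≠ ∞ ∧ ((treeDensity x r 0 β).toReal : ℂ) = treeSum x r β := by
  have h1 : ∀ G : {G : SimpleGraph V // G.IsTree},
      ENNReal.ofReal (treeWeight G.1 r β) * treeAmp x G.1 0 β ≠ ∞ := fun G =>
    ENNReal.mul_ne_top ENNReal.ofReal_ne_top (toReal_treeAmp G.2 x β).1
  refine ⟨ENNReal.sum_ne_top.2 fun G _ => h1 G, ?_⟩
  rw [treeDensity, ENNReal.toReal_sum fun G _ => h1 G, treeSum]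
  push_cast
  refine Finset.sum_congr rfl fun G _ => ?_
  rw [ENNReal.toReal_mul, ENNReal.toReal_ofReal (treeWeight_nonneg (pos_of_mem_posOrthant hβ)),
    Complex.ofReal_mul, (toReal_treeAmp G.2 x β).2]

/-- `treeIntegral_eq`, valid for all nonnegative test functions, is an equality of measures on the
line: the law of `∑ βᵢ` under the tree density and the measure with density `branch`. Complex `g`
can then be integrated against it. -/
lemma integral_treeSum_of_nonneg {n : ℕ} (hV : Fintype.card V = n + 1) (r : V) {x : ℝ} (hx : 0 ≤ x)
    {g : ℝ → ℂ} (hg : Measurable g) :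
    ∫ β in posOrthant V, g (∑ i, β i) * treeSum x r β =
      n.factorial * ∫ B in Set.Ioi (0 : ℝ), g B * branch n x ((B ^ 2 : ℝ) : ℂ) := by
  have hD : Measurable (treeDensity x r 0) :=
    Measurable.comp (g := fun q : ℝ × (V → ℝ) => treeDensity x r q.1 q.2) (f := fun β => (0, β))
      (measurable_treeDensity x r) (measurable_const.prodMk measurable_id)
  have hS : Measurable fun β : V → ℝ => ∑ i, β i := by fun_prop
  have hκm : Measurable (branchKernel x n 0) :=
    Measurable.comp (g := fun q : ℝ × ℝ => branchKernel x n q.1 q.2) (f := fun B => (0, B))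
      ((isTreeKernel_branchKernel hx).measurable n) (measurable_const.prodMk measurable_id)
  have hmeas : ((volume.restrict (posOrthant V)).withDensity (treeDensity x r 0)).map (fun β => ∑ i, β i) =
      (n.factorial : ℝ≥0∞) • (volume.restrict (Set.Ioi (0 : ℝ))).withDensity (branchKernel x n 0) := by
    refine Measure.ext_of_lintegral _ fun f hf => ?_
    have h := treeIntegral_eq (isTreeKernel_branchKernel hx) n hV r 0 ⟨le_rfl, zero_le_one⟩ f hf
    have e1 : ∫⁻ B, f B ∂(((volume.restrict (posOrthant V)).withDensity (treeDensity x r 0)).map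
        (fun β => ∑ i, β i)) = treeIntegral x r 0 f := by
      rw [lintegral_map hf hS, lintegral_withDensity_eq_lintegral_mul _ hD (g := fun β => f (∑ i, β i))
        (hf.comp hS), treeIntegral]
      exact lintegral_congr fun β => mul_comm _ _
    have e2 : ∫⁻ B, f B ∂((n.factorial : ℝ≥0∞) • (volume.restrict (Set.Ioi (0 : ℝ))).withDensity
        (branchKernel x n 0)) = n.factorial * ∫⁻ B in Set.Ioi 0, f B * branchKernel x n 0 B := by
      rw [lintegral_smul_measure, lintegral_withDensity_eq_lintegral_mul _ hκm hf, smul_eq_mul]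
      congr 1
      exact lintegral_congr fun B => mul_comm _ _
    rw [e1, e2, h]
  have h1 : ∫ β in posOrthant V, g (∑ i, β i) * treeSum x r β =
      ∫ B, g B ∂(((volume.restrict (posOrthant V)).withDensity (treeDensity x r 0)).map (fun β => ∑ i, β i)) := by
    rw [integral_map hS.aemeasurable hg.aestronglyMeasurable, integral_withDensity_eq_integral_toReal_smul hD]
    · refine setIntegral_congr_fun measurableSet_posOrthant fun β hβ => ?_
      rw [Complex.real_smul, (toReal_treeDensity x r hβ).2, mul_comm]
    · exact (ae_restrict_iff' measurableSet_posOrthant).2 (ae_of_all _ fun β hβ =>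
        (toReal_treeDensity x r hβ).1.lt_top)
  rw [h1, hmeas, integral_smul_measure, integral_withDensity_eq_integral_toReal_smul hκm
    (ae_of_all _ fun B => ENNReal.ofReal_lt_top), ENNReal.toReal_natCast, Complex.real_smul]
  congr 1
  refine integral_congr_ae (ae_of_all _ fun B => ?_)
  obtain ⟨h2, h3⟩ := exists_branch_eq_ofReal n hx (sq_nonneg B)
  simp only
  rw [branchKernel, Complex.real_smul, sub_zero, one_mul, ENNReal.toReal_ofReal h2, ← h3, mul_comm]

lemma differentiable_branch_left (n : ℕ) (u : ℝ) : Differentiable ℂ fun x => branch n x u := by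
  intro x
  have hx : x ∈ Metric.ball (0 : ℂ) (‖x‖ + 1) := by simp
  have h := Complex.differentiableOn_tsum_of_summable_norm
    (F := fun l x => (branchWeight n u l : ℂ) * x ^ l) (u := fun l => ‖(branchWeight n u l : ℂ) *
      ((‖x‖ + 1 : ℝ) : ℂ) ^ l‖) (summable_norm_iff.2 (hasSum_branch_ofReal n ((‖x‖ + 1 : ℝ) : ℂ) u).summable)
    (fun l => by fun_prop) (Metric.isOpen_ball (x := (0 : ℂ)) (ε := ‖x‖ + 1)) (fun l w hw => by
      rw [mem_ball_zero_iff] at hw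
      rw [norm_mul, norm_mul, norm_pow, norm_pow, Complex.norm_real (‖x‖ + 1), Real.norm_of_nonneg (by positivity)]
      gcongr)
  have h2 : (fun x => branch n x u) = fun w => ∑' l, (branchWeight n u l : ℂ) * w ^ l :=
    funext fun w => (hasSum_branch_ofReal n w u).tsum_eq.symm
  rw [h2]
  exact h.differentiableAt (Metric.isOpen_ball.mem_nhds hx)

lemma branchWeight_nonneg (n : ℕ) {u : ℝ} (hu : 0 ≤ u) (l : ℕ) : 0 ≤ branchWeight n u l := by
  unfold branchWeight; positivity

lemma norm_branch_le_re (n : ℕ) {x : ℂ} {ρ u : ℝ} (hx : ‖x‖ ≤ ρ) (hu : 0 ≤ u) :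
    ‖branch n x u‖ ≤ (branch n ρ u).re := by
  have hρ : 0 ≤ ρ := (norm_nonneg x).trans hx
  have h := Complex.hasSum_re (hasSum_branch_ofReal n ρ u)
  rw [← (hasSum_branch_ofReal n x u).tsum_eq]
  refine tsum_of_norm_bounded h fun l => ?_
  have h1 : ((branchWeight n u l : ℂ) * (ρ : ℂ) ^ l).re = branchWeight n u l * ρ ^ l := by
    rw [← Complex.ofReal_pow, ← Complex.ofReal_mul, Complex.ofReal_re]
  have h0 := branchWeight_nonneg n hu l
  rw [h1, norm_mul, norm_pow, Complex.norm_real, Real.norm_of_nonneg h0]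
  gcongr

/-- The cutoff exponential. -/
noncomputable def cutExp (c : ℂ) (R : ℝ) (B : ℝ) : ℂ := if B ≤ R then Complex.exp (-(c * B)) else 0

lemma measurable_cutExp (c : ℂ) (R : ℝ) : Measurable (cutExp c R) :=
  Measurable.ite measurableSet_Iic (by fun_prop) measurable_const

lemma cutExp_of_lt {c : ℂ} {R B : ℝ} (h : R < B) : cutExp c R B = 0 := if_neg (not_le.2 h)

lemma norm_cutExp_le {c : ℂ} (hc : 0 ≤ c.re) (R : ℝ) {B : ℝ} (hB : 0 ≤ B) : ‖cutExp c R B‖ ≤ 1 := by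
  unfold cutExp
  split_ifs
  · refine norm_exp_le_one_of_re_nonpos ?_
    rw [Complex.neg_re, Complex.re_mul_ofReal]
    linarith [mul_nonneg hc hB]
  · simp

lemma stronglyMeasurable_treeSum (x : ℂ) (r : V) : StronglyMeasurable (treeSum x r) := by
  unfold treeSum
  refine Finset.stronglyMeasurable_fun_sum _ fun G _ => StronglyMeasurable.mul ?_ (stronglyMeasurable_cubeAmp x G.1)
  refine Measurable.stronglyMeasurable ?_
  unfold treeWeight
  fun_prop

lemma norm_treeSum_le (x : ℂ) (r : V) {β : V → ℝ} (hβ : β ∈ posOrthant V) :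
    ‖treeSum x r β‖ ≤ (∑ G : {G : SimpleGraph V // G.IsTree}, treeWeight G.1 r β) *
      Real.exp (‖x‖ / 2 * (∑ i, β i) ^ 2) := by
  have h0 := pos_of_mem_posOrthant hβ
  rw [treeSum, Finset.sum_mul]
  refine norm_sum_le_of_le _ fun G _ => ?_
  rw [norm_mul, Complex.norm_real, Real.norm_of_nonneg (treeWeight_nonneg h0)]
  have h1 := norm_cubeAmp_le G.2 x β
  rw [Finset.sum_congr rfl fun i _ => abs_of_pos (h0 i)] at h1
  exact mul_le_mul_of_nonneg_left h1 (treeWeight_nonneg h0)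

/-- The cutoff confines the `β`'s to the bounded cube `[0, R]^V`, where the amplitudes are bounded
locally uniformly in `x`. -/
lemma differentiableAt_treeSum_integral (r : V) {c : ℂ} (hc : 0 ≤ c.re) (R : ℝ) (x : ℂ) :
    DifferentiableAt ℂ (fun x => ∫ β in posOrthant V, cutExp c R (∑ i, β i) * treeSum x r β) x := by
  set K : ℝ := (∑ G : {G : SimpleGraph V // G.IsTree}, treeWeight G.1 r fun _ => R) *
    Real.exp ((‖x‖ + 1) / 2 * R ^ 2) with hK
  have hm := measurable_cutExp c R
  refine differentiableAt_integral_of_bound (Metric.ball_mem_nhds x one_pos)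
    (b := (Set.univ.pi fun _ : V => Set.Icc 0 R).indicator fun _ => K)
    (fun y _ => ?_) (ae_of_all _ fun β => ?_) ?_
    ((ae_restrict_iff' measurableSet_posOrthant).2 (ae_of_all _ fun β hβ y hy => ?_))
  · exact (Measurable.aestronglyMeasurable (by fun_prop)).mul (stronglyMeasurable_treeSum y r).aestronglyMeasurable
  · unfold treeSum
    refine Differentiable.differentiableOn ?_
    refine Differentiable.const_mul (Differentiable.fun_sum fun G _ => ?_) _
    exact (differentiable_cubeAmp G.2 β).const_mul _
  · refine Integrable.restrict ?_
    refine (integrable_indicator_iff (MeasurableSet.univ_pi fun _ => measurableSet_Icc)).2 ?_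
    refine integrableOn_const (ne_of_lt ?_)
    rw [volume_pi_pi]
    exact ENNReal.prod_lt_top fun i _ => by simp
  · have h0 := pos_of_mem_posOrthant hβ
    by_cases hR : ∑ i, β i ≤ R
    · have hle : ∀ i, β i ≤ R := fun i =>
        (Finset.single_le_sum (fun j _ => (h0 j).le) (Finset.mem_univ i)).trans hR
      have hS : 0 ≤ ∑ i, β i := Finset.sum_nonneg fun i _ => (h0 i).le
      rw [Set.indicator_of_mem fun i _ => ⟨(h0 i).le, hle i⟩, norm_mul]
      have hy' : ‖y‖ ≤ ‖x‖ + 1 := by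
        rw [Metric.mem_ball, dist_eq_norm] at hy
        linarith [norm_le_insert' y x]
      have h2 : ‖treeSum y r β‖ ≤ K := by
        refine (norm_treeSum_le y r hβ).trans ?_
        have h3 : ∑ G : {G : SimpleGraph V // G.IsTree}, treeWeight G.1 r β ≤
            ∑ G : {G : SimpleGraph V // G.IsTree}, treeWeight G.1 r fun _ => R :=
          Finset.sum_le_sum fun G _ => Finset.prod_le_prod (fun i _ => pow_nonneg (h0 i).le _)
            fun i _ => pow_le_pow_left₀ (h0 i).le (hle i) _
        have h4 : 0 ≤ ∑ G : {G : SimpleGraph V // G.IsTree}, treeWeight G.1 r β :=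
          Finset.sum_nonneg fun G _ => treeWeight_nonneg h0
        rw [hK]
        have := h4.trans h3
        gcongr
      calc _ ≤ 1 * K := mul_le_mul (norm_cutExp_le hc R hS) h2 (norm_nonneg _) zero_le_one
        _ = K := one_mul K
    · rw [cutExp_of_lt (not_le.1 hR), zero_mul, norm_zero]
      refine Set.indicator_nonneg (fun β' hβ' => ?_) _
      have hR0 : 0 ≤ R ∨ IsEmpty V := by
        by_cases h : Nonempty V
        · obtain ⟨i⟩ := h
          exact Or.inl ((hβ' i (Set.mem_univ i)).1.trans (hβ' i (Set.mem_univ i)).2)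
        · exact Or.inr (not_nonempty_iff.1 h)
      refine mul_nonneg (Finset.sum_nonneg fun G _ => Finset.prod_nonneg fun i _ => ?_) (Real.exp_pos _).le
      rcases hR0 with h | h
      · exact pow_nonneg h _
      · exact (h.false i).elim

lemma differentiableAt_branch_integral (n : ℕ) {c : ℂ} (hc : 0 ≤ c.re) (R : ℝ) (x : ℂ) :
    DifferentiableAt ℂ (fun x => ∫ B in Set.Ioi (0 : ℝ), cutExp c R B * branch n x ((B ^ 2 : ℝ) : ℂ)) x := by
  have hb : ∀ y : ℂ, Continuous fun u : ℂ => branch n y u := fun y => (differentiable_branch n y).continuous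
  have hm := measurable_cutExp c R
  refine differentiableAt_integral_of_bound (Metric.ball_mem_nhds x one_pos)
    (b := (Set.Icc 0 R).indicator fun B => (branch n ((‖x‖ + 1 : ℝ) : ℂ) ((B ^ 2 : ℝ) : ℂ)).re)
    (fun y _ => ?_) (ae_of_all _ fun B => ?_) ?_
    ((ae_restrict_iff' measurableSet_Ioi).2 (ae_of_all _ fun B hB y hy => ?_))
  · have := hb y
    exact hm.aestronglyMeasurable.mul (Continuous.aestronglyMeasurable (by fun_prop))
  · exact ((differentiable_branch_left n (B ^ 2)).const_mul _).differentiableOn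
  · refine Integrable.restrict ?_
    refine (integrable_indicator_iff measurableSet_Icc).2 ?_
    have := hb ((‖x‖ + 1 : ℝ) : ℂ)
    exact Continuous.integrableOn_Icc (by fun_prop)
  · rw [Set.mem_Ioi] at hB
    have hy' : ‖y‖ ≤ ‖x‖ + 1 := by
      rw [Metric.mem_ball, dist_eq_norm] at hy
      linarith [norm_le_insert' y x]
    by_cases hR : B ≤ R
    · rw [Set.indicator_of_mem (show B ∈ Set.Icc 0 R from ⟨hB.le, hR⟩), norm_mul]
      refine (mul_le_of_le_one_left (norm_nonneg _) (norm_cutExp_le hc R hB.le)).trans ?_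
      exact norm_branch_le_re n hy' (sq_nonneg B)
    · rw [cutExp_of_lt (not_le.1 hR), zero_mul, norm_zero]
      exact Set.indicator_nonneg (fun B' _ => (norm_nonneg _).trans
        (norm_branch_le_re n (x := ((‖x‖ + 1 : ℝ) : ℂ)) (by
          rw [Complex.norm_real, Real.norm_of_nonneg (by positivity)]) (sq_nonneg B'))) _

/-- Under the cutoff both sides are entire in `x`, and they agree for `x > 0`. The cutoff tames the
growth of `exp(x/2 ∑ βᵢXᵢⱼβⱼ)` for such `x`; it is removed afterwards, where `Re x ≤ 0`. -/
lemma integral_cutExp_mul_treeSum {n : ℕ} (hV : Fintype.card V = n + 1) (r : V) {c : ℂ} (hc : 0 ≤ c.re)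
    (R : ℝ) (x : ℂ) : ∫ β in posOrthant V, cutExp c R (∑ i, β i) * treeSum x r β =
      n.factorial * ∫ B in Set.Ioi (0 : ℝ), cutExp c R B * branch n x ((B ^ 2 : ℝ) : ℂ) := by
  have h := eqOn_of_eq_ofReal (U := Set.univ) (r := 0)
    (f := fun x => ∫ β in posOrthant V, cutExp c R (∑ i, β i) * treeSum x r β)
    (g := fun x => n.factorial * ∫ B in Set.Ioi (0 : ℝ), cutExp c R B * branch n x ((B ^ 2 : ℝ) : ℂ))
    (DifferentiableOn.analyticOnNhd (fun x _ =>
      (differentiableAt_treeSum_integral r hc R x).differentiableWithinAt) isOpen_univ)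
    (DifferentiableOn.analyticOnNhd (fun x _ =>
      ((differentiableAt_branch_integral n hc R x).const_mul _).differentiableWithinAt) isOpen_univ)
    isPreconnected_univ (Set.mem_univ _) (by
      filter_upwards [self_mem_nhdsWithin] with s hs
      exact integral_treeSum_of_nonneg hV r (le_of_lt hs) (measurable_cutExp c R))
  exact h (Set.mem_univ x)

lemma tendsto_integral_cutoff {α : Type*} [MeasurableSpace α] {μ : Measure α} {f : α → ℂ} {φ : α → ℝ}
    (hφ : Measurable φ) (c : ℂ) (hm : AEStronglyMeasurable f μ)
    (hf : Integrable (fun a => Complex.exp (-(c * φ a)) * f a) μ) :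
    Tendsto (fun k : ℕ => ∫ a, cutExp c k (φ a) * f a ∂μ) atTop (𝓝 (∫ a, Complex.exp (-(c * φ a)) * f a ∂μ)) := by
  refine tendsto_integral_of_dominated_convergence (fun a => ‖Complex.exp (-(c * φ a)) * f a‖) (fun k => ?_)
    hf.norm (fun k => ae_of_all _ fun a => ?_) (ae_of_all _ fun a => ?_)
  · exact ((measurable_cutExp c k).comp hφ).aestronglyMeasurable.mul hm
  · unfold cutExp
    split_ifs
    · exact le_rfl
    · simp
  · refine tendsto_const_nhds.congr' ?_
    filter_upwards [eventually_ge_atTop ⌈φ a⌉₊] with k hk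
    rw [cutExp, if_pos ((Nat.le_ceil _).trans (by exact_mod_cast hk))]

lemma integrableOn_prod_pow_mul_exp (k : V → ℕ) {c : ℂ} (hc : 0 < c.re) :
    IntegrableOn (fun β : V → ℝ => ∏ i, (β i : ℂ) ^ k i * Complex.exp (-(c * β i))) (posOrthant V) := by
  rw [IntegrableOn, posOrthant, volume_pi, Measure.restrict_pi_pi]
  exact Integrable.fintype_prod fun i => integrableOn_pow_mul_cexp_neg_mul (k i) hc

lemma exp_mul_treeWeight (c : ℂ) (G : SimpleGraph V) (r : V) (β : V → ℝ) :
    Complex.exp (-(c * ((∑ i, β i : ℝ) : ℂ))) * treeWeight G r β =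
      ∏ i, (β i : ℂ) ^ childCount G r i * Complex.exp (-(c * β i)) := by
  rw [treeWeight, Finset.prod_mul_distrib, ← Complex.exp_sum, mul_comm]
  push_cast
  rw [Finset.sum_neg_distrib, Finset.mul_sum]

lemma integrableOn_exp_mul_treeWeight (G : SimpleGraph V) (r : V) {c : ℂ} (hc : 0 < c.re) :
    IntegrableOn (fun β : V → ℝ => Complex.exp (-(c * ((∑ i, β i : ℝ) : ℂ))) * treeWeight G r β)
      (posOrthant V) := by
  simp_rw [exp_mul_treeWeight]
  exact integrableOn_prod_pow_mul_exp _ hc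

lemma integrableOn_exp_mul_amp {G : SimpleGraph V} (hG : G.IsTree) (r : V) {c x : ℂ} (hc : 0 < c.re)
    (hx : x.re ≤ 0) : IntegrableOn (fun β : V → ℝ => Complex.exp (-(c * ((∑ i, β i : ℝ) : ℂ))) *
      (treeWeight G r β * cubeAmp x G β)) (posOrthant V) := by
  simp_rw [← mul_assoc]
  exact (integrableOn_exp_mul_treeWeight G r hc).mul_bdd (c := 1)
    (stronglyMeasurable_cubeAmp x G).aestronglyMeasurable (ae_of_all _ fun β => norm_cubeAmp_le_one hG hx β)

lemma integrableOn_exp_mul_branch (n : ℕ) {c x : ℂ} (hc : 0 < c.re) (hx : x.re ≤ 0) :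
    IntegrableOn (fun B : ℝ => Complex.exp (-(c * B)) * branch n x ((B ^ 2 : ℝ) : ℂ)) (Set.Ioi 0) := by
  have hb : Continuous fun u : ℂ => branch n x u := (differentiable_branch n x).continuous
  refine Integrable.mono' ((integrableOn_pow_mul_exp_neg_mul (2 * n) hc).const_mul
    (catalan n / (2 * n).factorial : ℝ)) (Continuous.aestronglyMeasurable (by fun_prop)) (ae_of_all _ fun B => ?_)
  rw [norm_mul, Complex.norm_exp, Complex.neg_re, Complex.re_mul_ofReal]
  calc _ ≤ Real.exp (-(c.re * B)) * (catalan n * ((B ^ 2) ^ n / (2 * n).factorial)) := by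
        gcongr
        exact norm_branch_le n hx (sq_nonneg B)
    _ = _ := by rw [← pow_mul]; ring

/-- The sum over all labelled trees with `n + 1` vertices, on the complex domain. -/
lemma sum_integral_exp_mul_amp {n : ℕ} (hV : Fintype.card V = n + 1) (r : V) {c x : ℂ} (hc : 0 < c.re)
    (hx : x.re ≤ 0) :
    ∑ G : {G : SimpleGraph V // G.IsTree}, ∫ β in posOrthant V, Complex.exp (-(c * ((∑ i, β i : ℝ) : ℂ))) *
        (treeWeight G.1 r β * cubeAmp x G.1 β) =
      n.factorial * ∫ B in Set.Ioi (0 : ℝ), Complex.exp (-(c * B)) * branch n x ((B ^ 2 : ℝ) : ℂ) := by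
  have hb : Continuous fun u : ℂ => branch n x u := (differentiable_branch n x).continuous
  have hI : IntegrableOn (fun β : V → ℝ => Complex.exp (-(c * ((∑ i, β i : ℝ) : ℂ))) * treeSum x r β)
      (posOrthant V) := by
    unfold treeSum
    simp_rw [Finset.mul_sum]
    exact integrable_finsetSum _ fun G _ => integrableOn_exp_mul_amp G.2 r hc hx
  have h1 := tendsto_integral_cutoff (by fun_prop) c (stronglyMeasurable_treeSum x r).aestronglyMeasurable hI
  have h2 := tendsto_integral_cutoff (φ := fun B : ℝ => B) measurable_id c
    (Continuous.aestronglyMeasurable (f := fun B : ℝ => branch n x ((B ^ 2 : ℝ) : ℂ)) (by fun_prop))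
    (integrableOn_exp_mul_branch n hc hx)
  simp_rw [fun k : ℕ => integral_cutExp_mul_treeSum hV r hc.le k x] at h1
  rw [← tendsto_nhds_unique h1 (h2.const_mul _), ← integral_finsetSum _ fun G _ =>
    integrableOn_exp_mul_amp G.2 r hc hx]
  refine integral_congr_ae (ae_of_all _ fun β => ?_)
  simp only
  rw [treeSum, Finset.mul_sum]

end ComplexAmp

end NVector

namespace NVector

/-! ### The tree expansions -/

section Expansion

/-- Every vertex other than the root is the child of exactly one vertex, its parent. -/
lemma sum_childCount {V : Type} [Fintype V] {G : SimpleGraph V} (hG : G.IsTree) (r : V) :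
    ∑ i, childCount G r i = Fintype.card V - 1 := by
  classical
  simp_rw [← card_childSet hG r]
  rw [← Finset.card_univ, ← Finset.card_erase_of_mem (Finset.mem_univ r), ← Finset.card_biUnion]
  · congr 1
    ext j
    simp only [Finset.mem_biUnion, Finset.mem_univ, true_and, Finset.mem_erase, and_true]
    constructor
    · rintro ⟨i, hi⟩ rfl
      have := (mem_childSet.1 hi).2
      simp at this
    · intro hj
      obtain ⟨k, hk, hd, -⟩ := exists_parent hG hj
      exact ⟨k, mem_childSet.2 ⟨hk.symm, hd⟩⟩
  · intro i _ j _ hij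
    refine Finset.disjoint_left.2 fun l hi hj => hij ?_
    have h1 := mem_childSet.1 hi
    have h2 := mem_childSet.1 hj
    have hl : l ≠ r := by
      rintro rfl
      simpa using h1.2
    obtain ⟨k, -, -, hu⟩ := exists_parent hG hl
    rw [hu i h1.1.symm h1.2, hu j h2.1.symm h2.2]

variable {n N : ℕ} {z : ℂ} {ψ : ℝ}

lemma hasSum_anyPlaneTree {f : AnyPlaneTree → ℂ} {a : ℂ} {b : ℕ → ℝ}
    (hb : Summable b) (h1 : ∀ n, ∑ T : PlaneTree n, ‖f ⟨n, T⟩‖ ≤ b n)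
    (h2 : HasSum (fun n => ∑ T : PlaneTree n, f ⟨n, T⟩) a) : HasSum f a := by
  have hs : Summable f := by
    refine Summable.of_norm ((summable_sigma_of_nonneg fun _ => norm_nonneg _).2
      ⟨fun n => (hasSum_fintype _).summable, ?_⟩)
    simp_rw [tsum_fintype]
    exact Summable.of_nonneg_of_le (fun n => Finset.sum_nonneg fun T _ => norm_nonneg _) h1 hb
  have h3 := hs.hasSum.sigma fun n => hasSum_fintype _
  rw [← h3.unique h2]
  exact hs.hasSum

lemma energy_zero {V : Type} [Fintype V] (G : SimpleGraph V) (w : G.edgeSet → ℝ) (β : V → ℝ) :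
    energy G w 0 β = ∑ i, ∑ j, β i * β j * pathInf G w i j := by
  simp only [energy, sub_zero]

lemma PlaneTree.cube_eq (T : PlaneTree n) : T.cube = Set.univ.pi fun _ : T.Edge => Set.Icc (0 : ℝ) 1 := by
  rw [Set.pi_univ_Icc]
  rfl

lemma PlaneTree.measurable_quadExp (T : PlaneTree n) (N : ℕ) (z : ℂ) (b : Fin (n + 1) → ℂ) :
    Measurable (T.quadExp N z b) := by
  have : ∀ i j, Measurable fun w : T.graph.edgeSet → ℝ => pathInf T.graph w i j := fun i j => measurable_pathInf
  unfold PlaneTree.quadExp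
  simp_rw [T.X_eq_pathInf]
  fun_prop

lemma PlaneTree.integrableOn_quadExp (T : PlaneTree n) (N : ℕ) (z : ℂ) (b : Fin (n + 1) → ℂ) :
    IntegrableOn (T.quadExp N z b) T.cube := by
  rw [T.cube_eq]
  refine Integrable.mono' (integrable_const (Real.exp (‖z / (2 * (N : ℂ))‖ * ∑ i, ∑ j, ‖b i‖ * ‖b j‖)))
    (T.measurable_quadExp N z b).aestronglyMeasurable
    ((ae_restrict_iff' measurableSet_cube).2 (ae_of_all _ fun w hw => ?_))
  refine (Complex.norm_exp_le_exp_norm _).trans (Real.exp_le_exp.2 ?_)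
  rw [norm_mul]
  gcongr
  refine norm_sum_le_of_le _ fun i _ => norm_sum_le_of_le _ fun j _ => ?_
  have h := pathInf_mem_Icc (i := i) (j := j) T.isTree zero_le_one (NVector.mem_cube_iff.1 hw)
  rw [T.X_eq_pathInf, norm_mul, norm_mul, Complex.norm_real, Real.norm_of_nonneg h.1, mul_right_comm]
  exact mul_le_of_le_one_right (by positivity) h.2

/-- The effective coupling on a rotated contour. -/
noncomputable def rayCoupling (N : ℕ) (z : ℂ) (ψ : ℝ) : ℂ :=
  z * Complex.exp (ψ * Complex.I) ^ 2 * (((N : ℝ)⁻¹ : ℝ) : ℂ)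

lemma rayCoupling_re_nonpos (hz : (z * Complex.exp (ψ * Complex.I) ^ 2).re ≤ 0) (N : ℕ) :
    (rayCoupling N z ψ).re ≤ 0 := by
  rw [rayCoupling, Complex.re_mul_ofReal]
  exact mul_nonpos_of_nonpos_of_nonneg hz (by positivity)

lemma PlaneTree.quadExp_ray (T : PlaneTree n) (N : ℕ) (z : ℂ) (ψ : ℝ) (t : Fin (n + 1) → ℝ)
    (w : T.Edge → ℝ) : T.quadExp N z (fun i => Complex.exp (ψ * Complex.I) * (t i : ℂ)) w =
      Complex.exp (rayCoupling N z ψ / 2 * energy T.graph w 0 t) := by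
  rw [PlaneTree.quadExp, rayCoupling, energy_zero]
  congr 1
  push_cast
  rw [Finset.mul_sum, Finset.mul_sum]
  refine Finset.sum_congr rfl fun i _ => ?_
  rw [Finset.mul_sum, Finset.mul_sum]
  refine Finset.sum_congr rfl fun j _ => ?_
  rw [T.X_eq_pathInf, ← div_div]
  ring

/-- The weight of the orderings and of the rotation of the contour. -/
noncomputable def PlaneTree.prefactor (T : PlaneTree n) (ψ : ℝ) : ℂ :=
  (∏ i, (((T.degree i - 1).factorial : ℕ) : ℂ))⁻¹ * Complex.exp (ψ * Complex.I) ^ (2 * n + 1)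

/-- The phase exponent is `2n + 1`: `n + 1` factors from the `dβ_i` and `n` from the powers, the
total number of children being `n`. -/
lemma PlaneTree.prod_ray (T : PlaneTree n) (ψ : ℝ) (t : Fin (n + 1) → ℂ) :
    ∏ i, Complex.exp (ψ * Complex.I) * ((Complex.exp (ψ * Complex.I) * t i) ^ (T.degree i - 1) /
        ((T.degree i - 1).factorial : ℂ)) = T.prefactor ψ * ∏ i, t i ^ childCount T.graph 0 i := by
  have h := sum_childCount T.isTree 0
  rw [Fintype.card_fin, Nat.add_sub_cancel] at h
  rw [PlaneTree.prefactor]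
  simp only [T.degree_eq, Nat.add_sub_cancel, mul_pow, Finset.prod_mul_distrib, Finset.prod_div_distrib,
    Finset.prod_const, Finset.card_univ, Fintype.card_fin, Finset.prod_pow_eq_pow_sum, h]
  rw [show 2 * n + 1 = n + 1 + n by ring, pow_add]
  ring

lemma PlaneTree.betaIntegrand_eq (T : PlaneTree n) (N : ℕ) (z : ℂ) (ψ : ℝ) (t : Fin (n + 1) → ℝ) :
    T.betaIntegrand N z ψ t = T.prefactor ψ *
      (Complex.exp (-(Complex.exp (ψ * Complex.I) * ((∑ i, t i : ℝ) : ℂ))) *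
        (treeWeight T.graph 0 t * cubeAmp (rayCoupling N z ψ) T.graph t)) := by
  rw [PlaneTree.betaIntegrand]
  simp_rw [T.quadExp_ray]
  simp only [← mul_assoc, Finset.prod_mul_distrib]
  rw [← Finset.prod_mul_distrib, T.prod_ray ψ fun i => (t i : ℂ), ← Complex.exp_sum, cubeAmp, T.cube_eq, treeWeight]
  push_cast
  rw [Finset.mul_sum, Finset.sum_neg_distrib]
  ring

lemma PlaneTree.integrableOn_betaIntegrand (T : PlaneTree n) (hψ : 0 < Real.cos ψ)
    (hz : (z * Complex.exp (ψ * Complex.I) ^ 2).re ≤ 0) :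
    IntegrableOn (T.betaIntegrand N z ψ) (PlaneTree.orthant n) := by
  have h := (integrableOn_exp_mul_amp T.isTree 0 (c := Complex.exp (ψ * Complex.I))
    (by rwa [Complex.exp_ofReal_mul_I_re]) (rayCoupling_re_nonpos hz N)).const_mul (T.prefactor ψ)
  exact h.congr (ae_of_all _ fun t => (T.betaIntegrand_eq N z ψ t).symm)

lemma PlaneTree.betaAmplitude_eq (T : PlaneTree n) (N : ℕ) (z : ℂ) (ψ : ℝ) :
    T.betaAmplitude N z ψ = T.prefactor ψ * ∫ t in posOrthant (Fin (n + 1)),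
      Complex.exp (-(Complex.exp (ψ * Complex.I) * ((∑ i, t i : ℝ) : ℂ))) *
        (treeWeight T.graph 0 t * cubeAmp (rayCoupling N z ψ) T.graph t) := by
  rw [← integral_const_mul]
  exact integral_congr_ae (ae_of_all _ fun t => T.betaIntegrand_eq N z ψ t)

lemma sum_betaAmplitude (n N : ℕ) (hψ : 0 < Real.cos ψ)
    (hz : (z * Complex.exp (ψ * Complex.I) ^ 2).re ≤ 0) :
    ∑ T : PlaneTree n, T.betaAmplitude N z ψ = Complex.exp (ψ * Complex.I) ^ (2 * n + 1) * (n.factorial *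
      ∫ B in Set.Ioi (0 : ℝ), Complex.exp (-(Complex.exp (ψ * Complex.I) * B)) *
        branch n (rayCoupling N z ψ) ((B ^ 2 : ℝ) : ℂ)) := by
  rw [← sum_integral_exp_mul_amp (Fintype.card_fin (n + 1)) 0 (by rwa [Complex.exp_ofReal_mul_I_re])
    (rayCoupling_re_nonpos hz N), Finset.mul_sum, ← sum_planeTree fun G =>
      Complex.exp (ψ * Complex.I) ^ (2 * n + 1) * ∫ t in posOrthant (Fin (n + 1)),
      Complex.exp (-(Complex.exp (ψ * Complex.I) * ((∑ i, t i : ℝ) : ℂ))) *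
        (treeWeight G 0 t * cubeAmp (rayCoupling N z ψ) G t)]
  refine Finset.sum_congr rfl fun T _ => ?_
  rw [T.betaAmplitude_eq, PlaneTree.prefactor]
  ring

lemma norm_laplace_branch_le (n : ℕ) {c x : ℂ} (hc : 0 < c.re) (hx : x.re ≤ 0) :
    ‖∫ B in Set.Ioi (0 : ℝ), Complex.exp (-(c * B)) * branch n x ((B ^ 2 : ℝ) : ℂ)‖ ≤
      catalan n / c.re ^ (2 * n + 1) := by
  have h := integral_exp_mul_even_term n (catalan n) 1 hc
  rw [one_pow, mul_one] at h
  rw [← h]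
  refine norm_integral_le_of_norm_le ?_ (ae_of_all _ fun B => ?_)
  · refine ((integrableOn_pow_mul_exp_neg_mul (2 * n) hc).const_mul
      (catalan n / (2 * n).factorial : ℝ)).congr (ae_of_all _ fun B => ?_)
    simp only
    rw [one_mul, ← pow_mul]
    ring
  · rw [norm_mul, Complex.norm_exp, Complex.neg_re, Complex.re_mul_ofReal, one_mul]
    gcongr
    exact norm_branch_le n hx (sq_nonneg B)

lemma cubeAmp_zero {V : Type} [Fintype V] (G : SimpleGraph V) (β : V → ℝ) : cubeAmp 0 G β = 1 := by
  simp only [cubeAmp, zero_div, zero_mul, Complex.exp_zero, integral_const, probReal_univ, one_smul]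

/-- Positivity of `X` bounds the integral over the cube by `1`, its value at zero coupling. The
bounding sum is thus the exact tree formula with coupling `0` and decay rate `cos ψ`. -/
lemma sum_norm_betaAmplitude_le (n N : ℕ) (hψ : 0 < Real.cos ψ)
    (hz : (z * Complex.exp (ψ * Complex.I) ^ 2).re ≤ 0) :
    ∑ T : PlaneTree n, ‖T.betaAmplitude N z ψ‖ ≤
      n.factorial * (catalan n / Real.cos ψ ^ (2 * n + 1)) := by
  let F : SimpleGraph (Fin (n + 1)) → ℝ := fun G => ∫ t in posOrthant (Fin (n + 1)),
    Real.exp (-(Real.cos ψ * ∑ i, t i)) * treeWeight G 0 t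
  have hc : 0 < ((Real.cos ψ : ℝ) : ℂ).re := by rwa [Complex.ofReal_re]
  have hcast : ∀ (G : SimpleGraph (Fin (n + 1))) (t : Fin (n + 1) → ℝ),
      Complex.exp (-(((Real.cos ψ : ℝ) : ℂ) * ((∑ i, t i : ℝ) : ℂ))) * treeWeight G 0 t =
        ((Real.exp (-(Real.cos ψ * ∑ i, t i)) * treeWeight G 0 t : ℝ) : ℂ) := fun G t => by push_cast; rfl
  have hFI : ∀ G, IntegrableOn (fun t => Real.exp (-(Real.cos ψ * ∑ i, t i)) * treeWeight G 0 t)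
      (posOrthant (Fin (n + 1))) := fun G => by
    have h := (integrableOn_exp_mul_treeWeight G 0 hc).re
    refine h.congr (ae_of_all _ fun t => ?_)
    simp only
    rw [hcast]
    rfl
  have h1 : ∀ T : PlaneTree n, ‖T.betaAmplitude N z ψ‖ ≤
      (∏ i, (((T.degree i - 1).factorial : ℕ) : ℝ))⁻¹ * F T.graph := by
    intro T
    rw [T.betaAmplitude_eq, PlaneTree.prefactor, norm_mul, norm_mul, norm_pow, Complex.norm_exp_ofReal_mul_I,
      one_pow, mul_one, norm_inv, norm_prod]
    simp_rw [Complex.norm_natCast]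
    gcongr
    refine norm_integral_le_of_norm_le (hFI _)
      ((ae_restrict_iff' measurableSet_posOrthant).2 (ae_of_all _ fun t ht => ?_))
    have h0 := treeWeight_nonneg (G := T.graph) (r := 0) (pos_of_mem_posOrthant ht)
    rw [norm_mul, norm_exp_ray, norm_mul, Complex.norm_real, Real.norm_of_nonneg h0]
    gcongr
    exact mul_le_of_le_one_right h0 (norm_cubeAmp_le_one T.isTree (rayCoupling_re_nonpos hz N) t)
  refine (Finset.sum_le_sum fun T _ => h1 T).trans ?_
  rw [sum_planeTree F]
  have h2 := sum_integral_exp_mul_amp (Fintype.card_fin (n + 1)) 0 hc (x := 0) (by simp)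
  simp_rw [cubeAmp_zero, mul_one, hcast] at h2
  have h3 : ((∑ G : {G : SimpleGraph (Fin (n + 1)) // G.IsTree}, F G.1 : ℝ) : ℂ) = n.factorial *
      ∫ B in Set.Ioi (0 : ℝ), Complex.exp (-(((Real.cos ψ : ℝ) : ℂ) * B)) * branch n 0 ((B ^ 2 : ℝ) : ℂ) := by
    rw [← h2, Complex.ofReal_sum]
    exact Finset.sum_congr rfl fun G _ => integral_complex_ofReal.symm
  refine (le_abs_self _).trans ?_
  rw [← Real.norm_eq_abs, ← Complex.norm_real, h3, norm_mul, Complex.norm_natCast]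
  gcongr
  have := norm_laplace_branch_le n hc (x := 0) (by simp)
  rwa [Complex.ofReal_re] at this

/-- The sum of the tree expansion on a rotated contour. -/
lemma hasSum_betaAmplitude (N : ℕ) (hψ : 0 < Real.cos ψ)
    (hz : (z * Complex.exp (ψ * Complex.I) ^ 2).re ≤ 0) (h : 4 * ‖z‖ < Real.cos ψ ^ 2) :
    HasSum (fun T : AnyPlaneTree => 1 / (T.1.factorial : ℂ) * z ^ T.1 * T.2.betaAmplitude N z ψ)
      (rayIntegral (N : ℝ)⁻¹ ψ z) := by
  have ht := inv_natCast_mem_Icc N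
  refine hasSum_anyPlaneTree (b := fun n => catalan n * ‖z‖ ^ n / Real.cos ψ ^ (2 * n + 1))
    (hasSum_laplace_even_majorant catalan_nonneg' catalan_le_four_pow' (norm_nonneg z) hψ h).summable
    (fun n => ?_) ?_
  · simp_rw [norm_mul, norm_div, norm_pow, Complex.norm_natCast, norm_one, ← Finset.mul_sum]
    have hf : (0 : ℝ) < n.factorial := by exact_mod_cast n.factorial_pos
    calc _ ≤ 1 / (n.factorial : ℝ) * ‖z‖ ^ n * (n.factorial * (catalan n / Real.cos ψ ^ (2 * n + 1))) := by
          gcongr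
          exact sum_norm_betaAmplitude_le n N hψ hz
      _ = _ := by field_simp
  · have hterm : ∀ n, ∑ T : PlaneTree n, 1 / (n.factorial : ℂ) * z ^ n * T.betaAmplitude N z ψ =
        ∫ s in Set.Ioi (0 : ℝ), Complex.exp (ψ * Complex.I) *
          (Complex.exp (-(Complex.exp (ψ * Complex.I) * s)) * ((z * Complex.exp (ψ * Complex.I) ^ 2) ^ n *
            branch n (rayCoupling N z ψ) ((s ^ 2 : ℝ) : ℂ))) := by
      intro n
      rw [← Finset.mul_sum, sum_betaAmplitude n N hψ hz]
      have hf : (n.factorial : ℂ) ≠ 0 := by exact_mod_cast n.factorial_ne_zero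
      have e : ∀ s : ℝ, Complex.exp (ψ * Complex.I) *
          (Complex.exp (-(Complex.exp (ψ * Complex.I) * s)) * ((z * Complex.exp (ψ * Complex.I) ^ 2) ^ n *
            branch n (rayCoupling N z ψ) ((s ^ 2 : ℝ) : ℂ))) =
          (Complex.exp (ψ * Complex.I) * (z * Complex.exp (ψ * Complex.I) ^ 2) ^ n) *
          (Complex.exp (-(Complex.exp (ψ * Complex.I) * s)) * branch n (rayCoupling N z ψ) ((s ^ 2 : ℝ) : ℂ)) :=
        fun s => by ring
      simp_rw [e]
      rw [integral_const_mul, mul_pow, pow_succ, pow_mul]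
      field_simp
    simp_rw [hterm]
    refine hasSum_integral_of_dominated_convergence
      (fun n s => Real.exp (-(Real.cos ψ * s)) * (catalan n * ((‖z‖ * s ^ 2) ^ n / (2 * n).factorial)))
      (fun n => ?_) (fun n => ae_of_all _ fun s => ?_) (ae_of_all _ fun s => ?_) ?_ (ae_of_all _ fun s => ?_)
    · have := (differentiable_branch n (rayCoupling N z ψ)).continuous
      exact Continuous.aestronglyMeasurable (by fun_prop)
    · rw [norm_mul, Complex.norm_exp_ofReal_mul_I, one_mul, norm_mul, norm_exp_ray, norm_mul, norm_pow, norm_mul,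
        norm_pow, Complex.norm_exp_ofReal_mul_I, one_pow, mul_one]
      refine mul_le_mul_of_nonneg_left ?_ (Real.exp_pos _).le
      calc _ ≤ ‖z‖ ^ n * (catalan n * ((s ^ 2) ^ n / (2 * n).factorial)) := by
            gcongr
            exact norm_branch_le n (rayCoupling_re_nonpos hz N) (sq_nonneg s)
        _ = _ := by rw [mul_pow]; ring
    · exact (hasSum_even_majorant catalan_nonneg' catalan_le_four_pow' (‖z‖ * s ^ 2)).summable.mul_left _
    · simp_rw [tsum_mul_left]
      exact integrableOn_catalanMajorant (norm_nonneg z) hψ h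
    · exact ((hasSum_branch_seriesKernel ht (z * Complex.exp (ψ * Complex.I) ^ 2)
        ((s ^ 2 : ℝ) : ℂ)).mul_left _).mul_left _

end Expansion

end NVector

namespace NVector

/-! ### The loop vertex expansion -/

section LoopVertex

variable {n N : ℕ} {u : ℂ}

/-- The angle of the contour used for the loop vertex expansion. -/
noncomputable def lveAngle (u : ℂ) : ℝ := -(u.im / 2)

/-- The direction `ψ = -φ/2` makes `e^{iψ}√z` purely imaginary. For every real `τ` the Laplace
exponent of a resolvent then has real part `cos ψ`, and `τ` enters only through a phase. -/
lemma exp_lveAngle_mul_sqrtZOf (u : ℂ) :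
    Complex.exp (lveAngle u * Complex.I) * sqrtZOf u = (Real.exp (u.re / 2) : ℝ) * Complex.I := by
  rw [sqrtZOf, mul_left_comm, ← Complex.exp_add, mul_comm, Complex.ofReal_exp]
  congr 2
  rw [lveAngle]
  push_cast
  linear_combination (-1 / 2 : ℂ) * Complex.re_add_im u

lemma sqrtZOf_sq (u : ℂ) : sqrtZOf u ^ 2 = zOf u := by
  rw [sqrtZOf, zOf, mul_pow, Complex.I_sq, ← Complex.exp_nat_mul]
  push_cast
  rw [mul_div_cancel₀ _ (two_ne_zero' ℂ)]
  ring

lemma zOf_mul_exp_lveAngle_sq (u : ℂ) :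
    zOf u * Complex.exp (lveAngle u * Complex.I) ^ 2 = -((Real.exp (u.re / 2) ^ 2 : ℝ) : ℂ) := by
  rw [← sqrtZOf_sq, ← mul_pow, mul_comm, exp_lveAngle_mul_sqrtZOf, mul_pow, Complex.I_sq]
  push_cast
  ring

/-- The exponent of the Laplace representation of a resolvent. -/
noncomputable def resolventExponent (u : ℂ) (τ : ℝ) : ℂ :=
  Complex.exp (lveAngle u * Complex.I) * (1 - sqrtZOf u * τ)

lemma resolventExponent_eq (u : ℂ) (τ : ℝ) : resolventExponent u τ =
    Complex.exp (lveAngle u * Complex.I) - ((Real.exp (u.re / 2) * τ : ℝ) : ℂ) * Complex.I := by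
  rw [resolventExponent, mul_sub, mul_one, ← mul_assoc, exp_lveAngle_mul_sqrtZOf]
  push_cast
  ring

lemma resolventExponent_re (u : ℂ) (τ : ℝ) : (resolventExponent u τ).re = Real.cos (lveAngle u) := by
  rw [resolventExponent_eq, Complex.sub_re, Complex.exp_ofReal_mul_I_re, Complex.re_ofReal_mul, Complex.I_re]
  ring

lemma norm_resolvent_le (hψ : 0 < Real.cos (lveAngle u)) (τ : ℝ) :
    ‖1 / (1 - sqrtZOf u * τ)‖ ≤ 1 / Real.cos (lveAngle u) := by
  have h1 := Complex.re_le_norm (resolventExponent u τ)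
  rw [resolventExponent_re, resolventExponent, norm_mul, Complex.norm_exp_ofReal_mul_I, one_mul] at h1
  rw [norm_div, norm_one]
  gcongr

lemma PlaneTree.measurable_resolvents (T : PlaneTree n) (s : ℂ) : Measurable (T.resolvents s) := by
  unfold PlaneTree.resolvents
  fun_prop

instance isProbabilityMeasure_gaussian (T : PlaneTree n) (N : ℕ) (w : T.Edge → ℝ) :
    IsProbabilityMeasure (T.gaussian N w) := by
  unfold PlaneTree.gaussian
  infer_instance

lemma PlaneTree.integrable_resolvents (T : PlaneTree n) (N : ℕ) (w : T.Edge → ℝ)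
    (hψ : 0 < Real.cos (lveAngle u)) : Integrable (T.resolvents (sqrtZOf u)) (T.gaussian N w) := by
  refine Integrable.mono' (integrable_const (∏ _c : T.Corner, 1 / Real.cos (lveAngle u)))
    (T.measurable_resolvents _).aestronglyMeasurable (ae_of_all _ fun τ => ?_)
  rw [PlaneTree.resolvents, norm_prod]
  exact Finset.prod_le_prod (fun c _ => norm_nonneg _) fun c _ => norm_resolvent_le hψ _

/-- Each vertex carries `(1 - √z τ_i)^{-d_i}`, written as a Laplace integral along the rotated ray;
the product is an integral over the orthant in which `τ` appears only in a bounded oscillating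
factor. -/
lemma PlaneTree.resolvents_eq (T : PlaneTree n) (hψ : 0 < Real.cos (lveAngle u))
    (τ : EuclideanSpace ℝ (Fin (n + 1))) : T.resolvents (sqrtZOf u) τ = T.prefactor (lveAngle u) *
      ∫ t in posOrthant (Fin (n + 1)),
        Complex.exp (-(Complex.exp (lveAngle u * Complex.I) * ((∑ i, t i : ℝ) : ℂ))) *
        treeWeight T.graph 0 t * Complex.exp (((∑ i, τ i * (Real.exp (u.re / 2) * t i) : ℝ) : ℂ) * Complex.I) := by
  have hc : ∀ i, 0 < (resolventExponent u (τ i)).re := fun i => by rwa [resolventExponent_re]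
  have h1 : ∫ t in posOrthant (Fin (n + 1)), ∏ i, (t i : ℂ) ^ childCount T.graph 0 i *
      Complex.exp (-(resolventExponent u (τ i) * t i)) =
      ∏ i, (((childCount T.graph 0 i).factorial : ℂ) / resolventExponent u (τ i) ^ (childCount T.graph 0 i + 1)) := by
    rw [posOrthant, volume_pi, Measure.restrict_pi_pi, integral_fintype_prod_eq_prod
      (fun (i : Fin (n + 1)) (t : ℝ) => (t : ℂ) ^ childCount T.graph 0 i *
        Complex.exp (-(resolventExponent u (τ i) * t)))]
    exact Finset.prod_congr rfl fun i _ => integral_pow_mul_cexp_neg_mul_Ioi _ (hc i)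
  have h2 : ∀ t : Fin (n + 1) → ℝ, Complex.exp (-(Complex.exp (lveAngle u * Complex.I) * ((∑ i, t i : ℝ) : ℂ))) *
        treeWeight T.graph 0 t * Complex.exp (((∑ i, τ i * (Real.exp (u.re / 2) * t i) : ℝ) : ℂ) * Complex.I) =
      ∏ i, (t i : ℂ) ^ childCount T.graph 0 i * Complex.exp (-(resolventExponent u (τ i) * t i)) := by
    intro t
    rw [Finset.prod_mul_distrib, ← Complex.exp_sum, mul_right_comm, ← Complex.exp_add, mul_comm, treeWeight]
    push_cast
    congr 2
    rw [Finset.mul_sum, Finset.sum_mul, ← Finset.sum_neg_distrib, ← Finset.sum_add_distrib]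
    refine Finset.sum_congr rfl fun i _ => ?_
    rw [resolventExponent_eq]
    push_cast
    ring
  simp_rw [h2]
  rw [h1, PlaneTree.prefactor, PlaneTree.resolvents, Fintype.prod_sigma]
  have h3 := sum_childCount T.isTree 0
  rw [Fintype.card_fin, Nat.add_sub_cancel] at h3
  have h4 : Complex.exp (lveAngle u * Complex.I) ^ (2 * n + 1) =
      ∏ i, Complex.exp (lveAngle u * Complex.I) ^ (childCount T.graph 0 i + 1) := by
    rw [Finset.prod_pow_eq_pow_sum, Finset.sum_add_distrib, h3]
    congr 1
    simp
    ring
  rw [h4, ← Finset.prod_inv_distrib, ← Finset.prod_mul_distrib, ← Finset.prod_mul_distrib]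
  refine Finset.prod_congr rfl fun i _ => ?_
  simp only [Finset.prod_const, Finset.card_univ, Fintype.card_fin]
  rw [T.degree_eq, Nat.add_sub_cancel, resolventExponent, mul_pow, one_div, inv_pow]
  have hf : ((childCount T.graph 0 i).factorial : ℂ) ≠ 0 := by
    exact_mod_cast (childCount T.graph 0 i).factorial_ne_zero
  have he := Complex.exp_ne_zero (lveAngle u * Complex.I)
  have hr : 1 - sqrtZOf u * τ i ≠ 0 := by
    intro h
    have := hc i
    rw [resolventExponent, h, mul_zero, Complex.zero_re] at this
    exact lt_irrefl _ this
  field_simp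

/-- The characteristic function of the Gaussian with covariance `X/N`, whose formula requires `X` to
be positive semidefinite. The coupling is real and negative here, `z e^{2iψ} = -|z|`. -/
lemma PlaneTree.integral_exp_gaussian (T : PlaneTree n) (N : ℕ) {w : T.Edge → ℝ} (hw : w ∈ T.cube)
    (t : Fin (n + 1) → ℝ) :
    ∫ τ, Complex.exp (((∑ i, τ i * (Real.exp (u.re / 2) * t i) : ℝ) : ℂ) * Complex.I) ∂(T.gaussian N w) =
      Complex.exp (rayCoupling N (zOf u) (lveAngle u) / 2 * energy T.graph w 0 t) := by
  have hS : ((N : ℝ)⁻¹ • T.X w).PosSemidef := (T.posSemidef_X hw).smul (by positivity)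
  have h := ProbabilityTheory.charFun_multivariateGaussian (μ := 0) hS
    (WithLp.toLp 2 fun i => Real.exp (u.re / 2) * t i)
  rw [charFun_apply] at h
  have h1 : ∀ τ : EuclideanSpace ℝ (Fin (n + 1)),
      inner ℝ τ (WithLp.toLp 2 fun i => Real.exp (u.re / 2) * t i) = ∑ i, τ i * (Real.exp (u.re / 2) * t i) := by
    intro τ
    rw [PiLp.inner_apply]
    exact Finset.sum_congr rfl fun i _ => by simp [mul_comm]
  simp_rw [h1] at h
  rw [PlaneTree.gaussian, h, inner_zero_right, rayCoupling, zOf_mul_exp_lveAngle_sq, energy_zero]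
  congr 1
  simp only [dotProduct, Matrix.mulVec, Matrix.smul_apply, smul_eq_mul, T.X_eq_pathInf]
  push_cast
  simp only [Finset.mul_sum, zero_mul, zero_sub, Finset.sum_div]
  rw [← Finset.sum_neg_distrib]
  refine Finset.sum_congr rfl fun i _ => ?_
  rw [← Finset.sum_neg_distrib]
  refine Finset.sum_congr rfl fun j _ => ?_
  ring

lemma integrable_swap_bounded {α β : Type*} [MeasurableSpace α] [MeasurableSpace β] {μ : Measure α}
    {ν : Measure β} [IsFiniteMeasure μ] [SFinite ν] {f : β → ℂ} {g : α × β → ℂ} (hf : Integrable f ν)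
    (hg : AEStronglyMeasurable g (μ.prod ν)) (hb : ∀ᵐ p ∂(μ.prod ν), ‖g p‖ ≤ 1) :
    Integrable (fun p : α × β => f p.2 * g p) (μ.prod ν) :=
  (hf.comp_snd μ).mul_bdd (c := 1) hg hb

lemma PlaneTree.integral_resolvents (T : PlaneTree n) (N : ℕ) (hψ : 0 < Real.cos (lveAngle u))
    {w : T.Edge → ℝ} (hw : w ∈ T.cube) : ∫ τ, T.resolvents (sqrtZOf u) τ ∂(T.gaussian N w) =
      T.prefactor (lveAngle u) * ∫ t in posOrthant (Fin (n + 1)),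
        Complex.exp (-(Complex.exp (lveAngle u * Complex.I) * ((∑ i, t i : ℝ) : ℂ))) *
        treeWeight T.graph 0 t *
          Complex.exp (rayCoupling N (zOf u) (lveAngle u) / 2 * energy T.graph w 0 t) := by
  simp_rw [T.resolvents_eq hψ]
  rw [integral_const_mul]
  congr 1
  rw [integral_integral_swap]
  · refine integral_congr_ae (ae_of_all _ fun t => ?_)
    simp only
    rw [integral_const_mul, T.integral_exp_gaussian N hw]
  · refine integrable_swap_bounded
      (f := fun t : Fin (n + 1) → ℝ => Complex.exp (-(Complex.exp (lveAngle u * Complex.I) *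
        ((∑ i, t i : ℝ) : ℂ))) * treeWeight T.graph 0 t)
      (g := fun p : EuclideanSpace ℝ (Fin (n + 1)) × (Fin (n + 1) → ℝ) =>
        Complex.exp (((∑ i, p.1 i * (Real.exp (u.re / 2) * p.2 i) : ℝ) : ℂ) * Complex.I))
      (integrableOn_exp_mul_treeWeight T.graph 0 (by rwa [Complex.exp_ofReal_mul_I_re]))
      (Measurable.aestronglyMeasurable (by fun_prop)) (ae_of_all _ fun p => ?_)
    rw [Complex.norm_exp_ofReal_mul_I]

lemma PlaneTree.integrable_cube_orthant (T : PlaneTree n) (N : ℕ) {z : ℂ} {ψ : ℝ} (hψ : 0 < Real.cos ψ)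
    (hz : (z * Complex.exp (ψ * Complex.I) ^ 2).re ≤ 0) :
    Integrable (fun p : (T.Edge → ℝ) × (Fin (n + 1) → ℝ) =>
      Complex.exp (-(Complex.exp (ψ * Complex.I) * ((∑ i, p.2 i : ℝ) : ℂ))) * treeWeight T.graph 0 p.2 *
          Complex.exp (rayCoupling N z ψ / 2 * energy T.graph p.1 0 p.2))
      ((volume.restrict T.cube).prod (volume.restrict (posOrthant (Fin (n + 1))))) := by
  rw [T.cube_eq]
  have hm : Measurable fun p : (T.graph.edgeSet → ℝ) × (Fin (n + 1) → ℝ) => energy T.graph p.1 0 p.2 :=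
    Measurable.comp (g := fun q : (Fin (n + 1) → ℝ) × (T.graph.edgeSet → ℝ) => energy T.graph q.2 0 q.1)
      (f := Prod.swap) measurable_energy measurable_swap
  refine integrable_swap_bounded (integrableOn_exp_mul_treeWeight T.graph 0 (by rwa [Complex.exp_ofReal_mul_I_re]))
    (Measurable.aestronglyMeasurable (by fun_prop)) ?_
  have h1 : ∀ᵐ w ∂(volume.restrict (Set.univ.pi fun _ : T.Edge => Set.Icc (0 : ℝ) 1)),
      w ∈ Set.univ.pi fun _ : T.Edge => Set.Icc (0 : ℝ) 1 := ae_restrict_mem measurableSet_cube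
  filter_upwards [Measure.quasiMeasurePreserving_fst.ae h1] with p hp
  exact norm_exp_energy_le_one T.isTree (NVector.mem_cube_iff.1 hp) (rayCoupling_re_nonpos hz N) p.2

lemma PlaneTree.measurableSet_cube (T : PlaneTree n) : MeasurableSet T.cube := by
  rw [T.cube_eq]
  exact NVector.measurableSet_cube

lemma zOf_mul_exp_lveAngle_sq_re (u : ℂ) : (zOf u * Complex.exp (lveAngle u * Complex.I) ^ 2).re ≤ 0 := by
  rw [zOf_mul_exp_lveAngle_sq, Complex.neg_re, Complex.ofReal_re]
  exact neg_nonpos.2 (by positivity)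

lemma PlaneTree.integrableOn_integral_resolvents (T : PlaneTree n) (N : ℕ) (hψ : 0 < Real.cos (lveAngle u)) :
    IntegrableOn (fun w => ∫ τ, T.resolvents (sqrtZOf u) τ ∂(T.gaussian N w)) T.cube := by
  have h := ((T.integrable_cube_orthant N hψ (zOf_mul_exp_lveAngle_sq_re u)).integral_prod_left).const_mul
    (T.prefactor (lveAngle u))
  refine h.congr ((ae_restrict_iff' T.measurableSet_cube).2 (ae_of_all _ fun w hw => ?_))
  exact (T.integral_resolvents N hψ hw).symm

/-- After the Gaussian integration, Fubini between the cube and the orthant identifies each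
amplitude with the `β`-amplitude at the angle `-φ/2`, tree by tree. -/
lemma PlaneTree.lveAmplitude_eq (T : PlaneTree n) (N : ℕ) (hψ : 0 < Real.cos (lveAngle u)) :
    T.lveAmplitude N (sqrtZOf u) = T.betaAmplitude N (zOf u) (lveAngle u) := by
  rw [PlaneTree.lveAmplitude, T.betaAmplitude_eq,
    setIntegral_congr_fun T.measurableSet_cube fun w hw => T.integral_resolvents N hψ hw, integral_const_mul]
  congr 1
  rw [integral_integral_swap (T.integrable_cube_orthant N hψ (zOf_mul_exp_lveAngle_sq_re u))]
  refine integral_congr_ae (ae_of_all _ fun t => ?_)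
  simp only
  rw [integral_const_mul, cubeAmp, T.cube_eq, mul_assoc]

lemma cos_lveAngle_pos (hu : u ∈ cardioid) : 0 < Real.cos (lveAngle u) := by
  have h := abs_lt.1 hu.1
  refine Real.cos_pos_of_mem_Ioo ⟨?_, ?_⟩ <;> rw [lveAngle] <;> linarith

lemma four_mul_norm_lt_of_mem_cardioid (hu : u ∈ cardioid) : 4 * ‖zOf u‖ < Real.cos (lveAngle u) ^ 2 := by
  rw [lveAngle, Real.cos_neg]
  exact hu.2

end LoopVertex

end NVector

/-! ### The main theorem -/

theorem mainTheorem4 :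
    -- the functional integrals converge absolutely, and `Z` does not vanish
    (∀ N : ℕ, 1 ≤ N → ∀ z : ℂ, z.re ≤ 0 →
      Integrable (weight N z) ∧
      Integrable (fun φ : Fin N → ℂ => (sqNorm φ : ℂ) / (N : ℂ) * weight N z φ) ∧
      (4 * ‖z‖ < 1 → partitionFunction N z ≠ 0)) ∧
    -- analytic continuation to the extended cardioid, tree expansions, large `N` limit
    (∃ G : ℕ → ℂ → ℂ,
      (∀ N : ℕ, 1 ≤ N →
        AnalyticOnNhd ℂ (G N) extendedCardioid ∧
        (∀ u : ℂ, |u.im| ≤ Real.pi / 2 → 4 * ‖zOf u‖ < 1 → G N u = twoPoint N (zOf u)) ∧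
        -- the loop vertex expansion
        (∀ u ∈ cardioid,
          (∀ T : AnyPlaneTree,
            (∀ w ∈ T.2.cube, (T.2.X w).PosSemidef ∧
              Integrable (T.2.resolvents (sqrtZOf u)) (T.2.gaussian N w)) ∧
            IntegrableOn (fun w => ∫ τ, T.2.resolvents (sqrtZOf u) τ ∂(T.2.gaussian N w))
              T.2.cube) ∧
          HasSum (fun T : AnyPlaneTree =>
            1 / (T.1.factorial : ℂ) * zOf u ^ T.1 * T.2.lveAmplitude N (sqrtZOf u)) (G N u)) ∧
        -- the `β`-representation, on rotated contours, and a bound which is uniform in `N`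
        (∀ u : ℂ, ∀ ψ : ℝ, |ψ| < Real.pi / 2 → |u.im + 2 * ψ| ≤ Real.pi / 2 →
          4 * ‖zOf u‖ < Real.cos ψ ^ 2 →
          (∀ T : AnyPlaneTree,
            (∀ b : Fin (T.1 + 1) → ℂ, IntegrableOn (T.2.quadExp N (zOf u) b) T.2.cube) ∧
            IntegrableOn (T.2.betaIntegrand N (zOf u) ψ) (PlaneTree.orthant T.1)) ∧
          HasSum (fun T : AnyPlaneTree =>
            1 / (T.1.factorial : ℂ) * zOf u ^ T.1 * T.2.betaAmplitude N (zOf u) ψ) (G N u) ∧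
          ‖G N u‖ ≤ ∑' n : ℕ, (catalan n : ℝ) * ‖zOf u‖ ^ n / Real.cos ψ ^ (2 * n + 1))) ∧
      (∀ u ∈ extendedCardioid,
        Tendsto (fun N : ℕ => G N u) atTop
          (𝓝 ((1 - (1 - 4 * zOf u) ^ (1 / 2 : ℂ)) / (2 * zOf u))))) ∧
    -- Taylor estimates in the half-disk, uniformly in `N`
    (∃ K : ℝ, 0 < K ∧ ∀ N : ℕ, 1 ≤ N → ∀ p : ℕ, 1 ≤ p → ∀ z : ℂ, z.re ≤ 0 → 16 * ‖z‖ < 1 →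
      ‖twoPoint N z - ∑ q ∈ Finset.range p, perturbativeCoeff N q * z ^ q‖ ≤
        K ^ p * (p.factorial : ℝ) * ‖z‖ ^ p) ∧
    -- `G₂` is the unique Borel sum of its perturbation series (in the variable `x = -z`),
    -- uniformly in `N`
    (∃ A σ C : ℝ, 0 < σ ∧ ∀ N : ℕ, 1 ≤ N →
      BorelSummable (1 / 16) A σ (fun x => twoPoint N (-x))
        (fun k => (-1) ^ k * perturbativeCoeff N k) ∧
      IsBorelSum (1 / 16) σ C (fun x => twoPoint N (-x))
        (fun k => (-1) ^ k * perturbativeCoeff N k) ∧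
      ∀ (R A' σ' : ℝ) (f : ℂ → ℂ), 0 < R →
        BorelSummable R A' σ' f (fun k => (-1) ^ k * perturbativeCoeff N k) →
        ∀ x ∈ borelDisk R ∩ borelDisk (1 / 16), f x = twoPoint N (-x)) := by
  refine ⟨fun N hN z hz => ⟨integrable_weight hN hz, integrable_sqNorm_mul_weight hN hz,
    partitionFunction_ne_zero hN hz⟩, ⟨continuation, fun N hN => ⟨analyticOnNhd_continuation N,
      fun u hu h => continuation_eq_twoPoint hN hu h, fun u hu => ?_, fun u ψ h1 h2 h3 => ?_⟩,
      fun u hu => tendsto_continuation hu⟩,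
    ⟨36, by norm_num, fun N hN p hp z hz h => ?_⟩,
    -- The remainder estimates hold with `σ = 12`; the larger value `24` is imposed by the radius
    -- `1/24` of the disk on which the Borel transform is controlled.
    ⟨3, 24, ∫ v, Real.exp (v ^ 2 / 4) ∂stdGauss, by norm_num, fun N hN =>
      ⟨(borelSummable_twoPoint hN).mono (by norm_num) (by norm_num) (by norm_num), isBorelSum_twoPoint hN,
        fun R A' σ' f hR hf x hx => (borelSummable_twoPoint hN).eqOn (by norm_num) (by norm_num) hf hx⟩⟩⟩
  · have hcos := cos_lveAngle_pos hu
    have h4 := four_mul_norm_lt_of_mem_cardioid hu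
    -- In the cardioid `ψ = -φ/2` is admissible: `φ + 2ψ = 0`, and the condition `4|z| < cos² ψ` is
    -- the definition of the cardioid.
    have hv : ValidAngle u (lveAngle u) := by
      refine ⟨?_, ?_, h4⟩
      · rw [lveAngle, abs_neg, abs_div, abs_two]
        linarith [hu.1]
      · rw [lveAngle, show u.im + 2 * -(u.im / 2) = 0 by ring, abs_zero]
        positivity
    refine ⟨fun T => ⟨fun w hw => ⟨T.2.posSemidef_X hw, T.2.integrable_resolvents N w hcos⟩,
      T.2.integrableOn_integral_resolvents N hcos⟩, ?_⟩
    rw [continuation_eq N hv]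
    simp_rw [fun T : AnyPlaneTree => T.2.lveAmplitude_eq N hcos]
    exact hasSum_betaAmplitude N hcos (zOf_mul_exp_lveAngle_sq_re u) h4
  · have hv : ValidAngle u ψ := ⟨h1, h2, h3⟩
    have hz : (zOf u * Complex.exp (ψ * Complex.I) ^ 2).re ≤ 0 := by
      simpa using re_nonpos_of_abs_le h2 zero_le_one
    refine ⟨fun T => ⟨T.2.integrableOn_quadExp N (zOf u), T.2.integrableOn_betaIntegrand hv.cos_pos hz⟩, ?_,
      norm_continuation_le N hv⟩
    rw [continuation_eq N hv]
    exact hasSum_betaAmplitude N hv.cos_pos hz h3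
  · refine (norm_twoPoint_sub_le hN hz h p).trans ?_
    gcongr
    exact taylor_constant_le' hp
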